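/- **Setting.** All point processes are homogeneous Poisson point processes (PPPs) in $\mathbb R^2$, all fading powers are i.i.d. exponential with mean $1$ and independent of the points, and thermal noise is neglected. The path loss exponent is $\alpha>2$. Tier $i\in\{\mathtt m,\mathtt s\}$ (macro, small cell) has base stations of density $\lambda_i>0$ and transmit power $P_i>0$; its users transmit with power $Q_i>0$; its biases are $B_{\mathtt D,i},B_{\mathtt U,i}>0$. Each cell of tier $i$ is in downlink (DL) mode with probability $q_i\in[0,1]$ and else in uplink (UL) mode, so that the DL and UL base stations of tier $i$ are PPPs of densities $q_i\lambda_i$ and $(1-q_i)\lambda_i$. Mobile users have density $\lambda_{\mathtt u}>0$; a fraction $\zeta\in[0,1]$ of them are potential D2D transmitters with power $Q_{\mathtt d}>0$ and link length $r_{\mathtt d}>0$; each other user transmits with probability $\mu\in[0,1]$ and else receives. A typical receiving user is served by the DL base station that maximizes $P_kB_{\mathtt D,k}\|x\|^{-\alpha}$ over all DL base stations $x$ (of tier $k$), a typical transmitting user by the UL base station that maximizes $Q_kB_{\mathtt U,k}\|x\|^{-\alpha}$. Put $$\mathcal A_{\mathtt D,i}=\frac{q_i\lambda_i}{\sum_k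 q_k\lambda_k\big(\tfrac{P_kB_{\mathtt D,k}}{P_iB_{\mathtt D,i}}\big)^{2/\alpha}},\qquad \mathcal A_{\mathtt U,i}=\frac{(1-q_i)\lambda_i}{\sum_k(1-q_k)\lambda_k\big(\tfrac{Q_kB_{\mathtt U,k}}{Q_iB_{\mathtt U,i}}\big)^{2/\alpha}}$$ ($0$ if the denominator vanishes). The normalized area of a random cell is Gamma distributed with density $\frac{3.5^{3.5}}{\Gamma(3.5)}x^{2.5}e^{-3.5x}$, and given that area the number of users in the cell is Poisson, the users having density $(1-\mu)(1-\zeta)\lambda_{\mathtt u}\mathcal A_{\mathtt D,i}$ in DL and $\mu(1-\zeta)\lambda_{\mathtt u}\mathcal A_{\mathtt U,i}$ in UL. A base station is active if its cell is not void; the DL base stations are active independently with the probability that a random cell is not void. Hence the active DL and UL base stations of tier $i$ have the densities $$\lambda_i^{\mathtt D}=q_i\lambda_i\Big(1-\big(1+\tfrac{(1-\mu)(1-\zeta)\lambda_{\mathtt u}\mathcal A_{\mathtt D,i}}{3.5\,q_i\lambda_i}\big)^{-3.5}\Big),\quad \lambda_i^{\mathtt U}=(1-q_i)\lambda_i\Big(1-\big(1+\tfrac{\mu(1-\zeta)\lambda_{\mathtt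 u}\mathcal A_{\mathtt U,i}}{3.5(1-q_i)\lambda_i}\big)^{-3.5}\Big)$$ (read as $0$ if $q_i=0$, resp. $q_i=1$). The transmitting users of tier $i$ form an independent PPP of density $\lambda_{\mathtt u,i}^{\mathtt T}=\lambda_i^{\mathtt U}$. CSMA: a potential D2D transmitter $T_0$ draws a timer uniform on $[0,1]$. It transmits if the power $Q_{\mathtt d}h\|T_0-x\|^{-\alpha}$ that it imposes is smaller than $\rho_{\mathtt s}>0$ at every active DL small-cell base station and every transmitting small-cell user $x$, and smaller than $\rho_{\mathtt d}>0$ at every other potential D2D transmitter $x$ with a smaller timer. The active D2D transmitters are modelled as an independent PPP of density $\lambda_{\mathtt d}=\beta\zeta\lambda_{\mathtt u}$, with $\beta$ the probability that a typical potential D2D transmitter transmits; thus $$\lambda_{\mathtt d}=e^{-(\lambda_{\mathtt s}^{\mathtt D}+\lambda_{\mathtt u,\mathtt s}^{\mathtt T})K_{\mathtt s}}\,\frac{1-e^{-\zeta\lambda_{\mathtt u}K_{\mathtt d}}}{K_{\mathtt d}},\qquad K_{j}=\frac{2\pi\Gamma(2/\alpha)}{\alpha(\rho_j/Q_{\mathtt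 d})^{2/\alpha}}.$$ For $0<\epsilon<1$ let $\iota_j=\big(\tfrac{-\ln\epsilon}{\rho_j/Q_{\mathtt d}}\big)^{1/\alpha}$, $j\in\{\mathtt s,\mathtt d\}$. Interference: the macro tier and the small-cell tier use disjoint bands. A receiver of tier $i$ suffers from the active DL base stations (power $P_i$) and the transmitting users (power $Q_i$) of its tier, the serving transmitter excepted. A receiver of the small-cell tier also suffers from the active D2D transmitters outside the ball of radius $\iota_{\mathtt s}$ about its serving transmitter; this interference is $I_{\mathtt d\to\mathtt D}$ in DL and $I_{\mathtt d\to\mathtt U}$ in UL. A D2D receiver, at distance $r_{\mathtt d}$ from its transmitter $z_0$, suffers from the active DL small-cell base stations (power $P_{\mathtt s}$) and the transmitting small-cell users (power $Q_{\mathtt s}$) outside the ball of radius $\iota_{\mathtt s}$ about $z_0$, and from the active D2D transmitters (power $Q_{\mathtt d}$) outside the ball of radius $\iota_{\mathtt d}$ about $z_0$. The SIR is the received power divided by the interference. Let $\mathbb P_i^{\mathtt D},\mathbb P_i^{\mathtt U}$ be the probabilities that the SIR of a typical DL, UL user exceeds $\gamma_i^{\mathtt D}>0$, $\gamma_i^{\mathtt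 U}>0$, given that it is associated with tier $i$; let $\bar{\mathbb P}_{\mathtt D},\bar{\mathbb P}_{\mathtt U}$ be the overall probabilities that a typical DL, UL user is associated with some tier $i$ and its SIR exceeds the threshold of that tier; let $\mathbb P_{\mathtt d}$ be the probability that the SIR of a typical D2D receiver exceeds $\gamma_{\mathtt d}>0$. **Theorem.** $\mathcal A_{\mathtt D,i},\mathcal A_{\mathtt U,i}$ are the probabilities of association with tier $i$, and $$\bar{\mathbb P}_{\mathtt D}=\mathbb P_{\mathtt m}^{\mathtt D}\mathcal A_{\mathtt D,\mathtt m}+\mathbb P_{\mathtt s}^{\mathtt D}\mathcal A_{\mathtt D,\mathtt s},\qquad \bar{\mathbb P}_{\mathtt U}=\mathbb P_{\mathtt m}^{\mathtt U}\mathcal A_{\mathtt U,\mathtt m}+\mathbb P_{\mathtt s}^{\mathtt U}\mathcal A_{\mathtt U,\mathtt s}.$$ With $$C(\alpha)=\frac{2\pi/\alpha}{\sin(2\pi/\alpha)},\quad \delta(\beta,\alpha)=\int_{\beta^{-2/\alpha}}^\infty\frac{\beta^{2/\alpha}}{1+u^{\alpha/2}}du,\quad \mathcal Z_{\theta_l,\kappa_l}^{\theta_u,\kappa_u}(s;Q)=(sQ)^{2/\alpha}\int_{\theta_l}^{\theta_u}\int_{\kappa_l^2/(sQ)^{2/\alpha}}^{\kappa_u^2/(sQ)^{2/\alpha}}\frac{du\,d\theta}{1+u^{\alpha/2}}$$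 the per-tier coverages are: if $q_{\mathtt m}>0$, $$\mathbb P_{\mathtt m}^{\mathtt D}=\frac{q_{\mathtt m}\lambda_{\mathtt m}}{\lambda_{\mathtt m}^{\mathtt D}\mathcal A_{\mathtt D,\mathtt m}\delta(\gamma_{\mathtt m}^{\mathtt D},\alpha)+\lambda_{\mathtt u,\mathtt m}^{\mathtt T}\mathcal A_{\mathtt D,\mathtt m}C(\alpha)\big(\frac{Q_{\mathtt m}}{P_{\mathtt m}}\gamma_{\mathtt m}^{\mathtt D}\big)^{2/\alpha}+q_{\mathtt m}\lambda_{\mathtt m}};$$ if $q_{\mathtt m}<1$, $$\mathbb P_{\mathtt m}^{\mathtt U}=\frac{(1-q_{\mathtt m})\lambda_{\mathtt m}}{C(\alpha)(\gamma_{\mathtt m}^{\mathtt U})^{2/\alpha}\mathcal A_{\mathtt U,\mathtt m}\big(\lambda_{\mathtt m}^{\mathtt D}(\frac{P_{\mathtt m}}{Q_{\mathtt m}})^{2/\alpha}+\lambda_{\mathtt u,\mathtt m}^{\mathtt T}\big)+(1-q_{\mathtt m})\lambda_{\mathtt m}};$$ if $q_{\mathtt s}>0$, $$\mathbb P_{\mathtt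 s}^{\mathtt D}=\frac{\pi q_{\mathtt s}\lambda_{\mathtt s}}{\mathcal A_{\mathtt D,\mathtt s}}\int_0^\infty e^{-\pi v\mathcal F}\mathcal L\Big(\frac{\gamma_{\mathtt s}^{\mathtt D}v^{\alpha/2}}{P_{\mathtt s}}\,\Big|\,\sqrt v\Big)dv,$$ if $q_{\mathtt s}<1$, $$\mathbb P_{\mathtt s}^{\mathtt U}=\frac{\pi(1-q_{\mathtt s})\lambda_{\mathtt s}}{\mathcal A_{\mathtt U,\mathtt s}}\int_0^\infty e^{-\pi v\mathcal G}\mathcal L\Big(\frac{\gamma_{\mathtt s}^{\mathtt U}v^{\alpha/2}}{Q_{\mathtt s}}\,\Big|\,\sqrt v\Big)dv,$$ the integrals being the sums of the integrals over $v\le\iota_{\mathtt s}^2$ and $v>\iota_{\mathtt s}^2$. Here $$\mathcal F=\lambda_{\mathtt s}^{\mathtt D}\delta(\gamma_{\mathtt s}^{\mathtt D},\alpha)+\lambda_{\mathtt u,\mathtt s}^{\mathtt T}C(\alpha)\big(\tfrac{Q_{\mathtt s}}{P_{\mathtt s}}\gamma_{\mathtt s}^{\mathtt D}\big)^{2/\alpha}+\tfrac{q_{\mathtt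 s}\lambda_{\mathtt s}}{\mathcal A_{\mathtt D,\mathtt s}},\quad \mathcal G=C(\alpha)(\gamma_{\mathtt s}^{\mathtt U})^{2/\alpha}\big(\lambda_{\mathtt s}^{\mathtt D}(\tfrac{P_{\mathtt s}}{Q_{\mathtt s}})^{2/\alpha}+\lambda_{\mathtt u,\mathtt s}^{\mathtt T}\big)+\tfrac{(1-q_{\mathtt s})\lambda_{\mathtt s}}{\mathcal A_{\mathtt U,\mathtt s}},$$ and $\mathcal L(s\mid r)$, $s>0$, is the Laplace transform at $s$ of $I_{\mathtt d\to\mathtt D}$, and of $I_{\mathtt d\to\mathtt U}$, for a link of length $r$. It equals $$\mathcal L(s\mid r)=e^{-\pi\lambda_{\mathtt d}(\iota_{\mathtt s}+r)^2\delta(sQ_{\mathtt d}/(\iota_{\mathtt s}+r)^\alpha,\alpha)}\cdot\begin{cases}\exp\big(-\lambda_{\mathtt d}\mathcal Z_{0,l_{OA}}^{\pi,\iota_{\mathtt s}+r}(s;Q_{\mathtt d})\big),& r\le\iota_{\mathtt s},\\ \exp\big(-\lambda_{\mathtt d}\big(\mathcal Z_{0,0}^{\Theta,l_{OD}}+\mathcal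 Z_{0,l_{OC}}^{\Theta,\iota_{\mathtt s}+r}+\mathcal Z_{\Theta,0}^{\pi,\iota_{\mathtt s}+r}\big)(s;Q_{\mathtt d})\big),& r>\iota_{\mathtt s},\end{cases}$$ with $\Theta=\arcsin(\iota_{\mathtt s}/r)$, $l_{OA}=l_{OC}=\sqrt{\iota_{\mathtt s}^2-(r\sin\theta)^2}+r\cos\theta$, $l_{OD}=r\cos\theta-\sqrt{\iota_{\mathtt s}^2-(r\sin\theta)^2}$. Finally, if $r_{\mathtt d}\le\iota_{\mathtt s}$ and $r_{\mathtt d}\le\iota_{\mathtt d}$, then with $s=\gamma_{\mathtt d}r_{\mathtt d}^\alpha/Q_{\mathtt d}$ $$\mathbb P_{\mathtt d}=\exp\big(-\mathcal I(\lambda_{\mathtt s}^{\mathtt D},\iota_{\mathtt s};s,P_{\mathtt s})-\mathcal I(\lambda_{\mathtt u,\mathtt s}^{\mathtt T},\iota_{\mathtt s};s,Q_{\mathtt s})-\mathcal I(\lambda_{\mathtt d},\iota_{\mathtt d};s,Q_{\mathtt d})\big),$$ $$\mathcal I(\lambda,\iota;s,Q)=\pi\lambda(\iota+r_{\mathtt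 d})^2\,\delta\Big(\frac{sQ}{(\iota+r_{\mathtt d})^\alpha},\alpha\Big)+\lambda\,\mathcal Z_{0,l}^{\pi,\iota+r_{\mathtt d}}(s;Q),\qquad l=\sqrt{\iota^2-(r_{\mathtt d}\sin\theta)^2}+r_{\mathtt d}\cos\theta .$$ -/

import Mathlib

open MeasureTheory ProbabilityTheory
open scoped ENNReal NNReal

noncomputable section

namespace HCN

/-! ## Parameters -/

/-- The two infrastructure tiers: macro base stations and small-cell access points. -/
inductive Tier
  | mbs
  | sap

/-- System parameters of the two-tier dynamic-TDD network. -/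
structure Params where
  /-- path loss exponent -/
  α : ℝ
  /-- densities of the base stations of each tier -/
  lam : Tier → ℝ
  /-- density of the mobile users -/
  lamU : ℝ
  /-- transmit power of the base stations of each tier -/
  P : Tier → ℝ
  /-- transmit power of the mobile users associated with each tier -/
  Q : Tier → ℝ
  /-- transmit power of the D2D transmitters -/
  Qd : ℝ
  /-- downlink and uplink association biases -/
  BD : Tier → ℝ
  BU : Tier → ℝ
  /-- probability that a cell is in downlink mode -/
  q : Tier → ℝ
  /-- probability that a mobile user acts as a transmitter -/
  μ : ℝ
  /-- fraction of the mobile users that are potential D2D transmitters -/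
  ζ : ℝ
  /-- SIR thresholds: downlink, uplink, D2D -/
  γD : Tier → ℝ
  γU : Tier → ℝ
  γd : ℝ
  /-- protection threshold (small-cell transmissions) and contention threshold (D2D) -/
  ρs : ℝ
  ρd : ℝ
  /-- threshold of the miss-detection probability -/
  ε : ℝ
  /-- length of a D2D link -/
  rd : ℝ
  two_lt_α : 2 < α
  lam_pos : ∀ i, 0 < lam i
  lamU_pos : 0 < lamU
  P_pos : ∀ i, 0 < P i
  Q_pos : ∀ i, 0 < Q i
  Qd_pos : 0 < Qd
  BD_pos : ∀ i, 0 < BD i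
  BU_pos : ∀ i, 0 < BU i
  q_mem : ∀ i, q i ∈ Set.Icc (0 : ℝ) 1
  μ_mem : μ ∈ Set.Icc (0 : ℝ) 1
  ζ_mem : ζ ∈ Set.Icc (0 : ℝ) 1
  γD_pos : ∀ i, 0 < γD i
  γU_pos : ∀ i, 0 < γU i
  γd_pos : 0 < γd
  ρs_pos : 0 < ρs
  ρd_pos : 0 < ρd
  ε_mem : ε ∈ Set.Ioo (0 : ℝ) 1
  rd_pos : 0 < rd

/-! ## Point processes in the plane -/

/-- The plane with its Euclidean norm. -/
abbrev Plane := EuclideanSpace ℝ (Fin 2)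

/-- An enumerated, at most countable collection of points: the entry with index `n` tells
whether a point with this index is present, and where it is. -/
abbrev Config := ℕ → Bool × Plane

/-- The indices of the points that are present. -/
def Config.present (c : Config) : Set ℕ := {n | (c n).1 = true}

/-- The set of the points. -/
def Config.points (c : Config) : Set Plane := {x | ∃ n ∈ c.present, (c n).2 = x}

/-- The number of points in a region. -/
def Config.count (c : Config) (B : Set Plane) : ℕ∞ :=
  {n | n ∈ c.present ∧ (c n).2 ∈ B}.encard

/-- `Φ` is a homogeneous Poisson point process of density `d` under `Pr`: the number of points in
a Borel set of finite area is Poisson distributed with mean `d` times the area, and the numbers of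
points in disjoint sets are independent. -/
structure IsPoisson {Ω : Type*} [MeasurableSpace Ω] (Pr : Measure Ω) (d : ℝ)
    (Φ : Ω → Config) : Prop where
  measurable : Measurable Φ
  count_law : ∀ B : Set Plane, MeasurableSet B → volume B ≠ ∞ → ∀ k : ℕ,
    Pr {ω | (Φ ω).count B = k} = poissonMeasure (d * (volume B).toReal).toNNReal {k}
  count_indep : ∀ (m : ℕ) (B : Fin m → Set Plane), (∀ a, MeasurableSet (B a)) →
    (∀ a, volume (B a) ≠ ∞) → Pairwise (fun a b => Disjoint (B a) (B b)) →
    iIndepFun (fun a ω => (Φ ω).count (B a)) Pr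

/-- A finite family of independent Poisson point processes `Φ j` of densities `d j`; to the `n`-th
point of `Φ j` belongs the fading power `h j n`, and the fading powers are i.i.d. exponential with
mean one and independent of the points. -/
structure IsRayleighField {Ω : Type*} [MeasurableSpace Ω] (Pr : Measure Ω) {J : Type}
    (d : J → ℝ) (Φ : J → Ω → Config) (h : J → ℕ → Ω → ℝ) : Prop where
  poisson : ∀ j, IsPoisson Pr (d j) (Φ j)
  points_indep : iIndepFun Φ Pr
  fading_law : ∀ j n, HasLaw (h j n) (expMeasure 1) Pr
  fading_indep : iIndepFun (fun a : J × ℕ => h a.1 a.2) Pr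
  points_fading_indep : IndepFun (fun ω j => Φ j ω) (fun ω j n => h j n ω) Pr

/-- The interference received at `y` from the points of `c` outside `S`, all transmitting with
power `pw`, when the point with index `n` has fading power `h n` to the receiver. -/
def interference (α pw : ℝ) (c : Config) (h : ℕ → ℝ) (S : Set Plane) (y : Plane) : ℝ≥0∞ :=
  ∑' n : {n : ℕ // n ∈ c.present ∧ (c n).2 ∉ S},
    ENNReal.ofReal (pw * h n * ‖(c n).2 - y‖ ^ (-α))

open Classical in
/-- `exp (-x)` on `[0, ∞]`. -/
def expNeg (x : ℝ≥0∞) : ℝ := if x = ∞ then 0 else Real.exp (-x.toReal)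

/-! ## Association probabilities, load, densities of the active transmitters -/

namespace Params

variable (p : Params)

/-- The downlink association probability of tier `i`. -/
def assocD (i : Tier) : ℝ :=
  p.q i * p.lam i /
    (p.q .mbs * p.lam .mbs * (p.P .mbs / p.P i * (p.BD .mbs / p.BD i)) ^ (2 / p.α)
      + p.q .sap * p.lam .sap * (p.P .sap / p.P i * (p.BD .sap / p.BD i)) ^ (2 / p.α))

/-- The uplink association probability of tier `i`. -/
def assocU (i : Tier) : ℝ :=
  (1 - p.q i) * p.lam i /
    ((1 - p.q .mbs) * p.lam .mbs *
        (p.Q .mbs / p.Q i * (p.BU .mbs / p.BU i)) ^ (2 / p.α)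
      + (1 - p.q .sap) * p.lam .sap *
        (p.Q .sap / p.Q i * (p.BU .sap / p.BU i)) ^ (2 / p.α))

/-- The probability that a random cell contains `n` users, when there are on average `m` users per
cell: given that the cell has `x` times the mean area, the number of users is Poisson with
mean `m * x`; the normalized area `x` of a cell has density `3.5 ^ 3.5 / Γ(3.5) x ^ 2.5 e ^ (-3.5 x)`. -/
def loadProb (m : ℝ) (n : ℕ) : ℝ :=
  ∫ x, (poissonMeasure (m * x).toNNReal).real {n} ∂(gammaMeasure 3.5 3.5)

/-- The probability that a random downlink cell of tier `i` is void. -/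
def voidD (i : Tier) : ℝ :=
  loadProb ((1 - p.μ) * (1 - p.ζ) * p.lamU * p.assocD i / (p.q i * p.lam i)) 0

/-- The probability that a random uplink cell of tier `i` is void. -/
def voidU (i : Tier) : ℝ :=
  loadProb (p.μ * (1 - p.ζ) * p.lamU * p.assocU i / ((1 - p.q i) * p.lam i)) 0

/-- The density of the active downlink base stations of tier `i`. -/
def densD (i : Tier) : ℝ := p.q i * p.lam i * (1 - p.voidD i)

/-- The density of the active uplink base stations of tier `i`; it is also the density of the
transmitting mobile users that are associated with tier `i`, as every active uplink base station
serves exactly one of them. -/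
def densU (i : Tier) : ℝ := (1 - p.q i) * p.lam i * (1 - p.voidU i)

/-- Radius of the exclusion ball for a sensing threshold `ρ`: the solution `l` of
`Pr[Qd * h / l ^ α > ρ] = ε`, where `h` is exponential with mean one. -/
def exclRadius (ρ : ℝ) : ℝ := (-Real.log p.ε / (ρ / p.Qd)) ^ (1 / p.α)

/-- Exclusion radius due to the sensing of small-cell transmissions. -/
def ιs : ℝ := p.exclRadius p.ρs

/-- Exclusion radius due to the sensing among D2D transmitters. -/
def ιd : ℝ := p.exclRadius p.ρd

end Params

/-! ## The CSMA scheme -/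

/-- The transmitters that a potential D2D transmitter senses. -/
inductive SensedField
  /-- active small-cell access points in downlink mode -/
  | station
  /-- transmitting mobile users associated with the small-cell tier -/
  | user
  /-- the other potential D2D transmitters -/
  | contender

/-- Densities of the sensed transmitters. -/
def Params.sensedDens (p : Params) : SensedField → ℝ
  | .station => p.densD .sap
  | .user => p.densU .sap
  | .contender => p.ζ * p.lamU

/-- The surroundings of a typical potential D2D transmitter, located at the origin: `t₀` is its
back-off timer, `t n` the timer of the `n`-th contender. -/
structure Contention (p : Params) {Ω : Type*} [MeasurableSpace Ω] (Pr : Measure Ω) where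
  Φ : SensedField → Ω → Config
  h : SensedField → ℕ → Ω → ℝ
  t₀ : Ω → ℝ
  t : ℕ → Ω → ℝ
  field : IsRayleighField Pr p.sensedDens Φ h
  t₀_law : HasLaw t₀ (volume.restrict (Set.Icc 0 1)) Pr
  t_law : ∀ n, HasLaw (t n) (volume.restrict (Set.Icc 0 1)) Pr
  t_indep : iIndepFun t Pr
  t₀_t_indep : IndepFun t₀ (fun ω n => t n ω) Pr
  timers_indep : IndepFun (fun ω => (t₀ ω, fun n => t n ω))
    (fun ω => (fun j => Φ j ω, fun j n => h j n ω)) Pr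

namespace Contention

variable {p : Params} {Ω : Type*} [MeasurableSpace Ω] {Pr : Measure Ω} (C : Contention p Pr)

/-- The power received from the typical potential D2D transmitter at the `n`-th point of the
field `j`. -/
def power (j : SensedField) (n : ℕ) (ω : Ω) : ℝ :=
  p.Qd * C.h j n ω / ‖(C.Φ j ω n).2‖ ^ p.α

/-- The event that the typical potential D2D transmitter is granted access: it does not disturb
any small-cell transmitter, and it disturbs no contender with a smaller timer. -/
def retained : Set Ω := {ω |
  (∀ n ∈ (C.Φ .station ω).present, C.power .station n ω < p.ρs) ∧
  (∀ n ∈ (C.Φ .user ω).present, C.power .user n ω < p.ρs) ∧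
  (∀ n ∈ (C.Φ .contender ω).present, C.t₀ ω ≤ C.t n ω ∨
    (C.t n ω < C.t₀ ω ∧ C.power .contender n ω < p.ρd))}

/-- The density of the active D2D transmitters: every potential D2D transmitter is retained
with the retaining probability. -/
def activeDens : ℝ := Pr.real C.retained * (p.ζ * p.lamU)

end Contention

/-! ## The downlink -/

/-- The point processes seen by a typical downlink user. The base stations of a tier that operate
in downlink mode form a Poisson process of density `q i * lam i`; each of them is active with
probability `1 - voidD i`, independently of the others, so that the active and the idle ones form
independent Poisson processes. -/
inductive DownField
  | active (i : Tier)
  | idle (i : Tier)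
  /-- transmitting mobile users associated with tier `i` -/
  | user (i : Tier)
  /-- active D2D transmitters -/
  | d2d

/-- Densities of these processes, if the active D2D transmitters have density `lamd`. -/
def Params.downDens (p : Params) (lamd : ℝ) : DownField → ℝ
  | .active i => p.densD i
  | .idle i => p.q i * p.lam i - p.densD i
  | .user i => p.densU i
  | .d2d => lamd

/-- The network as seen by a typical receiving mobile user, located at the origin. -/
structure Downlink (p : Params) (lamd : ℝ) {Ω : Type*} [MeasurableSpace Ω] (Pr : Measure Ω) where
  Φ : DownField → Ω → Config
  h : DownField → ℕ → Ω → ℝ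
  /-- fading power of the typical link -/
  h₀ : Ω → ℝ
  field : IsRayleighField Pr (p.downDens lamd) Φ h
  h₀_law : HasLaw h₀ (expMeasure 1) Pr
  h₀_indep : IndepFun h₀ (fun ω => (fun j => Φ j ω, fun j n => h j n ω)) Pr

namespace Downlink

variable {p : Params} {lamd : ℝ} {Ω : Type*} [MeasurableSpace Ω] {Pr : Measure Ω}
  (D : Downlink p lamd Pr)

/-- The base stations of tier `i` in downlink mode. -/
def stations (i : Tier) (ω : Ω) : Set Plane :=
  (D.Φ (.active i) ω).points ∪ (D.Φ (.idle i) ω).points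

/-- The typical user is served by the base station of tier `i` at `y`: no base station in downlink
mode offers a larger biased received power, averaged over fading. -/
def Serves (i : Tier) (y : Plane) (ω : Ω) : Prop :=
  y ∈ D.stations i ω ∧ ∀ k, ∀ x ∈ D.stations k ω,
    p.P k * p.BD k * ‖x‖ ^ (-p.α) ≤ p.P i * p.BD i * ‖y‖ ^ (-p.α)

/-- Interference from D2D transmitters on a user served from `y`; the D2D users share the spectrum
of the small-cell tier only. -/
def interfd2d (i : Tier) (y : Plane) (ω : Ω) : ℝ≥0∞ :=
  match i with
  | .mbs => 0
  | .sap => interference p.α p.Qd (D.Φ .d2d ω) (fun n => D.h .d2d n ω) (Metric.ball y p.ιs) 0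

/-- The SIR of the typical user if it is served by the base station of tier `i` at `y`. -/
def sir (i : Tier) (y : Plane) (ω : Ω) : ℝ≥0∞ :=
  ENNReal.ofReal (p.P i * D.h₀ ω * ‖y‖ ^ (-p.α)) /
    (interference p.α (p.P i) (D.Φ (.active i) ω) (fun n => D.h (.active i) n ω) {y} 0
      + interference p.α (p.Q i) (D.Φ (.user i) ω) (fun n => D.h (.user i) n ω) ∅ 0
      + D.interfd2d i y ω)

/-- The typical user is associated with tier `i`. -/
def associated (i : Tier) : Set Ω := {ω | ∃ y, D.Serves i y ω}

/-- The typical user is associated with tier `i` and its SIR exceeds the threshold of tier `i`. -/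
def coveredBy (i : Tier) : Set Ω :=
  {ω | ∃ y, D.Serves i y ω ∧ ENNReal.ofReal (p.γD i) < D.sir i y ω}

/-- Coverage probability of a user associated with tier `i`. -/
def coverage (i : Tier) : ℝ := (ProbabilityTheory.cond Pr (D.associated i)).real (D.coveredBy i)

/-- Overall coverage probability. -/
def overall : ℝ := Pr.real (⋃ i, D.coveredBy i)

end Downlink

/-! ## The uplink -/

/-- The point processes seen by a typical uplink user. -/
inductive UpField
  /-- base stations of tier `i` in uplink mode -/
  | station (i : Tier)
  /-- active downlink base stations of tier `i` -/
  | active (i : Tier)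
  /-- the other transmitting mobile users associated with tier `i` -/
  | user (i : Tier)
  /-- active D2D transmitters -/
  | d2d

/-- Densities of these processes, if the active D2D transmitters have density `lamd`. -/
def Params.upDens (p : Params) (lamd : ℝ) : UpField → ℝ
  | .station i => (1 - p.q i) * p.lam i
  | .active i => p.densD i
  | .user i => p.densU i
  | .d2d => lamd

/-- The network around a typical transmitting mobile user, located at the origin. The fading
powers `h` are those to its serving base station. -/
structure Uplink (p : Params) (lamd : ℝ) {Ω : Type*} [MeasurableSpace Ω] (Pr : Measure Ω) where
  Φ : UpField → Ω → Config
  h : UpField → ℕ → Ω → ℝ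
  /-- fading power of the typical link -/
  h₀ : Ω → ℝ
  field : IsRayleighField Pr (p.upDens lamd) Φ h
  h₀_law : HasLaw h₀ (expMeasure 1) Pr
  h₀_indep : IndepFun h₀ (fun ω => (fun j => Φ j ω, fun j n => h j n ω)) Pr

namespace Uplink

variable {p : Params} {lamd : ℝ} {Ω : Type*} [MeasurableSpace Ω] {Pr : Measure Ω}
  (U : Uplink p lamd Pr)

/-- The base stations of tier `i` in uplink mode. -/
def stations (i : Tier) (ω : Ω) : Set Plane := (U.Φ (.station i) ω).points

/-- The typical user is served by the base station of tier `i` at `b`. -/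
def Serves (i : Tier) (b : Plane) (ω : Ω) : Prop :=
  b ∈ U.stations i ω ∧ ∀ k, ∀ x ∈ U.stations k ω,
    p.Q k * p.BU k * ‖x‖ ^ (-p.α) ≤ p.Q i * p.BU i * ‖b‖ ^ (-p.α)

/-- Interference from D2D transmitters on the serving base station at `b`; the exclusion ball is
centred at the transmitting user. -/
def interfd2d (i : Tier) (b : Plane) (ω : Ω) : ℝ≥0∞ :=
  match i with
  | .mbs => 0
  | .sap => interference p.α p.Qd (U.Φ .d2d ω) (fun n => U.h .d2d n ω) (Metric.ball 0 p.ιs) b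

/-- The SIR at the base station of tier `i` at `b` if it serves the typical user. -/
def sir (i : Tier) (b : Plane) (ω : Ω) : ℝ≥0∞ :=
  ENNReal.ofReal (p.Q i * U.h₀ ω * ‖b‖ ^ (-p.α)) /
    (interference p.α (p.P i) (U.Φ (.active i) ω) (fun n => U.h (.active i) n ω) ∅ b
      + interference p.α (p.Q i) (U.Φ (.user i) ω) (fun n => U.h (.user i) n ω) {0} b
      + U.interfd2d i b ω)

/-- The typical user is associated with tier `i`. -/
def associated (i : Tier) : Set Ω := {ω | ∃ b, U.Serves i b ω}

/-- The typical user is associated with tier `i` and its SIR exceeds the threshold of tier `i`. -/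
def coveredBy (i : Tier) : Set Ω :=
  {ω | ∃ b, U.Serves i b ω ∧ ENNReal.ofReal (p.γU i) < U.sir i b ω}

/-- Coverage probability of a user associated with tier `i`. -/
def coverage (i : Tier) : ℝ := (ProbabilityTheory.cond Pr (U.associated i)).real (U.coveredBy i)

/-- Overall coverage probability. -/
def overall : ℝ := Pr.real (⋃ i, U.coveredBy i)

end Uplink

/-! ## A D2D link -/

/-- The interferers of a typical D2D receiver. -/
inductive D2DField
  /-- active small-cell access points in downlink mode -/
  | station
  /-- transmitting mobile users associated with the small-cell tier -/
  | user
  /-- active D2D transmitters -/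
  | d2d

/-- Densities of the interferers, if the active D2D transmitters have density `lamd`. -/
def Params.d2dDens (p : Params) (lamd : ℝ) : D2DField → ℝ
  | .station => p.densD .sap
  | .user => p.densU .sap
  | .d2d => lamd

/-- The network as seen by a typical D2D receiver, located at the origin; its transmitter `z₀` is
at distance `rd`, in a random direction that is independent of everything else. -/
structure D2DLink (p : Params) (lamd : ℝ) {Ω : Type*} [MeasurableSpace Ω] (Pr : Measure Ω) where
  Φ : D2DField → Ω → Config
  h : D2DField → ℕ → Ω → ℝ
  /-- position of the serving transmitter -/
  z₀ : Ω → Plane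
  /-- fading power of the typical link -/
  h₀ : Ω → ℝ
  field : IsRayleighField Pr (p.d2dDens lamd) Φ h
  z₀_measurable : Measurable z₀
  norm_z₀ : ∀ ω, ‖z₀ ω‖ = p.rd
  h₀_law : HasLaw h₀ (expMeasure 1) Pr
  h₀_z₀_indep : IndepFun h₀ z₀ Pr
  link_indep : IndepFun (fun ω => (h₀ ω, z₀ ω)) (fun ω => (fun j => Φ j ω, fun j n => h j n ω)) Pr

namespace D2DLink

variable {p : Params} {lamd : ℝ} {Ω : Type*} [MeasurableSpace Ω] {Pr : Measure Ω}
  (T : D2DLink p lamd Pr)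

/-- The SIR of the typical D2D receiver. -/
def sir (ω : Ω) : ℝ≥0∞ :=
  ENNReal.ofReal (p.Qd * T.h₀ ω * p.rd ^ (-p.α)) /
    (interference p.α (p.P .sap) (T.Φ .station ω) (fun n => T.h .station n ω)
        (Metric.ball (T.z₀ ω) p.ιs) 0
      + interference p.α (p.Q .sap) (T.Φ .user ω) (fun n => T.h .user n ω)
        (Metric.ball (T.z₀ ω) p.ιs) 0
      + interference p.α p.Qd (T.Φ .d2d ω) (fun n => T.h .d2d n ω)
        (Metric.ball (T.z₀ ω) p.ιd) 0)

/-- Coverage probability of the typical D2D receiver. -/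
def coverage : ℝ := Pr.real {ω | ENNReal.ofReal p.γd < T.sir ω}

end D2DLink

/-! ## The explicit expressions -/

namespace Params

variable (p : Params)

/-- `λ_i^D` in closed form. -/
def lamD (i : Tier) : ℝ :=
  p.lam i * p.q i *
    (1 - (1 + (1 - p.μ) * (1 - p.ζ) * p.lamU * p.assocD i / (3.5 * p.q i * p.lam i)) ^ (-3.5 : ℝ))

/-- `λ_i^U = λ_{u,i}^T` in closed form. -/
def lamT (i : Tier) : ℝ :=
  p.lam i * (1 - p.q i) *
    (1 - (1 + p.μ * (1 - p.ζ) * p.lamU * p.assocU i / (3.5 * (1 - p.q i) * p.lam i)) ^ (-3.5 : ℝ))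

/-- The constant `K_o` for a sensing threshold `ρ`. -/
def Kconst (ρ : ℝ) : ℝ :=
  2 * Real.pi * Real.Gamma (2 / p.α) / (p.α * (ρ / p.Qd) ^ (2 / p.α))

/-- `λ_d` in closed form. -/
def lamd : ℝ :=
  Real.exp (-((p.lamD .sap + p.lamT .sap) * p.Kconst p.ρs)) *
    ((1 - Real.exp (-(p.ζ * p.lamU * p.Kconst p.ρd))) / p.Kconst p.ρd)

/-- `C(α)` -/
def Cconst : ℝ := (2 * Real.pi / p.α) / Real.sin (2 * Real.pi / p.α)

/-- `δ(β, α)` -/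
def δ (β : ℝ) : ℝ :=
  ∫ u in Set.Ioi (β ^ (-(2 / p.α))), β ^ (2 / p.α) / (1 + u ^ (p.α / 2))

/-- The function `Z` with angular bounds `θl`, `θu` and radial bounds `κl`, `κu`, which may depend
on the angle. -/
def Z (s Q θl θu : ℝ) (κl κu : ℝ → ℝ) : ℝ :=
  (s * Q) ^ (2 / p.α) * ∫ θ in θl..θu,
    ∫ u in (κl θ ^ 2 / (s * Q) ^ (2 / p.α))..(κu θ ^ 2 / (s * Q) ^ (2 / p.α)),
      1 / (1 + u ^ (p.α / 2))

/-- Distance from a point to the far intersection of the ray of angle `θ` with the circle of radius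
`l` about a centre at distance `r` and angle `0`. -/
def farDist (l r θ : ℝ) : ℝ := √(l ^ 2 - (r * Real.sin θ) ^ 2) + r * Real.cos θ

/-- Distance to the near intersection. -/
def nearDist (l r θ : ℝ) : ℝ := r * Real.cos θ - √(l ^ 2 - (r * Real.sin θ) ^ 2)

/-- `L_{I_out}(s | r)` -/
def laplaceOut (s r : ℝ) : ℝ :=
  Real.exp (-(Real.pi * p.lamd * (p.ιs + r) ^ 2 * p.δ (s * p.Qd / (p.ιs + r) ^ p.α)))

/-- The Laplace transform of the D2D interference for a link of length `r ≤ ι_s`. -/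
def laplaceShort (s r : ℝ) : ℝ :=
  p.laplaceOut s r *
    Real.exp (-(p.lamd * p.Z s p.Qd 0 Real.pi (farDist p.ιs r) (fun _ => p.ιs + r)))

/-- `Θ` -/
def Θ (r : ℝ) : ℝ := Real.arcsin (p.ιs / r)

/-- The Laplace transform of the D2D interference for a link of length `r > ι_s`. -/
def laplaceLong (s r : ℝ) : ℝ :=
  p.laplaceOut s r *
    Real.exp (-(p.lamd * (p.Z s p.Qd 0 (p.Θ r) (fun _ => 0) (nearDist p.ιs r)
      + p.Z s p.Qd 0 (p.Θ r) (farDist p.ιs r) (fun _ => p.ιs + r)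
      + p.Z s p.Qd (p.Θ r) Real.pi (fun _ => 0) (fun _ => p.ιs + r))))

/-- `F` -/
def F : ℝ :=
  p.lamD .sap * p.δ (p.γD .sap)
    + p.lamT .sap * p.Cconst * (p.Q .sap / p.P .sap * p.γD .sap) ^ (2 / p.α)
    + p.q .sap * p.lam .sap / p.assocD .sap

/-- `G` -/
def G : ℝ :=
  p.Cconst * p.γU .sap ^ (2 / p.α) *
      (p.lamD .sap * (p.P .sap / p.Q .sap) ^ (2 / p.α) + p.lamT .sap)
    + (1 - p.q .sap) * p.lam .sap / p.assocU .sap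

/-- Macro tier, downlink. -/
def covMacroD : ℝ :=
  p.q .mbs * p.lam .mbs /
    (p.lamD .mbs * p.assocD .mbs * p.δ (p.γD .mbs)
      + p.lamT .mbs * p.assocD .mbs * p.Cconst *
        (p.Q .mbs / p.P .mbs * p.γD .mbs) ^ (2 / p.α)
      + p.q .mbs * p.lam .mbs)

/-- Macro tier, uplink. -/
def covMacroU : ℝ :=
  (1 - p.q .mbs) * p.lam .mbs /
    (p.Cconst * p.γU .mbs ^ (2 / p.α) * p.assocU .mbs *
        (p.lamD .mbs * (p.P .mbs / p.Q .mbs) ^ (2 / p.α) + p.lamT .mbs)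
      + (1 - p.q .mbs) * p.lam .mbs)

/-- Small-cell tier, downlink. -/
def covSmallD : ℝ :=
  Real.pi * p.q .sap * p.lam .sap / p.assocD .sap *
    ((∫ v in (0 : ℝ)..(p.ιs ^ 2), Real.exp (-(Real.pi * v * p.F)) *
        p.laplaceShort (p.γD .sap * v ^ (p.α / 2) / p.P .sap) (√v))
      + ∫ v in Set.Ioi (p.ιs ^ 2), Real.exp (-(Real.pi * v * p.F)) *
        p.laplaceLong (p.γD .sap * v ^ (p.α / 2) / p.P .sap) (√v))

/-- Small-cell tier, uplink. -/
def covSmallU : ℝ :=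
  Real.pi * (1 - p.q .sap) * p.lam .sap / p.assocU .sap *
    ((∫ v in (0 : ℝ)..(p.ιs ^ 2), Real.exp (-(Real.pi * v * p.G)) *
        p.laplaceShort (p.γU .sap * v ^ (p.α / 2) / p.Q .sap) (√v))
      + ∫ v in Set.Ioi (p.ιs ^ 2), Real.exp (-(Real.pi * v * p.G)) *
        p.laplaceLong (p.γU .sap * v ^ (p.α / 2) / p.Q .sap) (√v))

/-- The common form of `I₁`, `I₂`, `I₃`: interferers of density `d` and power `Q` outside the ball
of radius `l` about the serving D2D transmitter. -/
def Iexp (d l s Q : ℝ) : ℝ :=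
  Real.pi * d * (l + p.rd) ^ 2 * p.δ (s * Q / (l + p.rd) ^ p.α)
    + d * p.Z s Q 0 Real.pi (farDist l p.rd) (fun _ => l + p.rd)

/-- Typical D2D receiver. -/
def covD2D : ℝ :=
  Real.exp (-p.Iexp (p.lamD .sap) p.ιs (p.γd * p.rd ^ p.α / p.Qd) (p.P .sap)
    - p.Iexp (p.lamT .sap) p.ιs (p.γd * p.rd ^ p.α / p.Qd) (p.Q .sap)
    - p.Iexp p.lamd p.ιd (p.γd * p.rd ^ p.α / p.Qd) p.Qd)

end Params

end HCN

end

/-! Every probability in the theorem is a Laplace functional of independent Poisson processes. A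
Rayleigh link of mean power `q` succeeds against interference `I` with probability `E exp(-γ I /
q)`, because its fading power is exponential (`measure_sir_gt`). Averaging over the independent
fading powers of the interferers turns a point at `x` into the factor `1 / (1 + s p ‖x - y‖ ^
(-α))`, that is, into an exponent `log (1 + …)` attached to the point. What is left is `E exp(-∑ f)
= exp(-∑ d ∫ (1 - exp(-f)))`. This is derived from the laws and the independence of the counts:
generating functions give it for simple functions, limits for measurable ones (`IsPoisson.laplace`).

The serving station is itself a random point, so a sum over candidate stations has to be averaged.
This is the Mecke formula. It comes from differentiating the Laplace functional; dyadic difference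
quotients of `exp` increase, so monotone convergence suffices. All functions take values in `[0,
∞]`. A station at distance `r` is strictly best iff the other stations avoid discs of radii
proportional to `r`, and an exponent equal to `∞` on these discs encodes that event. Association and
coverage are thus treated by one formula, `mecke_radial`, where the exponents increase with `r` and
their total is `a r²`; rounding `r` down and up gives the two bounds. Ties are almost surely absent,
since blocking by open and by closed discs has the same finite expectation (`ae_generic`).

The D2D exclusion ball in the downlink depends on the whole position of the server and is not
monotone in its distance. Fields that contain no stations are therefore averaged out first, by
independence, and enter the Mecke formula as a weight bounded by one (`lintegral_weight_loss`,
`measure_covered`). Integrating over the position of the server then gives a Gaussian integral for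
the macro tier and an integral in `v = ‖y‖²` for the small-cell tier.

The explicit constants come from one kernel, `1 / (1 + u ^ (α / 2))` with `u = ρ² / T` and `T = (sQ)
^ (2/α)`. Over the whole plane Euler's reflection formula gives `C(α)`. Outside a centred disc it
gives `δ`. Outside an eccentric disc, polar coordinates with the axis towards its centre leave one
or two intervals on each ray; cutting at `ι + r` separates the angle-dependent part `Z` from the
common tail `δ`.

For CSMA, given its own timer `a`, the typical transmitter has to respect a contender with
probability `a`, independently for different contenders. The retaining probability given `a` is
again a Laplace functional, exponential in `a`, and its integral over `[0, 1]` gives `λ_d`. For the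
D2D link the direction of the transmitter is irrelevant, because the Laplace transform depends only
on its distance. -/

namespace HCN

set_option linter.unusedSectionVars false

open Filter Topology

/-! ## The function `exp (-x)` on `[0, ∞]` -/

/-- `exp (-x)` for `x ∈ [0, ∞]`, with values in `[0, ∞]`. -/
noncomputable def eexp (x : ℝ≥0∞) : ℝ≥0∞ := EReal.exp (-(x : EReal))

@[simp] lemma eexp_zero : eexp 0 = 1 := by simp [eexp]

@[simp] lemma eexp_top : eexp ∞ = 0 := by simp [eexp]

lemma eexp_ofReal {x : ℝ} (hx : 0 ≤ x) : eexp (ENNReal.ofReal x) = ENNReal.ofReal (Real.exp (-x)) := by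
  rw [eexp, EReal.coe_ennreal_ofReal, max_eq_left hx, ← EReal.coe_neg, EReal.exp_coe]

lemma eexp_eq (x : ℝ≥0∞) : eexp x = ENNReal.ofReal (expNeg x) := by
  unfold expNeg
  split_ifs with h
  · simp [h]
  · conv_lhs => rw [← ENNReal.ofReal_toReal h]
    rw [eexp_ofReal ENNReal.toReal_nonneg]

lemma eexp_add (x y : ℝ≥0∞) : eexp (x + y) = eexp x * eexp y := by
  rw [eexp, eexp, eexp, ← EReal.exp_add, EReal.coe_ennreal_add, EReal.neg_add]
  · rfl
  · simp
  · simp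

lemma continuous_eexp : Continuous eexp :=
  ENNReal.continuous_exp.comp (continuous_neg.comp continuous_coe_ennreal_ereal)

@[fun_prop]
lemma measurable_eexp : Measurable eexp := continuous_eexp.measurable

lemma antitone_eexp : Antitone eexp := fun x y h => by
  unfold eexp
  simp only [EReal.exp_le_exp_iff, EReal.neg_le_neg_iff]
  exact_mod_cast h

lemma eexp_le_one (x : ℝ≥0∞) : eexp x ≤ 1 := by
  simpa using antitone_eexp (zero_le (a := x))

lemma eexp_ne_top (x : ℝ≥0∞) : eexp x ≠ ∞ := ((eexp_le_one x).trans_lt ENNReal.one_lt_top).ne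

lemma eexp_eq_zero {x : ℝ≥0∞} : eexp x = 0 ↔ x = ∞ := by
  simp [eexp, EReal.neg_eq_bot_iff]

lemma eexp_finset_sum {ι : Type*} (s : Finset ι) (f : ι → ℝ≥0∞) :
    eexp (∑ i ∈ s, f i) = ∏ i ∈ s, eexp (f i) := by
  classical
  induction s using Finset.induction_on with
  | empty => simp
  | insert a s ha ih => rw [Finset.sum_insert ha, Finset.prod_insert ha, eexp_add, ih]

lemma eexp_natCast_mul (n : ℕ) (x : ℝ≥0∞) : eexp (n * x) = eexp x ^ n := by
  have := eexp_finset_sum (Finset.range n) (fun _ => x)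
  simpa using this

/-- The identity `1 - ab = (1 - a) + a (1 - b)`, with truncated subtraction harmless because `a, b ≤
1`. It compares a step of the difference quotient with the half step, and it isolates the effect of
a perturbation on a Laplace exponent. -/
lemma one_sub_eexp_add (x y : ℝ≥0∞) :
    1 - eexp (x + y) = (1 - eexp x) + eexp x * (1 - eexp y) := by
  have hx := eexp_le_one x
  have hy := eexp_le_one y
  rw [eexp_add]
  lift eexp x to ℝ≥0 using eexp_ne_top x with a
  lift eexp y to ℝ≥0 using eexp_ne_top y with b
  norm_cast at *
  rw [← NNReal.coe_inj]
  rw [NNReal.coe_sub (mul_le_one' hx hy)]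
  push_cast [hx, hy]
  ring

/-! ### Dyadic difference quotients of the exponential. -/

/-- The difference quotient of `-exp` at the step `2 ^ (-m)`. -/
noncomputable def expSlope (m : ℕ) (x : ℝ≥0∞) : ℝ≥0∞ := 2 ^ m * (1 - eexp (x / 2 ^ m))

lemma two_pow_ne_zero' (m : ℕ) : (2 : ℝ≥0∞) ^ m ≠ 0 := by positivity

lemma two_pow_ne_top (m : ℕ) : (2 : ℝ≥0∞) ^ m ≠ ∞ := by simp

lemma expSlope_mono_right (m : ℕ) : Monotone (expSlope m) := fun x y h => by
  unfold expSlope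
  have := antitone_eexp (ENNReal.div_le_div_right h (2 ^ m))
  gcongr

/-- Halving the step: `1 - e^(-2y) = (1 - e^(-y)) + e^(-y) (1 - e^(-y)) ≤ 2 (1 - e^(-y))`. Steps are
dyadic for this reason; the limits can then be taken by monotone convergence. -/
lemma expSlope_mono_left (x : ℝ≥0∞) : Monotone (fun m => expSlope m x) := by
  refine monotone_nat_of_le_succ fun m => ?_
  unfold expSlope
  have h : x / 2 ^ m = x / 2 ^ (m + 1) + x / 2 ^ (m + 1) := by
    rw [ENNReal.div_add_div_same, ← two_mul, pow_succ, mul_comm (2 ^ m) 2,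
      ENNReal.mul_div_mul_left _ _ (by norm_num) (by norm_num)]
  rw [h, one_sub_eexp_add, pow_succ, mul_assoc, two_mul]
  gcongr
  exact mul_le_of_le_one_left zero_le (eexp_le_one _)

@[fun_prop]
lemma measurable_expSlope (m : ℕ) : Measurable (expSlope m) := by
  unfold expSlope; fun_prop

lemma expSlope_ofReal (m : ℕ) {x : ℝ} (hx : 0 ≤ x) :
    expSlope m (ENNReal.ofReal x) = ENNReal.ofReal (2 ^ m * (1 - Real.exp (-(x / 2 ^ m)))) := by
  unfold expSlope
  have h2 : (2 : ℝ≥0∞) ^ m = ENNReal.ofReal (2 ^ m) := by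
    rw [ENNReal.ofReal_pow (by norm_num)]; norm_num
  rw [h2, ← ENNReal.ofReal_div_of_pos (by positivity), eexp_ofReal (by positivity),
    ← ENNReal.ofReal_one, ← ENNReal.ofReal_sub _ (by positivity), ← ENNReal.ofReal_mul (by positivity)]

lemma tendsto_expSlope (x : ℝ≥0∞) : Tendsto (fun m => expSlope m x) atTop (𝓝 x) := by
  have h2 : Tendsto (fun m : ℕ => (2 : ℝ) ^ m) atTop atTop :=
    tendsto_pow_atTop_atTop_of_one_lt (by norm_num)
  rcases eq_or_ne x ∞ with rfl | hx
  · have : ∀ m, expSlope m ∞ = ENNReal.ofReal (2 ^ m) := fun m => by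
      unfold expSlope
      rw [ENNReal.top_div_of_ne_top (two_pow_ne_top m), eexp_top, ENNReal.ofReal_pow (by norm_num)]
      simp
    simp_rw [this]
    exact ENNReal.tendsto_ofReal_atTop.comp h2
  · obtain ⟨r, hr, rfl⟩ : ∃ r : ℝ, 0 ≤ r ∧ x = ENNReal.ofReal r :=
      ⟨x.toReal, ENNReal.toReal_nonneg, (ENNReal.ofReal_toReal hx).symm⟩
    simp_rw [expSlope_ofReal _ hr]
    refine ENNReal.tendsto_ofReal ?_
    have h3 : Tendsto (fun m : ℕ => r / 2 ^ m) atTop (𝓝 0) := Tendsto.div_atTop tendsto_const_nhds h2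
    -- With `y = r / 2 ^ m`, the bounds `1 - y ≤ e^(-y) ≤ 1 / (1 + y)` squeeze the quotient between
    -- `r / (1 + y)` and `r`.
    have h4 : Tendsto (fun m : ℕ => r / (1 + r / 2 ^ m)) atTop (𝓝 r) := by
      have := (tendsto_const_nhds (x := r)).div (h3.const_add 1) (by norm_num)
      simpa [Pi.div_def] using this
    refine tendsto_of_tendsto_of_tendsto_of_le_of_le h4 tendsto_const_nhds (fun m => ?_) (fun m => ?_)
    · have hp : (0 : ℝ) < 2 ^ m := by positivity
      have hy : 0 ≤ r / 2 ^ m := by positivity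
      set y := r / 2 ^ m with hydef
      have hry : r = 2 ^ m * y := by rw [hydef]; field_simp
      have : Real.exp (-y) ≤ 1 / (1 + y) := by
        rw [Real.exp_neg, inv_eq_one_div]
        exact one_div_le_one_div_of_le (by positivity) (by linarith [Real.add_one_le_exp y])
      have e : r / (1 + y) = 2 ^ m * (1 - 1 / (1 + y)) := by
        rw [hry]; field_simp; ring
      show r / (1 + y) ≤ 2 ^ m * (1 - Real.exp (-y))
      rw [e]
      gcongr
    · have hp : (0 : ℝ) < 2 ^ m := by positivity
      have h := Real.add_one_le_exp (-(r / 2 ^ m))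
      calc 2 ^ m * (1 - Real.exp (-(r / 2 ^ m))) ≤ 2 ^ m * (r / 2 ^ m) := by
            gcongr; linarith
        _ = r := by field_simp

lemma iSup_expSlope (x : ℝ≥0∞) : ⨆ m, expSlope m x = x :=
  iSup_eq_of_tendsto (expSlope_mono_left x) (tendsto_expSlope x)

/-- In the Mecke formula the same `m` sets the step and the argument. Monotonicity in both reduces
the double supremum to the diagonal. -/
lemma iSup_expSlope_diag {b : ℕ → ℝ≥0∞} (hb : Monotone b) :
    ⨆ m, expSlope m (b m) = ⨆ m, b m := by
  apply le_antisymm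
  · refine iSup_le fun m => le_iSup_of_le m ?_
    exact (le_iSup (fun k => expSlope k (b m)) m).trans (iSup_expSlope (b m)).le
  · refine iSup_le fun l => ?_
    rw [← iSup_expSlope (b l)]
    refine iSup_le fun k => ?_
    refine le_iSup_of_le (max k l) ?_
    exact (expSlope_mono_left _ (le_max_left k l)).trans
      (expSlope_mono_right _ (hb (le_max_right k l)))

/-! ## Sums over the points of a configuration -/

namespace Config

/-- The sum of `f` over the points of `c`. -/
noncomputable def sum (c : Config) (f : Plane → ℝ≥0∞) : ℝ≥0∞ :=
  ∑' n, if (c n).1 = true then f (c n).2 else 0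

/-- The configuration without its `n`-th point. -/
def erase (c : Config) (n : ℕ) : Config := fun k => if k = n then (false, (c k).2) else c k

lemma sum_eq_add_erase (c : Config) (n : ℕ) (hn : (c n).1 = true) (f : Plane → ℝ≥0∞) :
    c.sum f = f (c n).2 + (c.erase n).sum f := by
  unfold sum
  rw [ENNReal.tsum_eq_add_tsum_ite n, if_pos hn]
  congr 1
  refine tsum_congr fun k => ?_
  by_cases hk : k = n <;> simp [erase, hk]

lemma sum_mono (c : Config) {f g : Plane → ℝ≥0∞} (h : f ≤ g) : c.sum f ≤ c.sum g := by
  refine ENNReal.tsum_le_tsum fun n => ?_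
  split_ifs
  · exact h _
  · exact le_rfl

lemma sum_add (c : Config) (f g : Plane → ℝ≥0∞) :
    c.sum (fun x => f x + g x) = c.sum f + c.sum g := by
  unfold sum
  rw [← ENNReal.tsum_add]
  refine tsum_congr fun n => ?_
  split_ifs <;> simp

lemma sum_const_mul (c : Config) (a : ℝ≥0∞) (f : Plane → ℝ≥0∞) :
    c.sum (fun x => a * f x) = a * c.sum f := by
  unfold sum
  rw [← ENNReal.tsum_mul_left]
  refine tsum_congr fun n => ?_
  split_ifs <;> simp

@[simp] lemma sum_zero (c : Config) : c.sum (fun _ => 0) = 0 := by simp [sum]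

lemma sum_finset_sum {ι : Type*} (s : Finset ι) (c : Config) (f : ι → Plane → ℝ≥0∞) :
    c.sum (fun x => ∑ i ∈ s, f i x) = ∑ i ∈ s, c.sum (f i) := by
  classical
  induction s using Finset.induction_on with
  | empty => simp
  | insert a s ha ih => simp_rw [Finset.sum_insert ha, sum_add, ih]

lemma sum_iSup (c : Config) {f : ℕ → Plane → ℝ≥0∞} (hf : Monotone f) :
    c.sum (fun x => ⨆ k, f k x) = ⨆ k, c.sum (f k) := by
  unfold sum
  simp_rw [← lintegral_count]
  rw [← lintegral_iSup (fun k => measurable_from_top)]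
  · refine lintegral_congr fun n => ?_
    split_ifs <;> simp
  · intro k l hkl n
    simp only
    split_ifs
    · exact hf hkl _
    · exact le_rfl

lemma measurable_fst (n : ℕ) : Measurable (fun c : Config => (c n).1) := by fun_prop

lemma measurableSet_present (n : ℕ) : MeasurableSet {c : Config | (c n).1 = true} :=
  measurable_fst n (measurableSet_singleton true)

/-- Measurability of sums over the points, with a parameter. -/
lemma measurable_sum_param {X : Type*} [MeasurableSpace X] {c : X → Config} {f : X → Plane → ℝ≥0∞}
    (hc : Measurable c) (hf : Measurable (Function.uncurry f)) :
    Measurable (fun x => (c x).sum (f x)) := by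
  unfold sum
  refine Measurable.tsum fun n => ?_
  refine Measurable.ite ((measurableSet_present n).preimage hc) ?_ measurable_const
  exact hf.comp (measurable_id.prodMk ((by fun_prop : Measurable fun c : Config => (c n).2).comp hc))

lemma measurable_sum {f : Plane → ℝ≥0∞} (hf : Measurable f) :
    Measurable (fun c : Config => c.sum f) :=
  measurable_sum_param (f := fun _ => f) measurable_id (hf.comp measurable_snd)

lemma measurable_erase (n : ℕ) : Measurable (fun c : Config => c.erase n) := by
  refine measurable_pi_lambda _ fun k => ?_
  unfold erase
  split_ifs
  · exact measurable_const.prodMk (by fun_prop)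
  · fun_prop

/-- The passage from counts, in which the Poisson property is stated, to sums over points. -/
lemma count_eq_sum (c : Config) (B : Set Plane) :
    ((c.count B : ℕ∞) : ℝ≥0∞) = c.sum (B.indicator 1) := by
  classical
  unfold count sum
  rw [← ENNReal.tsum_set_one, tsum_subtype _ (fun _ => (1 : ℝ≥0∞))]
  refine tsum_congr fun n => ?_
  by_cases h1 : (c n).1 = true <;> by_cases h2 : (c n).2 ∈ B <;> simp [Set.indicator, present, h1, h2]

lemma measurable_count {B : Set Plane} (hB : MeasurableSet B) :
    Measurable (fun c : Config => c.count B) := by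
  refine measurable_to_countable' fun k => ?_
  have : (fun c : Config => c.count B) ⁻¹' {k}
      = (fun c : Config => c.sum (B.indicator 1)) ⁻¹' {((k : ℕ∞) : ℝ≥0∞)} := by
    ext c
    simp only [Set.mem_preimage, Set.mem_singleton_iff, ← count_eq_sum, ENat.toENNReal_inj]
  rw [this]
  exact measurable_sum (measurable_one.indicator hB) (measurableSet_singleton _)

end Config

/-! ## The Laplace functional of a Poisson process -/

/-- The generating function of the Poisson law at `a = e^(-z)`: `∑ e^(-m) (m a)^k / k! = e^(-m (1 -
a))`. The case `z = ∞`, `a = 0` is included and gives the void probability. -/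
lemma tsum_poissonMeasure_mul_eexp (m : ℝ≥0) (z : ℝ≥0∞) :
    ∑' k : ℕ, eexp (k * z) * poissonMeasure m {k} = eexp (m * (1 - eexp z)) := by
  obtain ⟨a, ha0, ha1, haz⟩ : ∃ a : ℝ, 0 ≤ a ∧ a ≤ 1 ∧ eexp z = ENNReal.ofReal a :=
    ⟨(eexp z).toReal, ENNReal.toReal_nonneg, by
      simpa using ENNReal.toReal_mono ENNReal.one_ne_top (eexp_le_one z),
      (ENNReal.ofReal_toReal (eexp_ne_top z)).symm⟩
  have h1 : (m : ℝ≥0∞) * (1 - eexp z) = ENNReal.ofReal (m * (1 - a)) := by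
    rw [haz, ← ENNReal.ofReal_one, ← ENNReal.ofReal_sub _ ha0, ENNReal.ofReal_mul m.coe_nonneg,
      ENNReal.ofReal_coe_nnreal]
  rw [h1, eexp_ofReal (mul_nonneg m.coe_nonneg (by linarith))]
  have hs : HasSum (fun k : ℕ => Real.exp (-m) * ((m * a) ^ k / (k.factorial : ℝ)))
      (Real.exp (-(m * (1 - a)))) := by
    have := (NormedSpace.expSeries_div_hasSum_exp (m * a : ℝ)).mul_left (Real.exp (-m))
    convert! this using 1
    rw [← Real.exp_eq_exp_ℝ, ← Real.exp_add]
    ring_nf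
  rw [← hs.tsum_eq, ENNReal.ofReal_tsum_of_nonneg (fun k => by positivity) hs.summable]
  refine tsum_congr fun k => ?_
  rw [eexp_natCast_mul, haz, ← ENNReal.ofReal_pow ha0, poissonMeasure_singleton,
    ← ENNReal.ofReal_mul (by positivity)]
  congr 1
  rw [mul_pow]; ring

section Laplace

variable {Ω : Type*} [MeasurableSpace Ω] {Pr : Measure Ω} [IsProbabilityMeasure Pr] {d : ℝ}
  {Φ : Ω → Config}

lemma IsPoisson.lintegral_eexp_count (hΦ : IsPoisson Pr d Φ) (hd : 0 ≤ d) {B : Set Plane}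
    (hB : MeasurableSet B) (hv : volume B ≠ ∞) (z : ℝ≥0∞) :
    ∫⁻ ω, eexp (z * ((Φ ω).count B : ℕ∞)) ∂Pr
      = eexp (ENNReal.ofReal d * volume B * (1 - eexp z)) := by
  set m := (d * (volume B).toReal).toNNReal with hm
  let A : ℕ → Set Ω := fun k => {ω | (Φ ω).count B = k}
  have hA : ∀ k, MeasurableSet (A k) := fun k =>
    ((Config.measurable_count hB).comp hΦ.measurable) (measurableSet_singleton (k : ℕ∞))
  have hdisj : Pairwise (Function.onFun Disjoint A) := by
    intro k l hkl
    refine Set.disjoint_left.2 fun ω h1 h2 => hkl ?_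
    have : (k : ℕ∞) = l := by rw [← h1, ← h2]
    exact_mod_cast this
  have hlaw : ∀ k, Pr (A k) = poissonMeasure m {k} := hΦ.count_law B hB hv
  -- The count takes values in `ℕ∞`; that it is almost surely finite follows because the Poisson
  -- masses of the finite values add up to one.
  have hU : Pr (⋃ k, A k) = 1 := by
    rw [measure_iUnion hdisj hA]
    simp_rw [hlaw]
    rw [← measure_iUnion (fun k l hkl => by simpa using hkl) (fun k => measurableSet_singleton k)]
    simp [Set.iUnion_of_singleton]
  have hae : ∀ᵐ ω ∂Pr, ω ∈ ⋃ k, A k := by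
    rw [ae_iff]
    exact (prob_compl_eq_zero_iff (MeasurableSet.iUnion hA)).2 hU
  rw [← Measure.restrict_eq_self_of_ae_mem hae, lintegral_iUnion hA hdisj]
  have h1 : (m : ℝ≥0∞) = ENNReal.ofReal d * volume B := by
    rw [hm]
    change ENNReal.ofReal (d * (volume B).toReal) = _
    rw [ENNReal.ofReal_mul hd, ENNReal.ofReal_toReal hv]
  rw [← h1, ← tsum_poissonMeasure_mul_eexp]
  refine tsum_congr fun k => ?_
  rw [setLIntegral_congr_fun (g := fun _ => eexp (k * z)) (hA k), setLIntegral_const, hlaw]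
  intro ω hω
  have : (Φ ω).count B = k := hω
  simp [this, mul_comm]

/-- The finite linear combination of indicators of disjoint sets, composed with a function that
vanishes at the origin. -/
lemma comp_sum_indicator {m : ℕ} {B : Fin m → Set Plane}
    (hdisj : Pairwise (fun a b => Disjoint (B a) (B b))) (z : Fin m → ℝ≥0∞) (g : ℝ≥0∞ → ℝ≥0∞)
    (hg : g 0 = 0) (x : Plane) :
    g (∑ a, (B a).indicator (fun _ => z a) x) = ∑ a, (B a).indicator (fun _ => g (z a)) x := by
  classical
  by_cases h : ∃ a, x ∈ B a
  · obtain ⟨a, ha⟩ := h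
    have hne : ∀ b, b ≠ a → x ∉ B b := fun b hb hx => Set.disjoint_left.1 (hdisj hb) hx ha
    rw [Finset.sum_eq_single a (fun b _ hb => Set.indicator_of_notMem (hne b hb) _) (by simp),
      Finset.sum_eq_single a (fun b _ hb => Set.indicator_of_notMem (hne b hb) _) (by simp)]
    simp [ha]
  · push Not at h
    simp [h, hg]

/-- The sum over the points is a combination of counts in disjoint sets, so independence factorises
the expectation. On the other side `1 - e^(-·)` acts value by value, since it vanishes at zero and
the sets are disjoint. -/
lemma IsPoisson.laplace_step (hΦ : IsPoisson Pr d Φ) (hd : 0 ≤ d) {m : ℕ}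
    {B : Fin m → Set Plane} (hB : ∀ a, MeasurableSet (B a)) (hv : ∀ a, volume (B a) ≠ ∞)
    (hdisj : Pairwise (fun a b => Disjoint (B a) (B b))) (z : Fin m → ℝ≥0∞) :
    ∫⁻ ω, eexp ((Φ ω).sum (fun x => ∑ a, (B a).indicator (fun _ => z a) x)) ∂Pr
      = eexp (ENNReal.ofReal d * ∫⁻ x, (1 - eexp (∑ a, (B a).indicator (fun _ => z a) x))) := by
  have h1 : ∀ ω, eexp ((Φ ω).sum (fun x => ∑ a, (B a).indicator (fun _ => z a) x))
      = ∏ a, eexp (z a * ((Φ ω).count (B a) : ℕ∞)) := fun ω => by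
    rw [Config.sum_finset_sum, eexp_finset_sum]
    refine Finset.prod_congr rfl fun a _ => ?_
    rw [Config.count_eq_sum, ← Config.sum_const_mul]
    congr 2
    ext x
    by_cases hx : x ∈ B a <;> simp [hx]
  simp_rw [h1]
  have hind := (hΦ.count_indep m B hB hv hdisj).comp
    (g := fun a (k : ℕ∞) => eexp (z a * (k : ℝ≥0∞))) (fun a => measurable_from_top)
  rw [lintegral_prod_eq_prod_lintegral_of_indepFun Finset.univ
    (fun a ω => eexp (z a * ((Φ ω).count (B a) : ℕ∞))) hind]
  · simp_rw [fun a => hΦ.lintegral_eexp_count hd (hB a) (hv a) (z a)]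
    rw [← eexp_finset_sum]
    congr 1
    simp_rw [comp_sum_indicator hdisj z (fun y => 1 - eexp y) (by simp)]
    rw [lintegral_finsetSum _ (fun a _ => measurable_const.indicator (hB a)), Finset.mul_sum]
    refine Finset.sum_congr rfl fun a _ => ?_
    rw [lintegral_indicator_const (hB a), mul_assoc, mul_comm (volume (B a))]
  · exact fun a => (measurable_from_top (f := fun k : ℕ∞ => eexp (z a * (k : ℝ≥0∞)))).comp
      ((Config.measurable_count (hB a)).comp hΦ.measurable)

/-- The cut-off to `K` is there because the law of the counts is given for sets of finite area only,
and level sets of a simple function on the plane need not have finite area. -/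
lemma IsPoisson.laplace_simple (hΦ : IsPoisson Pr d Φ) (hd : 0 ≤ d) (g : SimpleFunc Plane ℝ≥0∞)
    {K : Set Plane} (hK : MeasurableSet K) (hv : volume K ≠ ∞) :
    ∫⁻ ω, eexp ((Φ ω).sum (K.indicator g)) ∂Pr
      = eexp (ENNReal.ofReal d * ∫⁻ x, (1 - eexp (K.indicator g x))) := by
  classical
  let e := g.range.equivFin
  let z : Fin g.range.card → ℝ≥0∞ := fun a => (e.symm a : ℝ≥0∞)
  let B : Fin g.range.card → Set Plane := fun a => g ⁻¹' {z a} ∩ K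
  have hrep : K.indicator g = fun x => ∑ a, (B a).indicator (fun _ => z a) x := by
    ext x
    by_cases hx : x ∈ K
    · have ha : z (e ⟨g x, g.mem_range_self x⟩) = g x := by simp [z]
      rw [Finset.sum_eq_single (e ⟨g x, g.mem_range_self x⟩)]
      · simp [B, hx, ha]
      · intro b _ hb
        refine Set.indicator_of_notMem (fun hxb => hb ?_) _
        have : g x = z b := hxb.1
        apply e.symm.injective
        ext1
        simp [this, z]
      · simp
    · simp [B, hx]
  rw [hrep]
  refine hΦ.laplace_step hd (fun a => (g.measurableSet_preimage _).inter hK)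
    (fun a => measure_ne_top_of_subset Set.inter_subset_right hv) (fun a b hab => ?_) z
  refine Set.disjoint_left.2 fun x hxa hxb => hab ?_
  have : z a = z b := by rw [← (hxa.1 : g x = z a), ← (hxb.1 : g x = z b)]
  exact e.symm.injective (Subtype.ext this)

/-- The Laplace functional of a Poisson process. -/
lemma IsPoisson.laplace (hΦ : IsPoisson Pr d Φ) (hd : 0 ≤ d) {f : Plane → ℝ≥0∞}
    (hf : Measurable f) :
    ∫⁻ ω, eexp ((Φ ω).sum f) ∂Pr = eexp (ENNReal.ofReal d * ∫⁻ x, (1 - eexp (f x))) := by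
  -- Simple approximations cut off to growing balls increase to `f`. The left side then converges by
  -- domination with the constant one, the right side by monotone convergence.
  let f' : ℕ → Plane → ℝ≥0∞ := fun k => (Metric.ball 0 (k : ℝ)).indicator (SimpleFunc.eapprox f k)
  have hf'm : ∀ k, Measurable (f' k) := fun k =>
    (SimpleFunc.measurable _).indicator Metric.isOpen_ball.measurableSet
  have hmono : Monotone f' := by
    intro k l hkl x
    exact (Set.indicator_le_indicator (SimpleFunc.monotone_eapprox f hkl x)).trans
      (Set.indicator_le_indicator_of_subset (Metric.ball_subset_ball (by exact_mod_cast hkl))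
        (fun _ => zero_le) x)
  have hsup : ∀ x, ⨆ k, f' k x = f x := by
    intro x
    apply le_antisymm
    · refine iSup_le fun k => ?_
      refine (Set.indicator_le_self' (fun _ _ => zero_le) x).trans ?_
      rw [← SimpleFunc.iSup_eapprox_apply hf x]
      exact le_iSup (fun k => SimpleFunc.eapprox f k x) k
    · rw [← SimpleFunc.iSup_eapprox_apply hf x]
      refine iSup_le fun k => ?_
      obtain ⟨N, hN⟩ := exists_nat_gt ‖x‖
      refine le_iSup_of_le (max k N) ?_
      have hx : x ∈ Metric.ball (0 : Plane) ((max k N : ℕ) : ℝ) := by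
        rw [mem_ball_zero_iff]
        exact hN.trans_le (by exact_mod_cast le_max_right k N)
      simp only [f', Set.indicator_of_mem hx]
      exact SimpleFunc.monotone_eapprox f (le_max_left k N) x
  have hstep : ∀ k, ∫⁻ ω, eexp ((Φ ω).sum (f' k)) ∂Pr
      = eexp (ENNReal.ofReal d * ∫⁻ x, (1 - eexp (f' k x))) := fun k =>
    hΦ.laplace_simple hd _ Metric.isOpen_ball.measurableSet measure_ball_lt_top.ne
  have hf_eq : f = fun x => ⨆ k, f' k x := by ext x; exact (hsup x).symm
  have hL : Tendsto (fun k => ∫⁻ ω, eexp ((Φ ω).sum (f' k)) ∂Pr) atTop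
      (𝓝 (∫⁻ ω, eexp ((Φ ω).sum f) ∂Pr)) := by
    refine tendsto_lintegral_of_dominated_convergence (fun _ => 1)
      (fun k => measurable_eexp.comp ((Config.measurable_sum (hf'm k)).comp hΦ.measurable))
      (fun k => ae_of_all _ fun ω => eexp_le_one _) (by simp) (ae_of_all _ fun ω => ?_)
    refine (continuous_eexp.tendsto _).comp ?_
    rw [hf_eq, Config.sum_iSup _ hmono]
    exact tendsto_atTop_iSup fun k l hkl => Config.sum_mono _ (hmono hkl)
  have hR : Tendsto (fun k => eexp (ENNReal.ofReal d * ∫⁻ x, (1 - eexp (f' k x)))) atTop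
      (𝓝 (eexp (ENNReal.ofReal d * ∫⁻ x, (1 - eexp (f x))))) := by
    refine (continuous_eexp.tendsto _).comp ?_
    refine ENNReal.Tendsto.const_mul ?_ (Or.inr ENNReal.ofReal_ne_top)
    refine lintegral_tendsto_of_tendsto_of_monotone (fun k => by have := hf'm k; fun_prop)
      (ae_of_all _ fun x k l hkl => tsub_le_tsub_left (antitone_eexp (hmono hkl x)) 1)
      (ae_of_all _ fun x => ?_)
    refine ENNReal.Tendsto.sub tendsto_const_nhds ?_ (Or.inl ENNReal.one_ne_top)
    refine (continuous_eexp.tendsto _).comp ?_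
    rw [← hsup x]
    exact tendsto_atTop_iSup fun k l hkl => hmono hkl x
  simp_rw [hstep] at hL
  exact tendsto_nhds_unique hL hR

end Laplace

/-! ## Independent families of Poisson processes -/

section Family

variable {Ω : Type*} [MeasurableSpace Ω] {Pr : Measure Ω} [IsProbabilityMeasure Pr]
  {J : Type} [Fintype J] {d : J → ℝ} {Φ : J → Ω → Config}

/-- The joint Laplace functional of independent Poisson processes. -/
lemma laplace_family (hΦ : ∀ j, IsPoisson Pr (d j) (Φ j)) (hind : iIndepFun Φ Pr)
    (hd : ∀ j, 0 ≤ d j) {f : J → Plane → ℝ≥0∞} (hf : ∀ j, Measurable (f j)) :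
    ∫⁻ ω, eexp (∑ j, (Φ j ω).sum (f j)) ∂Pr
      = eexp (∑ j, ENNReal.ofReal (d j) * ∫⁻ x, (1 - eexp (f j x))) := by
  simp_rw [eexp_finset_sum]
  have hm : ∀ j, Measurable fun c : Config => eexp (c.sum (f j)) := fun j =>
    measurable_eexp.comp (Config.measurable_sum (hf j))
  rw [lintegral_prod_eq_prod_lintegral_of_indepFun Finset.univ
    (fun j ω => eexp ((Φ j ω).sum (f j))) (hind.comp _ hm)
    (fun j => (hm j).comp (hΦ j).measurable)]
  exact Finset.prod_congr rfl fun j _ => (hΦ j).laplace (hd j) (hf j)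

end Family

/-! ## The Mecke formula -/

section Mecke

variable {J : Type} [Fintype J]

/-- The sum of `f j` over the points of `c j`, over all `j`. -/
noncomputable def famSum (c : J → Config) (f : J → Plane → ℝ≥0∞) : ℝ≥0∞ := ∑ j, (c j).sum (f j)

open Classical in
/-- The family without the `n`-th point of its `j`-th configuration. -/
noncomputable def famErase (c : J → Config) (j : J) (n : ℕ) : J → Config :=
  Function.update c j ((c j).erase n)

lemma famSum_eq_add_erase (c : J → Config) (j : J) (n : ℕ) (hn : (c j n).1 = true)
    (f : J → Plane → ℝ≥0∞) :
    famSum c f = f j (c j n).2 + famSum (famErase c j n) f := by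
  classical
  unfold famSum
  rw [← Finset.add_sum_erase _ _ (Finset.mem_univ j), ← Finset.add_sum_erase _ _ (Finset.mem_univ j),
    Config.sum_eq_add_erase _ n hn, ← add_assoc]
  congr 1
  · simp [famErase]
  · refine Finset.sum_congr rfl fun k hk => ?_
    simp [famErase, Finset.ne_of_mem_erase hk]

lemma famSum_mono (c : J → Config) {f g : J → Plane → ℝ≥0∞} (h : ∀ j x, f j x ≤ g j x) :
    famSum c f ≤ famSum c g :=
  Finset.sum_le_sum fun j _ => (c j).sum_mono (h j)

lemma measurable_famSum_param {X : Type*} [MeasurableSpace X] {c : X → J → Config}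
    {f : X → J → Plane → ℝ≥0∞} (hc : Measurable c)
    (hf : ∀ j, Measurable (Function.uncurry fun x => f x j)) :
    Measurable (fun x => famSum (c x) (f x)) := by
  unfold famSum
  refine Finset.measurable_sum _ fun j _ => ?_
  exact Config.measurable_sum_param (c := fun x => c x j) ((measurable_pi_apply j).comp hc) (hf j)

lemma measurable_famSum {f : J → Plane → ℝ≥0∞} (hf : ∀ j, Measurable (f j)) :
    Measurable (fun c : J → Config => famSum c f) :=
  measurable_famSum_param (f := fun _ => f) measurable_id fun j => (hf j).comp measurable_snd

omit [Fintype J] in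
lemma measurable_famErase (j : J) (n : ℕ) : Measurable (fun c : J → Config => famErase c j n) := by
  classical
  refine measurable_pi_lambda _ fun k => ?_
  unfold famErase
  by_cases hk : k = j
  · subst hk
    simp only [Function.update_self]
    exact (Config.measurable_erase n).comp (measurable_pi_apply k)
  · simpa [hk] using measurable_pi_apply k

variable {Ω : Type*} [MeasurableSpace Ω] {Pr : Measure Ω} [IsProbabilityMeasure Pr]
  {d : J → ℝ} {Φ : J → Ω → Config}

/-- Independent Poisson processes with nonnegative densities. -/
structure IsPoissonFamily (Pr : Measure Ω) (d : J → ℝ) (Φ : J → Ω → Config) : Prop where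
  poisson : ∀ j, IsPoisson Pr (d j) (Φ j)
  indep : iIndepFun Φ Pr
  nonneg : ∀ j, 0 ≤ d j

omit [Fintype J] [IsProbabilityMeasure Pr] in
lemma IsPoissonFamily.measurable (H : IsPoissonFamily Pr d Φ) : Measurable (fun ω j => Φ j ω) :=
  measurable_pi_lambda _ fun j => (H.poisson j).measurable

/-- The integral `∑ j, d j ∫ (1 - exp (-f j))`. -/
noncomputable def laplaceExponent (d : J → ℝ) (f : J → Plane → ℝ≥0∞) : ℝ≥0∞ :=
  ∑ j, ENNReal.ofReal (d j) * ∫⁻ x, (1 - eexp (f j x))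

lemma IsPoissonFamily.laplace (H : IsPoissonFamily Pr d Φ) {f : J → Plane → ℝ≥0∞}
    (hf : ∀ j, Measurable (f j)) :
    ∫⁻ ω, eexp (famSum (fun j => Φ j ω) f) ∂Pr = eexp (laplaceExponent d f) :=
  laplace_family H.poisson H.indep H.nonneg hf

-- Differentiate `E exp(-∑ (f + t φ))` at `t = 0`, where `φ = w e^f` is added in field `j` only. On
-- the left the derivative is `E[e^(-∑ f) ∑ φ]`, and in each term the factor `e^f` of the point
-- cancels its own contribution to `e^(-∑ f)`, leaving the configuration without that point. On the
-- right it is `d j ∫ φ e^(-f) = d j ∫ w` times the Laplace functional. Finiteness of `f j` makes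
-- the division by `e^(-f)` legitimate; `w` need not be integrable.
open Classical in
lemma IsPoissonFamily.mecke_of_ne_top (H : IsPoissonFamily Pr d Φ) {f : J → Plane → ℝ≥0∞}
    (hf : ∀ j, Measurable (f j)) (j : J) (hfin : ∀ x, f j x ≠ ∞) {w : Plane → ℝ≥0∞}
    (hw : Measurable w) :
    ∫⁻ ω, ∑' n, (if (Φ j ω n).1 = true then
        w (Φ j ω n).2 * eexp (famSum (famErase (fun j => Φ j ω) j n) f) else 0) ∂Pr
      = ENNReal.ofReal (d j) * (∫⁻ x, w x) * eexp (laplaceExponent d f) := by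
  have hfj := hf j
  set φ : Plane → ℝ≥0∞ := fun x => w x / eexp (f j x) with hφ
  have hφm : Measurable φ := by fun_prop
  have hne : ∀ x, eexp (f j x) ≠ 0 := fun x => by rw [Ne, eexp_eq_zero]; exact hfin x
  have hmeasT : Measurable fun ω => famSum (fun j => Φ j ω) f :=
    (measurable_famSum hf).comp H.measurable
  have hmeasS : Measurable fun ω => (Φ j ω).sum φ :=
    (Config.measurable_sum hφm).comp (H.poisson j).measurable
  have h1 : ∀ ω, ∑' n, (if (Φ j ω n).1 = true then
        w (Φ j ω n).2 * eexp (famSum (famErase (fun j => Φ j ω) j n) f) else 0)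
      = eexp (famSum (fun j => Φ j ω) f) * (Φ j ω).sum φ := by
    intro ω
    unfold Config.sum
    rw [← ENNReal.tsum_mul_left]
    refine tsum_congr fun n => ?_
    split_ifs with hn
    · rw [famSum_eq_add_erase (fun j => Φ j ω) j n hn, eexp_add, hφ, mul_right_comm, mul_comm (w _)]
      rw [ENNReal.mul_div_cancel (hne _) (eexp_ne_top _)]
      ring
    · simp
  simp_rw [h1]
  have h2 : ∀ ω, eexp (famSum (fun j => Φ j ω) f) * (Φ j ω).sum φ
      = ⨆ m, eexp (famSum (fun j => Φ j ω) f) * expSlope m ((Φ j ω).sum φ) := fun ω => by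
    rw [← ENNReal.mul_iSup, iSup_expSlope]
  simp_rw [h2]
  rw [lintegral_iSup (fun m => by fun_prop) (fun m k hmk ω => by
    have := expSlope_mono_left ((Φ j ω).sum φ) hmk
    gcongr)]
  -- `b m / 2 ^ m` is the increase of the Laplace exponent when `f j` is increased by `φ / 2 ^ m`.
  set b : ℕ → ℝ≥0∞ := fun m => ENNReal.ofReal (d j) * ∫⁻ x, eexp (f j x) * expSlope m (φ x) with hb
  have hbm : Monotone b := fun m k hmk => by
    simp only [hb]
    gcongr with x
    exact expSlope_mono_left _ hmk
  have hbsup : ⨆ m, b m = ENNReal.ofReal (d j) * ∫⁻ x, w x := by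
    rw [hb, ← ENNReal.mul_iSup, ← lintegral_iSup (fun m => by fun_prop) (fun m k hmk x => by
      have := expSlope_mono_left (φ x) hmk
      gcongr)]
    congr 2
    ext x
    rw [← ENNReal.mul_iSup, iSup_expSlope, hφ, ENNReal.mul_div_cancel (hne _) (eexp_ne_top _)]
  have key : ∀ m, ∫⁻ ω, eexp (famSum (fun j => Φ j ω) f) * expSlope m ((Φ j ω).sum φ) ∂Pr
      = eexp (laplaceExponent d f) * expSlope m (b m) := by
    intro m
    let f' : J → Plane → ℝ≥0∞ := fun k => if k = j then fun x => f k x + φ x / 2 ^ m else f k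
    have hf' : ∀ k, Measurable (f' k) := fun k => by
      by_cases hk : k = j
      · have := hf k
        simp only [f', hk, if_true]
        fun_prop
      · simpa [f', hk] using hf k
    have e1 : ∀ ω, famSum (fun j => Φ j ω) f'
        = famSum (fun j => Φ j ω) f + (Φ j ω).sum φ / 2 ^ m := by
      intro ω
      unfold famSum
      rw [← Finset.add_sum_erase _ _ (Finset.mem_univ j),
        ← Finset.add_sum_erase Finset.univ (fun k => (Φ k ω).sum (f k)) (Finset.mem_univ j)]
      have : (Φ j ω).sum (f' j) = (Φ j ω).sum (f j) + (Φ j ω).sum φ / 2 ^ m := by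
        simp only [f', if_true]
        rw [Config.sum_add, ENNReal.div_eq_inv_mul, ← Config.sum_const_mul]
        simp_rw [ENNReal.div_eq_inv_mul]
      rw [this, add_right_comm]
      congr 2
      refine Finset.sum_congr rfl fun k hk => ?_
      simp [f', Finset.ne_of_mem_erase hk]
    have e2 : laplaceExponent d f' = laplaceExponent d f + b m / 2 ^ m := by
      unfold laplaceExponent
      rw [← Finset.add_sum_erase _ _ (Finset.mem_univ j),
        ← Finset.add_sum_erase Finset.univ
          (fun k => ENNReal.ofReal (d k) * ∫⁻ x, (1 - eexp (f k x))) (Finset.mem_univ j)]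
      have : ENNReal.ofReal (d j) * ∫⁻ x, (1 - eexp (f' j x))
          = ENNReal.ofReal (d j) * (∫⁻ x, (1 - eexp (f j x))) + b m / 2 ^ m := by
        simp only [f', if_true, one_sub_eexp_add]
        rw [lintegral_add_left (by fun_prop), mul_add]
        congr 1
        simp only [hb, expSlope]
        rw [mul_div_assoc]
        congr 1
        rw [ENNReal.div_eq_inv_mul, ← lintegral_const_mul _ (by fun_prop)]
        refine lintegral_congr fun x => ?_
        rw [mul_left_comm (eexp (f j x)) (2 ^ m), ← mul_assoc,
          ENNReal.inv_mul_cancel (two_pow_ne_zero' m) (two_pow_ne_top m), one_mul]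
      rw [this, add_right_comm]
      congr 2
      refine Finset.sum_congr rfl fun k hk => ?_
      simp [f', Finset.ne_of_mem_erase hk]
    -- A weighted slope is `2 ^ m` times a difference of two exponentials. Applied on both sides of
    -- the claim, it reduces the claim to the Laplace functionals of `f` and `f'`.
    have e3 : ∀ x y : ℝ≥0∞, eexp x * expSlope m y = 2 ^ m * (eexp x - eexp (x + y / 2 ^ m)) := by
      intro x y
      rw [expSlope, eexp_add, mul_left_comm, ENNReal.mul_sub (fun _ _ => eexp_ne_top _), mul_one]
    simp_rw [e3, ← e1, ← e2]
    have hm1 : Measurable fun ω => eexp (famSum (fun j => Φ j ω) f') :=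
      measurable_eexp.comp ((measurable_famSum hf').comp H.measurable)
    rw [lintegral_const_mul _ (by fun_prop), lintegral_sub hm1, H.laplace hf, H.laplace hf']
    · rw [H.laplace hf']; exact eexp_ne_top _
    · refine ae_of_all _ fun ω => ?_
      simp only [e1]
      exact antitone_eexp le_self_add
  simp_rw [key]
  rw [← ENNReal.mul_iSup, iSup_expSlope_diag hbm, hbsup, mul_comm]

lemma laplaceExponent_iSup {f : ℕ → J → Plane → ℝ≥0∞} (hf : ∀ k j, Measurable (f k j))
    (hmono : ∀ j x, Monotone fun k => f k j x) :
    Tendsto (fun k => laplaceExponent d (f k)) atTop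
      (𝓝 (laplaceExponent d fun j x => ⨆ k, f k j x)) := by
  refine tendsto_finsetSum _ fun j _ => ?_
  refine ENNReal.Tendsto.const_mul ?_ (Or.inr ENNReal.ofReal_ne_top)
  refine lintegral_tendsto_of_tendsto_of_monotone (fun k => by have := hf k j; fun_prop)
    (ae_of_all _ fun x k l hkl => tsub_le_tsub_left (antitone_eexp (hmono j x hkl)) 1)
    (ae_of_all _ fun x => ?_)
  refine ENNReal.Tendsto.sub tendsto_const_nhds ?_ (Or.inl ENNReal.one_ne_top)
  exact (continuous_eexp.tendsto _).comp (tendsto_atTop_iSup (hmono j x))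

lemma iSup_min_natCast (x : ℝ≥0∞) : ⨆ k : ℕ, min x (k : ℝ≥0∞) = x := by
  rw [← inf_iSup_eq, ENNReal.iSup_natCast, inf_top_eq]

lemma famSum_iSup (c : J → Config) {f : ℕ → J → Plane → ℝ≥0∞}
    (hmono : ∀ j x, Monotone fun k => f k j x) :
    famSum c (fun j x => ⨆ k, f k j x) = ⨆ k, famSum c (f k) := by
  unfold famSum
  rw [← ENNReal.finsetSum_iSup_of_monotone]
  · exact Finset.sum_congr rfl fun j _ => (c j).sum_iSup fun k l hkl x => hmono j x hkl
  · exact fun j k l hkl => (c j).sum_mono fun x => hmono j x hkl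

/-- The Mecke formula for multiplicative functionals. -/
lemma IsPoissonFamily.mecke (H : IsPoissonFamily Pr d Φ) {f : J → Plane → ℝ≥0∞}
    (hf : ∀ j, Measurable (f j)) (j : J) {w : Plane → ℝ≥0∞}
    (hw : Measurable w) (hwfin : ∫⁻ x, w x ≠ ∞) :
    ∫⁻ ω, ∑' n, (if (Φ j ω n).1 = true then
        w (Φ j ω n).2 * eexp (famSum (famErase (fun j => Φ j ω) j n) f) else 0) ∂Pr
      = ENNReal.ofReal (d j) * (∫⁻ x, w x) * eexp (laplaceExponent d f) := by
  -- Exponents that encode forbidden regions are infinite there; truncation makes the finite version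
  -- applicable.
  set g : ℕ → J → Plane → ℝ≥0∞ := fun k j x => min (f j x) k with hg
  have hgm : ∀ k j, Measurable (g k j) := fun k j => (hf j).min measurable_const
  have hgmono : ∀ j x, Monotone fun k => g k j x := fun j x k l hkl => by
    simp only [hg]; gcongr
  have hsup : f = fun j x => ⨆ k, g k j x := by
    ext j x; simp only [hg]; exact (iSup_min_natCast _).symm
  -- The integrands decrease as the truncation level grows, so domination is needed. The dominating
  -- sum has mean `d j ∫ w`, by the Mecke formula with zero exponents.
  have hsum0 : ∫⁻ ω, (Φ j ω).sum w ∂Pr ≠ ∞ := by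
    have := H.mecke_of_ne_top (f := fun _ _ => 0) (fun _ => measurable_const) j (by simp) hw
    simp only [famSum, Config.sum_zero, Finset.sum_const_zero, eexp_zero, mul_one, laplaceExponent,
      tsub_self, lintegral_zero, mul_zero] at this
    change ∫⁻ ω, (Φ j ω).sum w ∂Pr = _ at this
    rw [this]
    exact ENNReal.mul_ne_top ENNReal.ofReal_ne_top hwfin
  have hmeas : ∀ k n, Measurable fun ω => (if (Φ j ω n).1 = true then
        w (Φ j ω n).2 * eexp (famSum (famErase (fun j => Φ j ω) j n) (g k)) else 0) := by
    intro k n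
    refine Measurable.ite ((Config.measurableSet_present n).preimage (H.poisson j).measurable) ?_
      measurable_const
    refine Measurable.mul ?_ ?_
    · exact hw.comp ((by fun_prop : Measurable fun c : Config => (c n).2).comp (H.poisson j).measurable)
    · exact measurable_eexp.comp ((measurable_famSum (hgm k)).comp
        ((measurable_famErase j n).comp H.measurable))
  have hL : Tendsto (fun k => ∫⁻ ω, ∑' n, (if (Φ j ω n).1 = true then
        w (Φ j ω n).2 * eexp (famSum (famErase (fun j => Φ j ω) j n) (g k)) else 0) ∂Pr) atTop
      (𝓝 (∫⁻ ω, ∑' n, (if (Φ j ω n).1 = true then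
        w (Φ j ω n).2 * eexp (famSum (famErase (fun j => Φ j ω) j n) f) else 0) ∂Pr)) := by
    have hbound : ∀ k ω n, (if (Φ j ω n).1 = true then
        w (Φ j ω n).2 * eexp (famSum (famErase (fun j => Φ j ω) j n) (g k)) else 0)
        ≤ if (Φ j ω n).1 = true then w (Φ j ω n).2 else 0 := by
      intro k ω n
      split_ifs
      · exact mul_le_of_le_one_right zero_le (eexp_le_one _)
      · exact le_rfl
    refine tendsto_lintegral_of_dominated_convergence (fun ω => (Φ j ω).sum w)
      (fun k => Measurable.tsum (hmeas k))
      (fun k => ae_of_all _ fun ω => ENNReal.tsum_le_tsum (hbound k ω)) hsum0 ?_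
    filter_upwards [ae_lt_top ((Config.measurable_sum hw).comp (H.poisson j).measurable) hsum0]
      with ω hω
    simp_rw [← lintegral_count]
    refine tendsto_lintegral_of_dominated_convergence
      (fun n => if (Φ j ω n).1 = true then w (Φ j ω n).2 else 0)
      (fun k => measurable_from_top) (fun k => ae_of_all _ (hbound k ω)) ?_
      (ae_of_all _ fun n => ?_)
    · rw [lintegral_count]
      exact hω.ne
    · split_ifs with hn
      · refine ENNReal.Tendsto.const_mul ?_ (Or.inr ?_)
        · refine (continuous_eexp.tendsto _).comp ?_
          conv => enter [3]; rw [hsup]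
          rw [famSum_iSup _ hgmono]
          exact tendsto_atTop_iSup fun k l hkl => famSum_mono _ fun j x => hgmono j x hkl
        · have := ENNReal.ne_top_of_tsum_ne_top hω.ne n
          simp only [hn, if_true] at this
          exact this
      · exact tendsto_const_nhds
  have hR : Tendsto (fun k => ENNReal.ofReal (d j) * (∫⁻ x, w x) * eexp (laplaceExponent d (g k)))
      atTop (𝓝 (ENNReal.ofReal (d j) * (∫⁻ x, w x) * eexp (laplaceExponent d f))) := by
    refine ENNReal.Tendsto.const_mul ?_ (Or.inr (ENNReal.mul_ne_top ENNReal.ofReal_ne_top hwfin))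
    refine (continuous_eexp.tendsto _).comp ?_
    rw [hsup]
    exact laplaceExponent_iSup hgm hgmono
  refine tendsto_nhds_unique hL (hR.congr fun k => ?_)
  exact (H.mecke_of_ne_top (hgm k) j (fun x => by simp [hg]) hw).symm

lemma tsum_indicator_comp (κ : Plane → ℕ) (x : Plane) (G : ℕ → ℝ≥0∞) :
    ∑' i, (κ ⁻¹' {i}).indicator (fun _ => G i) x = G (κ x) := by
  rw [tsum_eq_single (κ x)]
  · simp
  · intro i hi
    exact Set.indicator_of_notMem (fun h => hi h.symm) _

/-- The Mecke formula for a functional that depends on the point through a discrete parameter. -/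
lemma IsPoissonFamily.mecke_discrete (H : IsPoissonFamily Pr d Φ) {f : ℕ → J → Plane → ℝ≥0∞}
    (hf : ∀ i j, Measurable (f i j)) (j : J) {κ : Plane → ℕ} (hκ : Measurable κ)
    (hκfin : ∀ i, volume (κ ⁻¹' {i}) ≠ ∞) {g : Plane → ℝ≥0∞}
    (hg : Measurable g) (hg1 : ∀ x, g x ≤ 1) :
    ∫⁻ ω, ∑' n, (if (Φ j ω n).1 = true then
        g (Φ j ω n).2 * eexp (famSum (famErase (fun j => Φ j ω) j n) (f (κ (Φ j ω n).2))) else 0) ∂Pr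
      = ENNReal.ofReal (d j) * ∫⁻ x, g x * eexp (laplaceExponent d (f (κ x))) := by
  have hw : ∀ i, Measurable ((κ ⁻¹' {i}).indicator g) := fun i =>
    hg.indicator (hκ (measurableSet_singleton i))
  have h1 : ∀ ω n, (if (Φ j ω n).1 = true then
        g (Φ j ω n).2 * eexp (famSum (famErase (fun j => Φ j ω) j n) (f (κ (Φ j ω n).2))) else 0)
      = ∑' i, (if (Φ j ω n).1 = true then (κ ⁻¹' {i}).indicator g (Φ j ω n).2 *
          eexp (famSum (famErase (fun j => Φ j ω) j n) (f i)) else 0) := by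
    intro ω n
    split_ifs
    · rw [← tsum_indicator_comp κ (Φ j ω n).2
        (fun i => g (Φ j ω n).2 * eexp (famSum (famErase (fun j => Φ j ω) j n) (f i)))]
      refine tsum_congr fun i => ?_
      by_cases h : (Φ j ω n).2 ∈ κ ⁻¹' {i}
      · rw [Set.indicator_of_mem h, Set.indicator_of_mem h]
      · rw [Set.indicator_of_notMem h, Set.indicator_of_notMem h, zero_mul]
    · simp
  have hmeas : ∀ i n, Measurable fun ω => (if (Φ j ω n).1 = true then
        (κ ⁻¹' {i}).indicator g (Φ j ω n).2 *
          eexp (famSum (famErase (fun j => Φ j ω) j n) (f i)) else 0) := by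
    intro i n
    refine Measurable.ite ((Config.measurableSet_present n).preimage (H.poisson j).measurable) ?_
      measurable_const
    refine Measurable.mul ?_ ?_
    · exact (hw i).comp
        ((by fun_prop : Measurable fun c : Config => (c n).2).comp (H.poisson j).measurable)
    · exact measurable_eexp.comp ((measurable_famSum (hf i)).comp
        ((measurable_famErase j n).comp H.measurable))
  simp_rw [h1, fun ω => ENNReal.tsum_comm (f := fun n i => (if (Φ j ω n).1 = true then
        (κ ⁻¹' {i}).indicator g (Φ j ω n).2 *
          eexp (famSum (famErase (fun j => Φ j ω) j n) (f i)) else 0))]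
  rw [lintegral_tsum fun i => (Measurable.tsum (hmeas i)).aemeasurable]
  have h2 : ∀ x, g x * eexp (laplaceExponent d (f (κ x)))
      = ∑' i, (κ ⁻¹' {i}).indicator g x * eexp (laplaceExponent d (f i)) := by
    intro x
    rw [← tsum_indicator_comp κ x (fun i => g x * eexp (laplaceExponent d (f i)))]
    refine tsum_congr fun i => ?_
    by_cases h : x ∈ κ ⁻¹' {i}
    · rw [Set.indicator_of_mem h, Set.indicator_of_mem h]
    · rw [Set.indicator_of_notMem h, Set.indicator_of_notMem h, zero_mul]
  simp_rw [h2]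
  rw [lintegral_tsum fun i => ((hw i).mul_const _).aemeasurable, ← ENNReal.tsum_mul_left]
  refine tsum_congr fun i => ?_
  rw [H.mecke (hf i) j (hw i), lintegral_mul_const _ (hw i), mul_assoc]
  -- The weight is at most one and is supported on a fibre of `κ`, so its integral is at most the
  -- finite area of the fibre.
  refine ne_top_of_le_ne_top (hκfin i) ?_
  rw [lintegral_indicator (hκ (measurableSet_singleton i))]
  calc ∫⁻ x in κ ⁻¹' {i}, g x ≤ ∫⁻ x in κ ⁻¹' {i}, 1 := lintegral_mono fun x => hg1 x
    _ = volume (κ ⁻¹' {i}) := by simp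

lemma lintegral_eexp_mul_norm_sq {a : ℝ} (ha : 0 < a) :
    ∫⁻ x : Plane, eexp (ENNReal.ofReal (a * ‖x‖ ^ 2)) = ENNReal.ofReal (Real.pi / a) := by
  have h := GaussianFourier.integral_rexp_neg_mul_sq_norm (V := Plane) ha
  -- The Bochner integral of a non-integrable function is zero by convention, so the positive value
  -- of the Gaussian integral already proves integrability.
  have hint : Integrable fun x : Plane => Real.exp (-a * ‖x‖ ^ 2) := by
    by_contra hn
    rw [integral_undef hn] at h
    have : 0 < (Real.pi / a) ^ ((Module.finrank ℝ Plane : ℝ) / 2) := by positivity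
    exact this.ne h
  have e : ∀ x : Plane, eexp (ENNReal.ofReal (a * ‖x‖ ^ 2)) = ENNReal.ofReal (Real.exp (-a * ‖x‖ ^ 2)) :=
    fun x => by rw [eexp_ofReal (by positivity), neg_mul]
  simp_rw [e]
  rw [← ofReal_integral_eq_lintegral_ofReal hint (ae_of_all _ fun x => (Real.exp_pos _).le), h]
  simp

/-- The Mecke formula for a functional that is monotone in the distance of the point. -/
lemma IsPoissonFamily.mecke_radial (H : IsPoissonFamily Pr d Φ) {f : ℝ → J → Plane → ℝ≥0∞}
    (hf : ∀ r j, Measurable (f r j)) (hmono : ∀ j x r s, 0 ≤ r → r ≤ s → f r j x ≤ f s j x)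
    {a : ℝ} (j : J) (ha : d j ≠ 0 → 0 < a)
    (hA : ∀ r, 0 ≤ r → laplaceExponent d (f r) = ENNReal.ofReal (a * r ^ 2))
    {g : Plane → ℝ≥0∞} (hg : Measurable g) (hg1 : ∀ x, g x ≤ 1) :
    ∫⁻ ω, ∑' n, (if (Φ j ω n).1 = true then
        g (Φ j ω n).2 * eexp (famSum (famErase (fun j => Φ j ω) j n) (f ‖(Φ j ω n).2‖)) else 0) ∂Pr
      = ENNReal.ofReal (d j) * ∫⁻ x, g x * eexp (ENNReal.ofReal (a * ‖x‖ ^ 2)) := by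
  -- For an empty field `a` need not be positive and the Gaussian bound below is lost; the left side
  -- is then zero because the mean number of points is.
  by_cases hdj : d j = 0
  · rw [hdj, ENNReal.ofReal_zero, zero_mul, ← le_zero_iff]
    have := H.mecke_of_ne_top (f := fun _ _ => 0) (fun _ => measurable_const) j (by simp)
      (w := fun _ => 1) measurable_const
    rw [hdj, ENNReal.ofReal_zero, zero_mul, zero_mul] at this
    refine le_of_le_of_eq (lintegral_mono fun ω => ENNReal.tsum_le_tsum fun n => ?_) this
    split_ifs
    · simp only [famSum, Config.sum_zero, Finset.sum_const_zero, eexp_zero, mul_one]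
      exact mul_le_one' (hg1 _) (eexp_le_one _)
    · exact le_rfl
  have ha := ha hdj
  -- The distance is measured in units of `1 / (k + 1)`. Its values rounded down and up are `κ / (k
  -- + 1)` and `(κ + 1) / (k + 1)`, and for these discrete parameters the formula is already known.
  let κ : ℕ → Plane → ℕ := fun k x => ⌊‖x‖ * ((k : ℝ) + 1)⌋₊
  have hκ : ∀ k, Measurable (κ k) := fun k => Nat.measurable_floor.comp (by fun_prop)
  have hκ1 : ∀ (k : ℕ) x, (κ k x : ℝ) / (k + 1) ≤ ‖x‖ := fun k x => by
    rw [div_le_iff₀ (by positivity)]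
    exact Nat.floor_le (by positivity)
  have hκ2 : ∀ (k : ℕ) x, ‖x‖ ≤ ((κ k x : ℝ) + 1) / (k + 1) := fun k x => by
    rw [le_div_iff₀ (by positivity)]
    exact (Nat.lt_floor_add_one _).le
  have hκfin : ∀ (k : ℕ) i, volume (κ k ⁻¹' {i}) ≠ ∞ := fun k i => by
    have hsub : κ k ⁻¹' {i} ⊆ Metric.closedBall (0 : Plane) (((i : ℝ) + 1) / (k + 1)) := by
      rintro x rfl
      rw [mem_closedBall_zero_iff]
      exact hκ2 k x
    exact ((measure_mono hsub).trans_lt measure_closedBall_lt_top).ne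
  have hlo := fun k : ℕ => H.mecke_discrete (f := fun i => f ((i : ℝ) / (k + 1))) (fun i j => hf _ j) j
    (hκ k) (hκfin k) hg hg1
  have hhi := fun k : ℕ => H.mecke_discrete (f := fun i => f (((i : ℝ) + 1) / (k + 1)))
    (fun i j => hf _ j) j (hκ k) (hκfin k) hg hg1
  simp_rw [fun (k : ℕ) x => hA ((κ k x : ℝ) / (k + 1)) (by positivity)] at hlo
  simp_rw [fun (k : ℕ) x => hA (((κ k x : ℝ) + 1) / (k + 1)) (by positivity)] at hhi
  have hinv : Tendsto (fun k : ℕ => 1 / ((k : ℝ) + 1)) atTop (𝓝 0) :=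
    tendsto_one_div_add_atTop_nhds_zero_nat
  have hlim : ∀ ρ : ℕ → Plane → ℝ, (∀ k, Measurable (ρ k)) → (∀ k x, 0 ≤ ρ k x) →
      (∀ (k : ℕ) x, |ρ k x - ‖x‖| ≤ 1 / (k + 1)) →
      Tendsto (fun k => ENNReal.ofReal (d j) * ∫⁻ x, g x * eexp (ENNReal.ofReal (a * ρ k x ^ 2)))
        atTop (𝓝 (ENNReal.ofReal (d j) * ∫⁻ x, g x * eexp (ENNReal.ofReal (a * ‖x‖ ^ 2)))) := by
    intro ρ hρ hρ0 hρ1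
    refine ENNReal.Tendsto.const_mul ?_ (Or.inr ENNReal.ofReal_ne_top)
    -- From `‖x‖ ≤ ρ + 1` follows `‖x‖² ≤ 2 ρ² + 2`, hence `e^(-a ρ²) ≤ e^a e^(-a ‖x‖² / 2)`: an
    -- integrable bound that does not depend on `k`.
    refine tendsto_lintegral_of_dominated_convergence
      (fun x => ENNReal.ofReal (Real.exp a) * eexp (ENNReal.ofReal (a / 2 * ‖x‖ ^ 2)))
      (fun k => by have := hρ k; fun_prop) (fun k => ae_of_all _ fun x => ?_) ?_
      (ae_of_all _ fun x => ?_)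
    · refine (mul_le_of_le_one_left zero_le (hg1 x)).trans ?_
      beta_reduce
      rw [eexp_ofReal (by positivity), eexp_ofReal (by positivity),
        ← ENNReal.ofReal_mul (Real.exp_pos _).le, ← Real.exp_add]
      refine ENNReal.ofReal_le_ofReal (Real.exp_le_exp.2 ?_)
      have h1 : ‖x‖ ≤ ρ k x + 1 := by
        have := (abs_le.1 (hρ1 k x)).1
        have : 1 / ((k : ℝ) + 1) ≤ 1 := by
          rw [div_le_one (by positivity)]; linarith [(Nat.cast_nonneg k : (0 : ℝ) ≤ k)]
        linarith
      have h2 : ‖x‖ ^ 2 ≤ 2 * ρ k x ^ 2 + 2 := by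
        have := hρ0 k x
        nlinarith [norm_nonneg x, sq_nonneg (ρ k x - 1)]
      nlinarith
    · rw [lintegral_const_mul _ (by fun_prop), lintegral_eexp_mul_norm_sq (by positivity)]
      exact ENNReal.mul_ne_top ENNReal.ofReal_ne_top ENNReal.ofReal_ne_top
    · refine ENNReal.Tendsto.const_mul ?_
        (Or.inr (ne_top_of_le_ne_top ENNReal.one_ne_top (hg1 x)))
      refine (continuous_eexp.tendsto _).comp (ENNReal.tendsto_ofReal ?_)
      have : Tendsto (fun k => ρ k x) atTop (𝓝 ‖x‖) := by
        rw [tendsto_iff_norm_sub_tendsto_zero]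
        exact squeeze_zero (fun k => norm_nonneg _) (fun k => hρ1 k x) hinv
      exact (this.pow 2).const_mul a
  have habs : ∀ (k : ℕ) x, |(κ k x : ℝ) / (k + 1) - ‖x‖| ≤ 1 / (k + 1) := fun k x => by
    have h1 := hκ1 k x
    have h2 := hκ2 k x
    rw [add_div] at h2
    rw [abs_le]; constructor <;> linarith [show (0 : ℝ) ≤ 1 / (k + 1) by positivity]
  have habs' : ∀ (k : ℕ) x, |((κ k x : ℝ) + 1) / (k + 1) - ‖x‖| ≤ 1 / (k + 1) := fun k x => by
    have h1 := hκ1 k x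
    have h2 := hκ2 k x
    rw [add_div] at h2 ⊢
    rw [abs_le]; constructor <;> linarith [show (0 : ℝ) ≤ 1 / (k + 1) by positivity]
  -- Exponents grow with the distance, so rounding down gives the upper bound and rounding up the
  -- lower one.
  apply le_antisymm
  · refine ge_of_tendsto' (hlim (fun k x => (κ k x : ℝ) / (k + 1))
      (fun k => (measurable_from_top.comp (hκ k)).div_const _) (fun k x => by positivity) habs)
      fun k => ?_
    rw [← hlo k]
    refine lintegral_mono fun ω => ENNReal.tsum_le_tsum fun n => ?_
    split_ifs
    · gcongr
      exact antitone_eexp (famSum_mono _ fun j x => hmono j x _ _ (by positivity) (hκ1 k _))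
    · exact le_rfl
  · refine le_of_tendsto' (hlim (fun k x => ((κ k x : ℝ) + 1) / (k + 1))
      (fun k => ((measurable_from_top.comp (hκ k)).add_const _).div_const _)
      (fun k x => by positivity) habs') fun k => ?_
    rw [← hhi k]
    refine lintegral_mono fun ω => ENNReal.tsum_le_tsum fun n => ?_
    split_ifs
    · gcongr
      exact antitone_eexp (famSum_mono _ fun j x => hmono j x _ _ (norm_nonneg _) (hκ2 k _))
    · exact le_rfl

end Mecke

/-! ## Independence -/

section Independence

variable {Ω : Type*} [MeasurableSpace Ω] {Pr : Measure Ω} [IsProbabilityMeasure Pr]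

/-- Fubini for independent random variables. -/
lemma lintegral_of_indepFun {A B : Type*} [MeasurableSpace A] [MeasurableSpace B] {X : Ω → A}
    {Y : Ω → B} (hX : AEMeasurable X Pr) (hY : AEMeasurable Y Pr) (hXY : IndepFun X Y Pr)
    {F : A → B → ℝ≥0∞} (hF : Measurable (Function.uncurry F)) :
    ∫⁻ ω, F (X ω) (Y ω) ∂Pr = ∫⁻ ω, ∫⁻ ω', F (X ω) (Y ω') ∂Pr ∂Pr := by
  have h1 : ∫⁻ ω, F (X ω) (Y ω) ∂Pr
      = ∫⁻ z, Function.uncurry F z ∂(Pr.map (fun ω => (X ω, Y ω))) := by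
    rw [lintegral_map' hF.aemeasurable (hX.prodMk hY)]
    rfl
  have := Measure.isProbabilityMeasure_map (μ := Pr) hX
  have := Measure.isProbabilityMeasure_map (μ := Pr) hY
  rw [h1, (indepFun_iff_map_prod_eq_prod_map_map hX hY).1 hXY, lintegral_prod _ hF.aemeasurable,
    lintegral_map' (Measurable.lintegral_prod_right' hF).aemeasurable hX]
  refine lintegral_congr fun ω => ?_
  exact lintegral_map' (f := fun b => F (X ω) b) (hF.comp measurable_prodMk_left).aemeasurable hY

/-- The Laplace transform of a sum of countably many independent random variables. -/
lemma lintegral_eexp_tsum {ι : Type*} [Countable ι] {X : ι → Ω → ℝ≥0∞} (hX : iIndepFun X Pr)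
    (hm : ∀ i, AEMeasurable (X i) Pr) {b : ι → ℝ≥0∞} (hb : ∀ i, ∫⁻ ω, eexp (X i ω) ∂Pr = eexp (b i)) :
    ∫⁻ ω, eexp (∑' i, X i ω) ∂Pr = eexp (∑' i, b i) := by
  let X' : ι → Ω → ℝ≥0∞ := fun i => (hm i).mk (X i)
  have hX'm : ∀ i, Measurable (X' i) := fun i => (hm i).measurable_mk
  have hae : ∀ i, X i =ᵐ[Pr] X' i := fun i => (hm i).ae_eq_mk
  have hX' : iIndepFun X' Pr := hX.congr hae
  have hb' : ∀ i, ∫⁻ ω, eexp (X' i ω) ∂Pr = eexp (b i) := fun i => by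
    rw [← hb i]
    exact lintegral_congr_ae ((hae i).mono fun ω hω => by simp only [hω])
  have h0 : ∫⁻ ω, eexp (∑' i, X i ω) ∂Pr = ∫⁻ ω, eexp (∑' i, X' i ω) ∂Pr := by
    refine lintegral_congr_ae ?_
    filter_upwards [ae_all_iff.2 hae] with ω hω
    simp_rw [hω]
  rw [h0]
  have hfin : ∀ s : Finset ι, ∫⁻ ω, eexp (∑ i ∈ s, X' i ω) ∂Pr = eexp (∑ i ∈ s, b i) := by
    intro s
    simp_rw [eexp_finset_sum]
    rw [lintegral_prod_eq_prod_lintegral_of_indepFun s (fun i ω => eexp (X' i ω))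
      (hX'.comp (fun _ => eexp) fun _ => measurable_eexp)
      (fun i => measurable_eexp.comp (hX'm i))]
    exact Finset.prod_congr rfl fun i _ => hb' i
  have hL : Tendsto (fun s : Finset ι => ∫⁻ ω, eexp (∑ i ∈ s, X' i ω) ∂Pr) atTop
      (𝓝 (∫⁻ ω, eexp (∑' i, X' i ω) ∂Pr)) := by
    -- Dominated convergence along finite subsets is available because the index type is countable,
    -- so that the filter is countably generated.
    refine tendsto_lintegral_filter_of_dominated_convergence (fun _ => 1)
      (Eventually.of_forall fun s => by fun_prop)
      (Eventually.of_forall fun s => ae_of_all _ fun ω => eexp_le_one _) (by simp)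
      (ae_of_all _ fun ω => (continuous_eexp.tendsto _).comp ENNReal.summable.hasSum)
  have hR : Tendsto (fun s : Finset ι => eexp (∑ i ∈ s, b i)) atTop (𝓝 (eexp (∑' i, b i))) :=
    (continuous_eexp.tendsto _).comp ENNReal.summable.hasSum
  simp_rw [hfin] at hL
  exact tendsto_nhds_unique hL hR

/-- Multiplying the density of rate `1` by `e^(-a x)` gives `(1 + a)⁻¹` times the density of rate `1
+ a`. The value is written as `exp(-log (1 + a))` so that the averaged fading becomes an exponent
carried by the point. -/
lemma lintegral_expMeasure_eexp {a : ℝ} (ha : 0 ≤ a) :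
    ∫⁻ x, eexp (ENNReal.ofReal (a * x)) ∂(expMeasure 1) = eexp (ENNReal.ofReal (Real.log (1 + a))) := by
  rw [eexp_ofReal (Real.log_nonneg (by linarith)), Real.exp_neg, Real.exp_log (by linarith)]
  have h1 : expMeasure 1 = volume.withDensity (exponentialPDF 1) := rfl
  rw [h1, lintegral_withDensity_eq_lintegral_mul _
    (f := exponentialPDF 1)
    (measurable_exponentialPDFReal 1).ennreal_ofReal (by fun_prop)]
  have h2 : ∀ x : ℝ, (exponentialPDF 1 * fun x => eexp (ENNReal.ofReal (a * x))) x
      = ENNReal.ofReal (1 + a)⁻¹ * exponentialPDF (1 + a) x := by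
    intro x
    rw [Pi.mul_apply]
    rcases lt_or_ge x 0 with hx | hx
    · simp [exponentialPDF_of_neg hx]
    · rw [exponentialPDF_of_nonneg hx, exponentialPDF_of_nonneg hx, eexp_ofReal (by positivity),
        ← ENNReal.ofReal_mul (by positivity), ← ENNReal.ofReal_mul (by positivity), mul_assoc,
        ← Real.exp_add, ← mul_assoc, inv_mul_cancel₀ (by positivity)]
      ring_nf
  simp_rw [h2]
  rw [lintegral_const_mul (f := exponentialPDF (1 + a)) _
      (measurable_exponentialPDFReal _).ennreal_ofReal,
    lintegral_exponentialPDF_eq_one (by positivity), mul_one]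

lemma expMeasure_Ioi {c : ℝ} (hc : 0 ≤ c) :
    expMeasure 1 (Set.Ioi c) = ENNReal.ofReal (Real.exp (-c)) := by
  have := isProbabilityMeasure_expMeasure (r := 1) one_pos
  have h := cdf_expMeasure_eq (r := 1) one_pos c
  rw [if_pos hc, cdf_eq_real] at h
  rw [← Set.compl_Iic, prob_compl_eq_one_sub measurableSet_Iic, ← ofReal_measureReal, h,
    ← ENNReal.ofReal_one, ← ENNReal.ofReal_sub _ (by
      have : Real.exp (-(1 * c)) ≤ 1 := Real.exp_le_one_iff.2 (by linarith)
      linarith)]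
  simp

/-- The success probability of a Rayleigh fading link. -/
lemma measure_sir_gt {h₀ : Ω → ℝ} (hh : HasLaw h₀ (expMeasure 1) Pr) {γ q : ℝ} (hγ : 0 < γ)
    (hq : 0 < q) (I : ℝ≥0∞) :
    Pr {ω | ENNReal.ofReal γ < ENNReal.ofReal (q * h₀ ω) / I} = eexp (ENNReal.ofReal (γ / q) * I) := by
  rcases eq_or_ne I ∞ with rfl | hI
  · rw [ENNReal.mul_top (by simpa using div_pos hγ hq), eexp_top]
    simp
  · obtain ⟨r, hr, rfl⟩ : ∃ r : ℝ, 0 ≤ r ∧ I = ENNReal.ofReal r :=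
      ⟨I.toReal, ENNReal.toReal_nonneg, (ENNReal.ofReal_toReal hI).symm⟩
    rw [← ENNReal.ofReal_mul (by positivity), eexp_ofReal (by positivity),
      ← expMeasure_Ioi (by positivity), ← hh.map_eq,
      Measure.map_apply_of_aemeasurable hh.aemeasurable measurableSet_Ioi]
    congr 1
    ext ω
    simp only [Set.mem_ofPred_eq, Set.mem_preimage, Set.mem_Ioi]
    rw [div_mul_eq_mul_div, div_lt_iff₀ hq, mul_comm (h₀ ω)]
    -- Without interference the ratio is `∞` for a positive signal and `0 / 0 = 0` otherwise, so the
    -- event is that of a positive fading power, in agreement with the general formula.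
    rcases hr.eq_or_lt with rfl | hr
    · rw [ENNReal.ofReal_zero, mul_zero]
      rcases le_or_gt (q * h₀ ω) 0 with h | h
      · simp [ENNReal.ofReal_of_nonpos h, h]
      · rw [ENNReal.div_zero (by simpa using h)]
        simp [h]
    · rw [ENNReal.lt_div_iff_mul_lt (Or.inl (by simpa using hr)) (Or.inl ENNReal.ofReal_ne_top),
        ← ENNReal.ofReal_mul hγ.le, ENNReal.ofReal_lt_ofReal_iff_of_nonneg (by positivity)]

end Independence

/-! ## Interference -/

section Interference

variable {J : Type} [Fintype J]

lemma interference_eq_tsum (α pw : ℝ) (c : Config) (h : ℕ → ℝ) (S : Set Plane) (y : Plane)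
    [DecidablePred (· ∈ S)] :
    interference α pw c h S y = ∑' n, if (c n).1 = true then
      (if (c n).2 ∈ S then 0 else ENNReal.ofReal (pw * ‖(c n).2 - y‖ ^ (-α) * h n)) else 0 := by
  unfold interference
  refine (tsum_subtype {n | n ∈ c.present ∧ (c n).2 ∉ S}
    (fun n => ENNReal.ofReal (pw * h n * ‖(c n).2 - y‖ ^ (-α)))).trans ?_
  refine tsum_congr fun n => ?_
  by_cases h1 : (c n).1 = true <;> by_cases h2 : (c n).2 ∈ S <;>
    simp [Set.indicator, Config.present, h1, h2, mul_right_comm]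

@[simp] lemma interference_zero_power (α : ℝ) (c : Config) (h : ℕ → ℝ) (S : Set Plane) (y : Plane) :
    interference α 0 c h S y = 0 := by
  simp [interference]

/-- The total interference at `y` from the points of `c j` outside `Ex j`, with power `pw j`. -/
noncomputable def famInterf (α : ℝ) (pw : J → ℝ) (Ex : J → Set Plane) (y : Plane) (c : J → Config)
    (h : J → ℕ → ℝ) : ℝ≥0∞ :=
  ∑ j, interference α (pw j) (c j) (h j) (Ex j) y

open Classical in
/-- The exponent contributed by an interferer at `x`, averaged over its fading power. -/
noncomputable def fadingLoss (α s : ℝ) (pw : J → ℝ) (Ex : J → Set Plane) (y : Plane) (j : J)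
    (x : Plane) : ℝ≥0∞ :=
  if x ∈ Ex j then 0 else ENNReal.ofReal (Real.log (1 + s * pw j * ‖x - y‖ ^ (-α)))

variable {Ω : Type*} [MeasurableSpace Ω] {Pr : Measure Ω} [IsProbabilityMeasure Pr]
  {d : J → ℝ} {Φ : J → Ω → Config} {h : J → ℕ → Ω → ℝ}

/-- Averaging over the fading powers. -/
lemma lintegral_eexp_famInterf (hlaw : ∀ j n, HasLaw (h j n) (expMeasure 1) Pr)
    (hind : iIndepFun (fun a : J × ℕ => h a.1 a.2) Pr) {α s : ℝ} (hs : 0 ≤ s) {pw : J → ℝ}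
    (hpw : ∀ j, 0 ≤ pw j) (Ex : J → Set Plane) (y : Plane) (c : J → Config) :
    ∫⁻ ω, eexp (ENNReal.ofReal s * famInterf α pw Ex y c (fun j n => h j n ω)) ∂Pr
      = eexp (famSum c (fadingLoss α s pw Ex y)) := by
  classical
  let a : J × ℕ → ℝ := fun i => s * pw i.1 * ‖(c i.1 i.2).2 - y‖ ^ (-α)
  have ha : ∀ i, 0 ≤ a i := fun i => by have := hpw i.1; positivity
  let on : J × ℕ → Prop := fun i => (c i.1 i.2).1 = true ∧ (c i.1 i.2).2 ∉ Ex i.1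
  have e1 : ∀ ω, ENNReal.ofReal s * famInterf α pw Ex y c (fun j n => h j n ω)
      = ∑' i : J × ℕ, if on i then ENNReal.ofReal (a i * h i.1 i.2 ω) else 0 := by
    intro ω
    rw [ENNReal.tsum_prod (f := fun j n => if on (j, n) then ENNReal.ofReal (a (j, n) * h j n ω) else 0),
      tsum_fintype, famInterf, Finset.mul_sum]
    refine Finset.sum_congr rfl fun j _ => ?_
    rw [interference_eq_tsum, ← ENNReal.tsum_mul_left]
    refine tsum_congr fun n => ?_
    by_cases h1 : (c j n).1 = true <;> by_cases h2 : (c j n).2 ∈ Ex j <;>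
      simp [on, a, h1, h2, ← ENNReal.ofReal_mul hs, mul_assoc]
  have e2 : famSum c (fadingLoss α s pw Ex y)
      = ∑' i : J × ℕ, if on i then ENNReal.ofReal (Real.log (1 + a i)) else 0 := by
    rw [ENNReal.tsum_prod (f := fun j n => if on (j, n) then ENNReal.ofReal (Real.log (1 + a (j, n))) else 0),
      tsum_fintype, famSum]
    refine Finset.sum_congr rfl fun j _ => ?_
    unfold Config.sum
    refine tsum_congr fun n => ?_
    by_cases h1 : (c j n).1 = true <;> by_cases h2 : (c j n).2 ∈ Ex j <;>
      simp [on, a, h1, h2, fadingLoss]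
  simp_rw [e1, e2]
  have hg : ∀ i : J × ℕ, Measurable fun t : ℝ =>
      (if on i then ENNReal.ofReal (a i * t) else 0 : ℝ≥0∞) := fun i => by
    by_cases hi : on i
    · simp only [hi, if_true]; fun_prop
    · simp only [hi, if_false]; fun_prop
  refine lintegral_eexp_tsum (X := fun i ω => if on i then ENNReal.ofReal (a i * h i.1 i.2 ω) else 0)
    (hind.comp _ hg) (fun i => (hg i).comp_aemeasurable (hlaw i.1 i.2).aemeasurable) fun i => ?_
  by_cases hi : on i
  · simp only [hi, if_true]
    rw [← lintegral_expMeasure_eexp (ha i)]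
    exact (hlaw i.1 i.2).lintegral_comp (f := fun t => eexp (ENNReal.ofReal (a i * t)))
      (by fun_prop)
  · simp [hi]

/-- Joint measurability is required because the excluded set and the receiver move with the serving
station, which is a function of the points. -/
lemma measurable_interference_param {X : Type*} [MeasurableSpace X] {α : ℝ} {pw : ℝ}
    {c : X → Config} {h : X → ℕ → ℝ} {S : X → Set Plane} {y : X → Plane} (hc : Measurable c)
    (hh : Measurable h) (hS : MeasurableSet {z : X × Plane | z.2 ∈ S z.1}) (hy : Measurable y) :
    Measurable fun x => interference α pw (c x) (h x) (S x) (y x) := by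
  classical
  simp_rw [interference_eq_tsum]
  refine Measurable.tsum fun n => ?_
  have h2 : Measurable fun x => (c x n).2 := by fun_prop
  refine Measurable.ite ((Config.measurableSet_present n).preimage hc) ?_ measurable_const
  refine Measurable.ite (hS.preimage (measurable_id.prodMk h2)) measurable_const ?_
  fun_prop

lemma measurable_famInterf_param {X : Type*} [MeasurableSpace X] {α : ℝ} {pw : J → ℝ}
    {c : X → J → Config} {h : X → J → ℕ → ℝ} {Ex : X → J → Set Plane} {y : X → Plane}
    (hc : Measurable c) (hh : Measurable h)
    (hS : ∀ j, MeasurableSet {z : X × Plane | z.2 ∈ Ex z.1 j}) (hy : Measurable y) :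
    Measurable fun x => famInterf α pw (Ex x) (y x) (c x) (h x) := by
  unfold famInterf
  refine Finset.measurable_sum _ fun j _ => ?_
  exact measurable_interference_param (c := fun x => c x j) (h := fun x => h x j)
    (by fun_prop) (by fun_prop) (hS j) hy

lemma measurable_fadingLoss_param {X : Type*} [MeasurableSpace X] {α : ℝ} {s : X → ℝ} {pw : J → ℝ}
    {Ex : X → J → Set Plane} {y : X → Plane} (hs : Measurable s)
    (hS : ∀ j, MeasurableSet {z : X × Plane | z.2 ∈ Ex z.1 j}) (hy : Measurable y) (j : J) :
    Measurable (Function.uncurry fun x => fadingLoss α (s x) pw (Ex x) (y x) j) := by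
  classical
  unfold fadingLoss
  refine Measurable.ite (hS j) measurable_const ?_
  fun_prop

end Interference

/-! ## Rayleigh fields -/

section Field

variable {J : Type} [Fintype J] {Ω : Type*} [MeasurableSpace Ω] {Pr : Measure Ω}
  [IsProbabilityMeasure Pr] {d : J → ℝ} {Φ : J → Ω → Config} {h : J → ℕ → Ω → ℝ}

lemma IsRayleighField.family (H : IsRayleighField Pr d Φ h) (hd : ∀ j, 0 ≤ d j) :
    IsPoissonFamily Pr d Φ := ⟨H.poisson, H.points_indep, hd⟩

lemma IsRayleighField.measurable_points (H : IsRayleighField Pr d Φ h) :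
    Measurable (fun ω j => Φ j ω) :=
  measurable_pi_lambda _ fun j => (H.poisson j).measurable

lemma IsRayleighField.aemeasurable_fading (H : IsRayleighField Pr d Φ h) :
    AEMeasurable (fun ω j n => h j n ω) Pr :=
  aemeasurable_pi_lambda _ fun j => aemeasurable_pi_lambda _ fun n => (H.fading_law j n).aemeasurable

/-- Averaging over the fading powers, with a weight and a receiver that depend on the points. -/
lemma IsRayleighField.lintegral_mul_eexp_famInterf (H : IsRayleighField Pr d Φ h) {α : ℝ}
    {pw : J → ℝ} (hpw : ∀ j, 0 ≤ pw j) {B : (J → Config) → ℝ≥0∞} (hB : Measurable B)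
    {s : (J → Config) → ℝ} (hs : Measurable s) (hs0 : ∀ c, 0 ≤ s c)
    {Ex : (J → Config) → J → Set Plane}
    (hEx : ∀ j, MeasurableSet {z : (J → Config) × Plane | z.2 ∈ Ex z.1 j})
    {y : (J → Config) → Plane} (hy : Measurable y) :
    ∫⁻ ω, B (fun j => Φ j ω) * eexp (ENNReal.ofReal (s fun j => Φ j ω) *
        famInterf α pw (Ex fun j => Φ j ω) (y fun j => Φ j ω) (fun j => Φ j ω)
          (fun j n => h j n ω)) ∂Pr
      = ∫⁻ ω, B (fun j => Φ j ω) * eexp (famSum (fun j => Φ j ω)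
          (fadingLoss α (s fun j => Φ j ω) pw (Ex fun j => Φ j ω) (y fun j => Φ j ω))) ∂Pr := by
  have hm : Measurable (Function.uncurry fun (c : J → Config) (k : J → ℕ → ℝ) =>
      B c * eexp (ENNReal.ofReal (s c) * famInterf α pw (Ex c) (y c) c k)) := by
    have h1 : Measurable fun z : (J → Config) × (J → ℕ → ℝ) =>
        famInterf α pw (Ex z.1) (y z.1) z.1 z.2 :=
      measurable_famInterf_param measurable_fst measurable_snd (fun j => (hEx j).preimage
        ((measurable_fst.comp measurable_fst).prodMk measurable_snd)) (hy.comp measurable_fst)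
    simp only [Function.uncurry_def]
    fun_prop
  rw [lintegral_of_indepFun (F := fun c k =>
    B c * eexp (ENNReal.ofReal (s c) * famInterf α pw (Ex c) (y c) c k))
    H.measurable_points.aemeasurable H.aemeasurable_fading H.points_fading_indep hm]
  refine lintegral_congr fun ω => ?_
  rw [lintegral_const_mul'' _ ?_, lintegral_eexp_famInterf H.fading_law H.fading_indep (hs0 _) hpw]
  refine measurable_eexp.comp_aemeasurable (AEMeasurable.const_mul ?_ _)
  refine Measurable.comp_aemeasurable
    (g := fun k => famInterf α pw (Ex fun j => Φ j ω) (y fun j => Φ j ω) (fun j => Φ j ω) k)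
    (measurable_famInterf_param (Ex := fun _ => Ex fun j => Φ j ω) measurable_const measurable_id
      (fun j => ?_) measurable_const) H.aemeasurable_fading
  exact ((hEx j).preimage measurable_prodMk_left).preimage measurable_snd

/-- The Laplace transform of the interference. -/
lemma IsRayleighField.laplace_famInterf (H : IsRayleighField Pr d Φ h) (hd : ∀ j, 0 ≤ d j)
    {α : ℝ} {pw : J → ℝ} (hpw : ∀ j, 0 ≤ pw j) {s : ℝ} (hs : 0 ≤ s) {Ex : J → Set Plane}
    (hEx : ∀ j, MeasurableSet (Ex j)) (y : Plane) :
    ∫⁻ ω, eexp (ENNReal.ofReal s *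
        famInterf α pw Ex y (fun j => Φ j ω) (fun j n => h j n ω)) ∂Pr
      = eexp (laplaceExponent d (fadingLoss α s pw Ex y)) := by
  have h1 := H.lintegral_mul_eexp_famInterf (α := α) hpw (B := fun _ => 1) measurable_const
    (s := fun _ => s) measurable_const (fun _ => hs) (Ex := fun _ => Ex)
    (fun j => (hEx j).preimage measurable_snd) (y := fun _ => y) measurable_const
  simp only [one_mul] at h1
  rw [h1]
  refine (H.family hd).laplace fun j => ?_
  exact (measurable_fadingLoss_param (X := Unit) (s := fun _ => s) (Ex := fun _ => Ex)
    (y := fun _ => y) measurable_const (fun j => (hEx j).preimage measurable_snd) measurable_const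
    j).comp (measurable_prodMk_left (x := ()))

/-- The success probability of a Rayleigh fading link whose length depends on the points. -/
lemma IsRayleighField.lintegral_mul_sir (H : IsRayleighField Pr d Φ h) {h₀ : Ω → ℝ}
    (hlaw : HasLaw h₀ (expMeasure 1) Pr)
    (hind : IndepFun h₀ (fun ω => (fun j => Φ j ω, fun j n => h j n ω)) Pr) {α γ : ℝ} (hγ : 0 < γ)
    {pw : J → ℝ} (hpw : ∀ j, 0 ≤ pw j) {B : (J → Config) → ℝ≥0∞} (hB : Measurable B)
    {q : (J → Config) → ℝ} (hq : Measurable q) (hq0 : ∀ c, 0 ≤ q c) (hqB : ∀ c, B c ≠ 0 → 0 < q c)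
    {Ex : (J → Config) → J → Set Plane}
    (hEx : ∀ j, MeasurableSet {z : (J → Config) × Plane | z.2 ∈ Ex z.1 j})
    {y : (J → Config) → Plane} (hy : Measurable y) :
    ∫⁻ ω, B (fun j => Φ j ω) * {ω | ENNReal.ofReal γ < ENNReal.ofReal ((q fun j => Φ j ω) * h₀ ω) /
        famInterf α pw (Ex fun j => Φ j ω) (y fun j => Φ j ω) (fun j => Φ j ω)
          (fun j n => h j n ω)}.indicator 1 ω ∂Pr
      = ∫⁻ ω, B (fun j => Φ j ω) * eexp (famSum (fun j => Φ j ω)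
          (fadingLoss α (γ / q fun j => Φ j ω) pw (Ex fun j => Φ j ω) (y fun j => Φ j ω))) ∂Pr := by
  rw [← H.lintegral_mul_eexp_famInterf hpw hB (s := fun c => γ / q c) (measurable_const.div hq)
    (fun c => div_nonneg hγ.le (hq0 c)) hEx hy]
  let X : Ω → (J → Config) × (J → ℕ → ℝ) := fun ω => (fun j => Φ j ω, fun j n => h j n ω)
  have hX : AEMeasurable X Pr := H.measurable_points.aemeasurable.prodMk H.aemeasurable_fading
  let I : (J → Config) × (J → ℕ → ℝ) → ℝ≥0∞ := fun z => famInterf α pw (Ex z.1) (y z.1) z.1 z.2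
  have hI : Measurable I :=
      measurable_famInterf_param measurable_fst measurable_snd (fun j => (hEx j).preimage
        ((measurable_fst.comp measurable_fst).prodMk measurable_snd)) (hy.comp measurable_fst)
  let S : Set (((J → Config) × (J → ℕ → ℝ)) × ℝ) :=
    {z | ENNReal.ofReal γ < ENNReal.ofReal (q z.1.1 * z.2) / I z.1}
  have hS : MeasurableSet S := measurableSet_lt measurable_const (by fun_prop)
  have hF : Measurable (Function.uncurry fun z t => B z.1 * S.indicator (fun _ => (1 : ℝ≥0∞)) (z, t)) := by
    have : Measurable (S.indicator (fun _ => (1 : ℝ≥0∞))) := measurable_const.indicator hS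
    simp only [Function.uncurry_def]
    fun_prop
  have := lintegral_of_indepFun hX hlaw.aemeasurable hind.symm hF
  refine Eq.trans ?_ (this.trans ?_)
  · refine lintegral_congr fun ω => ?_
    congr 1
  · refine lintegral_congr fun ω => ?_
    -- The mean link power is positive only where the weight does not vanish; elsewhere both sides
    -- are zero.
    by_cases hBz : B (X ω).1 = 0
    · have : B (fun j => Φ j ω) = 0 := hBz
      simp [hBz, this]
    · rw [lintegral_const_mul'' (f := fun ω' => S.indicator (fun _ => 1) (X ω, h₀ ω')) _
        ((measurable_const.indicator hS).comp measurable_prodMk_left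
        |>.comp_aemeasurable hlaw.aemeasurable)]
      have := measure_sir_gt hlaw hγ (hqB _ hBz) (I (X ω))
      rw [show (B fun j => Φ j ω) = B (X ω).1 from rfl, ← this]
      congr 1
      have hset : NullMeasurableSet {ω' | ENNReal.ofReal γ <
          ENNReal.ofReal (q (X ω).1 * h₀ ω') / I (X ω)} Pr :=
        nullMeasurableSet_lt aemeasurable_const
          (((hlaw.aemeasurable.const_mul _).ennreal_ofReal).div aemeasurable_const)
      rw [← lintegral_indicator_one₀ hset]
      rfl

end Field

/-! ## Polar coordinates -/

/-- A rotation that takes the positive real axis to the direction of `y`. It allows the polar angle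
to be measured from the centre of the exclusion ball. -/
lemma exists_isometry_ofReal_norm (y : Plane) :
    ∃ e : ℂ ≃ₗᵢ[ℝ] Plane, e ((‖y‖ : ℝ) : ℂ) = y := by
  let b := Complex.orthonormalBasisOneI.repr
  let w : ℂ := b.symm y
  refine ⟨(rotation (Circle.exp w.arg)).trans b, ?_⟩
  have hw : ‖w‖ = ‖y‖ := b.symm.norm_map y
  rw [LinearIsometryEquiv.trans_apply, rotation_apply, Circle.coe_exp, mul_comm, ← hw,
    Complex.norm_mul_exp_arg_mul_I]
  exact b.apply_symm_apply y

lemma norm_polar_sub_sq (ρ θ r : ℝ) :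
    ‖Complex.polarCoord.symm (ρ, θ) - r‖ ^ 2 = ρ ^ 2 - 2 * ρ * r * Real.cos θ + r ^ 2 := by
  rw [Complex.polarCoord_symm_apply, ← Complex.normSq_eq_norm_sq, Complex.normSq_apply]
  simp only [Complex.sub_re, Complex.mul_re, Complex.add_re, Complex.ofReal_re, Complex.I_re,
    Complex.ofReal_im, Complex.I_im, Complex.sub_im, Complex.mul_im, Complex.add_im]
  have := Real.sin_sq_add_cos_sq θ
  linear_combination ρ ^ 2 * this

lemma lintegral_Ioo_neg_eq {f : ℝ → ℝ≥0∞} (b : ℝ) (heven : ∀ θ, f (-θ) = f θ) :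
    ∫⁻ θ in Set.Ioo (-b) b, f θ = 2 * ∫⁻ θ in Set.Ioo 0 b, f θ := by
  rcases le_or_gt b 0 with hb | hb
  · rw [Set.Ioo_eq_empty (by linarith), Set.Ioo_eq_empty (by linarith)]; simp
  have h1 : ∫⁻ θ in Set.Ioo (-b) 0, f θ = ∫⁻ θ in Set.Ioo 0 b, f θ := by
    have himg : MeasurableEquiv.neg ℝ '' Set.Ioo 0 b = Set.Ioo (-b) 0 := by
      simp
    have h2 := (Measure.measurePreserving_neg (volume : Measure ℝ)).setLIntegral_comp_emb
      (MeasurableEquiv.neg ℝ).measurableEmbedding f (Set.Ioo 0 b)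
    refine Eq.trans ?_ (h2.symm.trans (lintegral_congr heven))
    exact congrArg (fun s => ∫⁻ θ in s, f θ) himg.symm
  rw [← Set.Ioc_union_Ioo_eq_Ioo (a := -b) (b := 0) (c := b) (by linarith) hb,
    lintegral_union measurableSet_Ioo (by
      rw [Set.disjoint_left]; intro x hx hx'; exact absurd hx.2 (not_le.2 hx'.1)),
    two_mul, setLIntegral_congr Ioo_ae_eq_Ioc.symm, h1]

/-- A radial function integrated over the complement of a ball, in polar coordinates whose axis
points to the centre of the ball. -/
lemma lintegral_compl_ball (y : Plane) {l : ℝ} (hl : 0 ≤ l) {k : ℝ → ℝ≥0∞} (hk : Measurable k) :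
    ∫⁻ x in (Metric.ball y l)ᶜ, k ‖x‖
      = 2 * ∫⁻ θ in Set.Ioo 0 Real.pi,
          ∫⁻ ρ in Set.Ioi 0 ∩ {ρ | l ^ 2 ≤ ρ ^ 2 - 2 * ρ * ‖y‖ * Real.cos θ + ‖y‖ ^ 2},
            ENNReal.ofReal ρ * k ρ := by
  obtain ⟨e, he⟩ := exists_isometry_ofReal_norm y
  set r := ‖y‖ with hr
  let S : Set (ℝ × ℝ) := {p | l ^ 2 ≤ p.1 ^ 2 - 2 * p.1 * r * Real.cos p.2 + r ^ 2}
  have hS : MeasurableSet S := measurableSet_le (by fun_prop) (by fun_prop)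
  have h1 : ∫⁻ x in (Metric.ball y l)ᶜ, k ‖x‖
      = ∫⁻ z : ℂ, (Metric.ball y l)ᶜ.indicator (fun x => k ‖x‖) (e z) := by
    rw [← lintegral_indicator Metric.isOpen_ball.measurableSet.compl]
    exact (e.measurePreserving.lintegral_comp_emb e.toHomeomorph.measurableEmbedding _).symm
  have h2 : ∀ p ∈ polarCoord.target, ENNReal.ofReal p.1 •
      (Metric.ball y l)ᶜ.indicator (fun x => k ‖x‖) (e (Complex.polarCoord.symm p))
      = S.indicator (fun p => ENNReal.ofReal p.1 * k p.1) p := by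
    rintro ⟨ρ, θ⟩ hp
    have hρ : 0 < ρ := hp.1
    have hn : ‖e (Complex.polarCoord.symm (ρ, θ))‖ = ρ := by
      rw [e.norm_map, Complex.norm_polarCoord_symm, abs_of_pos hρ]
    have hiff : e (Complex.polarCoord.symm (ρ, θ)) ∈ (Metric.ball y l)ᶜ ↔ (ρ, θ) ∈ S := by
      rw [Set.mem_compl_iff, Metric.mem_ball, not_lt, dist_eq_norm]
      conv_lhs => rw [← he, ← map_sub, e.norm_map]
      rw [← pow_le_pow_iff_left₀ hl (norm_nonneg _) two_ne_zero, norm_polar_sub_sq]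
      rfl
    by_cases hin : (ρ, θ) ∈ S
    · rw [Set.indicator_of_mem hin, Set.indicator_of_mem (hiff.2 hin), hn, smul_eq_mul]
    · rw [Set.indicator_of_notMem hin, Set.indicator_of_notMem (fun h => hin (hiff.1 h)), smul_zero]
  rw [h1, ← Complex.lintegral_comp_polarCoord_symm, setLIntegral_congr_fun
    polarCoord.open_target.measurableSet h2]
  have hm : Measurable (S.indicator fun p : ℝ × ℝ => ENNReal.ofReal p.1 * k p.1) :=
    Measurable.indicator (by fun_prop) hS
  rw [polarCoord_target, Measure.volume_eq_prod, ← Measure.prod_restrict,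
    lintegral_prod_symm _ hm.aemeasurable]
  have h3 : ∀ θ, ∫⁻ ρ in Set.Ioi 0, S.indicator (fun p : ℝ × ℝ => ENNReal.ofReal p.1 * k p.1) (ρ, θ)
      = ∫⁻ ρ in Set.Ioi 0 ∩ {ρ | l ^ 2 ≤ ρ ^ 2 - 2 * ρ * r * Real.cos θ + r ^ 2},
            ENNReal.ofReal ρ * k ρ := by
    intro θ
    have hSθ : MeasurableSet {ρ : ℝ | l ^ 2 ≤ ρ ^ 2 - 2 * ρ * r * Real.cos θ + r ^ 2} :=
      measurableSet_le (by fun_prop) (by fun_prop)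
    rw [Set.inter_comm, ← Measure.restrict_restrict hSθ, ← lintegral_indicator hSθ]
    rfl
  simp_rw [h3]
  -- Reflection in the axis through the centre folds the angles `(-π, π)` onto `(0, π)`; hence the
  -- factor two.
  exact lintegral_Ioo_neg_eq _ fun θ => by simp only [Real.cos_neg]

lemma lintegral_comp_norm {k : ℝ → ℝ≥0∞} (hk : Measurable k) :
    ∫⁻ x : Plane, k ‖x‖ = 2 * ENNReal.ofReal Real.pi * ∫⁻ ρ in Set.Ioi 0, ENNReal.ofReal ρ * k ρ := by
  have := lintegral_compl_ball 0 le_rfl hk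
  rw [Metric.ball_zero, Set.compl_empty, setLIntegral_univ] at this
  rw [this, mul_assoc]
  congr 1
  have h : ∀ θ : ℝ, Set.Ioi (0 : ℝ) ∩
      {ρ | (0 : ℝ) ^ 2 ≤ ρ ^ 2 - 2 * ρ * ‖(0 : Plane)‖ * Real.cos θ + ‖(0 : Plane)‖ ^ 2} = Set.Ioi 0 := by
    intro θ
    refine Set.inter_eq_left.2 fun ρ _ => ?_
    simp only [norm_zero, Set.mem_ofPred_eq]
    nlinarith [sq_nonneg ρ]
  simp_rw [h]
  rw [setLIntegral_const, Real.volume_Ioo, sub_zero, mul_comm]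

/-- Radial functions outside a centred ball. -/
lemma lintegral_comp_norm_of_gt {k : ℝ → ℝ≥0∞} (hk : Measurable k) {R : ℝ} (hR : 0 ≤ R) :
    ∫⁻ x in {x : Plane | R < ‖x‖}, k ‖x‖
      = 2 * ENNReal.ofReal Real.pi * ∫⁻ ρ in Set.Ioi R, ENNReal.ofReal ρ * k ρ := by
  have h1 : MeasurableSet {x : Plane | R < ‖x‖} := measurableSet_lt measurable_const measurable_norm
  rw [← lintegral_indicator h1]
  have := lintegral_comp_norm (k := (Set.Ioi R).indicator k) (hk.indicator measurableSet_Ioi)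
  refine Eq.trans (lintegral_congr fun x => rfl) (this.trans ?_)
  congr 1
  have h2 : ∀ ρ : ℝ, ENNReal.ofReal ρ * (Set.Ioi R).indicator k ρ
      = (Set.Ioi R).indicator (fun ρ => ENNReal.ofReal ρ * k ρ) ρ := fun ρ => by
    by_cases h : ρ ∈ Set.Ioi R
    · rw [Set.indicator_of_mem h, Set.indicator_of_mem h]
    · rw [Set.indicator_of_notMem h, Set.indicator_of_notMem h, mul_zero]
  simp_rw [h2]
  rw [setLIntegral_indicator measurableSet_Ioi, Set.inter_eq_left.2 (Set.Ioi_subset_Ioi hR)]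

/-! ## The kernel `1 / (1 + u ^ (α / 2))` -/

section Kernel

variable {α : ℝ}

/-- The absolute value extends the kernel from the half-line to a continuous function on the line.
Its primitive is then continuous and monotone everywhere, and it can be composed with the
angle-dependent limits without side conditions. -/
lemma continuous_kernel_abs (hα : 2 < α) : Continuous fun u : ℝ => 1 / (1 + |u| ^ (α / 2)) := by
  refine continuous_const.div₀ (continuous_const.add
    ((Real.continuous_rpow_const (by linarith)).comp continuous_abs)) fun u => ?_
  have : 0 ≤ |u| ^ (α / 2) := by positivity
  positivity

lemma measurable_kernel : Measurable fun u : ℝ => 1 / (1 + u ^ (α / 2)) := by fun_prop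

lemma kernel_nonneg {u : ℝ} (hu : 0 ≤ u) : 0 ≤ 1 / (1 + u ^ (α / 2)) := by positivity

lemma integrableOn_kernel (hα : 2 < α) : IntegrableOn (fun u : ℝ => 1 / (1 + u ^ (α / 2))) (Set.Ioi 0) := by
  rw [← Set.Ioc_union_Ioi_eq_Ioi (zero_le_one (α := ℝ))]
  refine IntegrableOn.union ?_ ?_
  · refine Measure.integrableOn_of_bounded (M := 1) (by simp) measurable_kernel.aestronglyMeasurable ?_
    filter_upwards [ae_restrict_mem measurableSet_Ioc] with u hu
    have : 0 ≤ u ^ (α / 2) := Real.rpow_nonneg hu.1.le _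
    rw [Real.norm_of_nonneg (by positivity), div_le_one (by positivity)]
    linarith
  · refine Integrable.mono' (integrableOn_Ioi_rpow_of_lt (a := -(α / 2)) (by linarith) one_pos)
      measurable_kernel.aestronglyMeasurable ?_
    filter_upwards [ae_restrict_mem measurableSet_Ioi] with u hu
    have hu0 : (0 : ℝ) < u := one_pos.trans hu
    have : 0 < u ^ (α / 2) := Real.rpow_pos_of_pos hu0 _
    rw [Real.norm_of_nonneg (by positivity), Real.rpow_neg hu0.le, ← one_div]
    exact one_div_le_one_div_of_le this (by linarith)

/-- The radial density of the interference, in units of `T`. -/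
noncomputable def kern (α T ρ : ℝ) : ℝ := 1 / (1 + (ρ ^ 2 / T) ^ (α / 2))

lemma measurable_kern {T : ℝ} : Measurable (kern α T) := by unfold kern; fun_prop

/-- The substitution `u = ρ² / T`, `ρ dρ = (T / 2) du`. After it the kernel depends on the path loss
exponent only. -/
lemma lintegral_mul_kern {T : ℝ} (hT : 0 < T) {s : Set ℝ} (hs : MeasurableSet s)
    (hs0 : s ⊆ Set.Ioi 0) :
    ∫⁻ ρ in s, ENNReal.ofReal ρ * ENNReal.ofReal (kern α T ρ)
      = ENNReal.ofReal (T / 2) * ∫⁻ u in (fun ρ => ρ ^ 2 / T) '' s,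
          ENNReal.ofReal (1 / (1 + u ^ (α / 2))) := by
  rw [lintegral_image_eq_lintegral_abs_deriv_mul (f' := fun ρ => 2 * ρ / T) hs
    (fun ρ _ => by simpa using (((hasDerivAt_id ρ).pow 2).div_const T).hasDerivWithinAt)
    (fun a ha b hb hab => by
      have ha := hs0 ha
      have hb := hs0 hb
      simp only [Set.mem_Ioi] at ha hb
      have : a ^ 2 = b ^ 2 := by simpa [div_left_inj' hT.ne'] using hab
      exact (pow_left_inj₀ ha.le hb.le two_ne_zero).1 this),
    ← lintegral_const_mul' _ _ ENNReal.ofReal_ne_top]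
  refine setLIntegral_congr_fun hs fun ρ hρ => ?_
  have hρ0 : 0 < ρ := hs0 hρ
  rw [abs_of_pos (by positivity), ← mul_assoc, ← ENNReal.ofReal_mul (p := T / 2) (by positivity),
    kern]
  congr 2
  field_simp

lemma lintegral_mul_kern_Ioi (hα : 2 < α) {T : ℝ} (hT : 0 < T) {a : ℝ} (ha : 0 ≤ a) :
    ∫⁻ ρ in Set.Ioi a, ENNReal.ofReal ρ * ENNReal.ofReal (kern α T ρ)
      = ENNReal.ofReal (T / 2 * ∫ u in Set.Ioi (a ^ 2 / T), 1 / (1 + u ^ (α / 2))) := by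
  have himg : (fun ρ : ℝ => ρ ^ 2 / T) '' Set.Ioi a = Set.Ioi (a ^ 2 / T) := by
    ext u
    simp only [Set.mem_image, Set.mem_Ioi]
    constructor
    · rintro ⟨ρ, hρ, rfl⟩; gcongr
    · intro hu
      have hu0 : 0 ≤ u * T := by
        have : 0 ≤ a ^ 2 / T := by positivity
        nlinarith
      refine ⟨√(u * T), Real.lt_sqrt_of_sq_lt ?_, ?_⟩
      · rwa [div_lt_iff₀ hT] at hu
      · rw [Real.sq_sqrt hu0]; field_simp
  rw [lintegral_mul_kern hT measurableSet_Ioi (Set.Ioi_subset_Ioi ha), himg,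
    ENNReal.ofReal_mul (by positivity), ofReal_integral_eq_lintegral_ofReal
      ((integrableOn_kernel hα).mono_set (Set.Ioi_subset_Ioi (by positivity)))]
  filter_upwards [ae_restrict_mem measurableSet_Ioi] with u hu
  have : 0 ≤ a ^ 2 / T := by positivity
  exact kernel_nonneg (this.trans hu.le)

/-- A primitive of the kernel. -/
noncomputable def kernelPrim (α x : ℝ) : ℝ := ∫ u in (0 : ℝ)..x, 1 / (1 + |u| ^ (α / 2))

lemma continuous_kernelPrim (hα : 2 < α) : Continuous (kernelPrim α) :=
  intervalIntegral.continuous_primitive (fun _ _ => (continuous_kernel_abs hα).intervalIntegrable _ _) 0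

lemma integral_kernel (hα : 2 < α) {a b : ℝ} (ha : 0 ≤ a) (hb : 0 ≤ b) :
    ∫ u in a..b, 1 / (1 + u ^ (α / 2)) = kernelPrim α b - kernelPrim α a := by
  unfold kernelPrim
  rw [intervalIntegral.integral_interval_sub_left
    ((continuous_kernel_abs hα).intervalIntegrable _ _)
    ((continuous_kernel_abs hα).intervalIntegrable _ _)]
  refine intervalIntegral.integral_congr fun u hu => ?_
  have : 0 ≤ u := (le_min ha hb).trans hu.1
  simp only [abs_of_nonneg this]

lemma kernelPrim_mono (hα : 2 < α) : Monotone (kernelPrim α) := by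
  intro a b hab
  rw [← sub_nonneg]
  unfold kernelPrim
  rw [intervalIntegral.integral_interval_sub_left
    ((continuous_kernel_abs hα).intervalIntegrable _ _)
    ((continuous_kernel_abs hα).intervalIntegrable _ _)]
  exact intervalIntegral.integral_nonneg hab fun u _ => kernel_nonneg (abs_nonneg u)

lemma lintegral_mul_kern_Ioo (hα : 2 < α) {T : ℝ} (hT : 0 < T) {a b : ℝ} (ha : 0 ≤ a) (hab : a ≤ b) :
    ∫⁻ ρ in Set.Ioo a b, ENNReal.ofReal ρ * ENNReal.ofReal (kern α T ρ)
      = ENNReal.ofReal (T / 2 * (kernelPrim α (b ^ 2 / T) - kernelPrim α (a ^ 2 / T))) := by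
  have himg : (fun ρ : ℝ => ρ ^ 2 / T) '' Set.Ioo a b = Set.Ioo (a ^ 2 / T) (b ^ 2 / T) := by
    ext u
    simp only [Set.mem_image, Set.mem_Ioo]
    constructor
    · rintro ⟨ρ, hρ, rfl⟩
      have := hρ.1; have := hρ.2; have : 0 ≤ ρ := by linarith
      constructor <;> gcongr
    · rintro ⟨hu, hu'⟩
      have hu0 : 0 ≤ u * T := by
        have : 0 ≤ a ^ 2 / T := by positivity
        nlinarith
      refine ⟨√(u * T), ⟨Real.lt_sqrt_of_sq_lt ?_, ?_⟩, ?_⟩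
      · rwa [div_lt_iff₀ hT] at hu
      · rw [Real.sqrt_lt' (lt_of_le_of_ne (ha.trans hab) ?_)]
        · rwa [lt_div_iff₀ hT] at hu'
        · rintro rfl
          have : (0 : ℝ) ≤ a ^ 2 / T := by positivity
          rw [zero_pow two_ne_zero, zero_div] at hu'
          linarith
      · rw [Real.sq_sqrt hu0]; field_simp
  have hab' : a ^ 2 / T ≤ b ^ 2 / T := by gcongr
  rw [lintegral_mul_kern hT measurableSet_Ioo (fun x hx => ha.trans_lt hx.1), himg,
    ENNReal.ofReal_mul (by positivity), ← integral_kernel hα (by positivity) (by positivity),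
    intervalIntegral.integral_of_le hab', setLIntegral_congr Ioo_ae_eq_Ioc,
    ofReal_integral_eq_lintegral_ofReal]
  · exact (integrableOn_kernel hα).mono_set fun u hu => (by positivity : 0 ≤ a ^ 2 / T).trans_lt hu.1
  · filter_upwards [ae_restrict_mem measurableSet_Ioc] with u hu
    have : 0 ≤ a ^ 2 / T := by positivity
    exact kernel_nonneg (this.trans hu.1.le)

/-- Euler's reflection formula in the form of a beta integral. -/
lemma integral_kernel_Ioi (hα : 2 < α) :
    ∫ u in Set.Ioi (0 : ℝ), 1 / (1 + u ^ (α / 2)) = (2 * Real.pi / α) / Real.sin (2 * Real.pi / α) := by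
  have hα0 : 0 < α := by linarith
  -- Write `1 / (1 + u ^ (α/2))` as `∫ e^(-t (1 + u ^ (α/2))) dt` and exchange the integrals. The
  -- integral in `u` is `Γ(2/α + 1) t ^ (-2/α) e^(-t)`, the one in `t` then gives `(2/α) Γ(2/α) Γ(1
  -- - 2/α)`, and reflection finishes. Here `α > 2` makes `1 - 2/α` positive.
  have hL : ∫⁻ u in Set.Ioi (0 : ℝ), ENNReal.ofReal (1 / (1 + u ^ (α / 2)))
      = ENNReal.ofReal ((2 * Real.pi / α) / Real.sin (2 * Real.pi / α)) := by
    have h1 : ∀ u ∈ Set.Ioi (0 : ℝ), ENNReal.ofReal (1 / (1 + u ^ (α / 2)))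
        = ∫⁻ t in Set.Ioi (0 : ℝ), ENNReal.ofReal (Real.exp (-t * (1 + u ^ (α / 2)))) := by
      intro u hu
      have hp : 0 < 1 + u ^ (α / 2) := by
        have := Real.rpow_nonneg (le_of_lt hu) (α / 2); positivity
      have h := integral_exp_neg_mul_rpow (p := 1) (b := 1 + u ^ (α / 2)) one_pos hp
      have hi := integrableOn_rpow_mul_exp_neg_mul_rpow (s := 0) (p := 1) (b := 1 + u ^ (α / 2))
        (by norm_num) one_pos hp
      simp only [Real.rpow_one, Real.rpow_zero, one_mul] at h hi
      rw [← ofReal_integral_eq_lintegral_ofReal]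
      · congr 1
        rw [show (fun t : ℝ => Real.exp (-t * (1 + u ^ (α / 2))))
          = fun t => Real.exp (-(1 + u ^ (α / 2)) * t) by ext t; ring_nf, h]
        norm_num [Real.rpow_neg_one]
      · refine hi.congr_fun (fun t _ => ?_) measurableSet_Ioi
        ring_nf
      · exact ae_of_all _ fun t => (Real.exp_pos _).le
    have h2 : ∀ t ∈ Set.Ioi (0 : ℝ),
        ∫⁻ u in Set.Ioi (0 : ℝ), ENNReal.ofReal (Real.exp (-t * (1 + u ^ (α / 2))))
        = ENNReal.ofReal (Real.Gamma (2 / α + 1) * (t ^ (-(2 / α)) * Real.exp (-t))) := by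
      intro t ht
      have h := integral_exp_neg_mul_rpow (p := α / 2) (b := t) (by positivity) ht
      have hi := integrableOn_rpow_mul_exp_neg_mul_rpow (s := 0) (p := α / 2) (b := t)
        (by norm_num) (by positivity) ht
      simp only [Real.rpow_zero, one_mul] at hi
      rw [← ofReal_integral_eq_lintegral_ofReal]
      · congr 1
        have e : ∀ u : ℝ, Real.exp (-t * (1 + u ^ (α / 2)))
            = Real.exp (-t) * Real.exp (-t * u ^ (α / 2)) := fun u => by
          rw [← Real.exp_add]; ring_nf
        simp_rw [e]
        rw [integral_const_mul, h, one_div_div, neg_div, one_div_div]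
        ring
      · refine IntegrableOn.congr_fun (hi.const_mul (Real.exp (-t))) (fun u _ => ?_) measurableSet_Ioi
        change Real.exp (-t) * _ = _
        rw [← Real.exp_add]; ring_nf
      · exact ae_of_all _ fun t => (Real.exp_pos _).le
    rw [setLIntegral_congr_fun measurableSet_Ioi h1, lintegral_lintegral_swap (by fun_prop),
      setLIntegral_congr_fun measurableSet_Ioi h2, ← ofReal_integral_eq_lintegral_ofReal]
    · congr 1
      have h := integral_rpow_mul_exp_neg_mul_rpow (p := 1) (q := -(2 / α)) (b := 1) one_pos
        (by rw [neg_lt_neg_iff, div_lt_one hα0]; exact hα) one_pos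
      simp only [Real.rpow_one, Real.one_rpow, one_mul, div_one, neg_one_mul] at h
      have href := Real.Gamma_mul_Gamma_one_sub (2 / α)
      rw [integral_const_mul, h, Real.Gamma_add_one (by positivity), mul_assoc,
        show -(2 / α) + 1 = 1 - 2 / α by ring, href]
      rw [show Real.pi * (2 / α) = 2 * Real.pi / α by ring]
      ring
    · have hi := integrableOn_rpow_mul_exp_neg_mul_rpow (s := -(2 / α)) (p := 1) (b := 1)
        (by rw [neg_lt_neg_iff, div_lt_one hα0]; exact hα) one_pos one_pos
      simp only [Real.rpow_one, neg_one_mul] at hi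
      exact hi.const_mul _
    · filter_upwards [ae_restrict_mem measurableSet_Ioi] with t ht
      have : 0 < t := ht
      have := Real.Gamma_pos_of_pos (s := 2 / α + 1) (by positivity)
      simp only [Pi.zero_apply]
      positivity
  rw [integral_eq_lintegral_of_nonneg_ae, hL, ENNReal.toReal_ofReal]
  · have h1 : 0 < 2 * Real.pi / α := by positivity
    have h2 : 2 * Real.pi / α < Real.pi := by
      rw [div_lt_iff₀ hα0]; nlinarith [Real.pi_pos]
    exact div_nonneg h1.le (Real.sin_pos_of_pos_of_lt_pi h1 h2).le
  · filter_upwards [ae_restrict_mem measurableSet_Ioi] with u hu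
    exact kernel_nonneg (le_of_lt hu)
  · exact measurable_kernel.aestronglyMeasurable

end Kernel

/-! ## The kernel outside a ball -/

/-- With `b` taken at the radius `l + r`, the tail beyond `b` is the same for every angle and
becomes the `δ` term, while the difference of primitives goes into `Z`. -/
lemma integral_kernel_tail (α : ℝ) (hα : 2 < α) {a b : ℝ} (ha : 0 ≤ a) (hb : 0 ≤ b) :
    ∫ u in Set.Ioi a, 1 / (1 + u ^ (α / 2))
      = kernelPrim α b - kernelPrim α a + ∫ u in Set.Ioi b, 1 / (1 + u ^ (α / 2)) := by
  rw [← integral_kernel hα ha hb, intervalIntegral.integral_interval_add_Ioi]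
  · exact (integrableOn_kernel hα).mono_set (Set.Ioi_subset_Ioi ha)
  · exact (integrableOn_kernel hα).mono_set (Set.Ioi_subset_Ioi hb)

lemma integral_kernel_tail_nonneg (α : ℝ) {a : ℝ} (ha : 0 ≤ a) :
    0 ≤ ∫ u in Set.Ioi a, 1 / (1 + u ^ (α / 2)) :=
  setIntegral_nonneg measurableSet_Ioi fun _ hu => kernel_nonneg (ha.trans (le_of_lt hu))

lemma lintegral_Ioo_ofReal {g : ℝ → ℝ} (hg : Continuous g) {a b : ℝ} (hab : a ≤ b)
    (h0 : ∀ θ ∈ Set.Ioo a b, 0 ≤ g θ) :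
    ∫⁻ θ in Set.Ioo a b, ENNReal.ofReal (g θ) = ENNReal.ofReal (∫ θ in a..b, g θ) := by
  rw [intervalIntegral.integral_of_le hab, integral_Ioc_eq_integral_Ioo,
    ofReal_integral_eq_lintegral_ofReal]
  · exact (hg.integrableOn_Icc).mono_set Set.Ioo_subset_Icc_self
  · filter_upwards [ae_restrict_mem measurableSet_Ioo] with θ hθ using h0 θ hθ

namespace Params

variable (p : Params)

lemma α_pos : 0 < p.α := by linarith [p.two_lt_α]

lemma exclRadius_pos {ρ : ℝ} (hρ : 0 < ρ) : 0 < p.exclRadius ρ := by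
  unfold exclRadius
  have h1 := Real.log_neg p.ε_mem.1 p.ε_mem.2
  have := p.Qd_pos
  have : 0 < -Real.log p.ε := by linarith
  positivity

lemma ιs_pos : 0 < p.ιs := p.exclRadius_pos p.ρs_pos

lemma ιd_pos : 0 < p.ιd := p.exclRadius_pos p.ρd_pos

/-- At the argument `t / R ^ α` the lower limit of `δ` is `R² / t ^ (2/α)` and its prefactor is `t ^
(2/α) / R²`. So `R² δ` is a scaled tail of the kernel beyond the radius `R`. -/
lemma sq_mul_δ {t R : ℝ} (ht : 0 < t) (hR : 0 < R) :
    R ^ 2 * p.δ (t / R ^ p.α)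
      = t ^ (2 / p.α) * ∫ u in Set.Ioi (R ^ 2 / t ^ (2 / p.α)), 1 / (1 + u ^ (p.α / 2)) := by
  have hα := p.α_pos
  have h1 : (t / R ^ p.α) ^ (2 / p.α) = t ^ (2 / p.α) / R ^ 2 := by
    rw [Real.div_rpow ht.le (by positivity), ← Real.rpow_mul hR.le, mul_div_cancel₀ _ hα.ne',
      Real.rpow_two]
  have h2 : (t / R ^ p.α) ^ (-(2 / p.α)) = R ^ 2 / t ^ (2 / p.α) := by
    rw [Real.rpow_neg (by positivity), h1, inv_div]
  unfold δ
  rw [h2, h1]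
  simp_rw [div_eq_mul_one_div (t ^ (2 / p.α) / R ^ 2)]
  rw [integral_const_mul, ← mul_assoc]
  congr 1
  field_simp

/-- Expressed by the primitive, the integrand in `θ` is visibly continuous for continuous radial
bounds. -/
lemma Z_eq {s Q θl θu : ℝ} {κl κu : ℝ → ℝ} (hsQ : 0 < s * Q) :
    p.Z s Q θl θu κl κu = (s * Q) ^ (2 / p.α) * ∫ θ in θl..θu,
      (kernelPrim p.α (κu θ ^ 2 / (s * Q) ^ (2 / p.α))
        - kernelPrim p.α (κl θ ^ 2 / (s * Q) ^ (2 / p.α))) := by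
  unfold Z
  congr 1
  refine intervalIntegral.integral_congr fun θ _ => ?_
  exact integral_kernel p.two_lt_α (by positivity) (by positivity)

end Params

lemma farDist_continuous (l r : ℝ) : Continuous (Params.farDist l r) := by
  unfold Params.farDist; fun_prop

lemma nearDist_continuous (l r : ℝ) : Continuous (Params.nearDist l r) := by
  unfold Params.nearDist; fun_prop

/-! ### Intersection of a ray with the exclusion disc. -/

section Geometry

variable {l r θ ρ : ℝ}

/-- Put `D = √(l² - (r sin θ)²)`. The squared distance to the centre minus `l²` factors as `(ρ - r
cos θ - D) (ρ - r cos θ + D)`. Since `r ≤ l`, `D ≥ |r cos θ|` and the second factor is positive: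
from inside the disc a ray leaves it once. -/
lemma outside_iff_of_le (hr : 0 ≤ r) (hrl : r ≤ l) (hρ : 0 < ρ) :
    l ^ 2 ≤ ρ ^ 2 - 2 * ρ * r * Real.cos θ + r ^ 2 ↔ Params.farDist l r θ ≤ ρ := by
  unfold Params.farDist
  have hsc := Real.sin_sq_add_cos_sq θ
  have hD : 0 ≤ l ^ 2 - (r * Real.sin θ) ^ 2 := by
    have h1 : Real.sin θ ^ 2 ≤ 1 := Real.sin_sq_le_one θ
    have h2 : (r * Real.sin θ) ^ 2 ≤ r ^ 2 := by
      rw [mul_pow]; exact mul_le_of_le_one_right (sq_nonneg r) h1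
    nlinarith
  have hsq := Real.sq_sqrt hD
  have hs0 := Real.sqrt_nonneg (l ^ 2 - (r * Real.sin θ) ^ 2)
  set D := √(l ^ 2 - (r * Real.sin θ) ^ 2)
  have hcD : |r * Real.cos θ| ≤ D := by
    refine Real.abs_le_sqrt ?_
    have : (r * Real.cos θ) ^ 2 = r ^ 2 - (r * Real.sin θ) ^ 2 := by
      linear_combination r ^ 2 * hsc
    nlinarith
  have hc := (abs_le.1 hcD)
  have key : ρ ^ 2 - 2 * ρ * r * Real.cos θ + r ^ 2 - l ^ 2
      = (ρ - r * Real.cos θ - D) * (ρ - r * Real.cos θ + D) := by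
    linear_combination (-r ^ 2) * hsc + hsq
  have hpos : 0 < ρ - r * Real.cos θ + D := by linarith [hc.2]
  constructor
  · intro h
    have : 0 ≤ (ρ - r * Real.cos θ - D) * (ρ - r * Real.cos θ + D) := by linarith
    have := nonneg_of_mul_nonneg_left this hpos
    linarith
  · intro h
    have : 0 ≤ (ρ - r * Real.cos θ - D) * (ρ - r * Real.cos θ + D) :=
      mul_nonneg (by linarith) hpos.le
    linarith

lemma farDist_nonneg_of_le (hr : 0 ≤ r) (hrl : r ≤ l) : 0 ≤ Params.farDist l r θ := by
  by_contra h
  push Not at h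
  unfold Params.farDist at h
  have hsc := Real.sin_sq_add_cos_sq θ
  have : |r * Real.cos θ| ≤ √(l ^ 2 - (r * Real.sin θ) ^ 2) := by
    refine Real.abs_le_sqrt ?_
    have : (r * Real.cos θ) ^ 2 = r ^ 2 - (r * Real.sin θ) ^ 2 := by
      linear_combination r ^ 2 * hsc
    nlinarith
  linarith [(abs_le.1 this).1]

lemma farDist_le (hr : 0 ≤ r) (hl : 0 ≤ l) : Params.farDist l r θ ≤ l + r := by
  unfold Params.farDist
  have h1 : √(l ^ 2 - (r * Real.sin θ) ^ 2) ≤ l := by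
    rw [Real.sqrt_le_left hl]
    nlinarith [sq_nonneg (r * Real.sin θ)]
  have h2 : r * Real.cos θ ≤ r := mul_le_of_le_one_right hr (Real.cos_le_one θ)
  linarith

/-- `r sin θ` is the distance of the centre from the line of the ray: below the tangent angle
`arcsin (l / r)` the line cuts the disc, and the centre lies ahead. -/
lemma mul_sin_lt_of_lt_arcsin (hl : 0 < l) (hlr : l < r) (hθ0 : 0 < θ)
    (hθ : θ < Real.arcsin (l / r)) : r * Real.sin θ < l ∧ 0 < Real.cos θ := by
  have hr : 0 < r := hl.trans hlr
  have h1 := Real.arcsin_le_pi_div_two (l / r)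
  have h2 : Real.sin θ < l / r := by
    rw [← Real.lt_arcsin_iff_sin_lt' ⟨by linarith [Real.pi_pos], by linarith⟩]
    exact hθ
  refine ⟨?_, Real.cos_pos_of_mem_Ioo ⟨by linarith [Real.pi_pos], by linarith⟩⟩
  rw [lt_div_iff₀ hr] at h2
  linarith

/-- The same factorisation seen from outside the disc. Now `l < r` gives `D ≤ r cos θ`, so both
roots are nonnegative and the ray is free before the first root and after the second. -/
lemma nearDist_farDist (hl : 0 < l) (hlr : l < r) (hθ0 : 0 < θ)
    (hθ : θ < Real.arcsin (l / r)) :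
    0 ≤ Params.nearDist l r θ ∧ Params.nearDist l r θ ≤ Params.farDist l r θ ∧
    ∀ ρ, l ^ 2 ≤ ρ ^ 2 - 2 * ρ * r * Real.cos θ + r ^ 2 ↔
      ρ ≤ Params.nearDist l r θ ∨ Params.farDist l r θ ≤ ρ := by
  unfold Params.nearDist Params.farDist
  obtain ⟨h1, h2⟩ := mul_sin_lt_of_lt_arcsin hl hlr hθ0 hθ
  have hr : 0 < r := hl.trans hlr
  have hsin : 0 < Real.sin θ := Real.sin_pos_of_pos_of_lt_pi hθ0
    (by linarith [Real.arcsin_le_pi_div_two (l / r), Real.pi_pos])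
  have hsc := Real.sin_sq_add_cos_sq θ
  have hD : 0 ≤ l ^ 2 - (r * Real.sin θ) ^ 2 := by
    have : 0 < r * Real.sin θ := by positivity
    nlinarith
  have hsq := Real.sq_sqrt hD
  have hs0 := Real.sqrt_nonneg (l ^ 2 - (r * Real.sin θ) ^ 2)
  have hle : √(l ^ 2 - (r * Real.sin θ) ^ 2) ≤ r * Real.cos θ := by
    rw [Real.sqrt_le_left (by positivity)]
    have : (r * Real.cos θ) ^ 2 = r ^ 2 - (r * Real.sin θ) ^ 2 := by
      linear_combination r ^ 2 * hsc
    nlinarith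
  set D := √(l ^ 2 - (r * Real.sin θ) ^ 2)
  refine ⟨by linarith, by linarith, fun ρ => ?_⟩
  have key : ρ ^ 2 - 2 * ρ * r * Real.cos θ + r ^ 2 - l ^ 2
      = (ρ - r * Real.cos θ - D) * (ρ - r * Real.cos θ + D) := by
    linear_combination (-r ^ 2) * hsc + hsq
  rw [← sub_nonneg, key, mul_nonneg_iff]
  constructor
  · rintro (⟨ha, hb⟩ | ⟨ha, hb⟩)
    · right; linarith
    · left; linarith
  · rintro (h | h)
    · right; constructor <;> linarith
    · left; constructor <;> linarith

/-- Up to the right angle the line of the ray is at distance `r sin θ ≥ l` from the centre. Beyond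
it the ray moves away from the centre, which is at distance `r > l` at the start. -/
lemma outside_of_arcsin_le (hl : 0 < l) (hlr : l < r) (hθ : Real.arcsin (l / r) ≤ θ)
    (hθπ : θ ≤ Real.pi) (hρ : 0 < ρ) : l ^ 2 ≤ ρ ^ 2 - 2 * ρ * r * Real.cos θ + r ^ 2 := by
  have hr : 0 < r := hl.trans hlr
  have hsc := Real.sin_sq_add_cos_sq θ
  rcases le_or_gt θ (Real.pi / 2) with h | h
  · have h1 : l / r ≤ Real.sin θ := by
      have h0 : 0 ≤ l / r := by positivity
      have h0' := Real.arcsin_nonneg.2 h0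
      rw [← Real.arcsin_le_iff_le_sin ⟨by linarith, by rw [div_le_one hr]; exact hlr.le⟩
        ⟨by linarith [Real.pi_pos], h⟩]
      exact hθ
    rw [div_le_iff₀ hr] at h1
    have h2 : l ^ 2 ≤ (r * Real.sin θ) ^ 2 := by
      rw [mul_comm]; gcongr
    have : ρ ^ 2 - 2 * ρ * r * Real.cos θ + r ^ 2
        = (ρ - r * Real.cos θ) ^ 2 + (r * Real.sin θ) ^ 2 := by
      linear_combination (-r ^ 2) * hsc
    nlinarith [sq_nonneg (ρ - r * Real.cos θ)]
  · have h1 : Real.cos θ ≤ 0 := Real.cos_nonpos_of_pi_div_two_le_of_le h.le (by linarith)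
    have h2 : 0 ≤ ρ * r * (-Real.cos θ) := by
      have : 0 ≤ -Real.cos θ := by linarith
      positivity
    nlinarith [sq_nonneg ρ]

end Geometry

/-! ### The kernel integrated outside an eccentric disc. -/

namespace Params

variable (p : Params)

/-- The origin lies in the closed disc, so each ray contributes the half-line from `farDist` on.
Cutting it at `l + ‖y‖`, which no `farDist` exceeds, separates `Z` from `δ`. -/
lemma lintegral_kern_compl_ball_of_le {s Q l : ℝ} (hsQ : 0 < s * Q) (hl : 0 < l) {y : Plane}
    (hy : ‖y‖ ≤ l) :
    ∫⁻ x in (Metric.ball y l)ᶜ, ENNReal.ofReal (kern p.α ((s * Q) ^ (2 / p.α)) ‖x‖)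
      = ENNReal.ofReal (Real.pi * (l + ‖y‖) ^ 2 * p.δ (s * Q / (l + ‖y‖) ^ p.α)
        + p.Z s Q 0 Real.pi (farDist l ‖y‖) (fun _ => l + ‖y‖)) := by
  have hα := p.two_lt_α
  rw [lintegral_compl_ball y hl.le measurable_kern.ennreal_ofReal, Z_eq p hsQ, mul_assoc,
    p.sq_mul_δ hsQ (add_pos_of_pos_of_nonneg hl (norm_nonneg y))]
  set T := (s * Q) ^ (2 / p.α) with hTdef
  have hT : 0 < T := by positivity
  set r := ‖y‖ with hrdef
  have hr : 0 ≤ r := norm_nonneg y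
  set K := ∫ u in Set.Ioi ((l + r) ^ 2 / T), 1 / (1 + u ^ (p.α / 2)) with hK
  have hK0 : 0 ≤ K := integral_kernel_tail_nonneg _ (by positivity)
  let H : ℝ → ℝ := fun θ => kernelPrim p.α ((l + r) ^ 2 / T) - kernelPrim p.α (farDist l r θ ^ 2 / T)
  have hHc : Continuous H := continuous_const.sub
    ((continuous_kernelPrim hα).comp (((farDist_continuous l r).pow 2).div_const T))
  have hH0 : ∀ θ, 0 ≤ H θ := fun θ => sub_nonneg.2 (kernelPrim_mono hα (by
    have h1 := farDist_le (θ := θ) hr hl.le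
    have h2 := farDist_nonneg_of_le (θ := θ) hr hy
    gcongr))
  have h1 : ∀ θ, ∫⁻ ρ in Set.Ioi 0 ∩ {ρ | l ^ 2 ≤ ρ ^ 2 - 2 * ρ * r * Real.cos θ + r ^ 2},
      ENNReal.ofReal ρ * ENNReal.ofReal (kern p.α T ρ) = ENNReal.ofReal (T / 2 * (H θ + K)) := by
    intro θ
    have hf := farDist_nonneg_of_le (θ := θ) hr hy
    have hset : (Set.Ioi 0 ∩ {ρ | l ^ 2 ≤ ρ ^ 2 - 2 * ρ * r * Real.cos θ + r ^ 2} : Set ℝ)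
        =ᵐ[volume] Set.Ioi (farDist l r θ) := by
      have e : (Set.Ioi 0 ∩ {ρ | l ^ 2 ≤ ρ ^ 2 - 2 * ρ * r * Real.cos θ + r ^ 2} : Set ℝ)
          = Set.Ioi 0 ∩ Set.Ici (farDist l r θ) := by
        ext ρ
        exact and_congr_right fun hρ => outside_iff_of_le hr hy hρ
      rw [e, ← Set.inter_eq_right.2 (Set.Ioi_subset_Ioi hf)]
      exact (ae_eq_refl _).inter Ioi_ae_eq_Ici.symm
    rw [setLIntegral_congr hset, lintegral_mul_kern_Ioi hα hT hf,
      integral_kernel_tail p.α hα (b := (l + r) ^ 2 / T) (by positivity) (by positivity)]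
  simp_rw [h1]
  rw [lintegral_Ioo_ofReal (by fun_prop) Real.pi_pos.le (fun θ _ => by
      have := hH0 θ; positivity),
    show (2 : ℝ≥0∞) = ENNReal.ofReal 2 by norm_num, ← ENNReal.ofReal_mul (by norm_num)]
  congr 1
  rw [intervalIntegral.integral_const_mul, intervalIntegral.integral_add
    (hHc.intervalIntegrable _ _) (continuous_const.intervalIntegrable _ _),
    intervalIntegral.integral_const, smul_eq_mul]
  ring

/-- The origin lies outside the disc. Rays below the tangent angle contribute a segment up to
`nearDist` and a half-line from `farDist`; the remaining rays contribute entirely. With every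
half-line cut at `l + ‖y‖`, these are the three `Z` terms and the common tail. -/
lemma lintegral_kern_compl_ball_of_lt {s Q l : ℝ} (hsQ : 0 < s * Q) (hl : 0 < l) {y : Plane}
    (hy : l < ‖y‖) :
    ∫⁻ x in (Metric.ball y l)ᶜ, ENNReal.ofReal (kern p.α ((s * Q) ^ (2 / p.α)) ‖x‖)
      = ENNReal.ofReal (Real.pi * (l + ‖y‖) ^ 2 * p.δ (s * Q / (l + ‖y‖) ^ p.α)
        + (p.Z s Q 0 (Real.arcsin (l / ‖y‖)) (fun _ => 0) (nearDist l ‖y‖)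
          + p.Z s Q 0 (Real.arcsin (l / ‖y‖)) (farDist l ‖y‖) (fun _ => l + ‖y‖)
          + p.Z s Q (Real.arcsin (l / ‖y‖)) Real.pi (fun _ => 0) (fun _ => l + ‖y‖))) := by
  have hα := p.two_lt_α
  rw [lintegral_compl_ball y hl.le measurable_kern.ennreal_ofReal, Z_eq p hsQ, Z_eq p hsQ, Z_eq p hsQ, mul_assoc,
    p.sq_mul_δ hsQ (add_pos_of_pos_of_nonneg hl (norm_nonneg y))]
  set T := (s * Q) ^ (2 / p.α) with hTdef
  have hT : 0 < T := by positivity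
  set r := ‖y‖ with hrdef
  have hr : 0 < r := hl.trans hy
  set Θ' := Real.arcsin (l / r) with hΘ
  have hΘ0 : 0 ≤ Θ' := Real.arcsin_nonneg.2 (by positivity)
  have hΘπ : Θ' < Real.pi := by linarith [Real.arcsin_le_pi_div_two (l / r), Real.pi_pos]
  set K := ∫ u in Set.Ioi ((l + r) ^ 2 / T), 1 / (1 + u ^ (p.α / 2)) with hK
  have hK0 : 0 ≤ K := integral_kernel_tail_nonneg _ (by positivity)
  let H₁ : ℝ → ℝ := fun θ => kernelPrim p.α (nearDist l r θ ^ 2 / T) - kernelPrim p.α (0 ^ 2 / T)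
  let H₂ : ℝ → ℝ := fun θ => kernelPrim p.α ((l + r) ^ 2 / T) - kernelPrim p.α (farDist l r θ ^ 2 / T)
  let H₃ : ℝ → ℝ := fun _ => kernelPrim p.α ((l + r) ^ 2 / T) - kernelPrim p.α (0 ^ 2 / T)
  have hH₁c : Continuous H₁ :=
    ((continuous_kernelPrim hα).comp (((nearDist_continuous l r).pow 2).div_const T)).sub
      continuous_const
  have hH₂c : Continuous H₂ := continuous_const.sub
    ((continuous_kernelPrim hα).comp (((farDist_continuous l r).pow 2).div_const T))
  have hH₃c : Continuous H₃ := continuous_const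
  have hH₁0 : ∀ θ, 0 ≤ H₁ θ := fun θ => sub_nonneg.2 (kernelPrim_mono hα (by
    rw [zero_pow two_ne_zero, zero_div]; positivity))
  have hH₃0 : ∀ θ, 0 ≤ H₃ θ := fun θ => sub_nonneg.2 (kernelPrim_mono hα (by
    rw [zero_pow two_ne_zero, zero_div]; positivity))
  have hH₂0 : ∀ θ ∈ Set.Ioo 0 Θ', 0 ≤ H₂ θ := fun θ hθ => sub_nonneg.2 (kernelPrim_mono hα (by
    have h1 := farDist_le (θ := θ) hr.le hl.le
    obtain ⟨h2, h3, -⟩ := nearDist_farDist hl hy hθ.1 hθ.2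
    have := h2.trans h3
    gcongr))
  have h1 : ∀ θ ∈ Set.Ioo 0 Θ',
      ∫⁻ ρ in Set.Ioi 0 ∩ {ρ | l ^ 2 ≤ ρ ^ 2 - 2 * ρ * r * Real.cos θ + r ^ 2},
      ENNReal.ofReal ρ * ENNReal.ofReal (kern p.α T ρ)
        = ENNReal.ofReal (T / 2 * (H₁ θ + (H₂ θ + K))) := by
    intro θ hθ
    obtain ⟨hn0, hnf, hiff⟩ := nearDist_farDist hl hy hθ.1 hθ.2
    have e : (Set.Ioi 0 ∩ {ρ | l ^ 2 ≤ ρ ^ 2 - 2 * ρ * r * Real.cos θ + r ^ 2} : Set ℝ)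
        =ᵐ[volume] (Set.Ioo 0 (nearDist l r θ) ∪ Set.Ioi (farDist l r θ) : Set ℝ) := by
      have e : (Set.Ioi 0 ∩ {ρ | l ^ 2 ≤ ρ ^ 2 - 2 * ρ * r * Real.cos θ + r ^ 2} : Set ℝ)
          = Set.Ioc 0 (nearDist l r θ) ∪ (Set.Ioi 0 ∩ Set.Ici (farDist l r θ)) := by
        ext ρ
        simp only [Set.mem_inter_iff, Set.mem_Ioi, Set.mem_ofPred_eq, hiff, Set.mem_union,
          Set.mem_Ioc, Set.mem_Ici]
        tauto
      rw [e, ← Set.inter_eq_right.2 (Set.Ioi_subset_Ioi (hn0.trans hnf))]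
      exact Ioo_ae_eq_Ioc.symm.union ((ae_eq_refl _).inter Ioi_ae_eq_Ici.symm)
    rw [setLIntegral_congr e, lintegral_union measurableSet_Ioi (by
        rw [Set.disjoint_left]
        exact fun x hx hx' => absurd (hx.2.trans_le hnf) (not_lt.2 (le_of_lt hx'))),
      lintegral_mul_kern_Ioo hα hT le_rfl hn0, lintegral_mul_kern_Ioi hα hT (hn0.trans hnf),
      integral_kernel_tail p.α hα (b := (l + r) ^ 2 / T) (by positivity) (by positivity),
      ← ENNReal.ofReal_add, ← mul_add]
    · exact mul_nonneg (by positivity) (hH₁0 θ)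
    · exact mul_nonneg (by positivity) (add_nonneg (hH₂0 θ hθ) hK0)
  have h2 : ∀ θ ∈ Set.Ico Θ' Real.pi,
      ∫⁻ ρ in Set.Ioi 0 ∩ {ρ | l ^ 2 ≤ ρ ^ 2 - 2 * ρ * r * Real.cos θ + r ^ 2},
      ENNReal.ofReal ρ * ENNReal.ofReal (kern p.α T ρ)
        = ENNReal.ofReal (T / 2 * (H₃ θ + K)) := by
    intro θ hθ
    have e : (Set.Ioi 0 ∩ {ρ | l ^ 2 ≤ ρ ^ 2 - 2 * ρ * r * Real.cos θ + r ^ 2} : Set ℝ)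
        = Set.Ioi 0 :=
      Set.inter_eq_left.2 fun ρ hρ => outside_of_arcsin_le hl hy hθ.1 hθ.2.le hρ
    rw [e, lintegral_mul_kern_Ioi hα hT le_rfl,
      integral_kernel_tail p.α hα (b := (l + r) ^ 2 / T) (by positivity) (by positivity)]
  have hsplit : Set.Ioo 0 Real.pi =ᵐ[volume] (Set.Ioo 0 Θ' ∪ Set.Ico Θ' Real.pi : Set ℝ) := by
    rcases hΘ0.eq_or_lt with h | h
    · rw [← h, Set.Ioo_self, Set.empty_union]; exact Ioo_ae_eq_Ico
    · rw [Set.Ioo_union_Ico_eq_Ioo h hΘπ.le]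
      exact EventuallyEq.rfl
  rw [setLIntegral_congr hsplit, lintegral_union measurableSet_Ico (by
      rw [Set.disjoint_left]
      exact fun x hx hx' => absurd hx.2 (not_lt.2 hx'.1)),
    setLIntegral_congr_fun measurableSet_Ioo h1, setLIntegral_congr_fun measurableSet_Ico h2,
    setLIntegral_congr Ioo_ae_eq_Ico.symm,
    lintegral_Ioo_ofReal (by fun_prop) hΘ0 (fun θ hθ => by
      have := hH₁0 θ; have := hH₂0 θ hθ; positivity),
    lintegral_Ioo_ofReal (by fun_prop) hΘπ.le (fun θ _ => by have := hH₃0 θ; positivity),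
    show (2 : ℝ≥0∞) = ENNReal.ofReal 2 by norm_num, ← ENNReal.ofReal_add,
    ← ENNReal.ofReal_mul (by norm_num)]
  · congr 1
    have hi : IntervalIntegrable (fun θ => H₂ θ + K) volume 0 Θ' :=
      (hH₂c.add continuous_const).intervalIntegrable _ _
    have hc : ∀ a b : ℝ, ∫ _ in a..b, K = (b - a) * K := fun a b => by
      rw [intervalIntegral.integral_const, smul_eq_mul]
    change _ = Real.pi * (T * K) + (T * (∫ θ in (0 : ℝ)..Θ', H₁ θ) + T * (∫ θ in (0 : ℝ)..Θ', H₂ θ)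
      + T * ∫ θ in Θ'..Real.pi, H₃ θ)
    clear_value H₁ H₂ H₃
    rw [intervalIntegral.integral_const_mul, intervalIntegral.integral_const_mul,
      intervalIntegral.integral_add (hH₁c.intervalIntegrable _ _) hi,
      intervalIntegral.integral_add (hH₂c.intervalIntegrable _ _)
        (continuous_const.intervalIntegrable _ _),
      intervalIntegral.integral_add (hH₃c.intervalIntegrable _ _)
        (continuous_const.intervalIntegrable _ _),
      hc, hc]
    ring
  · rw [intervalIntegral.integral_of_le hΘ0, integral_Ioc_eq_integral_Ioo]
    exact setIntegral_nonneg measurableSet_Ioo fun θ hθ => by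
      have := hH₁0 θ; have := hH₂0 θ hθ; positivity
  · exact intervalIntegral.integral_nonneg hΘπ.le fun θ _ => by have := hH₃0 θ; positivity

end Params

/-! ## Association by biased received power -/

section Serving

variable {J : Type} [Fintype J]

/-- Together with `eexp_famSum_eq_zero`: when `f` takes the values `0` and `∞` only, the exponential
is the indicator that no point lies where `f` is infinite. Void events thereby become Laplace
functionals. -/
lemma eexp_famSum_eq_one (c : J → Config) {f : J → Plane → ℝ≥0∞}
    (h : ∀ j n, (c j n).1 = true → f j (c j n).2 = 0) : eexp (famSum c f) = 1 := by
  have : famSum c f = 0 := by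
    refine Finset.sum_eq_zero fun j _ => ?_
    refine ENNReal.tsum_eq_zero.2 fun n => ?_
    split_ifs with hn
    · exact h j n hn
    · rfl
  rw [this, eexp_zero]

lemma eexp_famSum_eq_zero (c : J → Config) {f : J → Plane → ℝ≥0∞} (j : J) (n : ℕ)
    (hn : (c j n).1 = true) (hf : f j (c j n).2 = ∞) : eexp (famSum c f) = 0 := by
  rw [famSum_eq_add_erase c j n hn, hf, top_add, eexp_top]

lemma famErase_apply_of_ne (c : J → Config) {j j' : J} {n n' : ℕ} (h : (j', n') ≠ (j, n)) :
    famErase c j n j' n' = c j' n' := by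
  classical
  unfold famErase
  by_cases hj : j' = j
  · subst hj
    have : n' ≠ n := fun hn => h (by rw [hn])
    simp [Config.erase, this]
  · simp [hj]

lemma famErase_apply_self (c : J → Config) (j : J) (n : ℕ) : (famErase c j n j n).1 = false := by
  classical
  simp [famErase, Config.erase]

lemma famErase_present {c : J → Config} {j j' : J} {n n' : ℕ}
    (h : (famErase c j n j' n').1 = true) :
    (j', n') ≠ (j, n) ∧ (c j' n').1 = true ∧ famErase c j n j' n' = c j' n' := by
  have hne : (j', n') ≠ (j, n) := by
    rintro heq
    obtain ⟨rfl, rfl⟩ := Prod.mk.inj heq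
    rw [famErase_apply_self] at h
    exact absurd h (by simp)
  have he := famErase_apply_of_ne c hne
  exact ⟨hne, by rw [← he]; exact h, he⟩

/-- Serving rule data: the tier of each field (if it consists of base stations), the bias weights
of the tiers, the path loss exponent and the tier under consideration. -/
structure ServeRule (J : Type) where
  α : ℝ
  two_lt : 2 < α
  tier : J → Option Tier
  w : Tier → ℝ
  w_pos : ∀ k, 0 < w k
  i : Tier

namespace ServeRule

variable (M : ServeRule J)

/-- A station of tier `k` loses against one of tier `i` iff it is `ratio k` times as far. -/
noncomputable def ratio (k : Tier) : ℝ := (M.w k / M.w M.i) ^ (1 / M.α)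

lemma α_pos : 0 < M.α := by linarith [M.two_lt]

lemma ratio_pos (k : Tier) : 0 < M.ratio k :=
  Real.rpow_pos_of_pos (div_pos (M.w_pos _) (M.w_pos _)) _

@[simp] lemma ratio_self : M.ratio M.i = 1 := by
  rw [ratio, div_self (M.w_pos _).ne', Real.one_rpow]

lemma ratio_rpow (k : Tier) : M.ratio k ^ M.α = M.w k / M.w M.i := by
  rw [ratio, ← Real.rpow_mul (div_pos (M.w_pos _) (M.w_pos _)).le, one_div_mul_cancel M.α_pos.ne',
    Real.rpow_one]

lemma ratio_sq (k : Tier) : M.ratio k ^ 2 = (M.w k / M.w M.i) ^ (2 / M.α) := by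
  rw [ratio, ← Real.rpow_natCast, ← Real.rpow_mul (div_pos (M.w_pos _) (M.w_pos _)).le]
  congr 1
  push_cast
  ring

/-- The origin must be excluded: there `‖x‖ ^ (-α)` evaluates to `0`, so a station at the user would
count as the weakest one. -/
lemma lt_iff {k : Tier} {x y : Plane} (hx : x ≠ 0) (hy : y ≠ 0) :
    M.w k * ‖x‖ ^ (-M.α) < M.w M.i * ‖y‖ ^ (-M.α) ↔ M.ratio k * ‖y‖ < ‖x‖ := by
  have hx' : 0 < ‖x‖ := norm_pos_iff.2 hx
  have hy' : 0 < ‖y‖ := norm_pos_iff.2 hy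
  have hwi := M.w_pos M.i
  rw [← Real.rpow_lt_rpow_iff (mul_nonneg (M.ratio_pos k).le hy'.le) hx'.le M.α_pos,
    Real.mul_rpow (M.ratio_pos k).le hy'.le, M.ratio_rpow, Real.rpow_neg hx'.le,
    Real.rpow_neg hy'.le]
  have h1 : 0 < ‖x‖ ^ M.α := by positivity
  have h2 : 0 < ‖y‖ ^ M.α := by positivity
  rw [← div_eq_mul_inv, ← div_eq_mul_inv, div_lt_div_iff₀ h1 h2, div_mul_eq_mul_div,
    div_lt_iff₀ hwi, mul_comm (‖x‖ ^ M.α)]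

lemma le_iff {k : Tier} {x y : Plane} (hx : x ≠ 0) (hy : y ≠ 0) :
    M.w k * ‖x‖ ^ (-M.α) ≤ M.w M.i * ‖y‖ ^ (-M.α) ↔ M.ratio k * ‖y‖ ≤ ‖x‖ := by
  have hx' : 0 < ‖x‖ := norm_pos_iff.2 hx
  have hy' : 0 < ‖y‖ := norm_pos_iff.2 hy
  have hwi := M.w_pos M.i
  rw [← Real.rpow_le_rpow_iff (mul_nonneg (M.ratio_pos k).le hy'.le) hx'.le M.α_pos,
    Real.mul_rpow (M.ratio_pos k).le hy'.le, M.ratio_rpow, Real.rpow_neg hx'.le,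
    Real.rpow_neg hy'.le]
  have h1 : 0 < ‖x‖ ^ M.α := by positivity
  have h2 : 0 < ‖y‖ ^ M.α := by positivity
  rw [← div_eq_mul_inv, ← div_eq_mul_inv, div_le_div_iff₀ h1 h2, div_mul_eq_mul_div,
    div_le_iff₀ hwi, mul_comm (‖x‖ ^ M.α)]

/-- The base stations of tier `k`. -/
def stations (k : Tier) (c : J → Config) : Set Plane :=
  {y | ∃ j, M.tier j = some k ∧ y ∈ (c j).points}

/-- The station at `y` of tier `i` offers the largest biased received power. -/
def Serves (y : Plane) (c : J → Config) : Prop :=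
  y ∈ M.stations M.i c ∧ ∀ k, ∀ x ∈ M.stations k c,
    M.w k * ‖x‖ ^ (-M.α) ≤ M.w M.i * ‖y‖ ^ (-M.α)

/-! ### Discs that must be free of competing stations. -/

open Classical in
/-- Infinite at the places from which a station beats or ties with a station at distance `r`. -/
noncomputable def blockS (r : ℝ) (j : J) (x : Plane) : ℝ≥0∞ :=
  if ∃ k, M.tier j = some k ∧ ‖x‖ ≤ M.ratio k * r then ∞ else 0

open Classical in
/-- Infinite at the places from which a station beats a station at distance `r`. -/
noncomputable def blockW (r : ℝ) (j : J) (x : Plane) : ℝ≥0∞ :=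
  if ∃ k, M.tier j = some k ∧ ‖x‖ < M.ratio k * r then ∞ else 0

lemma measurableSet_blockS (r : ℝ) (j : J) :
    MeasurableSet {x : Plane | ∃ k, M.tier j = some k ∧ ‖x‖ ≤ M.ratio k * r} := by
  rcases h : M.tier j with _ | k
  · simp
  · have : {x : Plane | ∃ k', some k = some k' ∧ ‖x‖ ≤ M.ratio k' * r}
        = Metric.closedBall 0 (M.ratio k * r) := by ext x; simp
    rw [this]; exact Metric.isClosed_closedBall.measurableSet

lemma measurableSet_blockW (r : ℝ) (j : J) :
    MeasurableSet {x : Plane | ∃ k, M.tier j = some k ∧ ‖x‖ < M.ratio k * r} := by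
  rcases h : M.tier j with _ | k
  · simp
  · have : {x : Plane | ∃ k', some k = some k' ∧ ‖x‖ < M.ratio k' * r}
        = Metric.ball 0 (M.ratio k * r) := by ext x; simp
    rw [this]; exact Metric.isOpen_ball.measurableSet

lemma measurable_blockS (r : ℝ) (j : J) : Measurable (M.blockS r j) :=
  Measurable.ite (M.measurableSet_blockS r j) measurable_const measurable_const

lemma measurable_blockW (r : ℝ) (j : J) : Measurable (M.blockW r j) :=
  Measurable.ite (M.measurableSet_blockW r j) measurable_const measurable_const

lemma blockS_mono (j : J) (x : Plane) (r s : ℝ) (hrs : r ≤ s) : M.blockS r j x ≤ M.blockS s j x := by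
  unfold blockS
  split_ifs with h1 h2
  · exact le_rfl
  · obtain ⟨k, hk, hx⟩ := h1
    exact absurd ⟨k, hk, hx.trans (by have := (M.ratio_pos k).le; gcongr)⟩ h2
  · exact zero_le
  · exact le_rfl

lemma blockW_mono (j : J) (x : Plane) (r s : ℝ) (hrs : r ≤ s) : M.blockW r j x ≤ M.blockW s j x := by
  unfold blockW
  split_ifs with h1 h2
  · exact le_rfl
  · obtain ⟨k, hk, hx⟩ := h1
    exact absurd ⟨k, hk, hx.trans_le (by have := (M.ratio_pos k).le; gcongr)⟩ h2
  · exact zero_le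
  · exact le_rfl

lemma blockW_le_blockS (r : ℝ) (j : J) (x : Plane) : M.blockW r j x ≤ M.blockS r j x := by
  unfold blockW blockS
  split_ifs with h1 h2
  · exact le_rfl
  · obtain ⟨k, hk, hx⟩ := h1
    exact absurd ⟨k, hk, hx.le⟩ h2
  · exact zero_le
  · exact le_rfl

/-- The contribution of a field to the exponent of the void probability. -/
noncomputable def voidCoef (j : J) : ℝ := (M.tier j).elim 0 fun k => Real.pi * M.ratio k ^ 2

lemma voidCoef_nonneg (j : J) : 0 ≤ M.voidCoef j := by
  unfold voidCoef
  rcases M.tier j with _ | k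
  · exact le_rfl
  · simp only [Option.elim_some]; positivity

lemma lintegral_blockS {r : ℝ} (hr : 0 ≤ r) (j : J) :
    ∫⁻ x, (1 - eexp (M.blockS r j x)) = ENNReal.ofReal (M.voidCoef j * r ^ 2) := by
  have h1 : ∀ x, 1 - eexp (M.blockS r j x)
      = {x : Plane | ∃ k, M.tier j = some k ∧ ‖x‖ ≤ M.ratio k * r}.indicator 1 x := by
    intro x
    unfold blockS
    by_cases h : ∃ k, M.tier j = some k ∧ ‖x‖ ≤ M.ratio k * r
    · simp only [if_pos h, Set.indicator, Set.mem_ofPred_eq]; simp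
    · simp only [if_neg h, Set.indicator, Set.mem_ofPred_eq]; simp
  simp_rw [h1]
  rw [lintegral_indicator_one (M.measurableSet_blockS r j)]
  unfold voidCoef
  rcases h : M.tier j with _ | k
  · simp
  · have : {x : Plane | ∃ k', some k = some k' ∧ ‖x‖ ≤ M.ratio k' * r}
        = Metric.closedBall 0 (M.ratio k * r) := by ext x; simp
    rw [this, EuclideanSpace.volume_closedBall_fin_two, ← ENNReal.ofReal_pow
      (mul_nonneg (M.ratio_pos k).le hr),
      ← ENNReal.ofReal_mul (by positivity)]
    congr 1
    simp only [Option.elim_some]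
    ring

/-- Open and closed discs have the same area. The agreement with `lintegral_blockS` is what rules
out ties. -/
lemma lintegral_blockW {r : ℝ} (hr : 0 ≤ r) (j : J) :
    ∫⁻ x, (1 - eexp (M.blockW r j x)) = ENNReal.ofReal (M.voidCoef j * r ^ 2) := by
  have h1 : ∀ x, 1 - eexp (M.blockW r j x)
      = {x : Plane | ∃ k, M.tier j = some k ∧ ‖x‖ < M.ratio k * r}.indicator 1 x := by
    intro x
    unfold blockW
    by_cases h : ∃ k, M.tier j = some k ∧ ‖x‖ < M.ratio k * r
    · simp only [if_pos h, Set.indicator, Set.mem_ofPred_eq]; simp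
    · simp only [if_neg h, Set.indicator, Set.mem_ofPred_eq]; simp
  simp_rw [h1]
  rw [lintegral_indicator_one (M.measurableSet_blockW r j)]
  unfold voidCoef
  rcases h : M.tier j with _ | k
  · simp
  · have : {x : Plane | ∃ k', some k = some k' ∧ ‖x‖ < M.ratio k' * r}
        = Metric.ball 0 (M.ratio k * r) := by ext x; simp
    rw [this, EuclideanSpace.volume_ball_fin_two, ← ENNReal.ofReal_pow
      (mul_nonneg (M.ratio_pos k).le hr),
      ← ENNReal.ofReal_mul (by positivity)]
    congr 1
    simp only [Option.elim_some]
    ring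

/-- The event that the `n`-th point of field `j` is strictly the best, as a function. -/
noncomputable def bestS (c : J → Config) (j : J) (n : ℕ) : ℝ≥0∞ :=
  eexp (famSum (famErase c j n) (M.blockS ‖(c j n).2‖))

lemma bestS_eq_one_iff (c : J → Config) (j : J) (n : ℕ) :
    M.bestS c j n = 1 ↔ ∀ j' n', (j', n') ≠ (j, n) → (c j' n').1 = true →
      ∀ k, M.tier j' = some k → M.ratio k * ‖(c j n).2‖ < ‖(c j' n').2‖ := by
  unfold bestS
  constructor
  · intro h j' n' hne hp k hk
    by_contra hlt
    rw [not_lt] at hlt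
    have he := famErase_apply_of_ne c hne
    rw [eexp_famSum_eq_zero _ j' n' (by rw [he]; exact hp)
      (by rw [he]; exact if_pos ⟨k, hk, hlt⟩)] at h
    exact zero_ne_one h
  · intro h
    refine eexp_famSum_eq_one _ fun j' n' hp => ?_
    obtain ⟨hne, hp', he⟩ := famErase_present hp
    rw [he]
    refine if_neg ?_
    rintro ⟨k, hk, hle⟩
    exact absurd (h j' n' hne hp' k hk) (not_lt.2 hle)

lemma bestS_eq_zero_or_one (c : J → Config) (j : J) (n : ℕ) :
    M.bestS c j n = 0 ∨ M.bestS c j n = 1 := by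
  by_cases h : M.bestS c j n = 1
  · exact Or.inr h
  · left
    rw [bestS_eq_one_iff] at h
    push Not at h
    obtain ⟨j', n', hne, hp, k, hk, hle⟩ := h
    have he := famErase_apply_of_ne c hne
    exact eexp_famSum_eq_zero _ j' n' (by rw [he]; exact hp)
      (by rw [he]; exact if_pos ⟨k, hk, hle⟩)

/-- No base station sits at the origin, and there are no ties. -/
structure Generic (c : J → Config) : Prop where
  ne_zero : ∀ j n, (c j n).1 = true → (c j n).2 ≠ 0
  best : ∀ j n, M.tier j = some M.i → (c j n).1 = true →
    eexp (famSum (famErase c j n) (M.blockW ‖(c j n).2‖)) = M.bestS c j n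

variable {M}

/-- `Serves` tolerates ties, so by itself it only empties the open discs; genericity replaces them
by the closed ones. -/
lemma Generic.exists_best {c : J → Config} (hc : M.Generic c) {y : Plane} (h : M.Serves y c) :
    ∃ j n, M.tier j = some M.i ∧ (c j n).1 = true ∧ (c j n).2 = y ∧ M.bestS c j n = 1 := by
  obtain ⟨⟨j, hj, n, hn, rfl⟩, hmax⟩ := h
  refine ⟨j, n, hj, hn, rfl, ?_⟩
  rw [← hc.best j n hj hn]
  refine eexp_famSum_eq_one _ fun j' n' hp => ?_
  obtain ⟨hne, hp', he⟩ := famErase_present hp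
  rw [he]
  refine if_neg ?_
  rintro ⟨k, hk, hlt⟩
  have := hmax k _ ⟨j', hk, n', hp', rfl⟩
  rw [M.le_iff (hc.ne_zero j' n' hp') (hc.ne_zero j n hn)] at this
  exact absurd hlt (not_lt.2 this)

lemma Generic.serves {c : J → Config} (hc : M.Generic c) {j : J} {n : ℕ}
    (hj : M.tier j = some M.i) (hn : (c j n).1 = true) (h : M.bestS c j n = 1) :
    M.Serves (c j n).2 c := by
  refine ⟨⟨j, hj, n, hn, rfl⟩, ?_⟩
  rintro k x ⟨j', hk, n', hp, rfl⟩
  by_cases hne : (j', n') = (j, n)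
  · obtain ⟨rfl, rfl⟩ := Prod.mk.inj hne
    have : k = M.i := by rw [hj] at hk; exact (Option.some.inj hk).symm
    rw [this]
  · rw [M.le_iff (hc.ne_zero j' n' hp) (hc.ne_zero j n hn)]
    exact ((M.bestS_eq_one_iff c j n).1 h j' n' hne hp k hk).le

/-- Strictness towards the other tier; it prevents a user from being associated with both tiers. -/
lemma Generic.lt_of_serves {c : J → Config} (hc : M.Generic c) {y : Plane} (h : M.Serves y c)
    {k : Tier} (hk : k ≠ M.i) {x : Plane} (hx : x ∈ M.stations k c) :
    M.w k * ‖x‖ ^ (-M.α) < M.w M.i * ‖y‖ ^ (-M.α) := by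
  obtain ⟨j, n, hj, hn, rfl, hb⟩ := hc.exists_best h
  obtain ⟨j', hk', n', hp, rfl⟩ := hx
  have hne : (j', n') ≠ (j, n) := by
    rintro heq
    obtain ⟨rfl, rfl⟩ := Prod.mk.inj heq
    rw [hj] at hk'
    exact hk (Option.some.inj hk').symm
  rw [M.lt_iff (hc.ne_zero j' n' hp) (hc.ne_zero j n hn)]
  exact (M.bestS_eq_one_iff c j n).1 hb j' n' hne hp k hk'

lemma bestS_unique {c : J → Config} {j j' : J} {n n' : ℕ} (hj : M.tier j = some M.i)
    (hj' : M.tier j' = some M.i) (hn : (c j n).1 = true) (hn' : (c j' n').1 = true)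
    (h : M.bestS c j n = 1) (h' : M.bestS c j' n' = 1) : (j', n') = (j, n) := by
  by_contra hne
  have h1 := (M.bestS_eq_one_iff c j n).1 h j' n' hne hn' _ hj'
  have h2 := (M.bestS_eq_one_iff c j' n').1 h' j n (Ne.symm hne) hn _ hj
  rw [M.ratio_self, one_mul] at h1 h2
  exact lt_asymm h1 h2

-- A strictly best point of the serving tier is unique, so the double sum has at most one nonzero
-- term. The sum over points is the form to which the Mecke formula applies.
open Classical in
lemma Generic.indicator_eq {c : J → Config} (hc : M.Generic c) (R : Plane → Prop) :
    (if ∃ y, M.Serves y c ∧ R y then (1 : ℝ≥0∞) else 0)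
      = ∑ j, if M.tier j = some M.i then ∑' n, (if (c j n).1 = true then
          M.bestS c j n * (if R (c j n).2 then 1 else 0) else 0) else 0 := by
  split_ifs with h
  · obtain ⟨y, hy, hR⟩ := h
    obtain ⟨j, n, hj, hn, rfl, hb⟩ := hc.exists_best hy
    rw [Finset.sum_eq_single j, if_pos hj, tsum_eq_single n, if_pos hn, hb, if_pos hR, one_mul]
    · intro n' hne
      split_ifs with hn' hR'
      · rcases M.bestS_eq_zero_or_one c j n' with h0 | h1
        · rw [h0, zero_mul]
        · have := bestS_unique hj hj hn hn' hb h1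
          exact absurd (Prod.mk.inj this).2 hne
      · rw [mul_zero]
      · rfl
    · intro j' _ hne
      split_ifs with hj'
      · refine ENNReal.tsum_eq_zero.2 fun n' => ?_
        split_ifs with hn' hR'
        · rcases M.bestS_eq_zero_or_one c j' n' with h0 | h1
          · rw [h0, zero_mul]
          · have := bestS_unique hj hj' hn hn' hb h1
            exact absurd (Prod.mk.inj this).1 hne
        · rw [mul_zero]
        · rfl
      · rfl
    · simp
  · symm
    refine Finset.sum_eq_zero fun j _ => ?_
    split_ifs with hj
    · refine ENNReal.tsum_eq_zero.2 fun n => ?_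
      split_ifs with hn hR
      · rcases M.bestS_eq_zero_or_one c j n with h0 | h1
        · rw [h0, zero_mul]
        · exact absurd ⟨_, hc.serves hj hn h1, hR⟩ h
      · rw [mul_zero]
      · rfl
    · rfl

variable {Ω : Type*} [MeasurableSpace Ω] {Pr : Measure Ω} [IsProbabilityMeasure Pr]
  {d : J → ℝ} {Φ : J → Ω → Config}

/-- The mean number of points at `z` is the density times the area of `{z}`, by the Mecke formula
with zero exponents. -/
lemma _root_.HCN.IsPoissonFamily.ae_ne (H : IsPoissonFamily Pr d Φ) (z : Plane) :
    ∀ᵐ ω ∂Pr, ∀ j n, (Φ j ω n).1 = true → (Φ j ω n).2 ≠ z := by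
  rw [ae_all_iff]
  intro j
  have h := H.mecke_of_ne_top (f := fun _ _ => 0) (fun _ => measurable_const) j (by simp)
    (w := ({z} : Set Plane).indicator 1) (measurable_one.indicator (measurableSet_singleton z))
  rw [lintegral_indicator_one (measurableSet_singleton z), measure_singleton, mul_zero,
    zero_mul] at h
  simp only [famSum, Config.sum_zero, Finset.sum_const_zero, eexp_zero, mul_one] at h
  change ∫⁻ ω, (Φ j ω).sum (({z} : Set Plane).indicator 1) ∂Pr = _ at h
  rw [lintegral_eq_zero_iff (f := fun ω => (Φ j ω).sum (({z} : Set Plane).indicator 1))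
    ((Config.measurable_sum
    (measurable_one.indicator (measurableSet_singleton z))).comp (H.poisson j).measurable)] at h
  filter_upwards [h] with ω hω n hn heq
  have := ENNReal.tsum_eq_zero.1 hω n
  rw [if_pos hn, heq] at this
  simp at this

variable (M)

/-- The exponent of the probability that a disc of radius one is void. -/
noncomputable def voidExp (d : J → ℝ) : ℝ := ∑ j, d j * M.voidCoef j

lemma voidExp_pos (hd : ∀ j, 0 ≤ d j) {j : J} (hj : M.tier j = some M.i) (hdj : d j ≠ 0) :
    0 < M.voidExp d := by
  refine Finset.sum_pos' (fun j _ => mul_nonneg (hd j) (M.voidCoef_nonneg j))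
    ⟨j, Finset.mem_univ j, ?_⟩
  have : 0 < d j := lt_of_le_of_ne (hd j) (Ne.symm hdj)
  have h2 : M.voidCoef j = Real.pi := by simp [voidCoef, hj]
  rw [h2]; positivity

lemma laplaceExponent_of_sq (hd : ∀ j, 0 ≤ d j) {f : J → Plane → ℝ≥0∞} {C : J → ℝ} {r : ℝ}
    (hC : ∀ j, 0 ≤ C j) (hf : ∀ j, ∫⁻ x, (1 - eexp (f j x)) = ENNReal.ofReal (C j * r ^ 2)) :
    laplaceExponent d f = ENNReal.ofReal ((∑ j, d j * C j) * r ^ 2) := by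
  unfold laplaceExponent
  rw [Finset.sum_mul, ENNReal.ofReal_sum_of_nonneg]
  · refine Finset.sum_congr rfl fun j _ => ?_
    rw [hf j, ← ENNReal.ofReal_mul (hd j), mul_assoc]
  · intro j _
    have := hd j; have := hC j; positivity

lemma lintegral_bestS (H : IsPoissonFamily Pr d Φ) {j : J} (hj : M.tier j = some M.i) :
    ∫⁻ ω, ∑' n, (if (Φ j ω n).1 = true then M.bestS (fun j => Φ j ω) j n else 0) ∂Pr
      = ENNReal.ofReal (d j) * ∫⁻ x : Plane, eexp (ENNReal.ofReal (M.voidExp d * ‖x‖ ^ 2)) := by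
  have h := H.mecke_radial M.measurable_blockS (fun j x r s _ hrs => M.blockS_mono j x r s hrs) j
    (fun hdj => M.voidExp_pos H.nonneg hj hdj)
    (fun r hr => laplaceExponent_of_sq H.nonneg M.voidCoef_nonneg fun j => M.lintegral_blockS hr j)
    (g := fun _ => 1) measurable_const (fun _ => le_rfl)
  simp only [one_mul] at h
  exact h

lemma lintegral_bestW (H : IsPoissonFamily Pr d Φ) {j : J} (hj : M.tier j = some M.i) :
    ∫⁻ ω, ∑' n, (if (Φ j ω n).1 = true then
        eexp (famSum (famErase (fun j => Φ j ω) j n) (M.blockW ‖(Φ j ω n).2‖)) else 0) ∂Pr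
      = ENNReal.ofReal (d j) * ∫⁻ x : Plane, eexp (ENNReal.ofReal (M.voidExp d * ‖x‖ ^ 2)) := by
  have h := H.mecke_radial M.measurable_blockW (fun j x r s _ hrs => M.blockW_mono j x r s hrs) j
    (fun hdj => M.voidExp_pos H.nonneg hj hdj)
    (fun r hr => laplaceExponent_of_sq H.nonneg M.voidCoef_nonneg fun j => M.lintegral_blockW hr j)
    (g := fun _ => 1) measurable_const (fun _ => le_rfl)
  simp only [one_mul] at h
  exact h

lemma lintegral_eexp_voidExp (H : IsPoissonFamily Pr d Φ) {j : J} (hj : M.tier j = some M.i) :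
    ENNReal.ofReal (d j) * ∫⁻ x : Plane, eexp (ENNReal.ofReal (M.voidExp d * ‖x‖ ^ 2))
      = ENNReal.ofReal (d j * (Real.pi / M.voidExp d)) := by
  by_cases hdj : d j = 0
  · simp [hdj]
  · rw [lintegral_eexp_mul_norm_sq (M.voidExp_pos H.nonneg hj hdj), ENNReal.ofReal_mul (H.nonneg j)]

lemma measurable_block_param {b : ℝ → J → Plane → ℝ≥0∞}
    (hb : ∀ j, Measurable (Function.uncurry fun r => b r j)) (j : J) (n : ℕ) :
    Measurable fun c : J → Config => eexp (famSum (famErase c j n) (b ‖(c j n).2‖)) := by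
  refine measurable_eexp.comp (measurable_famSum_param (measurable_famErase j n) fun j' => ?_)
  exact (hb j').comp (((by fun_prop : Measurable fun c : J → Config => ‖(c j n).2‖).comp
    measurable_fst).prodMk measurable_snd)

lemma measurable_uncurry_blockS (j : J) : Measurable (Function.uncurry fun r => M.blockS r j) := by
  unfold blockS
  refine Measurable.ite ?_ measurable_const measurable_const
  rcases h : M.tier j with _ | k
  · simp
  · have : {z : ℝ × Plane | ∃ k', some k = some k' ∧ ‖z.2‖ ≤ M.ratio k' * z.1}
        = {z : ℝ × Plane | ‖z.2‖ ≤ M.ratio k * z.1} := by ext x; simp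
    rw [this]; exact measurableSet_le (by fun_prop) (by fun_prop)

lemma measurable_uncurry_blockW (j : J) : Measurable (Function.uncurry fun r => M.blockW r j) := by
  unfold blockW
  refine Measurable.ite ?_ measurable_const measurable_const
  rcases h : M.tier j with _ | k
  · simp
  · have : {z : ℝ × Plane | ∃ k', some k = some k' ∧ ‖z.2‖ < M.ratio k' * z.1}
        = {z : ℝ × Plane | ‖z.2‖ < M.ratio k * z.1} := by ext x; simp
    rw [this]; exact measurableSet_lt (by fun_prop) (by fun_prop)

lemma measurable_bestS (j : J) (n : ℕ) : Measurable fun c : J → Config => M.bestS c j n :=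
  measurable_block_param M.measurable_uncurry_blockS j n

/-- The sum of the strict indicators is at most that of the weak ones, and both have the same finite
expectation. Hence the sums agree almost surely, and since they are finite, so do their terms. -/
lemma ae_generic (H : IsPoissonFamily Pr d Φ) : ∀ᵐ ω ∂Pr, M.Generic fun j => Φ j ω := by
  have hbest : ∀ j, ∀ᵐ ω ∂Pr, M.tier j = some M.i → ∀ n, (Φ j ω n).1 = true →
      eexp (famSum (famErase (fun j => Φ j ω) j n) (M.blockW ‖(Φ j ω n).2‖))
        = M.bestS (fun j => Φ j ω) j n := by
    intro j
    by_cases hj : M.tier j = some M.i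
    · have hle : ∀ ω n, (if (Φ j ω n).1 = true then M.bestS (fun j => Φ j ω) j n else 0)
          ≤ (if (Φ j ω n).1 = true then
            eexp (famSum (famErase (fun j => Φ j ω) j n) (M.blockW ‖(Φ j ω n).2‖)) else 0) := by
        intro ω n
        split_ifs
        · exact antitone_eexp (famSum_mono _ fun j x => M.blockW_le_blockS _ j x)
        · exact le_rfl
      have hfin := M.lintegral_bestS H hj
      rw [M.lintegral_eexp_voidExp H hj] at hfin
      have hmeas : ∀ n, Measurable fun ω => (if (Φ j ω n).1 = true then
          eexp (famSum (famErase (fun j => Φ j ω) j n) (M.blockW ‖(Φ j ω n).2‖)) else 0) := fun n =>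
        Measurable.ite ((Config.measurableSet_present n).preimage (H.poisson j).measurable)
          ((measurable_block_param M.measurable_uncurry_blockW j n).comp H.measurable)
          measurable_const
      have hmeasS : ∀ n, Measurable fun ω => (if (Φ j ω n).1 = true then
          M.bestS (fun j => Φ j ω) j n else 0) := fun n =>
        Measurable.ite ((Config.measurableSet_present n).preimage (H.poisson j).measurable)
          ((M.measurable_bestS j n).comp H.measurable)
          measurable_const
      have hfin' : ∫⁻ ω, ∑' n, (if (Φ j ω n).1 = true then M.bestS (fun j => Φ j ω) j n else 0) ∂Pr
          ≠ ∞ := by rw [hfin]; exact ENNReal.ofReal_ne_top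
      have hae := ae_eq_of_ae_le_of_lintegral_le
        (ae_of_all _ fun ω => ENNReal.tsum_le_tsum (hle ω)) hfin'
        (Measurable.tsum hmeas).aemeasurable
        (by rw [M.lintegral_bestW H hj, M.lintegral_bestS H hj])
      filter_upwards [hae, ae_lt_top (Measurable.tsum hmeasS) hfin'] with ω h1 h2 _ n hn
      by_contra hne
      have hlt := lt_of_le_of_ne (hle ω n) (by rw [if_pos hn, if_pos hn]; exact Ne.symm hne)
      exact absurd h1 (ENNReal.tsum_lt_tsum h2.ne (hle ω) hlt).ne
    · exact ae_of_all _ fun ω h => absurd h hj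
  filter_upwards [H.ae_ne 0, ae_all_iff.2 hbest] with ω h1 h2
  exact ⟨h1, fun j n hj hn => h2 j hj n hn⟩

open Classical in
/-- The probability that a station of tier `i` serves the user and has a further property. -/
lemma measure_serves (H : IsPoissonFamily Pr d Φ) (R : Plane → Ω → Prop)
    (hR : ∀ j n, M.tier j = some M.i → NullMeasurableSet {ω | R (Φ j ω n).2 ω} Pr) :
    NullMeasurableSet {ω | ∃ y, M.Serves y (fun j => Φ j ω) ∧ R y ω} Pr ∧
    Pr {ω | ∃ y, M.Serves y (fun j => Φ j ω) ∧ R y ω}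
      = ∑ j, if M.tier j = some M.i then ∫⁻ ω, ∑' n, (if (Φ j ω n).1 = true then
          M.bestS (fun j => Φ j ω) j n * (if R (Φ j ω n).2 ω then 1 else 0) else 0) ∂Pr else 0 := by
  have hmeas : ∀ j, M.tier j = some M.i → AEMeasurable (fun ω => ∑' n, (if (Φ j ω n).1 = true then
          M.bestS (fun j => Φ j ω) j n * (if R (Φ j ω n).2 ω then 1 else 0) else 0)) Pr := by
    intro j hj
    refine AEMeasurable.tsum fun n => ?_
    have hp : MeasurableSet {ω | (Φ j ω n).1 = true} :=
      (Config.measurableSet_present n).preimage (H.poisson j).measurable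
    have h1 : AEMeasurable (fun ω => M.bestS (fun j => Φ j ω) j n *
        (if R (Φ j ω n).2 ω then (1 : ℝ≥0∞) else 0)) Pr := by
      refine ((M.measurable_bestS j n).comp H.measurable).aemeasurable.mul ?_
      exact (aemeasurable_indicator_const_iff (1 : ℝ≥0∞)).2 (hR j n hj)
    exact (h1.indicator hp).congr (ae_of_all _ fun ω => by
      simp only [Set.indicator, Set.mem_ofPred_eq])
  have hae : (fun ω => if ∃ y, M.Serves y (fun j => Φ j ω) ∧ R y ω then (1 : ℝ≥0∞) else 0)
      =ᵐ[Pr] fun ω => ∑ j, if M.tier j = some M.i then ∑' n, (if (Φ j ω n).1 = true then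
          M.bestS (fun j => Φ j ω) j n * (if R (Φ j ω n).2 ω then 1 else 0) else 0) else 0 := by
    filter_upwards [M.ae_generic H] with ω hω
    exact hω.indicator_eq fun y => R y ω
  have hmeas' : ∀ j ∈ Finset.univ, AEMeasurable (fun ω => if M.tier j = some M.i then
      ∑' n, (if (Φ j ω n).1 = true then
          M.bestS (fun j => Φ j ω) j n * (if R (Φ j ω n).2 ω then 1 else 0) else 0) else 0) Pr := by
    intro j _
    by_cases hj : M.tier j = some M.i
    · simpa only [hj, if_true] using hmeas j hj
    · simp [hj]
  have hnull : NullMeasurableSet {ω | ∃ y, M.Serves y (fun j => Φ j ω) ∧ R y ω} Pr := by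
    refine (aemeasurable_indicator_const_iff (1 : ℝ≥0∞)).1 ?_
    exact (Finset.aemeasurable_fun_sum _ hmeas').congr hae.symm
  refine ⟨hnull, ?_⟩
  rw [← lintegral_indicator_one₀ hnull]
  refine (lintegral_congr_ae hae).trans ?_
  rw [lintegral_finsetSum' _ hmeas']
  refine Finset.sum_congr rfl fun j _ => ?_
  split_ifs <;> simp

open Classical in
/-- The association probability. -/
lemma measure_associated (H : IsPoissonFamily Pr d Φ) :
    Pr {ω | ∃ y, M.Serves y (fun j => Φ j ω)}
      = ENNReal.ofReal ((∑ j, if M.tier j = some M.i then d j else 0) * (Real.pi / M.voidExp d)) := by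
  have h := (M.measure_serves H (fun _ _ => True) (fun j n _ => by simp)).2
  simp only [and_true, if_true, mul_one] at h
  rw [h, Finset.sum_mul, ENNReal.ofReal_sum_of_nonneg]
  · refine Finset.sum_congr rfl fun j _ => ?_
    split_ifs with hj
    · rw [M.lintegral_bestS H hj, M.lintegral_eexp_voidExp H hj]
    · simp
  · intro j _
    have h0 : 0 ≤ M.voidExp d := Finset.sum_nonneg fun j _ =>
      mul_nonneg (H.nonneg j) (M.voidCoef_nonneg j)
    have := H.nonneg j
    split_ifs <;> positivity

end ServeRule

end Serving

/-! ## Coverage of a cellular link -/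

section Cellular

variable {J : Type} [Fintype J]

section Split

variable {Ω : Type*} [MeasurableSpace Ω] {Pr : Measure Ω} [IsProbabilityMeasure Pr]
  {d : J → ℝ} {Φ : J → Ω → Config}

open Classical in
/-- The configurations of the fields in `S`, the others being emptied. -/
noncomputable def restrictFields (S : Set J) (c : J → Config) : J → Config :=
  fun j => if j ∈ S then c j else fun _ => (false, 0)

lemma measurable_restrictFields (S : Set J) : Measurable (restrictFields S) := by
  refine measurable_pi_lambda _ fun j => ?_
  unfold restrictFields
  by_cases h : j ∈ S
  · simp only [h, if_true]; fun_prop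
  · simp only [h, if_false]; fun_prop

lemma restrictFields_of_mem {S : Set J} {j : J} (h : j ∈ S) (c : J → Config) :
    restrictFields S c j = c j := if_pos h

/-- Fields are emptied rather than dropped, so that both halves keep the index type `J` and
functionals of the whole family apply to them. -/
lemma IsPoissonFamily.indepFun_restrictFields (H : IsPoissonFamily Pr d Φ) (S : Set J) :
    IndepFun (fun ω => restrictFields S fun j => Φ j ω)
      (fun ω => restrictFields Sᶜ fun j => Φ j ω) Pr := by
  classical
  let F : Set J → Finset J := fun T => Finset.univ.filter (· ∈ T)
  have h := H.indep.indepFun_finset (F S) (F Sᶜ)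
    (by
      refine Finset.disjoint_left.2 fun j h1 h2 => ?_
      simp only [F, Finset.mem_filter] at h1 h2
      exact h2.2 h1.2) fun j => (H.poisson j).measurable
  have key : ∀ T : Set J, ∃ φ : (F T → Config) → J → Config, Measurable φ ∧
      (fun ω => restrictFields T fun j => Φ j ω)
        = φ ∘ fun ω (j : F T) => Φ j ω := by
    intro T
    refine ⟨fun c j => if h : j ∈ T then c ⟨j, by simpa [F] using h⟩ else fun _ => (false, 0), ?_, ?_⟩
    · refine measurable_pi_lambda _ fun j => ?_
      by_cases h : j ∈ T
      · simp only [h, dif_pos]; exact measurable_pi_apply _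
      · simp only [h, dif_neg, not_false_eq_true]; exact measurable_const
    · ext1 ω
      funext j
      by_cases h : j ∈ T <;> simp [restrictFields, h]
  obtain ⟨φ, hφ, e1⟩ := key S
  obtain ⟨ψ, hψ, e2⟩ := key Sᶜ
  rw [e1, e2]
  exact IndepFun.comp (φ := φ) (ψ := ψ) h hφ hψ

/-- Averaging over the fields outside `S` when weight and exponent depend on the fields in `S`. -/
lemma IsPoissonFamily.lintegral_mul_eexp_famSum (H : IsPoissonFamily Pr d Φ) (S : Set J)
    {B : (J → Config) → ℝ≥0∞} (hB : Measurable B) (hBS : ∀ c, B (restrictFields S c) = B c)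
    {ℓ : (J → Config) → J → Plane → ℝ≥0∞} (hℓ : ∀ j, Measurable (Function.uncurry fun c => ℓ c j))
    (hℓS : ∀ c, ℓ (restrictFields S c) = ℓ c) (hℓ0 : ∀ c, ∀ j ∈ S, ∀ x, ℓ c j x = 0) :
    ∫⁻ ω, B (fun j => Φ j ω) * eexp (famSum (fun j => Φ j ω) (ℓ fun j => Φ j ω)) ∂Pr
      = ∫⁻ ω, B (fun j => Φ j ω) * eexp (laplaceExponent d (ℓ fun j => Φ j ω)) ∂Pr := by
  have hsum : ∀ c c', famSum (restrictFields Sᶜ c') (ℓ c) = famSum c' (ℓ c) := by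
    intro c c'
    refine Finset.sum_congr rfl fun j _ => ?_
    by_cases hj : j ∈ S
    · have : ℓ c j = fun _ => 0 := funext (hℓ0 c j hj)
      rw [this, Config.sum_zero, Config.sum_zero]
    · rw [restrictFields_of_mem (by exact hj)]
  have hF : Measurable (Function.uncurry fun (c c' : J → Config) => B c * eexp (famSum c' (ℓ c))) := by
    have h1 : Measurable fun z : (J → Config) × (J → Config) => famSum z.2 (ℓ z.1) :=
      measurable_famSum_param measurable_snd fun j =>
        (hℓ j).comp ((measurable_fst.comp measurable_fst).prodMk measurable_snd)
    simp only [Function.uncurry_def]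
    fun_prop
  have h := lintegral_of_indepFun
    ((measurable_restrictFields S).comp H.measurable).aemeasurable
    ((measurable_restrictFields Sᶜ).comp H.measurable).aemeasurable
    (H.indepFun_restrictFields S) hF
  simp only [hBS, hℓS, hsum, Function.comp_apply] at h
  rw [h]
  refine lintegral_congr fun ω => ?_
  have hm : ∀ j, Measurable (ℓ (fun j => Φ j ω) j) := fun j => (hℓ j).comp measurable_prodMk_left
  rw [lintegral_const_mul (f := fun ω' => eexp (famSum (fun j => Φ j ω') (ℓ fun j => Φ j ω))) _
      (measurable_eexp.comp ((measurable_famSum hm).comp H.measurable)),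
    H.laplace hm]

end Split

/-! ### A common model of downlink and uplink. -/

/-- A user or base station at `rx y` receives a signal of power `P` over a link of length `‖y‖`,
where `y` is the serving station; the points of field `j` outside `Ex j y` interfere. -/
structure CellModel (J : Type) extends ServeRule J where
  γ : ℝ
  γ_pos : 0 < γ
  P : ℝ
  P_pos : 0 < P
  pw : J → ℝ
  pw_nonneg : ∀ j, 0 ≤ pw j
  Ex : J → Plane → Set Plane
  measurableSet_Ex : ∀ j, MeasurableSet {z : Plane × Plane | z.2 ∈ Ex j z.1}
  rx : Plane → Plane
  measurable_rx : Measurable rx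
  -- A field of stations is silent, or it transmits with the power of the signal, belongs to the
  -- serving tier, exempts exactly the server and is received at the origin. In the second case its
  -- interference is radial, as `mecke_radial` requires.
  station : ∀ j, tier j ≠ none → pw j = 0 ∨
    (pw j = P ∧ tier j = some i ∧ (∀ y, Ex j y = {y}) ∧ ∀ y, rx y = 0)

namespace CellModel

variable (M : CellModel J)

/-- The exponents of the interferers, for the serving station at `y`. -/
noncomputable def loss (y : Plane) : J → Plane → ℝ≥0∞ :=
  fadingLoss M.α (M.γ * ‖y‖ ^ M.α / M.P) M.pw (fun j => M.Ex j y) (M.rx y)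

open Classical in
/-- The part of the exponents that is due to fields other than those of the stations. -/
noncomputable def outerLoss (y : Plane) (j : J) (x : Plane) : ℝ≥0∞ :=
  if M.tier j = none then M.loss y j x else 0

open Classical in
/-- The part of the exponents that is due to stations. -/
noncomputable def stationLoss (y : Plane) (j : J) (x : Plane) : ℝ≥0∞ :=
  if M.tier j = none then 0 else M.loss y j x

open Classical in
/-- The exponent of the stations, infinite where no station may be. -/
noncomputable def radialLoss (r : ℝ) (j : J) (x : Plane) : ℝ≥0∞ :=
  M.blockS r j x + if M.tier j = none ∨ M.pw j = 0 then 0 else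
    ENNReal.ofReal (Real.log (1 + M.γ * r ^ M.α * ‖x‖ ^ (-M.α)))

lemma measurable_loss (j : J) : Measurable (Function.uncurry fun y => M.loss y j) := by
  refine measurable_fadingLoss_param (Ex := fun y j => M.Ex j y) ?_ (fun j => M.measurableSet_Ex j)
    M.measurable_rx j
  fun_prop

lemma measurable_outerLoss (j : J) : Measurable (Function.uncurry fun y => M.outerLoss y j) := by
  unfold outerLoss
  by_cases h : M.tier j = none
  · simp only [h, if_true]; exact M.measurable_loss j
  · simp only [h, if_false]; exact measurable_const

lemma measurable_stationLoss (j : J) : Measurable (Function.uncurry fun y => M.stationLoss y j) := by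
  unfold stationLoss
  by_cases h : M.tier j = none
  · simp only [h, if_true]; exact measurable_const
  · simp only [h, if_false]; exact M.measurable_loss j

lemma measurable_radialLoss (r : ℝ) (j : J) : Measurable (M.radialLoss r j) := by
  unfold radialLoss
  refine (M.measurable_blockS r j).add ?_
  split_ifs
  · exact measurable_const
  · fun_prop

lemma radialLoss_mono (j : J) (x : Plane) (r s : ℝ) (hr : 0 ≤ r) (hrs : r ≤ s) :
    M.radialLoss r j x ≤ M.radialLoss s j x := by
  unfold radialLoss
  refine add_le_add (M.blockS_mono j x r s hrs) ?_
  split_ifs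
  · exact le_rfl
  · have := M.γ_pos
    have := M.α_pos
    refine ENNReal.ofReal_le_ofReal (Real.log_le_log (by positivity) ?_)
    gcongr

lemma famSum_loss (y : Plane) (c : J → Config) :
    famSum c (M.loss y) = famSum c (M.outerLoss y) + famSum c (M.stationLoss y) := by
  unfold famSum
  rw [← Finset.sum_add_distrib]
  refine Finset.sum_congr rfl fun j _ => ?_
  by_cases h : M.tier j = none
  · have h1 : M.outerLoss y j = M.loss y j := funext fun x => if_pos h
    have h2 : M.stationLoss y j = fun _ => 0 := funext fun x => if_pos h
    rw [h1, h2, Config.sum_zero, add_zero]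
  · have h1 : M.outerLoss y j = fun _ => 0 := funext fun x => if_neg h
    have h2 : M.stationLoss y j = M.loss y j := funext fun x => if_neg h
    rw [h1, h2, Config.sum_zero, zero_add]

lemma loss_eq_zero_of_pw (y : Plane) {j : J} (h : M.pw j = 0) (x : Plane) : M.loss y j x = 0 := by
  simp [loss, fadingLoss, h]

lemma stationLoss_self (y : Plane) (j : J) : M.stationLoss y j y = 0 := by
  unfold stationLoss
  split_ifs with h
  · rfl
  · rcases M.station j h with h0 | ⟨-, -, hE, -⟩
    · exact M.loss_eq_zero_of_pw y h0 y
    · simp [loss, fadingLoss, hE]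

/-- For a transmitting field, the loss exempts the point `y` while the radial loss does not. The
difference is invisible because `y` lies in its own closed blocking disc, where both sides are
infinite. -/
lemma blockS_add_stationLoss (y : Plane) (j : J) (x : Plane) :
    M.blockS ‖y‖ j x + M.stationLoss y j x = M.radialLoss ‖y‖ j x := by
  unfold radialLoss stationLoss
  by_cases h : M.tier j = none
  · simp [h]
  rcases M.station j h with h0 | ⟨hP, hi, hE, hrx⟩
  · simp [h0, M.loss_eq_zero_of_pw y h0 x]
  · have hP0 := M.P_pos
    rw [if_neg h, if_neg (by rw [hP]; simp [h, hP0.ne'])]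
    by_cases hxy : x = y
    · have : M.blockS ‖y‖ j x = ∞ := if_pos ⟨M.i, hi, by rw [hxy, M.ratio_self, one_mul]⟩
      rw [this, top_add, top_add]
    · unfold loss fadingLoss
      rw [if_neg (by simp only [hE]; exact hxy), hrx, sub_zero, hP, div_mul_cancel₀ _ hP0.ne']

/-- Being the best station and surviving the interference of the other stations merge into one
exponential functional of the remaining points, which sees the server only through its distance. -/
lemma bestS_mul_eexp_stationLoss (c : J → Config) (j : J) (n : ℕ) (hn : (c j n).1 = true) :
    M.bestS c j n * eexp (famSum c (M.stationLoss (c j n).2))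
      = eexp (famSum (famErase c j n) (M.radialLoss ‖(c j n).2‖)) := by
  rw [famSum_eq_add_erase c j n hn, M.stationLoss_self, zero_add, ServeRule.bestS, ← eexp_add]
  congr 1
  unfold famSum
  rw [← Finset.sum_add_distrib]
  refine Finset.sum_congr rfl fun j' _ => ?_
  rw [← Config.sum_add]
  congr 1
  funext x
  exact M.blockS_add_stationLoss _ _ _

/-- The exponent of the interferers other than stations, for the serving station at `y`. -/
noncomputable def outer (d : J → ℝ) (y : Plane) : ℝ≥0∞ := laplaceExponent d (M.outerLoss y)

lemma measurable_outer (d : J → ℝ) : Measurable (M.outer d) := by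
  unfold outer laplaceExponent
  refine Finset.measurable_sum _ fun j _ => Measurable.const_mul ?_ _
  exact Measurable.lintegral_prod_right'
    (f := fun z : Plane × Plane => 1 - eexp (M.outerLoss z.1 j z.2))
    (measurable_const.sub (measurable_eexp.comp (M.measurable_outerLoss j)))

variable {Ω : Type*} [MeasurableSpace Ω] {Pr : Measure Ω} [IsProbabilityMeasure Pr]
  {d : J → ℝ} {Φ : J → Ω → Config} {h : J → ℕ → Ω → ℝ} {h₀ : Ω → ℝ}

/-- The SIR of the link. -/
noncomputable def sir (Φ : J → Ω → Config) (h : J → ℕ → Ω → ℝ) (h₀ : Ω → ℝ) (y : Plane) (ω : Ω) :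
    ℝ≥0∞ :=
  ENNReal.ofReal (M.P * h₀ ω * ‖y‖ ^ (-M.α)) /
    famInterf M.α M.pw (fun j => M.Ex j y) (M.rx y) (fun j => Φ j ω) (fun j n => h j n ω)

open Classical in
/-- The indicator of the event that the `n`-th point of field `j` is strictly the best station. -/
noncomputable def weight (j : J) (n : ℕ) (c : J → Config) : ℝ≥0∞ :=
  if (c j n).1 = true then (if (c j n).2 = 0 then 0 else M.bestS c j n) else 0

lemma measurable_weight (j : J) (n : ℕ) : Measurable (M.weight j n) := by
  have h2 : Measurable fun c : J → Config => (c j n).2 := by fun_prop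
  refine Measurable.ite ((Config.measurableSet_present n).preimage (measurable_pi_apply j)) ?_
    measurable_const
  exact Measurable.ite ((measurableSet_singleton (0 : Plane)).preimage h2) measurable_const
    (M.measurable_bestS j n)

lemma weight_eq {c : J → Config} {j : J} {n : ℕ} (hn : (c j n).1 = true) (h0 : (c j n).2 ≠ 0) :
    M.weight j n c = M.bestS c j n := by
  rw [weight, if_pos hn, if_neg h0]

lemma weight_of_absent {c : J → Config} {j : J} {n : ℕ} (hn : ¬ (c j n).1 = true) :
    M.weight j n c = 0 := if_neg hn

/-- The weight leaves out a server at the origin, since the mean link power evaluates to zero there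
and `lintegral_mul_sir` requires it to be positive. -/
lemma ne_zero_of_weight {c : J → Config} {j : J} {n : ℕ} (h : M.weight j n c ≠ 0) :
    (c j n).2 ≠ 0 := fun h0 => h (by simp [weight, h0])

/-- Only stations block, so the choice of the server is a function of the station fields. This is
what allows the other fields to be averaged separately. -/
lemma bestS_restrictFields (c : J → Config) (j : J) (n : ℕ) (hj : M.tier j = some M.i) :
    M.bestS (restrictFields {j | M.tier j ≠ none} c) j n = M.bestS c j n := by
  have hS : j ∈ {j | M.tier j ≠ none} := by simp [hj]
  have e : restrictFields {j | M.tier j ≠ none} c j = c j := restrictFields_of_mem hS c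
  unfold ServeRule.bestS
  rw [e]
  congr 1
  refine Finset.sum_congr rfl fun j' _ => ?_
  by_cases h : M.tier j' = none
  · have : M.blockS ‖(c j n).2‖ j' = fun _ => 0 := by
      funext x
      exact if_neg (by simp [h])
    rw [this, Config.sum_zero, Config.sum_zero]
  · have hS' : j' ∈ {j | M.tier j ≠ none} := h
    congr 1
    unfold famErase
    by_cases hjj : j' = j
    · subst hjj
      simp [e]
    · simp [hjj, restrictFields_of_mem hS' c]

lemma famSum_stationLoss_restrictFields (y : Plane) (c : J → Config) :
    famSum (restrictFields {j | M.tier j ≠ none} c) (M.stationLoss y) = famSum c (M.stationLoss y) := by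
  refine Finset.sum_congr rfl fun j _ => ?_
  by_cases h : M.tier j = none
  · have : M.stationLoss y j = fun _ => 0 := funext fun x => if_pos h
    rw [this, Config.sum_zero, Config.sum_zero]
  · rw [restrictFields_of_mem (by exact h)]

lemma lintegral_weight_sir (H : IsRayleighField Pr d Φ h)
    (hlaw : HasLaw h₀ (expMeasure 1) Pr)
    (hind : IndepFun h₀ (fun ω => (fun j => Φ j ω, fun j n => h j n ω)) Pr) (j : J) (n : ℕ) :
    ∫⁻ ω, M.weight j n (fun j => Φ j ω) *
        {ω | ENNReal.ofReal M.γ < M.sir Φ h h₀ (Φ j ω n).2 ω}.indicator 1 ω ∂Pr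
      = ∫⁻ ω, M.weight j n (fun j => Φ j ω) *
        eexp (famSum (fun j => Φ j ω) (M.loss (Φ j ω n).2)) ∂Pr := by
  have hy : Measurable fun c : J → Config => (c j n).2 := by fun_prop
  have hP := M.P_pos
  have h1 := H.lintegral_mul_sir hlaw hind (α := M.α) M.γ_pos M.pw_nonneg (M.measurable_weight j n)
    (q := fun c => M.P * ‖(c j n).2‖ ^ (-M.α)) (by fun_prop) (fun c => by positivity)
    (fun c hc => by have := norm_pos_iff.2 (M.ne_zero_of_weight hc); positivity)
    (Ex := fun c j' => M.Ex j' (c j n).2) (fun j' => (M.measurableSet_Ex j').preimage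
      ((hy.comp measurable_fst).prodMk measurable_snd)) (y := fun c => M.rx (c j n).2)
    (M.measurable_rx.comp hy)
  refine Eq.trans (lintegral_congr fun ω => ?_) (h1.trans (lintegral_congr fun ω => ?_))
  · simp only [sir, mul_right_comm M.P (h₀ _)]
  · by_cases hz : M.weight j n (fun j => Φ j ω) = 0
    · rw [hz, zero_mul, zero_mul]
    · have hp : 0 < ‖(Φ j ω n).2‖ :=
        norm_pos_iff.2 (M.ne_zero_of_weight (c := fun j => Φ j ω) hz)
      have : M.γ / (M.P * ‖(Φ j ω n).2‖ ^ (-M.α)) = M.γ * ‖(Φ j ω n).2‖ ^ M.α / M.P := by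
        rw [Real.rpow_neg hp.le]
        field_simp
      rw [this]
      rfl

lemma measurable_famSum_stationLoss (j : J) (n : ℕ) :
    Measurable fun c : J → Config => famSum c (M.stationLoss (c j n).2) := by
  refine measurable_famSum_param (c := fun c => c) (f := fun c => M.stationLoss (c j n).2)
      measurable_id fun j' => ?_
  have hy : Measurable fun z : (J → Config) × Plane => ((z.1 j n).2, z.2) := by fun_prop
  simpa only [Function.comp_def, Function.uncurry_def] using (M.measurable_stationLoss j').comp hy

lemma measurable_outerLoss_point (j : J) (n : ℕ) (j' : J) :
    Measurable (Function.uncurry fun (c : J → Config) => M.outerLoss (c j n).2 j') := by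
  have hy : Measurable fun z : (J → Config) × Plane => ((z.1 j n).2, z.2) := by fun_prop
  simpa only [Function.comp_def, Function.uncurry_def] using (M.measurable_outerLoss j').comp hy

lemma measurable_weight_mul (j : J) (n : ℕ) : Measurable fun c : J → Config =>
    M.weight j n c * eexp (famSum c (M.stationLoss (c j n).2)) :=
  (M.measurable_weight j n).mul (measurable_eexp.comp (M.measurable_famSum_stationLoss j n))

/-- The excluded regions of the other fields and the receiver may depend on the server in a
non-radial way. Those fields are independent of the stations, so they are integrated out with the
server frozen and leave the deterministic factor `eexp (outer d y)`. -/
lemma lintegral_weight_loss (H : IsPoissonFamily Pr d Φ) {j : J} (hj : M.tier j = some M.i)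
    (n : ℕ) :
    ∫⁻ ω, M.weight j n (fun j => Φ j ω) *
        eexp (famSum (fun j => Φ j ω) (M.loss (Φ j ω n).2)) ∂Pr
      = ∫⁻ ω, M.weight j n (fun j => Φ j ω) *
        eexp (famSum (fun j => Φ j ω) (M.stationLoss (Φ j ω n).2)) *
          eexp (M.outer d (Φ j ω n).2) ∂Pr := by
  have hS : j ∈ {j | M.tier j ≠ none} := by simp [hj]
  have hW : ∀ c, M.weight j n (restrictFields {j | M.tier j ≠ none} c) = M.weight j n c := by
    intro c
    simp only [weight, restrictFields_of_mem hS, M.bestS_restrictFields c j n hj]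
  have h2 := H.lintegral_mul_eexp_famSum {j | M.tier j ≠ none} (M.measurable_weight_mul j n)
    (fun c => by rw [hW, restrictFields_of_mem hS, M.famSum_stationLoss_restrictFields])
    (M.measurable_outerLoss_point j n)
    (fun c => by rw [restrictFields_of_mem hS]) (fun c j' hj' x => if_neg hj')
  refine Eq.trans (lintegral_congr fun ω => ?_) h2
  rw [M.famSum_loss, add_comm, eexp_add, mul_assoc]

open Classical in
lemma lintegral_best_sir (H : IsRayleighField Pr d Φ h) (hd : ∀ j, 0 ≤ d j)
    (hlaw : HasLaw h₀ (expMeasure 1) Pr)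
    (hind : IndepFun h₀ (fun ω => (fun j => Φ j ω, fun j n => h j n ω)) Pr) {j : J}
    (hj : M.tier j = some M.i) (n : ℕ) :
    ∫⁻ ω, (if (Φ j ω n).1 = true then M.bestS (fun j => Φ j ω) j n *
        (if ENNReal.ofReal M.γ < M.sir Φ h h₀ (Φ j ω n).2 ω then 1 else 0) else 0) ∂Pr
      = ∫⁻ ω, (if (Φ j ω n).1 = true then eexp (M.outer d (Φ j ω n).2) *
        eexp (famSum (famErase (fun j => Φ j ω) j n) (M.radialLoss ‖(Φ j ω n).2‖)) else 0) ∂Pr := by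
  have hF := H.family hd
  have hgen := hF.ae_ne 0
  refine Eq.trans (lintegral_congr_ae ?_) ((M.lintegral_weight_sir H hlaw hind j n).trans
    ((M.lintegral_weight_loss hF hj n).trans (lintegral_congr_ae ?_)))
  · filter_upwards [hgen] with ω hω
    by_cases hn : (Φ j ω n).1 = true
    · rw [if_pos hn, M.weight_eq (c := fun j => Φ j ω) hn (hω j n hn)]
      congr 1
      simp only [Set.indicator, Set.mem_ofPred_eq, Pi.one_apply]
    · rw [if_neg hn, M.weight_of_absent (c := fun j => Φ j ω) hn, zero_mul]
  · filter_upwards [hgen] with ω hω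
    by_cases hn : (Φ j ω n).1 = true
    · rw [if_pos hn, M.weight_eq (c := fun j => Φ j ω) hn (hω j n hn),
        M.bestS_mul_eexp_stationLoss (fun j => Φ j ω) j n hn, mul_comm]
    · rw [if_neg hn, M.weight_of_absent (c := fun j => Φ j ω) hn, zero_mul, zero_mul]

open Classical in
/-- The contribution of a field of stations to the quadratic exponent, if `κ` is that of an active
field. -/
noncomputable def coef (κ : ℝ) (j : J) : ℝ :=
  M.voidCoef j + if M.tier j = none ∨ M.pw j = 0 then 0 else κ

lemma coef_nonneg {κ : ℝ} (hκ : 0 ≤ κ) (j : J) : 0 ≤ M.coef κ j := by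
  unfold coef
  have := M.voidCoef_nonneg j
  split_ifs <;> positivity

/-- The quadratic exponent of the stations. -/
noncomputable def covExp (d : J → ℝ) (κ : ℝ) : ℝ := ∑ j, d j * M.coef κ j

lemma covExp_pos (hd : ∀ j, 0 ≤ d j) {κ : ℝ} (hκ : 0 ≤ κ) {j : J} (hj : M.tier j = some M.i)
    (hdj : d j ≠ 0) : 0 < M.covExp d κ := by
  refine (M.voidExp_pos hd hj hdj).trans_le (Finset.sum_le_sum fun j _ => ?_)
  refine mul_le_mul_of_nonneg_left ?_ (hd j)
  unfold coef
  split_ifs <;> linarith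

/-- For a transmitting field the blocking disc has radius exactly `r`. On it `1 - e^(-·)` is one and
gives the void coefficient; outside it only the fading loss remains, which by `hint` contributes `κ
r²`. Other fields only block. -/
lemma lintegral_radialLoss {κ : ℝ} (hκ : 0 ≤ κ) (hint : ∀ r, 0 ≤ r →
      ∫⁻ x in {x : Plane | r < ‖x‖},
        (1 - eexp (ENNReal.ofReal (Real.log (1 + M.γ * r ^ M.α * ‖x‖ ^ (-M.α)))))
      = ENNReal.ofReal (κ * r ^ 2)) {r : ℝ} (hr : 0 ≤ r) (j : J) :
    ∫⁻ x, (1 - eexp (M.radialLoss r j x)) = ENNReal.ofReal (M.coef κ j * r ^ 2) := by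
  unfold coef
  by_cases h : M.tier j = none ∨ M.pw j = 0
  · have e : M.radialLoss r j = M.blockS r j := by
      funext x; simp [radialLoss, h]
    rw [e, if_pos h, add_zero, M.lintegral_blockS hr]
  · rw [if_neg h, add_mul, ENNReal.ofReal_add (mul_nonneg (M.voidCoef_nonneg j) (sq_nonneg _))
      (by positivity), ← M.lintegral_blockS hr, ← hint r hr]
    push Not at h
    rcases M.station j h.1 with h0 | ⟨hP, hi, -, -⟩
    · exact absurd h0 h.2
    have hmeas : MeasurableSet {x : Plane | r < ‖x‖} := measurableSet_lt measurable_const (by fun_prop)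
    rw [← lintegral_indicator hmeas, ← lintegral_add_left (f := fun x => 1 - eexp (M.blockS r j x))
      (measurable_const.sub (measurable_eexp.comp (M.measurable_blockS r j)))]
    refine lintegral_congr fun x => ?_
    unfold radialLoss ServeRule.blockS
    rw [if_neg (show ¬ (M.tier j = none ∨ M.pw j = 0) by push Not; exact h)]
    rcases lt_or_ge r ‖x‖ with hx | hx
    · rw [if_neg, Set.indicator_of_mem (show x ∈ {x : Plane | r < ‖x‖} from hx)]
      · simp
      · rintro ⟨k, hk, hle⟩
        rw [hi] at hk
        rw [← Option.some.inj hk, M.ratio_self, one_mul] at hle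
        exact absurd hx (not_lt.2 hle)
    · rw [if_pos ⟨M.i, hi, by rw [M.ratio_self, one_mul]; exact hx⟩, Set.indicator_of_notMem
        (show x ∉ {x : Plane | r < ‖x‖} from not_lt.2 hx)]
      simp

open Classical in
/-- The probability that the user is associated with tier `i` and its SIR exceeds the threshold. -/
lemma measure_covered (H : IsRayleighField Pr d Φ h) (hd : ∀ j, 0 ≤ d j)
    (hlaw : HasLaw h₀ (expMeasure 1) Pr)
    (hind : IndepFun h₀ (fun ω => (fun j => Φ j ω, fun j n => h j n ω)) Pr)
    {κ : ℝ} (hκ : 0 ≤ κ) (hint : ∀ r, 0 ≤ r →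
      ∫⁻ x in {x : Plane | r < ‖x‖},
        (1 - eexp (ENNReal.ofReal (Real.log (1 + M.γ * r ^ M.α * ‖x‖ ^ (-M.α)))))
      = ENNReal.ofReal (κ * r ^ 2)) :
    NullMeasurableSet {ω | ∃ y, M.Serves y (fun j => Φ j ω) ∧
      ENNReal.ofReal M.γ < M.sir Φ h h₀ y ω} Pr ∧
    Pr {ω | ∃ y, M.Serves y (fun j => Φ j ω) ∧ ENNReal.ofReal M.γ < M.sir Φ h h₀ y ω}
      = ENNReal.ofReal (∑ j, if M.tier j = some M.i then d j else 0) *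
        ∫⁻ y : Plane, eexp (M.outer d y) * eexp (ENNReal.ofReal (M.covExp d κ * ‖y‖ ^ 2)) := by
  have hF := H.family hd
  have hR : ∀ j n, M.tier j = some M.i →
      NullMeasurableSet {ω | ENNReal.ofReal M.γ < M.sir Φ h h₀ (Φ j ω n).2 ω} Pr := by
    intro j n _
    refine nullMeasurableSet_lt aemeasurable_const ?_
    have hy : Measurable fun c : J → Config => (c j n).2 := by fun_prop
    have hI : Measurable fun z : (J → Config) × (J → ℕ → ℝ) =>
        famInterf M.α M.pw (fun j' => M.Ex j' (z.1 j n).2) (M.rx (z.1 j n).2) z.1 z.2 :=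
      measurable_famInterf_param measurable_fst measurable_snd (fun j' =>
        (M.measurableSet_Ex j').preimage
          ((hy.comp (measurable_fst.comp measurable_fst)).prodMk measurable_snd))
        (M.measurable_rx.comp (hy.comp measurable_fst))
    have hI' := hI.comp_aemeasurable
      (H.measurable_points.aemeasurable.prodMk H.aemeasurable_fading)
    have hh := hlaw.aemeasurable
    have hp : Measurable fun ω => (Φ j ω n).2 := hy.comp H.measurable_points
    refine AEMeasurable.div ?_ hI'
    refine AEMeasurable.ennreal_ofReal ?_
    exact (hh.const_mul _).mul ((by fun_prop : Measurable fun ω => ‖(Φ j ω n).2‖ ^ (-M.α)).aemeasurable)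
  obtain ⟨h1, h2⟩ := M.measure_serves hF (fun y ω => ENNReal.ofReal M.γ < M.sir Φ h h₀ y ω) hR
  refine ⟨h1, h2.trans ?_⟩
  rw [ENNReal.ofReal_sum_of_nonneg (fun j _ => by
    have := hd j
    split_ifs <;> simp [this]), Finset.sum_mul]
  refine Finset.sum_congr rfl fun j _ => ?_
  split_ifs with hj
  -- The factor of the non-station fields enters as the weight `g ≤ 1`, for which no monotonicity is
  -- needed.
  · have hr := hF.mecke_radial M.measurable_radialLoss M.radialLoss_mono j
      (fun hdj => M.covExp_pos hd hκ hj hdj)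
      (fun r hr => ServeRule.laplaceExponent_of_sq hd (M.coef_nonneg hκ)
        fun j => M.lintegral_radialLoss hκ hint hr j)
      (g := fun y => eexp (M.outer d y)) (measurable_eexp.comp (M.measurable_outer d))
      (fun y => eexp_le_one _)
    refine Eq.trans ?_ hr
    rw [lintegral_tsum, lintegral_tsum]
    · refine tsum_congr fun n => Eq.trans ?_ (M.lintegral_best_sir H hd hlaw hind hj n)
      refine lintegral_congr fun ω => ?_
      congr!
    · intro n
      refine (Measurable.ite ((Config.measurableSet_present n).preimage (H.poisson j).measurable)
        ?_ measurable_const).aemeasurable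
      refine Measurable.mul ?_ ?_
      · exact (measurable_eexp.comp (M.measurable_outer d)).comp
          ((by fun_prop : Measurable fun c : Config => (c n).2).comp (H.poisson j).measurable)
      · refine (ServeRule.measurable_block_param (b := M.radialLoss) (fun j' => ?_) j n).comp
          H.measurable_points
        unfold radialLoss
        refine (M.measurable_uncurry_blockS j').add ?_
        split_ifs
        · exact measurable_const
        · fun_prop
    · intro n
      refine AEMeasurable.congr (AEMeasurable.indicator
        (s := {ω | (Φ j ω n).1 = true}) (AEMeasurable.mul
          ((M.measurable_bestS j n).comp H.measurable_points).aemeasurable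
          ((aemeasurable_indicator_const_iff (1 : ℝ≥0∞)).2 (hR j n hj)))
        ((Config.measurableSet_present n).preimage (H.poisson j).measurable)) ?_
      exact ae_of_all _ fun ω => by
        by_cases hn : (Φ j ω n).1 = true <;>
          by_cases hs : ENNReal.ofReal M.γ < M.sir Φ h h₀ (Φ j ω n).2 ω <;>
          simp [Set.indicator, hn, hs]
  · simp

end CellModel

end Cellular

/-! ## The exponents of the interferers -/

section Exponents

variable {J : Type} [Fintype J]

/-- `1 - 1 / (1 + t ρ ^ (-α)) = 1 / (1 + ρ ^ α / t)`, and `ρ ^ α / t = (ρ² / t ^ (2/α)) ^ (α/2)`. -/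
lemma one_sub_eexp_log {α t ρ : ℝ} (hα : 0 < α) (ht : 0 < t) (hρ : 0 < ρ) :
    1 - eexp (ENNReal.ofReal (Real.log (1 + t * ρ ^ (-α))))
      = ENNReal.ofReal (kern α (t ^ (2 / α)) ρ) := by
  have h1 : 0 < t * ρ ^ (-α) := by positivity
  rw [eexp_ofReal (Real.log_nonneg (by linarith)), Real.exp_neg, Real.exp_log (by linarith),
    ← ENNReal.ofReal_one, ← ENNReal.ofReal_sub _ (by positivity)]
  congr 1
  have h2 : (ρ ^ 2 / t ^ (2 / α)) ^ (α / 2) = ρ ^ α / t := by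
    rw [Real.div_rpow (by positivity) (by positivity), ← Real.rpow_natCast, ← Real.rpow_mul hρ.le,
      ← Real.rpow_mul ht.le]
    have e1 : ((2 : ℕ) : ℝ) * (α / 2) = α := by push_cast; ring
    have e2 : 2 / α * (α / 2) = 1 := by field_simp
    rw [e1, e2, Real.rpow_one]
  rw [kern, h2, Real.rpow_neg hρ.le]
  have h3 : 0 < ρ ^ α := by positivity
  field_simp
  ring

lemma kern_pos {α T : ℝ} (hT : 0 ≤ T) (ρ : ℝ) : 0 < kern α T ρ := by
  unfold kern
  positivity

lemma lintegral_fadingLoss_of_eq_zero {α s : ℝ} {pw : J → ℝ} {Ex : J → Set Plane} {y : Plane} {j : J}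
    (h : s * pw j = 0) : ∫⁻ x, (1 - eexp (fadingLoss α s pw Ex y j x)) = 0 := by
  simp [fadingLoss, h]

lemma lintegral_fadingLoss {α s : ℝ} (hα : 0 < α) {pw : J → ℝ} {Ex : J → Set Plane} {y : Plane}
    {j : J} (h : 0 < s * pw j) (hEx : MeasurableSet (Ex j)) :
    ∫⁻ x, (1 - eexp (fadingLoss α s pw Ex y j x))
      = ∫⁻ x in (Ex j)ᶜ, ENNReal.ofReal (kern α ((s * pw j) ^ (2 / α)) ‖x - y‖) := by
  rw [← lintegral_indicator hEx.compl]
  refine lintegral_congr_ae ?_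
  have : ∀ᵐ x : Plane, x ≠ y := by
    simp [ae_iff, measure_singleton]
  filter_upwards [this] with x hx
  unfold fadingLoss
  by_cases hxE : x ∈ Ex j
  · rw [if_pos hxE, Set.indicator_of_notMem (by simpa using hxE)]; simp
  · rw [if_neg hxE, Set.indicator_of_mem (by simpa using hxE),
      one_sub_eexp_log hα h (norm_pos_iff.2 (sub_ne_zero.2 hx))]

/-- The whole plane, up to a null set. -/
lemma Params.lintegral_fadingLoss_plane (p : Params) {s : ℝ} {pw : J → ℝ} {Ex : J → Set Plane}
    {y : Plane} {j : J} (h : 0 < s * pw j) (hEx : MeasurableSet (Ex j)) (hnull : volume (Ex j) = 0) :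
    ∫⁻ x, (1 - eexp (fadingLoss p.α s pw Ex y j x))
      = ENNReal.ofReal (Real.pi * (p.Cconst * (s * pw j) ^ (2 / p.α))) := by
  have hT : 0 < (s * pw j) ^ (2 / p.α) := Real.rpow_pos_of_pos h _
  have hE : (Ex j)ᶜ =ᵐ[volume] (Set.univ : Set Plane) := by
    rw [← Set.compl_empty]
    exact (ae_eq_empty.2 hnull).compl
  refine (lintegral_fadingLoss p.α_pos h hEx).trans ((setLIntegral_congr hE).trans ?_)
  rw [setLIntegral_univ,
    lintegral_sub_right_eq_self (fun x => ENNReal.ofReal (kern p.α ((s * pw j) ^ (2 / p.α)) ‖x‖)) y,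
    lintegral_comp_norm (k := fun ρ => ENNReal.ofReal (kern p.α ((s * pw j) ^ (2 / p.α)) ρ))
      (by have := measurable_kern (α := p.α) (T := (s * pw j) ^ (2 / p.α)); fun_prop),
    lintegral_mul_kern_Ioi p.two_lt_α hT le_rfl]
  have e : (0 : ℝ) ^ 2 / (s * pw j) ^ (2 / p.α) = 0 := by simp
  rw [e, integral_kernel_Ioi p.two_lt_α, mul_assoc, ← ENNReal.ofReal_mul Real.pi_pos.le,
    ← ENNReal.ofReal_ofNat, ← ENNReal.ofReal_mul (by norm_num)]
  congr 1
  unfold Params.Cconst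
  ring

open Classical in
/-- The exponent of interferers outside a ball of radius `l` with centre at distance `r`. -/
noncomputable def Params.ballCoef (p : Params) (s Q l r : ℝ) : ℝ :=
  Real.pi * (l + r) ^ 2 * p.δ (s * Q / (l + r) ^ p.α) +
    if r ≤ l then p.Z s Q 0 Real.pi (Params.farDist l r) (fun _ => l + r)
    else p.Z s Q 0 (Real.arcsin (l / r)) (fun _ => 0) (Params.nearDist l r)
      + p.Z s Q 0 (Real.arcsin (l / r)) (Params.farDist l r) (fun _ => l + r)
      + p.Z s Q (Real.arcsin (l / r)) Real.pi (fun _ => 0) (fun _ => l + r)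

lemma Params.lintegral_kern_compl_ball (p : Params) {s Q l : ℝ} (hsQ : 0 < s * Q) (hl : 0 < l)
    (y : Plane) :
    ∫⁻ x in (Metric.ball y l)ᶜ, ENNReal.ofReal (kern p.α ((s * Q) ^ (2 / p.α)) ‖x‖)
      = ENNReal.ofReal (p.ballCoef s Q l ‖y‖) := by
  unfold Params.ballCoef
  split_ifs with h
  · rw [p.lintegral_kern_compl_ball_of_le hsQ hl h]
  · rw [p.lintegral_kern_compl_ball_of_lt hsQ hl (not_le.1 h)]

/-- The coefficient is the integral of a positive function over the complement of a ball, which is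
not a null set since the plane has infinite area. The sign is needed because `ENNReal.ofReal`
truncates negative numbers. -/
lemma Params.ballCoef_pos (p : Params) {s Q l r : ℝ} (hsQ : 0 < s * Q) (hl : 0 < l) (hr : 0 ≤ r) :
    0 < p.ballCoef s Q l r := by
  obtain ⟨y, rfl⟩ : ∃ y : Plane, ‖y‖ = r := ⟨EuclideanSpace.single 0 r, by simp [abs_of_nonneg hr]⟩
  rw [← ENNReal.ofReal_pos, ← p.lintegral_kern_compl_ball hsQ hl y, pos_iff_ne_zero]
  intro h0
  have hm : Measurable fun x : Plane => ENNReal.ofReal (kern p.α ((s * Q) ^ (2 / p.α)) ‖x‖) := by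
    have := measurable_kern (α := p.α) (T := (s * Q) ^ (2 / p.α)); fun_prop
  rw [setLIntegral_eq_zero_iff Metric.isOpen_ball.measurableSet.compl hm] at h0
  have h1 : ∀ᵐ x : Plane, x ∈ Metric.ball y l := by
    filter_upwards [h0] with x hx
    by_contra hxb
    have := hx hxb
    rw [ENNReal.ofReal_eq_zero] at this
    exact absurd this (not_le.2 (kern_pos (Real.rpow_nonneg hsQ.le _) _))
  have h2 : volume (Metric.ball y l)ᶜ = 0 := h1
  have h3 : (volume : Measure Plane) Set.univ < ∞ := by
    rw [← Set.union_compl_self (Metric.ball y l)]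
    exact (measure_union_le _ _).trans_lt (by rw [h2, add_zero]; exact measure_ball_lt_top)
  simp at h3

/-- Interferers outside a ball. -/
lemma Params.lintegral_fadingLoss_ball (p : Params) {s : ℝ} {pw : J → ℝ} {Ex : J → Set Plane}
    {y b : Plane} {l : ℝ} {j : J} (h : 0 < s * pw j) (hl : 0 < l) (hEx : Ex j = Metric.ball b l) :
    ∫⁻ x, (1 - eexp (fadingLoss p.α s pw Ex y j x))
      = ENNReal.ofReal (p.ballCoef s (pw j) l ‖b - y‖) := by
  have hm : MeasurableSet (Metric.ball b l)ᶜ := Metric.isOpen_ball.measurableSet.compl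
  rw [lintegral_fadingLoss p.α_pos h (by rw [hEx]; exact Metric.isOpen_ball.measurableSet), hEx,
    ← p.lintegral_kern_compl_ball h hl, ← lintegral_indicator hm,
    ← lintegral_indicator Metric.isOpen_ball.measurableSet.compl,
    ← lintegral_sub_right_eq_self ((Metric.ball (b - y) l)ᶜ.indicator _) y]
  refine lintegral_congr fun x => ?_
  have : x ∈ (Metric.ball b l)ᶜ ↔ x - y ∈ (Metric.ball (b - y) l)ᶜ := by
    simp [Metric.mem_ball]
  by_cases hx : x ∈ (Metric.ball b l)ᶜ
  · rw [Set.indicator_of_mem hx, Set.indicator_of_mem (this.1 hx)]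
  · rw [Set.indicator_of_notMem hx, Set.indicator_of_notMem (fun h => hx (this.2 h))]

lemma Params.δ_nonneg (p : Params) {β : ℝ} (hβ : 0 ≤ β) : 0 ≤ p.δ β := by
  unfold Params.δ
  refine setIntegral_nonneg measurableSet_Ioi fun u hu => ?_
  have : 0 ≤ u := le_of_lt (lt_of_le_of_lt (Real.rpow_nonneg hβ _) hu)
  positivity

/-- Active stations that are farther away than the serving station. -/
lemma Params.lintegral_farther (p : Params) {γ : ℝ} (hγ : 0 < γ) {r : ℝ} (hr : 0 ≤ r) :
    ∫⁻ x in {x : Plane | r < ‖x‖},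
        (1 - eexp (ENNReal.ofReal (Real.log (1 + γ * r ^ p.α * ‖x‖ ^ (-p.α)))))
      = ENNReal.ofReal (Real.pi * p.δ γ * r ^ 2) := by
  rcases hr.eq_or_lt with rfl | hr
  · simp [Real.zero_rpow p.α_pos.ne']
  have ht : 0 < γ * r ^ p.α := by positivity
  have hT : 0 < (γ * r ^ p.α) ^ (2 / p.α) := Real.rpow_pos_of_pos ht _
  have hmeas : MeasurableSet {x : Plane | r < ‖x‖} := measurableSet_lt measurable_const (by fun_prop)
  rw [setLIntegral_congr_fun hmeas
    (g := fun x => ENNReal.ofReal (kern p.α ((γ * r ^ p.α) ^ (2 / p.α)) ‖x‖))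
    (fun x hx => one_sub_eexp_log p.α_pos ht (hr.trans hx)),
    lintegral_comp_norm_of_gt
      (k := fun ρ => ENNReal.ofReal (kern p.α ((γ * r ^ p.α) ^ (2 / p.α)) ρ))
      (by have := measurable_kern (α := p.α) (T := (γ * r ^ p.α) ^ (2 / p.α)); fun_prop) hr.le,
    lintegral_mul_kern_Ioi p.two_lt_α hT hr.le, mul_assoc, ← ENNReal.ofReal_mul Real.pi_pos.le,
    ← ENNReal.ofReal_ofNat, ← ENNReal.ofReal_mul (by norm_num)]
  congr 1
  have h := p.sq_mul_δ ht hr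
  have e : γ * r ^ p.α / r ^ p.α = γ := mul_div_cancel_right₀ _ (by positivity)
  rw [e] at h
  linear_combination (-Real.pi) * h

end Exponents

/-! ## Densities of the active transmitters -/

namespace Params

variable (p : Params)

/-- Given the area, the cell is void with probability `e^(-m x)`. This factor turns the Gamma
density of rate `3.5` into `(1 + m / 3.5) ^ (-3.5)` times the Gamma density of rate `3.5 + m`. -/
lemma loadProb_zero {m : ℝ} (hm : 0 ≤ m) : loadProb m 0 = (1 + m / 3.5) ^ (-3.5 : ℝ) := by
  unfold loadProb
  have hΓ := isProbabilityMeasure_gammaMeasure (a := 3.5) (r := 3.5) (by norm_num) (by norm_num)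
  have hnn : ∀ x : ℝ, 0 ≤ (poissonMeasure (m * x).toNNReal).real {0} := fun x => measureReal_nonneg
  have hr : ∀ x : ℝ, (poissonMeasure (m * x).toNNReal).real {0} = Real.exp (-(m * x).toNNReal) := by
    intro x
    rw [poissonMeasure_real_singleton]
    simp
  have hmeas : Measurable fun x : ℝ => Real.exp (-((m * x).toNNReal : ℝ)) := by fun_prop
  simp_rw [hr]
  rw [integral_eq_lintegral_of_nonneg_ae (ae_of_all _ fun x => (Real.exp_pos _).le)
    hmeas.aestronglyMeasurable]
  have h1 : gammaMeasure 3.5 3.5 = volume.withDensity (gammaPDF 3.5 3.5) := rfl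
  rw [h1, lintegral_withDensity_eq_lintegral_mul _ (f := gammaPDF 3.5 3.5)
    (measurable_gammaPDFReal _ _).ennreal_ofReal hmeas.ennreal_ofReal]
  have hpos : (0 : ℝ) < 1 + m / 3.5 := by positivity
  have h2 : ∀ x : ℝ, (gammaPDF 3.5 3.5 * fun x => ENNReal.ofReal (Real.exp (-((m * x).toNNReal : ℝ)))) x
      = ENNReal.ofReal ((1 + m / 3.5) ^ (-3.5 : ℝ)) * gammaPDF 3.5 (3.5 + m) x := by
    intro x
    rw [Pi.mul_apply]
    rcases lt_or_ge x 0 with hx | hx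
    · rw [gammaPDF_of_neg hx, gammaPDF_of_neg hx, zero_mul, mul_zero]
    · rw [gammaPDF_of_nonneg hx, gammaPDF_of_nonneg hx, ← ENNReal.ofReal_mul (by positivity),
        ← ENNReal.ofReal_mul (by positivity), Real.coe_toNNReal _ (by positivity)]
      congr 1
      have e1 : (3.5 + m : ℝ) = 3.5 * (1 + m / 3.5) := by field_simp
      have e2 : Real.exp (-((3.5 + m) * x)) = Real.exp (-(3.5 * x)) * Real.exp (-(m * x)) := by
        rw [← Real.exp_add]; ring_nf
      rw [e2, e1, Real.mul_rpow (by norm_num) hpos.le, Real.rpow_neg hpos.le]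
      have : (1 + m / 3.5) ^ (3.5 : ℝ) ≠ 0 := by positivity
      field_simp
  simp_rw [h2]
  rw [lintegral_const_mul (f := gammaPDF 3.5 (3.5 + m)) _
    (measurable_gammaPDFReal _ _).ennreal_ofReal,
    lintegral_gammaPDF_eq_one (by norm_num) (by positivity), mul_one,
    ENNReal.toReal_ofReal (by positivity)]

lemma q_nonneg (i : Tier) : 0 ≤ p.q i := (p.q_mem i).1

lemma one_sub_q_nonneg (i : Tier) : 0 ≤ 1 - p.q i := by linarith [(p.q_mem i).2]

lemma downWeight_nonneg (i : Tier) : 0 ≤ p.q i * p.lam i := mul_nonneg (p.q_nonneg i) (p.lam_pos i).le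

lemma upWeight_nonneg (i : Tier) : 0 ≤ (1 - p.q i) * p.lam i :=
  mul_nonneg (p.one_sub_q_nonneg i) (p.lam_pos i).le

lemma assocD_nonneg (i : Tier) : 0 ≤ p.assocD i := by
  have h1 := p.downWeight_nonneg .mbs
  have h2 := p.downWeight_nonneg .sap
  have h3 := p.downWeight_nonneg i
  have h4 := fun k => p.P_pos k
  have h5 := fun k => p.BD_pos k
  unfold assocD
  have a1 := h4 i; have a2 := h5 i
  have a3 := h4 .mbs; have a4 := h5 .mbs
  have a5 := h4 .sap; have a6 := h5 .sap
  positivity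

lemma assocU_nonneg (i : Tier) : 0 ≤ p.assocU i := by
  have h1 := p.upWeight_nonneg .mbs
  have h2 := p.upWeight_nonneg .sap
  have h3 := p.upWeight_nonneg i
  have h4 := fun k => p.Q_pos k
  have h5 := fun k => p.BU_pos k
  unfold assocU
  have a1 := h4 i; have a2 := h5 i
  have a3 := h4 .mbs; have a4 := h5 .mbs
  have a5 := h4 .sap; have a6 := h5 .sap
  positivity

lemma downLoad_nonneg (i : Tier) :
    0 ≤ (1 - p.μ) * (1 - p.ζ) * p.lamU * p.assocD i / (p.q i * p.lam i) := by
  have h1 : 0 ≤ 1 - p.μ := by linarith [p.μ_mem.2]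
  have h2 : 0 ≤ 1 - p.ζ := by linarith [p.ζ_mem.2]
  have h3 := p.lamU_pos
  have h4 := p.assocD_nonneg i
  have h5 := p.downWeight_nonneg i
  positivity

lemma upLoad_nonneg (i : Tier) :
    0 ≤ p.μ * (1 - p.ζ) * p.lamU * p.assocU i / ((1 - p.q i) * p.lam i) := by
  have h1 := p.μ_mem.1
  have h2 : 0 ≤ 1 - p.ζ := by linarith [p.ζ_mem.2]
  have h3 := p.lamU_pos
  have h4 := p.assocU_nonneg i
  have h5 := p.upWeight_nonneg i
  positivity

/-- Valid also for `q i = 0`: the load is then `x / 0 = 0`, still nonnegative, and the prefactor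
vanishes on both sides. -/
lemma densD_eq (i : Tier) : p.densD i = p.lamD i := by
  unfold densD lamD voidD
  rw [loadProb_zero (p.downLoad_nonneg i), div_div, mul_comm (p.q i) (p.lam i),
    mul_comm (p.lam i * p.q i) 3.5, mul_comm (p.lam i) (p.q i), mul_assoc 3.5]

lemma densU_eq (i : Tier) : p.densU i = p.lamT i := by
  unfold densU lamT voidU
  rw [loadProb_zero (p.upLoad_nonneg i), div_div, mul_comm (1 - p.q i) (p.lam i),
    mul_comm (p.lam i * (1 - p.q i)) 3.5, mul_comm (p.lam i) (1 - p.q i), mul_assoc 3.5]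

lemma loadProb_zero_mem {m : ℝ} (hm : 0 ≤ m) : 0 ≤ loadProb m 0 ∧ loadProb m 0 ≤ 1 := by
  rw [loadProb_zero hm]
  have : (1 : ℝ) ≤ 1 + m / 3.5 := by
    have : 0 ≤ m / 3.5 := by positivity
    linarith
  exact ⟨by positivity, Real.rpow_le_one_of_one_le_of_nonpos this (by norm_num)⟩

lemma densD_nonneg (i : Tier) : 0 ≤ p.densD i :=
  mul_nonneg (p.downWeight_nonneg i)
    (sub_nonneg.2 (loadProb_zero_mem (p.downLoad_nonneg i)).2)

lemma densD_le (i : Tier) : p.densD i ≤ p.q i * p.lam i :=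
  mul_le_of_le_one_right (p.downWeight_nonneg i)
    (by linarith [(loadProb_zero_mem (p.downLoad_nonneg i)).1, show p.voidD i = loadProb _ 0 from rfl])

lemma densU_nonneg (i : Tier) : 0 ≤ p.densU i :=
  mul_nonneg (p.upWeight_nonneg i)
    (sub_nonneg.2 (loadProb_zero_mem (p.upLoad_nonneg i)).2)

lemma Kconst_pos {ρ : ℝ} (hρ : 0 < ρ) : 0 < p.Kconst ρ := by
  have h1 := p.α_pos
  have h2 := p.Qd_pos
  have h3 : 0 < Real.Gamma (2 / p.α) := Real.Gamma_pos_of_pos (by positivity)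
  have h4 := Real.pi_pos
  unfold Kconst
  positivity

lemma lamd_nonneg : 0 ≤ p.lamd := by
  have h1 := p.Kconst_pos p.ρd_pos
  have h2 := p.ζ_mem.1
  have h3 := p.lamU_pos
  have h4 : Real.exp (-(p.ζ * p.lamU * p.Kconst p.ρd)) ≤ 1 :=
    Real.exp_le_one_iff.2 (by have : 0 ≤ p.ζ * p.lamU * p.Kconst p.ρd := by positivity
                              linarith)
  have h5 := sub_nonneg.2 h4
  unfold lamd
  positivity

/-- The probability that a transmitter at `x` senses a power above the threshold `ρ`. -/
noncomputable def sense (ρ : ℝ) (x : Plane) : ℝ := Real.exp (-(ρ / p.Qd * ‖x‖ ^ p.α))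

/-- The origin of the constant `K`: in polar coordinates the sensing probability integrates to `2π ∫
r e^(-(ρ/Qd) r ^ α) dr`, a Gamma integral. -/
lemma lintegral_sense {ρ : ℝ} (hρ : 0 < ρ) :
    ∫⁻ x, ENNReal.ofReal (p.sense ρ x) = ENNReal.ofReal (p.Kconst ρ) := by
  have hα := p.α_pos
  have hb : 0 < ρ / p.Qd := div_pos hρ p.Qd_pos
  unfold sense
  rw [lintegral_comp_norm (k := fun r => ENNReal.ofReal (Real.exp (-(ρ / p.Qd * r ^ p.α))))
    (by fun_prop)]
  have h := integral_rpow_mul_exp_neg_mul_rpow (p := p.α) (q := 1) (b := ρ / p.Qd) hα (by norm_num) hb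
  have hi := integrableOn_rpow_mul_exp_neg_mul_rpow (p := p.α) (s := 1) (b := ρ / p.Qd)
    (by norm_num) (by linarith [p.two_lt_α]) hb
  rw [setLIntegral_congr_fun measurableSet_Ioi
    (g := fun x => ENNReal.ofReal (x ^ (1 : ℝ) * Real.exp (-(ρ / p.Qd) * x ^ p.α)))
    (fun x hx => by
      have hx' : 0 ≤ x := le_of_lt hx
      beta_reduce
      rw [← ENNReal.ofReal_mul hx', Real.rpow_one, neg_mul]),
    ← ofReal_integral_eq_lintegral_ofReal hi, h, mul_assoc, ← ENNReal.ofReal_mul Real.pi_pos.le,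
    ← ENNReal.ofReal_ofNat, ← ENNReal.ofReal_mul (by norm_num)]
  · congr 1
    have e : (1 + 1 : ℝ) / p.α = 2 / p.α := by norm_num
    rw [neg_div, e, Real.rpow_neg hb.le, Kconst]
    have : 0 < (ρ / p.Qd) ^ (2 / p.α) := by positivity
    field_simp
  · filter_upwards [self_mem_ae_restrict measurableSet_Ioi] with x hx
    have hx' : 0 ≤ x := le_of_lt hx
    simp only [Pi.zero_apply]
    positivity

end Params

/-! ## The density of the active D2D transmitters -/

instance : Fintype SensedField :=
  ⟨⟨([.station, .user, .contender] : List SensedField), by simp⟩, fun j => by cases j <;> simp⟩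

lemma sum_sensedField {A : Type*} [AddCommMonoid A] (f : SensedField → A) :
    ∑ j, f j = f .station + f .user + f .contender := by
  have : ∑ j, f j = (List.map f [.station, .user, .contender]).sum := rfl
  rw [this]
  simp [add_assoc]

/-- The exponent `-log u` of an event of probability `u`. -/
noncomputable def negLog (u : ℝ) : ℝ≥0∞ := if u ≤ 0 then ∞ else ENNReal.ofReal (-Real.log u)

lemma eexp_negLog {u : ℝ} (h1 : u ≤ 1) : eexp (negLog u) = ENNReal.ofReal u := by
  unfold negLog
  split_ifs with h
  · rw [eexp_top, ENNReal.ofReal_of_nonpos h]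
  · push Not at h
    rw [eexp_ofReal (by have := Real.log_nonpos h.le h1; linarith), neg_neg, Real.exp_log h]

lemma measurable_negLog : Measurable negLog :=
  Measurable.ite measurableSet_Iic measurable_const (by fun_prop)

open Classical in
/-- Infinite if one of the events occurs. -/
noncomputable def topIfAny (P : ℕ → Prop) : ℝ≥0∞ := ∑' n, if P n then ∞ else 0

lemma topIfAny_eq_zero (P : ℕ → Prop) : topIfAny P = 0 ↔ ∀ n, ¬ P n := by
  simp [topIfAny, ENNReal.tsum_eq_zero]

lemma topIfAny_eq_zero_or_top (P : ℕ → Prop) : topIfAny P = 0 ∨ topIfAny P = ∞ := by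
  by_cases h : ∃ n, P n
  · obtain ⟨n, hn⟩ := h
    exact Or.inr (ENNReal.tsum_eq_top_of_eq_top ⟨n, if_pos hn⟩)
  · push Not at h
    exact Or.inl ((topIfAny_eq_zero P).2 h)

lemma measurable_topIfAny {X : Type*} [MeasurableSpace X] {P : X → ℕ → Prop}
    (h : ∀ n, MeasurableSet {x | P x n}) : Measurable fun x => topIfAny (P x) :=
  Measurable.tsum fun n => Measurable.ite (h n) measurable_const measurable_const

lemma uniform_Iio {a : ℝ} (ha : a ∈ Set.Icc (0 : ℝ) 1) :
    (volume.restrict (Set.Icc (0 : ℝ) 1)) (Set.Ici a) = ENNReal.ofReal (1 - a) := by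
  rw [Measure.restrict_apply measurableSet_Ici]
  have : Set.Ici a ∩ Set.Icc 0 1 = Set.Icc a 1 := by
    ext x
    simp only [Set.mem_inter_iff, Set.mem_Ici, Set.mem_Icc]
    exact ⟨fun h => ⟨h.1, h.2.2⟩, fun h => ⟨h.1, ha.1.trans h.1, h.2⟩⟩
  rw [this, Real.volume_Icc]

lemma expMeasure_Iio {c : ℝ} (hc : 0 ≤ c) :
    expMeasure 1 (Set.Iio c) = ENNReal.ofReal (1 - Real.exp (-c)) := by
  have := isProbabilityMeasure_expMeasure (r := 1) one_pos
  have hna : expMeasure 1 {c} = 0 := by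
    have h1 : expMeasure 1 = volume.withDensity (exponentialPDF 1) := rfl
    rw [h1]
    exact withDensity_absolutelyContinuous _ _ (measure_singleton c)
  have h2 : expMeasure 1 (Set.Ici c) = ENNReal.ofReal (Real.exp (-c)) := by
    rw [← expMeasure_Ioi hc, ← Set.Ioi_union_left]
    exact le_antisymm ((measure_union_le _ _).trans (by rw [hna, add_zero]))
      (measure_mono Set.subset_union_left)
  rw [← Set.compl_Ici, prob_compl_eq_one_sub measurableSet_Ici, h2, ← ENNReal.ofReal_one,
    ← ENNReal.ofReal_sub _ (Real.exp_pos _).le]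

namespace Contention

variable {p : Params} {Ω : Type*} [MeasurableSpace Ω] {Pr : Measure Ω} [IsProbabilityMeasure Pr]
  (C : Contention p Pr)

/-- The sensing thresholds. -/
def threshold (p : Params) : SensedField → ℝ
  | .station => p.ρs
  | .user => p.ρs
  | .contender => p.ρd

/-- The probability that a transmitter of the given field has the right of way, if the timer of
the typical transmitter equals `a`. -/
def priority (a : ℝ) : SensedField → ℝ
  | .station => 1
  | .user => 1
  | .contender => a

/-- The transmitter at `x` senses the typical one, the fading power being `t`. -/
def Senses (p : Params) (j : SensedField) (x : Plane) (t : ℝ) : Prop :=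
  threshold p j ≤ p.Qd * t / ‖x‖ ^ p.α

/-- The `n`-th point of field `j` is present and senses the typical transmitter. -/
def Notices (p : Params) (z : (SensedField → Config) × (SensedField → ℕ → ℝ)) (j : SensedField)
    (n : ℕ) : Prop :=
  (z.1 j n).1 = true ∧ Senses p j (z.1 j n).2 (z.2 j n)

/-- Infinite if a transmitter with the right of way senses the typical one. -/
noncomputable def veto (p : Params) (τ : ℝ × (ℕ → ℝ))
    (z : (SensedField → Config) × (SensedField → ℕ → ℝ)) : ℝ≥0∞ :=
  topIfAny (Notices p z .station) + topIfAny (Notices p z .user)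
    + topIfAny fun n => Notices p z .contender n ∧ τ.2 n < τ.1

open Classical in
/-- The veto, averaged over the timers of the contenders. -/
noncomputable def vetoMean (p : Params) (a : ℝ)
    (z : (SensedField → Config) × (SensedField → ℕ → ℝ)) : ℝ≥0∞ :=
  ∑' i : SensedField × ℕ, if Notices p z i.1 i.2 then negLog (1 - priority a i.1) else 0

lemma measurableSet_senses {X : Type*} [MeasurableSpace X] {x : X → Plane} {t : X → ℝ}
    (hx : Measurable x) (ht : Measurable t) (j : SensedField) :
    MeasurableSet {z | Senses p j (x z) (t z)} :=
  measurableSet_le measurable_const (by fun_prop)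

lemma measurableSet_notices (j : SensedField) (n : ℕ) :
    MeasurableSet {z : (SensedField → Config) × (SensedField → ℕ → ℝ) | Notices p z j n} := by
  have h1 : Measurable fun z : (SensedField → Config) × (SensedField → ℕ → ℝ) => (z.1 j n).2 := by
    fun_prop
  have h2 : Measurable fun z : (SensedField → Config) × (SensedField → ℕ → ℝ) => z.2 j n := by
    fun_prop
  have h3 : Measurable fun z : (SensedField → Config) × (SensedField → ℕ → ℝ) => z.1 j := by
    fun_prop
  exact ((Config.measurableSet_present n).preimage h3).inter (measurableSet_senses h1 h2 j)

lemma measurable_veto {X : Type*} [MeasurableSpace X] {τ : X → ℝ × (ℕ → ℝ)}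
    {z : X → (SensedField → Config) × (SensedField → ℕ → ℝ)} (hτ : Measurable τ)
    (hz : Measurable z) : Measurable fun x => veto p (τ x) (z x) := by
  unfold veto
  have h := fun j n => (measurableSet_notices (p := p) j n).preimage hz
  refine ((measurable_topIfAny (h _)).add (measurable_topIfAny (h _))).add
    (measurable_topIfAny fun n => ?_)
  have h1 : Measurable fun x => (τ x).2 n := by fun_prop
  have h2 : Measurable fun x => (τ x).1 := by fun_prop
  exact (h _ n).inter (measurableSet_lt h1 h2)

lemma measurable_priority (j : SensedField) : Measurable fun a => priority a j := by
  cases j <;> simp only [priority] <;> fun_prop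

lemma measurable_vetoMean {X : Type*} [MeasurableSpace X] {a : X → ℝ}
    {z : X → (SensedField → Config) × (SensedField → ℕ → ℝ)} (ha : Measurable a)
    (hz : Measurable z) : Measurable fun x => vetoMean p (a x) (z x) := by
  unfold vetoMean
  refine Measurable.tsum fun i => Measurable.ite
    ((measurableSet_notices i.1 i.2).preimage hz) ?_ measurable_const
  exact measurable_negLog.comp (measurable_const.sub ((measurable_priority i.1).comp ha))

/-- The timers. -/
def timers (ω : Ω) : ℝ × (ℕ → ℝ) := (C.t₀ ω, fun n => C.t n ω)

/-- The points and the fading powers. -/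
def surroundings (ω : Ω) : (SensedField → Config) × (SensedField → ℕ → ℝ) :=
  (fun j => C.Φ j ω, fun j n => C.h j n ω)

lemma aemeasurable_t : AEMeasurable (fun ω n => C.t n ω) Pr :=
  aemeasurable_pi_lambda _ fun n => (C.t_law n).aemeasurable

lemma aemeasurable_timers : AEMeasurable C.timers Pr := C.t₀_law.aemeasurable.prodMk C.aemeasurable_t

lemma aemeasurable_surroundings : AEMeasurable C.surroundings Pr :=
  C.field.measurable_points.aemeasurable.prodMk C.field.aemeasurable_fading

lemma retained_eq : C.retained = {ω | veto p (C.timers ω) (C.surroundings ω) = 0} := by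
  ext ω
  rw [Set.mem_ofPred_eq, veto, add_eq_zero, add_eq_zero, topIfAny_eq_zero, topIfAny_eq_zero,
    topIfAny_eq_zero]
  simp only [retained, Set.mem_ofPred_eq, timers, surroundings, Config.present, power, Senses,
    Notices, threshold, not_and, not_le, not_lt, and_assoc]
  refine and_congr Iff.rfl (and_congr Iff.rfl (forall_congr' fun n => ?_))
  constructor
  · intro h hn hs
    rcases h hn with h | h
    · exact h
    · exact absurd h.2 (not_lt.2 hs)
  · intro h hn
    rcases le_or_gt (C.t₀ ω) (C.t n ω) with h1 | h1
    · exact Or.inl h1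
    · refine Or.inr ⟨h1, ?_⟩
      by_contra h2
      exact absurd (h hn (not_lt.1 h2)) (not_le.2 h1)

lemma veto_eq_zero_or_top (τ : ℝ × (ℕ → ℝ))
    (z : (SensedField → Config) × (SensedField → ℕ → ℝ)) : veto p τ z = 0 ∨ veto p τ z = ∞ := by
  unfold veto
  rcases topIfAny_eq_zero_or_top (Notices p z .station) with h1 | h1 <;>
  rcases topIfAny_eq_zero_or_top (Notices p z .user) with h2 | h2 <;>
  rcases topIfAny_eq_zero_or_top (fun n => Notices p z .contender n ∧ τ.2 n < τ.1)
    with h3 | h3 <;>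
  simp [h1, h2, h3]

/-- The veto takes only the values `0` and `∞`, so its exponential is the indicator of being
retained. -/
lemma measure_retained : Pr C.retained = ∫⁻ ω, eexp (veto p (C.timers ω) (C.surroundings ω)) ∂Pr := by
  have hm : AEMeasurable (fun ω => veto p (C.timers ω) (C.surroundings ω)) Pr :=
by
    simpa only [Function.comp_def] using (measurable_veto (p := p)
      measurable_fst measurable_snd).comp_aemeasurable
      (C.aemeasurable_timers.prodMk C.aemeasurable_surroundings)
  have hn : NullMeasurableSet C.retained Pr := by
    rw [retained_eq]
    exact hm.nullMeasurable (measurableSet_singleton (0 : ℝ≥0∞))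
  rw [← lintegral_indicator_one₀ hn]
  refine lintegral_congr fun ω => ?_
  rw [retained_eq]
  rcases veto_eq_zero_or_top (p := p) (C.timers ω) (C.surroundings ω) with h | h <;>
    simp [Set.indicator, h]

/-- Averaging over the timers of the contenders. -/
lemma lintegral_veto_timers {a : ℝ} (ha : a ∈ Set.Icc (0 : ℝ) 1)
    (z : (SensedField → Config) × (SensedField → ℕ → ℝ)) :
    ∫⁻ ω, eexp (veto p (a, fun n => C.t n ω) z) ∂Pr = eexp (vetoMean p a z) := by
  classical
  -- Small-cell transmitters have priority one: noticing is already a veto, whatever the timers.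
  have htop : negLog (1 - 1) = ∞ := by simp [negLog]
  have hmean : vetoMean p a z = topIfAny (Notices p z .station) + topIfAny (Notices p z .user)
      + ∑' n, if Notices p z .contender n then negLog (1 - a) else 0 := by
    unfold vetoMean
    rw [ENNReal.tsum_prod (f := fun j n => if Notices p z j n
      then negLog (1 - priority a j) else 0), tsum_fintype, sum_sensedField]
    simp only [priority, htop]
    rfl
  rw [hmean]
  unfold veto
  simp_rw [eexp_add]
  let A : ℕ → Prop := Notices p z .contender
  let g : ℕ → ℝ → ℝ≥0∞ := fun n s => @ite _ (A n ∧ s < a) (Classical.propDecidable _) ∞ 0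
  let X : ℕ → Ω → ℝ≥0∞ := fun n ω => g n (C.t n ω)
  have hg : ∀ n, Measurable (g n) := fun n =>
    Measurable.ite ((MeasurableSet.const _).inter measurableSet_Iio) measurable_const measurable_const
  have hX : ∀ n, AEMeasurable (X n) Pr := fun n => (hg n).comp_aemeasurable (C.t_law n).aemeasurable
  have key : ∫⁻ ω, eexp (∑' n, X n ω) ∂Pr = eexp (∑' n, if A n then negLog (1 - a) else 0) := by
    refine lintegral_eexp_tsum (X := X) (C.t_indep.comp _ hg) hX fun n => ?_
    by_cases hA : A n
    · rw [if_pos hA, eexp_negLog (by linarith [ha.1]), ← uniform_Iio ha, ← (C.t_law n).map_eq,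
        Measure.map_apply_of_aemeasurable (C.t_law n).aemeasurable measurableSet_Ici,
        ← lintegral_indicator_one₀ ((C.t_law n).aemeasurable.nullMeasurable measurableSet_Ici)]
      refine lintegral_congr fun ω => ?_
      by_cases h : C.t n ω < a
      · have h' : X n ω = ∞ := if_pos ⟨hA, h⟩
        rw [h', eexp_top, Set.indicator_of_notMem (by simpa using h)]
      · have h' : X n ω = 0 := if_neg fun h2 => h h2.2
        rw [h', eexp_zero, Set.indicator_of_mem (by simpa using h), Pi.one_apply]
    · have h' : ∀ ω, X n ω = 0 := fun ω => if_neg fun h2 => hA h2.1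
      simp [h', hA]
  rw [← key]
  have hs : AEMeasurable (fun ω => ∑' n, X n ω) Pr := AEMeasurable.tsum hX
  exact lintegral_const_mul'' (f := fun ω => eexp (∑' n, X n ω)) _
    (measurable_eexp.comp_aemeasurable hs)

open Classical in
/-- The exponent contributed by a transmitter at `x`. -/
noncomputable def csmaLoss (p : Params) (a : ℝ) (j : SensedField) (x : Plane) : ℝ≥0∞ :=
  if x = 0 then 0 else negLog (1 - priority a j * p.sense (threshold p j) x)

lemma threshold_pos (j : SensedField) : 0 < threshold p j := by
  cases j <;> simp only [threshold]
  exacts [p.ρs_pos, p.ρs_pos, p.ρd_pos]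

lemma priority_mem {a : ℝ} (ha : a ∈ Set.Icc (0 : ℝ) 1) (j : SensedField) :
    priority a j ∈ Set.Icc (0 : ℝ) 1 := by
  cases j <;> simp only [priority]
  exacts [⟨zero_le_one, le_rfl⟩, ⟨zero_le_one, le_rfl⟩, ha]

lemma measurable_csmaLoss (a : ℝ) (j : SensedField) : Measurable (csmaLoss p a j) := by
  unfold csmaLoss Params.sense
  refine Measurable.ite (measurableSet_singleton 0) measurable_const (measurable_negLog.comp ?_)
  fun_prop

/-- Averaging over the fading powers. -/
lemma lintegral_vetoMean_fading {a : ℝ} (ha : a ∈ Set.Icc (0 : ℝ) 1) (c : SensedField → Config) :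
    ∫⁻ ω, eexp (vetoMean p a (c, fun j n => C.h j n ω)) ∂Pr = eexp (famSum c (csmaLoss p a)) := by
  classical
  have e : famSum c (csmaLoss p a)
      = ∑' i : SensedField × ℕ, if (c i.1 i.2).1 = true then csmaLoss p a i.1 (c i.1 i.2).2 else 0 := by
    rw [ENNReal.tsum_prod (f := fun j n => if (c j n).1 = true then csmaLoss p a j (c j n).2 else 0),
      tsum_fintype]
    rfl
  rw [e]
  unfold vetoMean
  let g : SensedField × ℕ → ℝ → ℝ≥0∞ := fun i t =>
    @ite _ ((c i.1 i.2).1 = true ∧ Senses p i.1 (c i.1 i.2).2 t) (Classical.propDecidable _)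
      (negLog (1 - priority a i.1)) 0
  have hg : ∀ i, Measurable (g i) := fun i =>
    Measurable.ite ((MeasurableSet.const _).inter
      (measurableSet_senses measurable_const measurable_id i.1)) measurable_const measurable_const
  let X : SensedField × ℕ → Ω → ℝ≥0∞ := fun i ω => g i (C.h i.1 i.2 ω)
  have hX : ∀ i, AEMeasurable (X i) Pr := fun i =>
    (hg i).comp_aemeasurable (C.field.fading_law i.1 i.2).aemeasurable
  refine lintegral_eexp_tsum (X := X) (C.field.fading_indep.comp _ hg) hX ?_
  rintro ⟨j, n⟩
  dsimp only [X, g]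
  have hlaw := C.field.fading_law j n
  have hpr := priority_mem ha j
  by_cases hn : (c j n).1 = true
  swap
  · simp [hn]
  simp only [hn, true_and, if_true]
  have hth := threshold_pos (p := p) j
  have hQ := p.Qd_pos
  -- At the origin the received power is a division by zero, hence `0` and below the threshold;
  -- `csmaLoss` is set to zero there accordingly.
  by_cases hx : (c j n).2 = 0
  · have : ∀ ω, ¬ Senses p j (c j n).2 (C.h j n ω) := fun ω => by
      rw [Senses, hx, norm_zero, Real.zero_rpow p.α_pos.ne', div_zero, not_le]
      exact hth
    simp_rw [this]
    simp [csmaLoss, hx]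
  · have hx' : 0 < ‖(c j n).2‖ := norm_pos_iff.2 hx
    set k := p.sense (threshold p j) (c j n).2 with hk
    have hk0 : 0 < k := Real.exp_pos _
    have hk1 : k ≤ 1 := by
      rw [hk, Params.sense, Real.exp_le_one_iff]
      have : 0 ≤ threshold p j / p.Qd * ‖(c j n).2‖ ^ p.α := by positivity
      linarith
    have hiff : ∀ ω, Senses p j (c j n).2 (C.h j n ω) ↔
        ¬ C.h j n ω < threshold p j / p.Qd * ‖(c j n).2‖ ^ p.α := fun ω => by
      have : 0 < ‖(c j n).2‖ ^ p.α := by positivity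
      rw [Senses, not_lt, le_div_iff₀ this, div_mul_eq_mul_div, div_le_iff₀ hQ, mul_comm p.Qd]
    rw [csmaLoss, if_neg hx, eexp_negLog (by nlinarith [hpr.1])]
    have hset : Pr {ω | C.h j n ω < threshold p j / p.Qd * ‖(c j n).2‖ ^ p.α}
        = ENNReal.ofReal (1 - k) := by
      rw [hk, Params.sense, ← expMeasure_Iio (by positivity), ← hlaw.map_eq,
        Measure.map_apply_of_aemeasurable hlaw.aemeasurable measurableSet_Iio]
      rfl
    have hnull : NullMeasurableSet {ω | C.h j n ω < threshold p j / p.Qd * ‖(c j n).2‖ ^ p.α} Pr :=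
      hlaw.aemeasurable.nullMeasurable measurableSet_Iio
    -- The exponential is `1 - priority` if the point senses and `1` otherwise, an affine function
    -- of the indicator of not sensing. Its mean is `1 - priority * k`, where `k` is the sensing
    -- probability.
    have hfun : ∀ ω, eexp (if Senses p j (c j n).2 (C.h j n ω) then negLog (1 - priority a j) else 0)
        = ENNReal.ofReal (1 - priority a j) + ENNReal.ofReal (priority a j) *
          {ω | C.h j n ω < threshold p j / p.Qd * ‖(c j n).2‖ ^ p.α}.indicator 1 ω := by
      intro ω
      by_cases h : C.h j n ω < threshold p j / p.Qd * ‖(c j n).2‖ ^ p.α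
      · rw [if_neg (by rw [hiff]; exact not_not.2 h), Set.indicator_of_mem (by exact h), Pi.one_apply,
          mul_one, ← ENNReal.ofReal_add (by linarith [hpr.2]) hpr.1]
        simp
      · rw [if_pos ((hiff ω).2 h), Set.indicator_of_notMem (by exact h), mul_zero, add_zero,
          eexp_negLog (by linarith [hpr.1])]
    simp_rw [hfun]
    rw [lintegral_add_left measurable_const, lintegral_const, measure_univ, mul_one,
      lintegral_const_mul' _ _ ENNReal.ofReal_ne_top, lintegral_indicator_one₀ hnull, hset,
      ← ENNReal.ofReal_mul hpr.1, ← ENNReal.ofReal_add (by linarith [hpr.2])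
        (mul_nonneg hpr.1 (by linarith))]
    congr 1
    ring

lemma lintegral_csmaLoss {a : ℝ} (ha : a ∈ Set.Icc (0 : ℝ) 1) (j : SensedField) :
    ∫⁻ x, (1 - eexp (csmaLoss p a j x))
      = ENNReal.ofReal (priority a j * p.Kconst (threshold p j)) := by
  have hpr := priority_mem ha j
  rw [ENNReal.ofReal_mul hpr.1, ← p.lintegral_sense (threshold_pos j),
    ← lintegral_const_mul' _ _ ENNReal.ofReal_ne_top]
  refine lintegral_congr_ae ?_
  have : ∀ᵐ x : Plane, x ≠ 0 := by simp [ae_iff, measure_singleton]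
  filter_upwards [this] with x hx
  have hk0 : 0 < p.sense (threshold p j) x := Real.exp_pos _
  have hk1 : p.sense (threshold p j) x ≤ 1 := by
    rw [Params.sense, Real.exp_le_one_iff]
    have := threshold_pos (p := p) j
    have := p.Qd_pos
    have : 0 ≤ threshold p j / p.Qd * ‖x‖ ^ p.α := by positivity
    linarith
  have h1 : 0 ≤ priority a j * p.sense (threshold p j) x := mul_nonneg hpr.1 hk0.le
  have h2 : priority a j * p.sense (threshold p j) x ≤ 1 := mul_le_one₀ hpr.2 hk0.le hk1
  rw [csmaLoss, if_neg hx, eexp_negLog (by linarith), ← ENNReal.ofReal_mul hpr.1,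
    ← ENNReal.ofReal_one, ← ENNReal.ofReal_sub _ (by linarith)]
  congr 1
  ring

lemma sensedDens_nonneg (j : SensedField) : 0 ≤ p.sensedDens j := by
  cases j <;> simp only [Params.sensedDens]
  exacts [p.densD_nonneg _, p.densU_nonneg _, mul_nonneg p.ζ_mem.1 p.lamU_pos.le]

/-- The retaining probability for a given timer. -/
lemma lintegral_vetoMean {a : ℝ} (ha : a ∈ Set.Icc (0 : ℝ) 1) :
    ∫⁻ ω, eexp (vetoMean p a (C.surroundings ω)) ∂Pr
      = ENNReal.ofReal (Real.exp (-((p.lamD .sap + p.lamT .sap) * p.Kconst p.ρs)) *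
          Real.exp (-(p.ζ * p.lamU * p.Kconst p.ρd) * a)) := by
  have hm : Measurable (Function.uncurry fun (c : SensedField → Config)
      (h : SensedField → ℕ → ℝ) => eexp (vetoMean p a (c, h))) :=
    measurable_eexp.comp (measurable_vetoMean measurable_const measurable_id)
  have h1 := lintegral_of_indepFun C.field.measurable_points.aemeasurable C.field.aemeasurable_fading
    C.field.points_fading_indep hm
  refine h1.trans ?_
  simp_rw [C.lintegral_vetoMean_fading ha]
  rw [(C.field.family sensedDens_nonneg).laplace (measurable_csmaLoss a)]
  unfold laplaceExponent
  simp_rw [lintegral_csmaLoss ha, ← ENNReal.ofReal_mul (sensedDens_nonneg _)]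
  have hnn : ∀ j ∈ (Finset.univ : Finset SensedField),
      0 ≤ p.sensedDens j * (priority a j * p.Kconst (threshold p j)) := fun j _ =>
    mul_nonneg (sensedDens_nonneg j)
      (mul_nonneg (priority_mem ha j).1 (p.Kconst_pos (threshold_pos j)).le)
  rw [← ENNReal.ofReal_sum_of_nonneg hnn, eexp_ofReal (Finset.sum_nonneg hnn), sum_sensedField,
    ← Real.exp_add]
  simp only [Params.sensedDens, priority, threshold, p.densD_eq, p.densU_eq]
  congr 2
  ring

lemma ae_timer_mem : ∀ᵐ ω ∂Pr, C.t₀ ω ∈ Set.Icc (0 : ℝ) 1 := by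
  have h := ae_restrict_mem (μ := (volume : Measure ℝ)) (measurableSet_Icc (a := (0 : ℝ)) (b := 1))
  rw [← C.t₀_law.map_eq] at h
  exact ae_of_ae_map C.t₀_law.aemeasurable h

/-- The order of averaging matters. With the surroundings frozen, the timers of the contenders are
averaged for each value of the own timer. Then the own timer is moved outside, and fading and points
are averaged with it fixed. -/
lemma measure_retained_eq : Pr C.retained
    = ∫⁻ a in Set.Icc (0 : ℝ) 1, ENNReal.ofReal
        (Real.exp (-((p.lamD .sap + p.lamT .sap) * p.Kconst p.ρs)) *
          Real.exp (-(p.ζ * p.lamU * p.Kconst p.ρd) * a)) := by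
  have hmem := C.ae_timer_mem
  have hmean : Measurable (Function.uncurry fun (a : ℝ)
      (z : (SensedField → Config) × (SensedField → ℕ → ℝ)) => eexp (vetoMean p a z)) :=
    measurable_eexp.comp (measurable_vetoMean measurable_fst measurable_snd)
  have hveto : Measurable (Function.uncurry fun z τ => eexp (veto p τ z)) :=
    measurable_eexp.comp (measurable_veto measurable_snd measurable_fst)
  have hind : IndepFun C.t₀ C.surroundings Pr :=
    C.timers_indep.comp (φ := Prod.fst) (ψ := id) measurable_fst measurable_id
  have h1 := lintegral_of_indepFun C.aemeasurable_surroundings C.aemeasurable_timers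
    C.timers_indep.symm hveto
  have h2 : ∀ z, ∫⁻ ω, eexp (veto p (C.timers ω) z) ∂Pr
      = ∫⁻ ω, eexp (vetoMean p (C.t₀ ω) z) ∂Pr := by
    intro z
    have hz : Measurable (Function.uncurry fun (a : ℝ) (t : ℕ → ℝ) => eexp (veto p (a, t) z)) :=
      measurable_eexp.comp (measurable_veto measurable_id measurable_const)
    refine (lintegral_of_indepFun C.t₀_law.aemeasurable C.aemeasurable_t C.t₀_t_indep hz).trans ?_
    refine lintegral_congr_ae ?_
    filter_upwards [hmem] with ω hω
    exact C.lintegral_veto_timers hω z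
  have h3 := lintegral_of_indepFun C.aemeasurable_surroundings C.t₀_law.aemeasurable hind.symm
    (F := fun z a => eexp (vetoMean p a z)) (hmean.comp measurable_swap)
  have h4 := lintegral_of_indepFun C.t₀_law.aemeasurable C.aemeasurable_surroundings hind hmean
  rw [C.measure_retained, h1]
  simp_rw [h2]
  rw [← h3, h4, ← C.t₀_law.map_eq, lintegral_map' (by fun_prop) C.t₀_law.aemeasurable]
  refine lintegral_congr_ae ?_
  filter_upwards [hmem] with ω hω
  exact C.lintegral_vetoMean hω

/-- The density of the active D2D transmitters in closed form. -/
lemma activeDens_eq : C.activeDens = p.lamd := by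
  unfold activeDens Params.lamd
  set A := Real.exp (-((p.lamD .sap + p.lamT .sap) * p.Kconst p.ρs)) with hA
  have hK := p.Kconst_pos p.ρd_pos
  have hAp : 0 < A := Real.exp_pos _
  rcases p.ζ_mem.1.eq_or_lt with h0 | h0
  -- Without potential transmitters both densities vanish. Otherwise `B > 0`, and `∫ e^(-B a) da`
  -- over `[0, 1]` is `(1 - e^(-B)) / B`.
  · simp [← h0]
  have hB : 0 < p.ζ * p.lamU * p.Kconst p.ρd := mul_pos (mul_pos h0 p.lamU_pos) hK
  set B := p.ζ * p.lamU * p.Kconst p.ρd with hBdef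
  have hcont : Continuous fun a : ℝ => A * Real.exp (-B * a) := by fun_prop
  have hint : ∫ a in (0 : ℝ)..1, A * Real.exp (-B * a) = A * ((1 - Real.exp (-B)) / B) := by
    rw [intervalIntegral.integral_const_mul,
      intervalIntegral.integral_comp_mul_left (fun x => Real.exp x) (neg_ne_zero.2 hB.ne'),
      integral_exp]
    simp only [mul_zero, mul_one, Real.exp_zero, smul_eq_mul]
    field_simp
    ring
  have hret : Pr.real C.retained = A * ((1 - Real.exp (-B)) / B) := by
    rw [measureReal_def, C.measure_retained_eq, ← hint,
      intervalIntegral.integral_of_le zero_le_one, ← integral_Icc_eq_integral_Ioc,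
      integral_eq_lintegral_of_nonneg_ae (ae_of_all _ fun a => by positivity)
        hcont.aestronglyMeasurable]
  rw [hret, hBdef]
  have h1 := p.lamU_pos
  field_simp

end Contention

/-! ## Coverage probabilities in closed form -/

lemma lintegral_comp_norm_sq {k : ℝ → ℝ≥0∞} (hk : Measurable k) :
    ∫⁻ x : Plane, k (‖x‖ ^ 2) = ENNReal.ofReal Real.pi * ∫⁻ v in Set.Ioi 0, k v := by
  have himg : (fun ρ : ℝ => ρ ^ 2) '' Set.Ioi 0 = Set.Ioi 0 := by
    ext v
    constructor
    · rintro ⟨ρ, hρ, rfl⟩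
      have : (0 : ℝ) < ρ := hρ
      exact pow_pos this 2
    · intro hv
      exact ⟨√v, Real.sqrt_pos.2 hv, Real.sq_sqrt (le_of_lt hv)⟩
  have h1 := lintegral_image_eq_lintegral_abs_deriv_mul measurableSet_Ioi
    (f := fun ρ : ℝ => ρ ^ 2) (f' := fun ρ => 2 * ρ) (s := Set.Ioi 0)
    (fun ρ _ => by simpa using (hasDerivAt_pow 2 ρ).hasDerivWithinAt)
    (fun a ha b hb h => by
      have ha' : (0 : ℝ) ≤ a := le_of_lt ha
      have hb' : (0 : ℝ) ≤ b := le_of_lt hb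
      exact (pow_left_inj₀ ha' hb' two_ne_zero).1 h) k
  rw [himg] at h1
  have h2 : ∫⁻ ρ in Set.Ioi (0 : ℝ), ENNReal.ofReal |2 * ρ| * k (ρ ^ 2)
      = 2 * ∫⁻ ρ in Set.Ioi (0 : ℝ), ENNReal.ofReal ρ * k (ρ ^ 2) := by
    rw [← lintegral_const_mul' _ _ (by simp)]
    refine setLIntegral_congr_fun measurableSet_Ioi fun ρ hρ => ?_
    have hρ' : (0 : ℝ) < ρ := hρ
    rw [abs_of_pos (by positivity), ENNReal.ofReal_mul (by norm_num), ENNReal.ofReal_ofNat, mul_assoc]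
  rw [lintegral_comp_norm (k := fun ρ => k (ρ ^ 2)) (by fun_prop), h1, h2]
  ring

namespace Params

variable (p : Params)

lemma laplaceShort_eq {s r : ℝ} (h : r ≤ p.ιs) :
    p.laplaceShort s r = Real.exp (-(p.lamd * p.ballCoef s p.Qd p.ιs r)) := by
  rw [laplaceShort, laplaceOut, ballCoef, if_pos h, ← Real.exp_add]
  congr 1
  ring

lemma laplaceLong_eq {s r : ℝ} (h : p.ιs < r) :
    p.laplaceLong s r = Real.exp (-(p.lamd * p.ballCoef s p.Qd p.ιs r)) := by
  rw [laplaceLong, laplaceOut, ballCoef, if_neg (not_le.2 h), ← Real.exp_add, Θ]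
  congr 1
  ring

/-- The exponent of the interferers outside a ball, as a function of the length of the link that is
measurable everywhere. -/
noncomputable def ballExp (c l r : ℝ) : ℝ≥0∞ :=
  ∫⁻ x : Plane, {z : ℝ × Plane | l ≤ dist z.2 (EuclideanSpace.single 0 z.1)}.indicator
    (fun z => ENNReal.ofReal (kern p.α ((c * z.1 ^ p.α * p.Qd) ^ (2 / p.α)) ‖z.2‖)) (r, x)

lemma measurable_ballExp (c l : ℝ) : Measurable (p.ballExp c l) := by
  unfold ballExp
  refine Measurable.lintegral_prod_right' (f := {z : ℝ × Plane | l ≤ dist z.2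
    (EuclideanSpace.single 0 z.1)}.indicator
    (fun z => ENNReal.ofReal (kern p.α ((c * z.1 ^ p.α * p.Qd) ^ (2 / p.α)) ‖z.2‖))) ?_
  refine Measurable.indicator ?_ ?_
  · unfold kern
    fun_prop
  · have h1 : Measurable fun z : ℝ × Plane => (EuclideanSpace.single 0 z.1 : Plane) := by
      have : Continuous fun t : ℝ => (EuclideanSpace.single 0 t : Plane) := by
        have h : Isometry fun t : ℝ => (EuclideanSpace.single 0 t : Plane) :=
          Isometry.of_dist_eq fun a b => by simp
        exact h.continuous
      exact this.measurable.comp measurable_fst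
    exact measurableSet_le measurable_const (measurable_snd.dist h1)

/-- Placing the centre at distance `r` on a fixed axis writes the coefficient as a parametric
integral. Measurability in `r` comes for free that way and need not be read off the piecewise closed
form. -/
lemma ballExp_eq {c l r : ℝ} (hc : 0 < c) (hl : 0 < l) (hr : 0 < r) :
    p.ballExp c l r = ENNReal.ofReal (p.ballCoef (c * r ^ p.α) p.Qd l r) := by
  have hsQ : 0 < c * r ^ p.α * p.Qd := by have := p.Qd_pos; positivity
  have hn : ‖(EuclideanSpace.single 0 r : Plane)‖ = r := by simp [abs_of_pos hr]
  have h := p.lintegral_kern_compl_ball hsQ hl (EuclideanSpace.single 0 r)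
  rw [hn] at h
  rw [← h, ← lintegral_indicator Metric.isOpen_ball.measurableSet.compl, ballExp]
  refine lintegral_congr fun x => ?_
  by_cases hx : l ≤ dist x (EuclideanSpace.single 0 r)
  · rw [Set.indicator_of_mem (by exact hx), Set.indicator_of_mem (by simpa using hx)]
  · rw [Set.indicator_of_notMem (by exact hx), Set.indicator_of_notMem (by simpa using hx)]

/-- The coverage integral of the small-cell tier. -/
lemma lintegral_small {γ P E : ℝ} (hγ : 0 < γ) (hP : 0 < P) (hE : 0 < E) {G : Plane → ℝ≥0∞}
    (hG : ∀ y, y ≠ 0 →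
      G y = ENNReal.ofReal (p.lamd * p.ballCoef (γ * ‖y‖ ^ p.α / P) p.Qd p.ιs ‖y‖)) :
    ∫⁻ y, eexp (G y) * eexp (ENNReal.ofReal (Real.pi * E * ‖y‖ ^ 2))
      = ENNReal.ofReal (Real.pi *
        ((∫ v in (0 : ℝ)..(p.ιs ^ 2), Real.exp (-(Real.pi * v * E)) *
            p.laplaceShort (γ * v ^ (p.α / 2) / P) (√v))
          + ∫ v in Set.Ioi (p.ιs ^ 2), Real.exp (-(Real.pi * v * E)) *
            p.laplaceLong (γ * v ^ (p.α / 2) / P) (√v))) ∧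
    0 ≤ (∫ v in (0 : ℝ)..(p.ιs ^ 2), Real.exp (-(Real.pi * v * E)) *
            p.laplaceShort (γ * v ^ (p.α / 2) / P) (√v))
          + ∫ v in Set.Ioi (p.ιs ^ 2), Real.exp (-(Real.pi * v * E)) *
            p.laplaceLong (γ * v ^ (p.α / 2) / P) (√v) := by
  have hι := p.ιs_pos
  have hα := p.α_pos
  have hc : 0 < γ / P := div_pos hγ hP
  have hl := p.lamd_nonneg
  let k : ℝ → ℝ≥0∞ := fun v => eexp (ENNReal.ofReal p.lamd * p.ballExp (γ / P) p.ιs (√v)) *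
    eexp (ENNReal.ofReal (Real.pi * E * v))
  have hk : Measurable k := by
    have := (p.measurable_ballExp (γ / P) p.ιs).comp (Real.continuous_sqrt.measurable)
    exact (measurable_eexp.comp (this.const_mul _)).mul (by fun_prop)
  have hkle : ∀ v, k v ≤ eexp (ENNReal.ofReal (Real.pi * E * v)) := fun v =>
    mul_le_of_le_one_left zero_le (eexp_le_one _)
  have hsqrt : ∀ v, 0 < v → (√v) ^ p.α = v ^ (p.α / 2) := fun v hv => by
    rw [Real.sqrt_eq_rpow, ← Real.rpow_mul hv.le]
    ring_nf
  have hkv : ∀ v, 0 < v → k v = ENNReal.ofReal (Real.exp (-(Real.pi * v * E)) *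
      Real.exp (-(p.lamd * p.ballCoef (γ * v ^ (p.α / 2) / P) p.Qd p.ιs (√v)))) := by
    intro v hv
    have hs : 0 < √v := Real.sqrt_pos.2 hv
    have hs' : 0 < γ / P * √v ^ p.α * p.Qd := by have := p.Qd_pos; positivity
    have e : γ / P * √v ^ p.α = γ * v ^ (p.α / 2) / P := by rw [hsqrt v hv]; ring
    have hb := p.ballCoef_pos hs' hι hs.le
    simp only [k]
    rw [p.ballExp_eq hc hι hs, ← ENNReal.ofReal_mul hl, eexp_ofReal (mul_nonneg hl hb.le),
      eexp_ofReal (by positivity), ← ENNReal.ofReal_mul (Real.exp_pos _).le, e, mul_comm]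
    congr 3
    ring
  have hstart : ∫⁻ y, eexp (G y) * eexp (ENNReal.ofReal (Real.pi * E * ‖y‖ ^ 2))
      = ∫⁻ y : Plane, k (‖y‖ ^ 2) := by
    refine lintegral_congr_ae ?_
    have : ∀ᵐ y : Plane, y ≠ 0 := by simp [ae_iff, measure_singleton]
    filter_upwards [this] with y hy
    have hy' : 0 < ‖y‖ := norm_pos_iff.2 hy
    simp only [k]
    rw [hG y hy, Real.sqrt_sq hy'.le, p.ballExp_eq hc hι hy', ← ENNReal.ofReal_mul hl,
      mul_div_right_comm]
  -- The D2D factor is at most one, so the integral is bounded by the Gaussian one.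
  have hfin : ∫⁻ v in Set.Ioi (0 : ℝ), k v ≠ ∞ := by
    have h1 : ENNReal.ofReal Real.pi * ∫⁻ v in Set.Ioi (0 : ℝ), k v ≠ ∞ := by
      rw [← lintegral_comp_norm_sq hk]
      refine ne_top_of_le_ne_top ?_ (lintegral_mono fun y : Plane => hkle (‖y‖ ^ 2))
      rw [lintegral_eexp_mul_norm_sq (by positivity)]
      exact ENNReal.ofReal_ne_top
    intro h
    rw [h, ENNReal.mul_top (by simpa using Real.pi_pos)] at h1
    exact h1 rfl
  -- On `S` the real integrand is the real part of the measurable function `k`, from which it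
  -- inherits measurability and integrability.
  have hpiece : ∀ (S : Set ℝ) (_ : MeasurableSet S) (_ : ∀ v ∈ S, 0 < v) (f : ℝ → ℝ)
      (_ : ∀ v ∈ S, f v = Real.exp (-(Real.pi * v * E)) *
        Real.exp (-(p.lamd * p.ballCoef (γ * v ^ (p.α / 2) / P) p.Qd p.ιs (√v)))),
      ∫⁻ v in S, k v = ENNReal.ofReal (∫ v in S, f v) ∧ 0 ≤ ∫ v in S, f v := by
    intro S hS hS0 f hf
    have hfk : ∀ v ∈ S, k v = ENNReal.ofReal (f v) := fun v hv => by rw [hkv v (hS0 v hv), hf v hv]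
    have hf0 : ∀ v ∈ S, 0 ≤ f v := fun v hv => by rw [hf v hv]; positivity
    have hf0' : 0 ≤ᵐ[volume.restrict S] f := by
      filter_upwards [self_mem_ae_restrict hS] with v hv using hf0 v hv
    have hmeas : AEStronglyMeasurable f (volume.restrict S) := by
      refine hk.ennreal_toReal.aestronglyMeasurable.congr ?_
      filter_upwards [self_mem_ae_restrict hS] with v hv
      rw [hfk v hv, ENNReal.toReal_ofReal (hf0 v hv)]
    have hfS : ∫⁻ v in S, k v ≠ ∞ := ne_top_of_le_ne_top hfin
      (lintegral_mono_set fun v hv => hS0 v hv)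
    have hint : Integrable f (volume.restrict S) := by
      refine ⟨hmeas, ?_⟩
      rw [hasFiniteIntegral_iff_ofReal hf0', ← setLIntegral_congr_fun hS hfk]
      exact hfS.lt_top
    refine ⟨?_, setIntegral_nonneg hS hf0⟩
    rw [setLIntegral_congr_fun hS hfk, ofReal_integral_eq_lintegral_ofReal hint hf0']
  have hsplit : Set.Ioi (0 : ℝ) = Set.Ioc 0 (p.ιs ^ 2) ∪ Set.Ioi (p.ιs ^ 2) :=
    (Set.Ioc_union_Ioi_eq_Ioi (by positivity)).symm
  obtain ⟨h1, h1'⟩ := hpiece (Set.Ioc 0 (p.ιs ^ 2)) measurableSet_Ioc (fun v hv => hv.1)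
    (fun v => Real.exp (-(Real.pi * v * E)) * p.laplaceShort (γ * v ^ (p.α / 2) / P) (√v))
    (fun v hv => by
      rw [p.laplaceShort_eq]
      exact Real.sqrt_le_iff.2 ⟨hι.le, hv.2⟩)
  obtain ⟨h2, h2'⟩ := hpiece (Set.Ioi (p.ιs ^ 2)) measurableSet_Ioi
    (fun v hv => lt_trans (by positivity) hv)
    (fun v => Real.exp (-(Real.pi * v * E)) * p.laplaceLong (γ * v ^ (p.α / 2) / P) (√v))
    (fun v hv => by
      rw [p.laplaceLong_eq]
      exact (Real.lt_sqrt hι.le).2 hv)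
  rw [hstart, lintegral_comp_norm_sq hk, hsplit, lintegral_union measurableSet_Ioi
    (Set.disjoint_left.2 fun v hv hv' => not_lt.2 hv.2 hv'), h1, h2,
    intervalIntegral.integral_of_le (by positivity), ← ENNReal.ofReal_add h1' h2',
    ← ENNReal.ofReal_mul Real.pi_pos.le]
  exact ⟨rfl, add_nonneg h1' h2'⟩

lemma Cconst_nonneg : 0 ≤ p.Cconst := by
  rw [Cconst, ← integral_kernel_Ioi p.two_lt_α]
  exact setIntegral_nonneg measurableSet_Ioi fun u hu => kernel_nonneg (le_of_lt hu)

/-- At the Laplace argument `γ r ^ α / P` of a link of length `r`, interferers filling the plane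
contribute quadratically in `r`. -/
lemma rpow_link_mul {γ a P r : ℝ} (hγ : 0 ≤ γ) (ha : 0 ≤ a) (hP : 0 < P) (hr : 0 ≤ r) :
    (γ * r ^ p.α / P * a) ^ (2 / p.α) = (a / P * γ) ^ (2 / p.α) * r ^ 2 := by
  have e2 : γ * r ^ p.α / P * a = a / P * γ * r ^ p.α := by ring
  have e3 : (r ^ p.α) ^ (2 / p.α) = r ^ 2 := by
    rw [← Real.rpow_mul hr, mul_div_cancel₀ _ p.α_pos.ne']
    exact_mod_cast Real.rpow_natCast r 2
  rw [e2, Real.mul_rpow (by positivity) (by positivity), e3]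

/-- The power of the D2D interferers in the band of tier `i`. -/
def d2dPower : Tier → ℝ
  | .mbs => 0
  | .sap => p.Qd

lemma d2dPower_nonneg (i : Tier) : 0 ≤ p.d2dPower i := by
  cases i
  exacts [le_rfl, p.Qd_pos.le]

/-- The exponent of the D2D interferers in the band of tier `i`. -/
noncomputable def d2dExp (lamd : ℝ) (i : Tier) (s r : ℝ) : ℝ≥0∞ :=
  match i with
  | .mbs => 0
  | .sap => ENNReal.ofReal (lamd * p.ballCoef s p.Qd p.ιs r)

lemma mul_lintegral_fadingLoss_d2d {J : Type} [Fintype J] {lamd : ℝ} (hl : 0 ≤ lamd) {i : Tier} {s : ℝ}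
    (hs : 0 < s) {pw : J → ℝ} {Ex : J → Set Plane} {y b : Plane} {j : J} (hpw : pw j = p.d2dPower i)
    (hEx : Ex j = Metric.ball b p.ιs) :
    ENNReal.ofReal lamd * ∫⁻ x, (1 - eexp (fadingLoss p.α s pw Ex y j x))
      = p.d2dExp lamd i s ‖b - y‖ := by
  cases i with
  | mbs => rw [lintegral_fadingLoss_of_eq_zero (by rw [hpw]; exact mul_zero _), mul_zero]; rfl
  | sap =>
    rw [p.lintegral_fadingLoss_ball (by rw [hpw]; exact mul_pos hs p.Qd_pos) p.ιs_pos hEx, hpw,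
      ← ENNReal.ofReal_mul hl]
    rfl

/-- The Laplace transform of the D2D interference outside a ball. -/
theorem integral_expNeg_interference {J : Type} [Fintype J] {Ω : Type*} [MeasurableSpace Ω]
    {Pr : Measure Ω} [IsProbabilityMeasure Pr] {d : J → ℝ} {Φ : J → Ω → Config}
    {h : J → ℕ → Ω → ℝ} (H : IsRayleighField Pr d Φ h) (hd : ∀ j, 0 ≤ d j) {j : J}
    (hj : d j = p.lamd) {s : ℝ} (hs : 0 < s) (y b : Plane) :
    ∫ ω, expNeg (ENNReal.ofReal s * interference p.α p.Qd (Φ j ω) (fun n => h j n ω)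
        (Metric.ball b p.ιs) y) ∂Pr
      = if ‖b - y‖ ≤ p.ιs then p.laplaceShort s ‖b - y‖ else p.laplaceLong s ‖b - y‖ := by
  classical
  -- All other fields are silenced, so the Laplace transform of the total interference becomes that
  -- of field `j`.
  let pw : J → ℝ := Pi.single j p.Qd
  have hpw : ∀ k, 0 ≤ pw k := fun k => by
    by_cases hk : k = j
    · subst hk; simpa [pw] using p.Qd_pos.le
    · simp [pw, hk]
  let Ex : J → Set Plane := fun _ => Metric.ball b p.ιs
  have hEx : ∀ k, MeasurableSet (Ex k) := fun _ => Metric.isOpen_ball.measurableSet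
  have hI : ∀ ω, famInterf p.α pw Ex y (fun j => Φ j ω) (fun j n => h j n ω)
      = interference p.α p.Qd (Φ j ω) (fun n => h j n ω) (Metric.ball b p.ιs) y := fun ω => by
    rw [famInterf, Finset.sum_eq_single j (fun k _ hk => by simp [pw, hk]) (by simp)]
    simp [pw, Ex]
  have hm : AEMeasurable (fun ω => famInterf p.α pw Ex y (fun j => Φ j ω) (fun j n => h j n ω)) Pr :=
    (measurable_famInterf_param (X := (J → Config) × (J → ℕ → ℝ)) (α := p.α) (pw := pw)
      (c := Prod.fst) (h := Prod.snd) (Ex := fun _ => Ex) (y := fun _ => y) measurable_fst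
      measurable_snd (fun k => (hEx k).preimage measurable_snd) measurable_const).comp_aemeasurable
      (H.measurable_points.aemeasurable.prodMk H.aemeasurable_fading)
  have hb := p.ballCoef_pos (s := s) (mul_pos hs p.Qd_pos) p.ιs_pos (norm_nonneg (b - y))
  have hl := p.lamd_nonneg
  have hL : ∫⁻ ω, eexp (ENNReal.ofReal s * interference p.α p.Qd (Φ j ω) (fun n => h j n ω)
      (Metric.ball b p.ιs) y) ∂Pr
      = ENNReal.ofReal (Real.exp (-(p.lamd * p.ballCoef s p.Qd p.ιs ‖b - y‖))) := by
    have h1 := H.laplace_famInterf hd hpw hs.le hEx (α := p.α) y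
    simp only [hI] at h1
    rw [h1, laplaceExponent, Finset.sum_eq_single j
      (fun k _ hk => by rw [lintegral_fadingLoss_of_eq_zero (by simp [pw, hk]), mul_zero]) (by simp),
      hj, p.mul_lintegral_fadingLoss_d2d hl (i := .sap) hs (pw := pw) (Ex := Ex) (b := b)
        (by simp [pw, d2dPower]) rfl, d2dExp,
      eexp_ofReal (by positivity)]
  have hnn : ∀ x, 0 ≤ expNeg x := fun x => by unfold expNeg; split_ifs <;> positivity
  have htr : ∀ x, expNeg x = (eexp x).toReal := fun x => by
    rw [eexp_eq, ENNReal.toReal_ofReal (hnn x)]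
  simp only [hI] at hm
  rw [integral_eq_lintegral_of_nonneg_ae (Eventually.of_forall fun ω => hnn _)]
  · simp only [← eexp_eq]
    rw [hL, ENNReal.toReal_ofReal (Real.exp_pos _).le]
    split_ifs with hle
    · rw [p.laplaceShort_eq hle]
    · rw [p.laplaceLong_eq (not_le.1 hle)]
  · simp only [htr]
    exact ((measurable_eexp.comp_aemeasurable (hm.const_mul _)).ennreal_toReal).aestronglyMeasurable

lemma lintegral_small_d2dExp {γ P E : ℝ} (hγ : 0 < γ) (hP : 0 < P) (hE : 0 < E) :
    (∫⁻ y : Plane, eexp (p.d2dExp p.lamd .sap (γ * ‖y‖ ^ p.α / P) ‖y‖) *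
      eexp (ENNReal.ofReal (Real.pi * E * ‖y‖ ^ 2))).toReal
      = Real.pi *
        ((∫ v in (0 : ℝ)..(p.ιs ^ 2), Real.exp (-(Real.pi * v * E)) *
            p.laplaceShort (γ * v ^ (p.α / 2) / P) (√v))
          + ∫ v in Set.Ioi (p.ιs ^ 2), Real.exp (-(Real.pi * v * E)) *
            p.laplaceLong (γ * v ^ (p.α / 2) / P) (√v)) := by
  obtain ⟨h1, h2⟩ := p.lintegral_small hγ hP hE
    (G := fun y => p.d2dExp p.lamd .sap (γ * ‖y‖ ^ p.α / P) ‖y‖) fun y _ => rfl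
  rw [h1, ENNReal.toReal_ofReal (mul_nonneg Real.pi_pos.le h2)]

end Params

/-! ### Conditioning on the serving tier. -/

section Conditioning

variable {Ω : Type*} [MeasurableSpace Ω] {Pr : Measure Ω} [IsProbabilityMeasure Pr]

/-- Inclusion of `B` in `A` replaces the measurability of `A`, which is not at hand for the
association events. -/
lemma cond_real_of_subset {A B : Set Ω} (h : B ⊆ A) :
    (ProbabilityTheory.cond Pr A).real B = Pr.real B / Pr.real A := by
  rw [measureReal_def, ProbabilityTheory.cond, Measure.smul_apply, Measure.restrict_eq_self _ h,
    smul_eq_mul, ENNReal.toReal_mul, ENNReal.toReal_inv, div_eq_inv_mul]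
  rfl

lemma cond_real_mul_of_subset {A B : Set Ω} (h : B ⊆ A) :
    (ProbabilityTheory.cond Pr A).real B * Pr.real A = Pr.real B := by
  rw [cond_real_of_subset h]
  -- If the conditioning event is null, so is `B`, and both sides are zero.
  by_cases hA : Pr.real A = 0
  · have : Pr.real B = 0 := le_antisymm (hA ▸ measureReal_mono h) measureReal_nonneg
    rw [this, zero_div, zero_mul]
  · rw [div_mul_cancel₀ _ hA]

/-- Almost surely the typical user is not associated with two tiers. -/
lemma ServeRule.ae_not_serves {J : Type} [Fintype J] {d : J → ℝ} {Φ : J → Ω → Config}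
    (H : IsPoissonFamily Pr d Φ) (M N : ServeRule J) (hne : N.i ≠ M.i) (htier : N.tier = M.tier)
    (hw : N.w = M.w) (hα : N.α = M.α) :
    ∀ᵐ ω ∂Pr, ¬ ((∃ y, M.Serves y fun j => Φ j ω) ∧ ∃ x, N.Serves x fun j => Φ j ω) := by
  filter_upwards [M.ae_generic H] with ω hω
  rintro ⟨⟨y, hy⟩, x, hx⟩
  have hst : ∀ k, N.stations k = M.stations k := fun k => by
    funext c
    simp only [ServeRule.stations, htier]
  have h1 := hω.lt_of_serves hy hne (x := x) (by rw [← hst]; exact hx.1)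
  have h2 := hx.2 M.i y (by rw [hst]; exact hy.1)
  rw [hw, hα] at h2
  exact absurd h1 (not_lt.2 h2)

lemma measureReal_iUnion_tier {A B : Tier → Set Ω} (h : ∀ i, B i ⊆ A i)
    (hB : ∀ i, NullMeasurableSet (B i) Pr) (hd : ∀ᵐ ω ∂Pr, ¬ (ω ∈ A .mbs ∧ ω ∈ A .sap)) :
    Pr.real (⋃ i, B i) = (ProbabilityTheory.cond Pr (A .mbs)).real (B .mbs) * Pr.real (A .mbs)
      + (ProbabilityTheory.cond Pr (A .sap)).real (B .sap) * Pr.real (A .sap) := by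
  have hU : ⋃ i, B i = B .mbs ∪ B .sap := by
    ext ω
    simp only [Set.mem_iUnion, Set.mem_union]
    constructor
    · rintro ⟨i, hi⟩
      cases i
      exacts [Or.inl hi, Or.inr hi]
    · rintro (hi | hi)
      exacts [⟨_, hi⟩, ⟨_, hi⟩]
  have hdis : AEDisjoint Pr (B .mbs) (B .sap) := by
    rw [AEDisjoint, measure_eq_zero_iff_ae_notMem]
    filter_upwards [hd] with ω hω h2
    exact hω ⟨h _ h2.1, h _ h2.2⟩
  rw [hU, cond_real_mul_of_subset (h _), cond_real_mul_of_subset (h _), measureReal_def,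
    measure_union₀ (hB _) hdis, ENNReal.toReal_add (measure_ne_top _ _) (measure_ne_top _ _)]
  rfl

end Conditioning

/-! ## The downlink -/

instance : Fintype DownField :=
  ⟨⟨([.active .mbs, .active .sap, .idle .mbs, .idle .sap, .user .mbs, .user .sap, .d2d] :
    List DownField), by simp⟩, fun j => by rcases j with (_ | _) | (_ | _) | (_ | _) | _ <;> simp⟩

lemma sum_downField {A : Type*} [AddCommMonoid A] (f : DownField → A) :
    ∑ j, f j = f (.active .mbs) + f (.active .sap) + f (.idle .mbs) + f (.idle .sap)
      + f (.user .mbs) + f (.user .sap) + f .d2d := by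
  have : ∑ j, f j = (List.map f [.active .mbs, .active .sap, .idle .mbs, .idle .sap, .user .mbs,
    .user .sap, .d2d]).sum := rfl
  rw [this]
  simp [add_assoc]

namespace Downlink

variable {p : Params} {lamd : ℝ}

/-- The tier of the base stations of a field. -/
def tierOf : DownField → Option Tier
  | .active i => some i
  | .idle i => some i
  | .user _ => none
  | .d2d => none

open Classical in
/-- The powers of the interferers in the band of tier `i`. -/
noncomputable def powers (p : Params) (i : Tier) : DownField → ℝ
  | .active k => if k = i then p.P i else 0
  | .idle _ => 0
  | .user k => if k = i then p.Q i else 0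
  | .d2d => p.d2dPower i

/-- The regions without interferers when the serving station is at `y`. -/
def guard (p : Params) : DownField → Plane → Set Plane
  | .active _, y => {y}
  | .idle _, _ => ∅
  | .user _, _ => ∅
  | .d2d, y => Metric.ball y p.ιs

/-- The downlink of tier `i`. -/
noncomputable def model (p : Params) (i : Tier) : CellModel DownField where
  α := p.α
  two_lt := p.two_lt_α
  tier := tierOf
  w k := p.P k * p.BD k
  w_pos k := mul_pos (p.P_pos k) (p.BD_pos k)
  i := i
  γ := p.γD i
  γ_pos := p.γD_pos i
  P := p.P i
  P_pos := p.P_pos i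
  pw := powers p i
  pw_nonneg j := by
    have h1 := (p.P_pos i).le
    have h2 := (p.Q_pos i).le
    cases j <;> simp only [powers]
    · split_ifs <;> simp [h1]
    · exact le_rfl
    · split_ifs <;> simp [h2]
    · exact p.d2dPower_nonneg i
  Ex := guard p
  measurableSet_Ex j := by
    cases j <;> simp only [guard, Set.mem_singleton_iff, Metric.mem_ball, Set.mem_empty_iff_false]
    · exact measurableSet_eq_fun measurable_snd measurable_fst
    · exact MeasurableSet.const _
    · exact MeasurableSet.const _
    · exact measurableSet_lt (measurable_snd.dist measurable_fst) measurable_const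
  rx _ := 0
  measurable_rx := measurable_const
  station j hj := by
    cases j with
    | active k =>
      by_cases h : k = i
      · right
        simp [powers, h, tierOf, guard]
      · left
        simp [powers, h]
    | idle k => exact Or.inl rfl
    | user k => exact absurd rfl hj
    | d2d => exact absurd rfl hj

lemma downDens_nonneg (hl : 0 ≤ lamd) (j : DownField) : 0 ≤ p.downDens lamd j := by
  cases j <;> simp only [Params.downDens]
  exacts [p.densD_nonneg _, sub_nonneg.2 (p.densD_le _), p.densU_nonneg _, hl]

/-- The sum of the densities of the base stations, weighted with the relative ranges. -/
noncomputable def rangeSum (p : Params) (i : Tier) : ℝ :=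
  p.q .mbs * p.lam .mbs * (p.P .mbs / p.P i * (p.BD .mbs / p.BD i)) ^ (2 / p.α)
    + p.q .sap * p.lam .sap * (p.P .sap / p.P i * (p.BD .sap / p.BD i)) ^ (2 / p.α)

lemma assocD_eq (i : Tier) : p.assocD i = p.q i * p.lam i / rangeSum p i := rfl

lemma ratio_sq (i k : Tier) :
    (model p i).ratio k ^ 2 = (p.P k / p.P i * (p.BD k / p.BD i)) ^ (2 / p.α) := by
  rw [ServeRule.ratio_sq]
  have e : p.P k * p.BD k / (p.P i * p.BD i) = p.P k / p.P i * (p.BD k / p.BD i) := by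
    rw [mul_div_mul_comm]
  rw [← e]
  rfl

lemma voidCoef_station {i k : Tier} {j : DownField} (h : tierOf j = some k) :
    (model p i).voidCoef j = Real.pi * (p.P k / p.P i * (p.BD k / p.BD i)) ^ (2 / p.α) := by
  rw [← ratio_sq]
  simp [ServeRule.voidCoef, model, h]

lemma voidCoef_other {i : Tier} {j : DownField} (h : tierOf j = none) :
    (model p i).voidCoef j = 0 := by
  simp [ServeRule.voidCoef, model, h]

lemma voidExp_eq (i : Tier) :
    (model p i).voidExp (p.downDens lamd) = Real.pi * rangeSum p i := by
  rw [ServeRule.voidExp, sum_downField, voidCoef_station (k := .mbs) rfl,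
    voidCoef_station (k := .sap) rfl, voidCoef_station (k := .mbs) rfl,
    voidCoef_station (k := .sap) rfl, voidCoef_other rfl, voidCoef_other rfl, voidCoef_other rfl]
  simp only [Params.downDens, rangeSum]
  ring

open Classical in
lemma sum_tier (i : Tier) :
    (∑ j, if (model p i).tier j = some (model p i).i then p.downDens lamd j else 0)
      = p.q i * p.lam i := by
  rw [sum_downField]
  cases i <;> simp [model, tierOf, Params.downDens]

lemma covExp_eq (i : Tier) (κ : ℝ) :
    (model p i).covExp (p.downDens lamd) κ = Real.pi * rangeSum p i + p.densD i * κ := by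
  have hP := (p.P_pos i).ne'
  rw [← voidExp_eq (lamd := lamd), CellModel.covExp, ServeRule.voidExp]
  simp only [CellModel.coef, mul_add, Finset.sum_add_distrib]
  congr 1
  rw [sum_downField]
  cases i <;> simp [model, tierOf, powers, Params.downDens, hP]

variable {Ω : Type*} [MeasurableSpace Ω] {Pr : Measure Ω} [IsProbabilityMeasure Pr]
  (D : Downlink p lamd Pr)

lemma mem_stations_iff (i k : Tier) (y : Plane) (ω : Ω) :
    y ∈ (model p i).stations k (fun j => D.Φ j ω) ↔ y ∈ D.stations k ω := by
  constructor
  · rintro ⟨j, hj, hy⟩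
    cases j with
    | active k' => obtain rfl : k' = k := Option.some.inj hj; exact Or.inl hy
    | idle k' => obtain rfl : k' = k := Option.some.inj hj; exact Or.inr hy
    | user k' => exact absurd hj (by simp [model, tierOf])
    | d2d => exact absurd hj (by simp [model, tierOf])
  · rintro (hy | hy)
    · exact ⟨.active k, rfl, hy⟩
    · exact ⟨.idle k, rfl, hy⟩

lemma serves_iff (i : Tier) (y : Plane) (ω : Ω) :
    (model p i).Serves y (fun j => D.Φ j ω) ↔ D.Serves i y ω := by
  unfold ServeRule.Serves Serves
  simp only [D.mem_stations_iff]
  rfl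

lemma sir_eq (i : Tier) (y : Plane) (ω : Ω) : (model p i).sir D.Φ D.h D.h₀ y ω = D.sir i y ω := by
  unfold CellModel.sir sir famInterf
  rw [sum_downField]
  cases i <;> simp [model, powers, guard, interfd2d, Params.d2dPower]

lemma associated_eq (i : Tier) :
    D.associated i = {ω | ∃ y, (model p i).Serves y fun j => D.Φ j ω} := by
  simp only [associated, D.serves_iff]

lemma coveredBy_eq (i : Tier) :
    D.coveredBy i = {ω | ∃ y, (model p i).Serves y (fun j => D.Φ j ω) ∧
      ENNReal.ofReal (model p i).γ < (model p i).sir D.Φ D.h D.h₀ y ω} := by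
  simp only [coveredBy, D.serves_iff, D.sir_eq]
  rfl

lemma coveredBy_subset (i : Tier) : D.coveredBy i ⊆ D.associated i :=
  fun _ ⟨y, hy, _⟩ => ⟨y, hy⟩

lemma rangeSum_nonneg (i : Tier) : 0 ≤ rangeSum p i := by
  have h1 := p.downWeight_nonneg .mbs
  have h2 := p.downWeight_nonneg .sap
  have a1 := p.P_pos i; have a2 := p.BD_pos i
  have a3 := p.P_pos .mbs; have a4 := p.BD_pos .mbs
  have a5 := p.P_pos .sap; have a6 := p.BD_pos .sap
  unfold rangeSum
  positivity

lemma rangeSum_pos {i : Tier} (h : 0 < p.q i) : 0 < rangeSum p i := by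
  have h1 := p.downWeight_nonneg .mbs
  have h2 := p.downWeight_nonneg .sap
  have a1 := p.P_pos i; have a2 := p.BD_pos i
  have a3 := p.P_pos .mbs; have a4 := p.BD_pos .mbs
  have a5 := p.P_pos .sap; have a6 := p.BD_pos .sap
  have a7 := p.lam_pos i
  unfold rangeSum
  cases i
  · have : 0 < p.q .mbs * p.lam .mbs * (p.P .mbs / p.P .mbs * (p.BD .mbs / p.BD .mbs)) ^ (2 / p.α) := by
      positivity
    have : 0 ≤ p.q .sap * p.lam .sap * (p.P .sap / p.P .mbs * (p.BD .sap / p.BD .mbs)) ^ (2 / p.α) := by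
      positivity
    linarith
  · have : 0 < p.q .sap * p.lam .sap * (p.P .sap / p.P .sap * (p.BD .sap / p.BD .sap)) ^ (2 / p.α) := by
      positivity
    have : 0 ≤ p.q .mbs * p.lam .mbs * (p.P .mbs / p.P .sap * (p.BD .mbs / p.BD .sap)) ^ (2 / p.α) := by
      positivity
    linarith

/-- The association probabilities. -/
theorem measure_associated (hl : 0 ≤ lamd) (i : Tier) : Pr.real (D.associated i) = p.assocD i := by
  rw [measureReal_def, D.associated_eq,
    (model p i).measure_associated (D.field.family (downDens_nonneg hl)), sum_tier, voidExp_eq,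
    ENNReal.toReal_ofReal (mul_nonneg (p.downWeight_nonneg i)
      (by have := rangeSum_nonneg (p := p) i; positivity)), assocD_eq]
  by_cases h : rangeSum p i = 0
  · simp [h]
  · field_simp

/-- The exponent of the transmitting users, relative to the squared length of the link. -/
noncomputable def userCoef (p : Params) (i : Tier) : ℝ :=
  p.densU i * (p.Cconst * (p.Q i / p.P i * p.γD i) ^ (2 / p.α))

lemma userCoef_nonneg (i : Tier) : 0 ≤ userCoef p i := by
  have h1 := p.densU_nonneg i
  have h2 := p.Cconst_nonneg
  have h3 := p.Q_pos i; have h4 := p.P_pos i; have h5 := p.γD_pos i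
  unfold userCoef
  positivity

-- Transmitting users of the tier fill the plane, so they give a term quadratic in the link length.
-- D2D transmitters keep out of a ball about the server, at distance `‖y‖` from the receiver.
-- Station fields do not enter here.
open Classical in
lemma outer_eq (i : Tier) {y : Plane} (hy : y ≠ 0) (hl : 0 ≤ lamd) :
    (model p i).outer (p.downDens lamd) y
      = ENNReal.ofReal (Real.pi * userCoef p i * ‖y‖ ^ 2)
        + p.d2dExp lamd i (p.γD i * ‖y‖ ^ p.α / p.P i) ‖y‖ := by
  have hy' : 0 < ‖y‖ := norm_pos_iff.2 hy
  have hγ := p.γD_pos i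
  have hP := p.P_pos i
  have hQ := p.Q_pos i
  have hQd := p.Qd_pos
  have hs : 0 < p.γD i * ‖y‖ ^ p.α / p.P i := by positivity
  have huser : ∀ k, ∫⁻ x, (1 - eexp ((model p i).outerLoss y (.user k) x)) =
      if k = i then ENNReal.ofReal
        (Real.pi * (p.Cconst * (p.Q i / p.P i * p.γD i) ^ (2 / p.α)) * ‖y‖ ^ 2) else 0 := by
    intro k
    have e : (model p i).outerLoss y (.user k) = (model p i).loss y (.user k) :=
      funext fun x => if_pos rfl
    rw [e]
    split_ifs with h
    · have hpw : (model p i).pw (.user k) = p.Q i := if_pos h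
      refine (p.lintegral_fadingLoss_plane (pw := (model p i).pw) (Ex := fun j => (model p i).Ex j y)
        (j := .user k) (y := 0) (by rw [hpw]; positivity) MeasurableSet.empty measure_empty).trans ?_
      rw [hpw]
      congr 1
      change Real.pi * (p.Cconst * (p.γD i * ‖y‖ ^ p.α / p.P i * p.Q i) ^ (2 / p.α)) = _
      rw [p.rpow_link_mul hγ.le hQ.le hP hy'.le]
      ring
    · exact lintegral_fadingLoss_of_eq_zero (by
        have : (model p i).pw (.user k) = 0 := if_neg h
        rw [this, mul_zero])
  have hd2d : ENNReal.ofReal lamd * ∫⁻ x, (1 - eexp ((model p i).outerLoss y .d2d x))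
      = p.d2dExp lamd i (p.γD i * ‖y‖ ^ p.α / p.P i) ‖y‖ := by
    have e : (model p i).outerLoss y .d2d = (model p i).loss y .d2d :=
      funext fun x => if_pos rfl
    rw [e]
    refine (p.mul_lintegral_fadingLoss_d2d (i := i) (b := y) (j := DownField.d2d)
      (pw := (model p i).pw) (Ex := fun j => (model p i).Ex j y) hl hs rfl rfl).trans ?_
    change p.d2dExp _ _ _ ‖y - 0‖ = _
    rw [sub_zero]
  have hactive : ∀ j k, tierOf j = some k →
      ∫⁻ x, (1 - eexp ((model p i).outerLoss y j x)) = 0 := by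
    intro j k hk
    have e : (model p i).outerLoss y j = fun _ => 0 :=
      funext fun x => if_neg (by change ¬ tierOf j = none; simp [hk])
    simp [e]
  rw [CellModel.outer, laplaceExponent, sum_downField, hactive _ _ rfl, hactive _ _ rfl,
    hactive _ _ rfl, hactive _ _ rfl, huser, huser,
    show p.downDens lamd .d2d = lamd from rfl, hd2d]
  have hmul : ENNReal.ofReal (Real.pi * userCoef p i * ‖y‖ ^ 2) = ENNReal.ofReal (p.densU i) *
      ENNReal.ofReal (Real.pi * (p.Cconst * (p.Q i / p.P i * p.γD i) ^ (2 / p.α)) * ‖y‖ ^ 2) := by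
    rw [← ENNReal.ofReal_mul (p.densU_nonneg i), userCoef]
    congr 1
    ring
  rw [hmul]
  cases i <;> simp [Params.downDens]

/-- The quadratic exponent of the coverage probability. -/
noncomputable def covRate (p : Params) (i : Tier) : ℝ :=
  p.densD i * p.δ (p.γD i) + userCoef p i + rangeSum p i

lemma covRate_pos {i : Tier} (h : 0 < p.q i) : 0 < covRate p i := by
  have h1 := rangeSum_pos h
  have h2 := userCoef_nonneg (p := p) i
  have h3 := mul_nonneg (p.densD_nonneg i) (p.δ_nonneg (p.γD_pos i).le)
  unfold covRate
  linarith

lemma nullMeasurableSet_coveredBy_and (hl : 0 ≤ lamd) (i : Tier) :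
    NullMeasurableSet (D.coveredBy i) Pr ∧
    Pr (D.coveredBy i) = ENNReal.ofReal (p.q i * p.lam i) *
      ∫⁻ y : Plane, eexp (p.d2dExp lamd i (p.γD i * ‖y‖ ^ p.α / p.P i) ‖y‖) *
          eexp (ENNReal.ofReal (Real.pi * covRate p i * ‖y‖ ^ 2)) := by
  have hδ := p.δ_nonneg (p.γD_pos i).le
  -- Active stations of the serving tier are farther away than the server, and `lintegral_farther`
  -- gives `κ = π δ(γ)`.
  obtain ⟨h1, h2⟩ := (model p i).measure_covered D.field (downDens_nonneg hl) D.h₀_law D.h₀_indep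
    (κ := Real.pi * p.δ (p.γD i)) (mul_nonneg Real.pi_pos.le hδ)
    (fun r hr => p.lintegral_farther (p.γD_pos i) hr)
  rw [← D.coveredBy_eq] at h1 h2
  refine ⟨h1, ?_⟩
  rw [h2, sum_tier]
  congr 1
  refine lintegral_congr_ae ?_
  have : ∀ᵐ y : Plane, y ≠ 0 := by simp [ae_iff, measure_singleton]
  filter_upwards [this] with y hy
  have e : Real.pi * covRate p i * ‖y‖ ^ 2 = Real.pi * userCoef p i * ‖y‖ ^ 2
      + (Real.pi * rangeSum p i + p.densD i * (Real.pi * p.δ (p.γD i))) * ‖y‖ ^ 2 := by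
    rw [covRate]; ring
  have n1 := userCoef_nonneg (p := p) i
  have n2 := rangeSum_nonneg (p := p) i
  have n3 := p.densD_nonneg i
  rw [outer_eq i hy hl, covExp_eq, e, ENNReal.ofReal_add (by positivity) (by positivity), eexp_add,
    eexp_add]
  ring

theorem overall_eq (hl : 0 ≤ lamd) : D.overall = D.coverage .mbs * p.assocD .mbs
    + D.coverage .sap * p.assocD .sap := by
  rw [← D.measure_associated hl, ← D.measure_associated hl]
  refine measureReal_iUnion_tier D.coveredBy_subset
    (fun i => (D.nullMeasurableSet_coveredBy_and hl i).1) ?_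
  have h := ServeRule.ae_not_serves (D.field.family (downDens_nonneg hl)) (model p .mbs).toServeRule
    (model p .sap).toServeRule (by simp [model]) rfl rfl rfl
  filter_upwards [h] with ω hω
  rw [D.associated_eq, D.associated_eq]
  exact hω

/-- There are no D2D interferers in the macro band, so the position of the server is integrated
against a pure Gaussian. The result `qλ / covRate` is divided by the association probability `qλ /
rangeSum`. -/
theorem coverage_mbs (hl : 0 ≤ lamd) (h : 0 < p.q .mbs) : D.coverage .mbs = p.covMacroD := by
  have hE := covRate_pos h
  have hw : 0 < p.q .mbs * p.lam .mbs := mul_pos h (p.lam_pos _)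
  have hR := rangeSum_pos h
  have hcov := (D.nullMeasurableSet_coveredBy_and hl .mbs).2
  simp only [Params.d2dExp, eexp_zero, one_mul] at hcov
  rw [lintegral_eexp_mul_norm_sq (by positivity), ← ENNReal.ofReal_mul hw.le] at hcov
  rw [coverage, cond_real_of_subset (D.coveredBy_subset _), D.measure_associated hl, measureReal_def,
    hcov, ENNReal.toReal_ofReal (by positivity), Params.covMacroD, assocD_eq, ← p.densD_eq,
    ← p.densU_eq]
  have e : p.densD .mbs * (p.q .mbs * p.lam .mbs / rangeSum p .mbs) * p.δ (p.γD .mbs)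
      + p.densU .mbs * (p.q .mbs * p.lam .mbs / rangeSum p .mbs) * p.Cconst *
        (p.Q .mbs / p.P .mbs * p.γD .mbs) ^ (2 / p.α) + p.q .mbs * p.lam .mbs
      = p.q .mbs * p.lam .mbs / rangeSum p .mbs * covRate p .mbs := by
    rw [covRate, userCoef]
    field_simp
  rw [e]
  field_simp

theorem coverage_sap (hl : lamd = p.lamd) (h : 0 < p.q .sap) : D.coverage .sap = p.covSmallD := by
  subst hl
  have hE := covRate_pos h
  have hw : 0 < p.q .sap * p.lam .sap := mul_pos h (p.lam_pos _)
  have hR := rangeSum_pos h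
  -- The last summand of `F` is `qλ / assocD = rangeSum`; the cancellation uses `q > 0`.
  have hF : covRate p .sap = p.F := by
    have := (p.lam_pos .sap).ne'
    rw [covRate, userCoef, Params.F, assocD_eq, ← p.densD_eq, ← p.densU_eq]
    field_simp
  rw [coverage, cond_real_of_subset (D.coveredBy_subset _), D.measure_associated p.lamd_nonneg,
    measureReal_def, (D.nullMeasurableSet_coveredBy_and p.lamd_nonneg .sap).2, ENNReal.toReal_mul,
    ENNReal.toReal_ofReal hw.le, p.lintegral_small_d2dExp (p.γD_pos .sap) (p.P_pos .sap) hE, hF,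
    Params.covSmallD]
  ring

/-- The Laplace transform of the D2D interference. -/
theorem laplace_interfd2d (hl : lamd = p.lamd) (y : Plane) {s : ℝ} (hs : 0 < s) :
    ∫ ω, expNeg (ENNReal.ofReal s * D.interfd2d .sap y ω) ∂Pr =
      if ‖y‖ ≤ p.ιs then p.laplaceShort s ‖y‖ else p.laplaceLong s ‖y‖ := by
  have h := p.integral_expNeg_interference D.field (downDens_nonneg (hl ▸ p.lamd_nonneg)) (j := .d2d)
    hl hs 0 y
  rwa [sub_zero] at h

end Downlink

/-! ## The uplink -/

instance : Fintype UpField :=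
  ⟨⟨([.station .mbs, .station .sap, .active .mbs, .active .sap, .user .mbs, .user .sap, .d2d] :
    List UpField), by simp⟩, fun j => by rcases j with (_ | _) | (_ | _) | (_ | _) | _ <;> simp⟩

lemma sum_upField {A : Type*} [AddCommMonoid A] (f : UpField → A) :
    ∑ j, f j = f (.station .mbs) + f (.station .sap) + f (.active .mbs) + f (.active .sap)
      + f (.user .mbs) + f (.user .sap) + f .d2d := by
  have : ∑ j, f j = (List.map f [.station .mbs, .station .sap, .active .mbs, .active .sap,
    .user .mbs, .user .sap, .d2d]).sum := rfl
  rw [this]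
  simp [add_assoc]

namespace Uplink

variable {p : Params} {lamd : ℝ}

/-- The tier of the base stations of a field. -/
def tierOf : UpField → Option Tier
  | .station i => some i
  | .active _ => none
  | .user _ => none
  | .d2d => none

open Classical in
/-- The powers of the interferers in the band of tier `i`. -/
noncomputable def powers (p : Params) (i : Tier) : UpField → ℝ
  | .station _ => 0
  | .active k => if k = i then p.P i else 0
  | .user k => if k = i then p.Q i else 0
  | .d2d => p.d2dPower i

/-- The regions without interferers. -/
def guard (p : Params) : UpField → Set Plane
  | .station _ => ∅
  | .active _ => ∅
  | .user _ => {0}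
  | .d2d => Metric.ball 0 p.ιs

lemma measurableSet_guard (j : UpField) : MeasurableSet (guard p j) := by
  cases j
  exacts [.empty, .empty, measurableSet_singleton _, Metric.isOpen_ball.measurableSet]

/-- The uplink of tier `i`. -/
noncomputable def model (p : Params) (i : Tier) : CellModel UpField where
  α := p.α
  two_lt := p.two_lt_α
  tier := tierOf
  w k := p.Q k * p.BU k
  w_pos k := mul_pos (p.Q_pos k) (p.BU_pos k)
  i := i
  γ := p.γU i
  γ_pos := p.γU_pos i
  P := p.Q i
  P_pos := p.Q_pos i
  pw := powers p i
  pw_nonneg j := by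
    have h1 := (p.P_pos i).le
    have h2 := (p.Q_pos i).le
    cases j <;> simp only [powers]
    · exact le_rfl
    · split_ifs <;> simp [h1]
    · split_ifs <;> simp [h2]
    · exact p.d2dPower_nonneg i
  Ex j _ := guard p j
  measurableSet_Ex j := (measurableSet_guard j).preimage measurable_snd
  rx b := b
  measurable_rx := measurable_id
  station j hj := by
    cases j with
    | station k => exact Or.inl rfl
    | active k => exact absurd rfl hj
    | user k => exact absurd rfl hj
    | d2d => exact absurd rfl hj

lemma upDens_nonneg (hl : 0 ≤ lamd) (j : UpField) : 0 ≤ p.upDens lamd j := by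
  cases j <;> simp only [Params.upDens]
  exacts [mul_nonneg (p.one_sub_q_nonneg _) (p.lam_pos _).le, p.densD_nonneg _, p.densU_nonneg _, hl]

/-- The sum of the densities of the base stations, weighted with the relative ranges. -/
noncomputable def rangeSum (p : Params) (i : Tier) : ℝ :=
  (1 - p.q .mbs) * p.lam .mbs * (p.Q .mbs / p.Q i * (p.BU .mbs / p.BU i)) ^ (2 / p.α)
    + (1 - p.q .sap) * p.lam .sap * (p.Q .sap / p.Q i * (p.BU .sap / p.BU i)) ^ (2 / p.α)

lemma assocU_eq (i : Tier) : p.assocU i = (1 - p.q i) * p.lam i / rangeSum p i := rfl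

lemma ratio_sq (i k : Tier) :
    (model p i).ratio k ^ 2 = (p.Q k / p.Q i * (p.BU k / p.BU i)) ^ (2 / p.α) := by
  rw [ServeRule.ratio_sq]
  have e : p.Q k * p.BU k / (p.Q i * p.BU i) = p.Q k / p.Q i * (p.BU k / p.BU i) := by
    rw [mul_div_mul_comm]
  rw [← e]
  rfl

lemma voidCoef_station {i k : Tier} {j : UpField} (h : tierOf j = some k) :
    (model p i).voidCoef j = Real.pi * (p.Q k / p.Q i * (p.BU k / p.BU i)) ^ (2 / p.α) := by
  rw [← ratio_sq]
  simp [ServeRule.voidCoef, model, h]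

lemma voidCoef_other {i : Tier} {j : UpField} (h : tierOf j = none) :
    (model p i).voidCoef j = 0 := by
  simp [ServeRule.voidCoef, model, h]

lemma voidExp_eq (i : Tier) :
    (model p i).voidExp (p.upDens lamd) = Real.pi * rangeSum p i := by
  rw [ServeRule.voidExp, sum_upField, voidCoef_station (k := .mbs) rfl,
    voidCoef_station (k := .sap) rfl, voidCoef_other rfl, voidCoef_other rfl, voidCoef_other rfl,
    voidCoef_other rfl, voidCoef_other rfl]
  simp only [Params.upDens, rangeSum]
  ring

open Classical in
lemma sum_tier (i : Tier) :
    (∑ j, if (model p i).tier j = some (model p i).i then p.upDens lamd j else 0)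
      = (1 - p.q i) * p.lam i := by
  rw [sum_upField]
  cases i <;> simp [model, tierOf, Params.upDens]

/-- Uplink stations receive and do not interfere, so they contribute by blocking only and `κ` drops
out. -/
lemma covExp_eq (i : Tier) (κ : ℝ) :
    (model p i).covExp (p.upDens lamd) κ = Real.pi * rangeSum p i := by
  rw [← voidExp_eq (lamd := lamd), CellModel.covExp, ServeRule.voidExp]
  refine Finset.sum_congr rfl fun j _ => ?_
  cases j <;> simp [CellModel.coef, model, tierOf, powers]

variable {Ω : Type*} [MeasurableSpace Ω] {Pr : Measure Ω} [IsProbabilityMeasure Pr]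
  (U : Uplink p lamd Pr)

lemma mem_stations_iff (i k : Tier) (y : Plane) (ω : Ω) :
    y ∈ (model p i).stations k (fun j => U.Φ j ω) ↔ y ∈ U.stations k ω := by
  constructor
  · rintro ⟨j, hj, hy⟩
    cases j with
    | station k' => obtain rfl : k' = k := Option.some.inj hj; exact hy
    | active k' => exact absurd hj (by simp [model, tierOf])
    | user k' => exact absurd hj (by simp [model, tierOf])
    | d2d => exact absurd hj (by simp [model, tierOf])
  · exact fun hy => ⟨.station k, rfl, hy⟩

lemma serves_iff (i : Tier) (y : Plane) (ω : Ω) :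
    (model p i).Serves y (fun j => U.Φ j ω) ↔ U.Serves i y ω := by
  unfold ServeRule.Serves Serves
  simp only [U.mem_stations_iff]
  rfl

lemma sir_eq (i : Tier) (y : Plane) (ω : Ω) : (model p i).sir U.Φ U.h U.h₀ y ω = U.sir i y ω := by
  unfold CellModel.sir sir famInterf
  rw [sum_upField]
  cases i <;> simp [model, powers, guard, interfd2d, Params.d2dPower]

lemma associated_eq (i : Tier) :
    U.associated i = {ω | ∃ y, (model p i).Serves y fun j => U.Φ j ω} := by
  simp only [associated, U.serves_iff]

lemma coveredBy_eq (i : Tier) :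
    U.coveredBy i = {ω | ∃ y, (model p i).Serves y (fun j => U.Φ j ω) ∧
      ENNReal.ofReal (model p i).γ < (model p i).sir U.Φ U.h U.h₀ y ω} := by
  simp only [coveredBy, U.serves_iff, U.sir_eq]
  rfl

lemma coveredBy_subset (i : Tier) : U.coveredBy i ⊆ U.associated i :=
  fun _ ⟨y, hy, _⟩ => ⟨y, hy⟩

lemma rangeSum_nonneg (i : Tier) : 0 ≤ rangeSum p i := by
  have h1 := p.upWeight_nonneg .mbs
  have h2 := p.upWeight_nonneg .sap
  have a1 := p.Q_pos i; have a2 := p.BU_pos i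
  have a3 := p.Q_pos .mbs; have a4 := p.BU_pos .mbs
  have a5 := p.Q_pos .sap; have a6 := p.BU_pos .sap
  unfold rangeSum
  positivity

lemma rangeSum_pos {i : Tier} (h : p.q i < 1) : 0 < rangeSum p i := by
  have h1 := p.upWeight_nonneg .mbs
  have h2 := p.upWeight_nonneg .sap
  have a1 := p.Q_pos i; have a2 := p.BU_pos i
  have a3 := p.Q_pos .mbs; have a4 := p.BU_pos .mbs
  have a5 := p.Q_pos .sap; have a6 := p.BU_pos .sap
  have a7 := p.lam_pos i
  unfold rangeSum
  cases i
  · have : 0 < (1 - p.q .mbs) * p.lam .mbs * (p.Q .mbs / p.Q .mbs * (p.BU .mbs / p.BU .mbs)) ^ (2 / p.α) := by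
      positivity
    have : 0 ≤ (1 - p.q .sap) * p.lam .sap * (p.Q .sap / p.Q .mbs * (p.BU .sap / p.BU .mbs)) ^ (2 / p.α) := by
      positivity
    linarith
  · have : 0 < (1 - p.q .sap) * p.lam .sap * (p.Q .sap / p.Q .sap * (p.BU .sap / p.BU .sap)) ^ (2 / p.α) := by
      positivity
    have : 0 ≤ (1 - p.q .mbs) * p.lam .mbs * (p.Q .mbs / p.Q .sap * (p.BU .mbs / p.BU .sap)) ^ (2 / p.α) := by
      positivity
    linarith

/-- The association probabilities. -/
theorem measure_associated (hl : 0 ≤ lamd) (i : Tier) : Pr.real (U.associated i) = p.assocU i := by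
  rw [measureReal_def, U.associated_eq,
    (model p i).measure_associated (U.field.family (upDens_nonneg hl)), sum_tier, voidExp_eq,
    ENNReal.toReal_ofReal (mul_nonneg (p.upWeight_nonneg i)
      (by have := rangeSum_nonneg (p := p) i; positivity)), assocU_eq]
  by_cases h : rangeSum p i = 0
  · simp [h]
  · field_simp

/-- The exponent of the interferers of the same tier, relative to the squared length of the link. -/
noncomputable def tierCoef (p : Params) (i : Tier) : ℝ :=
  p.densD i * (p.Cconst * (p.P i / p.Q i * p.γU i) ^ (2 / p.α))
    + p.densU i * (p.Cconst * p.γU i ^ (2 / p.α))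

lemma tierCoef_nonneg (i : Tier) : 0 ≤ tierCoef p i := by
  have h0 := p.densD_nonneg i
  have h1 := p.densU_nonneg i
  have h2 := p.Cconst_nonneg
  have h3 := p.Q_pos i; have h4 := p.P_pos i; have h5 := p.γU_pos i
  unfold tierCoef
  positivity

/-- The receiver is the serving station at `y`, but the interferers fill the plane up to a null set.
By translation invariance only the link length matters. -/
lemma lintegral_outerLoss_of_pos {i : Tier} {y : Plane} (hy : y ≠ 0) {j : UpField}
    (hj : tierOf j = none) (hpw : 0 < powers p i j) (hnull : volume (guard p j) = 0) :
    ∫⁻ x, (1 - eexp ((model p i).outerLoss y j x)) = ENNReal.ofReal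
        (Real.pi * (p.Cconst * (powers p i j / p.Q i * p.γU i) ^ (2 / p.α)) * ‖y‖ ^ 2) := by
  have hy' : 0 < ‖y‖ := norm_pos_iff.2 hy
  have hγ := p.γU_pos i
  have hQ := p.Q_pos i
  have hs : 0 < p.γU i * ‖y‖ ^ p.α / p.Q i := by positivity
  have e : (model p i).outerLoss y j = (model p i).loss y j := funext fun x => if_pos hj
  rw [e]
  refine (p.lintegral_fadingLoss_plane (pw := powers p i) (Ex := fun j => (model p i).Ex j y)
    (y := y) (mul_pos hs hpw) (measurableSet_guard j) hnull).trans ?_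
  rw [p.rpow_link_mul hγ.le hpw.le hQ hy'.le]
  congr 1
  ring

lemma lintegral_outerLoss_of_eq_zero {i : Tier} {y : Plane} {j : UpField} (hpw : powers p i j = 0) :
    ∫⁻ x, (1 - eexp ((model p i).outerLoss y j x)) = 0 := by
  have e : (model p i).outerLoss y j = fun _ => 0 := by
    funext x
    unfold CellModel.outerLoss
    split_ifs
    exacts [(model p i).loss_eq_zero_of_pw y hpw x, rfl]
  simp [e]

lemma outer_eq (i : Tier) {y : Plane} (hy : y ≠ 0) (hl : 0 ≤ lamd) :
    (model p i).outer (p.upDens lamd) y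
      = ENNReal.ofReal (Real.pi * tierCoef p i * ‖y‖ ^ 2)
        + p.d2dExp lamd i (p.γU i * ‖y‖ ^ p.α / p.Q i) ‖y‖ := by
  have hy' : 0 < ‖y‖ := norm_pos_iff.2 hy
  have hγ := p.γU_pos i
  have hQ := p.Q_pos i
  have hP := p.P_pos i
  have hs : 0 < p.γU i * ‖y‖ ^ p.α / p.Q i := by positivity
  have hC := p.Cconst_nonneg
  have hD0 := p.densD_nonneg i
  have hU0 := p.densU_nonneg i
  have hd2d : ENNReal.ofReal lamd * ∫⁻ x, (1 - eexp ((model p i).outerLoss y .d2d x))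
      = p.d2dExp lamd i (p.γU i * ‖y‖ ^ p.α / p.Q i) ‖y‖ := by
    have e : (model p i).outerLoss y .d2d = (model p i).loss y .d2d :=
      funext fun x => if_pos rfl
    rw [e]
    refine (p.mul_lintegral_fadingLoss_d2d (i := i) (y := y) (b := 0) (j := UpField.d2d)
      (pw := (model p i).pw) (Ex := fun j => (model p i).Ex j y) hl hs rfl rfl).trans ?_
    -- The ball is now centred at the user and the receiver sits at `y`; their distance is again
    -- `‖y‖`, so the exponent has the same form as in the downlink.
    rw [zero_sub, norm_neg]
  have hself : ENNReal.ofReal (p.densD i) *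
        (∫⁻ x, (1 - eexp ((model p i).outerLoss y (.active i) x)))
      + ENNReal.ofReal (p.densU i) * ∫⁻ x, (1 - eexp ((model p i).outerLoss y (.user i) x))
      = ENNReal.ofReal (Real.pi * tierCoef p i * ‖y‖ ^ 2) := by
    have e1 : powers p i (.active i) = p.P i := if_pos rfl
    have e2 : powers p i (.user i) = p.Q i := if_pos rfl
    rw [lintegral_outerLoss_of_pos hy rfl (hP.trans_eq e1.symm) measure_empty,
      lintegral_outerLoss_of_pos hy rfl (hQ.trans_eq e2.symm) (measure_singleton _), e1, e2,
      div_self hQ.ne', one_mul, ← ENNReal.ofReal_mul hD0, ← ENNReal.ofReal_mul hU0,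
      ← ENNReal.ofReal_add (by positivity) (by positivity), tierCoef]
    congr 1
    ring
  have hst : ∀ k, ∫⁻ x, (1 - eexp ((model p i).outerLoss y (.station k) x)) = 0 :=
    fun k => lintegral_outerLoss_of_eq_zero rfl
  have hact : ∀ k, k ≠ i → ∫⁻ x, (1 - eexp ((model p i).outerLoss y (.active k) x)) = 0 :=
    fun k hk => lintegral_outerLoss_of_eq_zero (if_neg hk)
  have huser : ∀ k, k ≠ i → ∫⁻ x, (1 - eexp ((model p i).outerLoss y (.user k) x)) = 0 :=
    fun k hk => lintegral_outerLoss_of_eq_zero (if_neg hk)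
  rw [CellModel.outer, laplaceExponent, sum_upField, hst, hst, ← hself,
    show p.upDens lamd .d2d = lamd from rfl, hd2d]
  cases i
  · rw [hact .sap (by simp), huser .sap (by simp)]
    simp [Params.upDens]
  · rw [hact .mbs (by simp), huser .mbs (by simp)]
    simp [Params.upDens]

/-- The quadratic exponent of the coverage probability. -/
noncomputable def covRate (p : Params) (i : Tier) : ℝ := tierCoef p i + rangeSum p i

lemma covRate_pos {i : Tier} (h : p.q i < 1) : 0 < covRate p i := by
  have h1 := rangeSum_pos h
  have h2 := tierCoef_nonneg (p := p) i
  unfold covRate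
  linarith

lemma nullMeasurableSet_coveredBy_and (hl : 0 ≤ lamd) (i : Tier) :
    NullMeasurableSet (U.coveredBy i) Pr ∧
    Pr (U.coveredBy i) = ENNReal.ofReal ((1 - p.q i) * p.lam i) *
      ∫⁻ y : Plane, eexp (p.d2dExp lamd i (p.γU i * ‖y‖ ^ p.α / p.Q i) ‖y‖) *
          eexp (ENNReal.ofReal (Real.pi * covRate p i * ‖y‖ ^ 2)) := by
  have hδ := p.δ_nonneg (p.γU_pos i).le
  -- The value of `κ` is immaterial, by `covExp_eq`; it only has to satisfy the integral hypothesis.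
  obtain ⟨h1, h2⟩ := (model p i).measure_covered U.field (upDens_nonneg hl) U.h₀_law U.h₀_indep
    (κ := Real.pi * p.δ (p.γU i)) (mul_nonneg Real.pi_pos.le hδ)
    (fun r hr => p.lintegral_farther (p.γU_pos i) hr)
  rw [← U.coveredBy_eq] at h1 h2
  refine ⟨h1, ?_⟩
  rw [h2, sum_tier]
  congr 1
  refine lintegral_congr_ae ?_
  have : ∀ᵐ y : Plane, y ≠ 0 := by simp [ae_iff, measure_singleton]
  filter_upwards [this] with y hy
  have e : Real.pi * covRate p i * ‖y‖ ^ 2 = Real.pi * tierCoef p i * ‖y‖ ^ 2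
      + Real.pi * rangeSum p i * ‖y‖ ^ 2 := by
    rw [covRate]; ring
  have n1 := tierCoef_nonneg (p := p) i
  have n2 := rangeSum_nonneg (p := p) i
  rw [outer_eq i hy hl, covExp_eq, e, ENNReal.ofReal_add (by positivity) (by positivity), eexp_add,
    eexp_add]
  ring

theorem overall_eq (hl : 0 ≤ lamd) : U.overall = U.coverage .mbs * p.assocU .mbs
    + U.coverage .sap * p.assocU .sap := by
  rw [← U.measure_associated hl, ← U.measure_associated hl]
  refine measureReal_iUnion_tier U.coveredBy_subset
    (fun i => (U.nullMeasurableSet_coveredBy_and hl i).1) ?_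
  have h := ServeRule.ae_not_serves (U.field.family (upDens_nonneg hl)) (model p .mbs).toServeRule
    (model p .sap).toServeRule (by simp [model]) rfl rfl rfl
  filter_upwards [h] with ω hω
  rw [U.associated_eq, U.associated_eq]
  exact hω

lemma tierCoef_eq (i : Tier) : tierCoef p i = p.Cconst * p.γU i ^ (2 / p.α) *
    (p.lamD i * (p.P i / p.Q i) ^ (2 / p.α) + p.lamT i) := by
  rw [tierCoef, Real.mul_rpow (div_nonneg (p.P_pos i).le (p.Q_pos i).le) (p.γU_pos i).le, p.densD_eq,
    p.densU_eq]
  ring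

theorem coverage_mbs (hl : 0 ≤ lamd) (h : p.q .mbs < 1) : U.coverage .mbs = p.covMacroU := by
  have hE := covRate_pos h
  have hw : 0 < (1 - p.q .mbs) * p.lam .mbs := mul_pos (sub_pos.2 h) (p.lam_pos _)
  have hR := rangeSum_pos h
  have hcov := (U.nullMeasurableSet_coveredBy_and hl .mbs).2
  simp only [Params.d2dExp, eexp_zero, one_mul] at hcov
  rw [lintegral_eexp_mul_norm_sq (by positivity), ← ENNReal.ofReal_mul hw.le] at hcov
  rw [coverage, cond_real_of_subset (U.coveredBy_subset _), U.measure_associated hl, measureReal_def,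
    hcov, ENNReal.toReal_ofReal (by positivity), Params.covMacroU,
    mul_right_comm (p.Cconst * _), ← tierCoef_eq,
    assocU_eq]
  have e : tierCoef p .mbs * ((1 - p.q .mbs) * p.lam .mbs / rangeSum p .mbs)
        + (1 - p.q .mbs) * p.lam .mbs
      = (1 - p.q .mbs) * p.lam .mbs / rangeSum p .mbs * covRate p .mbs := by
    rw [covRate]
    field_simp
  rw [e]
  generalize (1 - p.q .mbs) * p.lam .mbs = w at hw
  field_simp

theorem coverage_sap (hl : lamd = p.lamd) (h : p.q .sap < 1) : U.coverage .sap = p.covSmallU := by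
  subst hl
  have hE := covRate_pos h
  have hw : 0 < (1 - p.q .sap) * p.lam .sap := mul_pos (sub_pos.2 h) (p.lam_pos _)
  have hR := rangeSum_pos h
  have hG : covRate p .sap = p.G := by
    rw [covRate, Params.G, ← tierCoef_eq, assocU_eq, div_div_cancel₀ hw.ne']
  rw [coverage, cond_real_of_subset (U.coveredBy_subset _), U.measure_associated p.lamd_nonneg,
    measureReal_def, (U.nullMeasurableSet_coveredBy_and p.lamd_nonneg .sap).2, ENNReal.toReal_mul,
    ENNReal.toReal_ofReal hw.le, p.lintegral_small_d2dExp (p.γU_pos .sap) (p.Q_pos .sap) hE, hG,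
    Params.covSmallU]
  ring

/-- The Laplace transform of the D2D interference. -/
theorem laplace_interfd2d (hl : lamd = p.lamd) (b : Plane) {s : ℝ} (hs : 0 < s) :
    ∫ ω, expNeg (ENNReal.ofReal s * U.interfd2d .sap b ω) ∂Pr =
      if ‖b‖ ≤ p.ιs then p.laplaceShort s ‖b‖ else p.laplaceLong s ‖b‖ := by
  have h := p.integral_expNeg_interference U.field (upDens_nonneg (hl ▸ p.lamd_nonneg)) (j := .d2d)
    hl hs b 0
  rwa [zero_sub, norm_neg] at h

end Uplink

/-! ## A D2D link -/

instance : Fintype D2DField :=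
  ⟨⟨([.station, .user, .d2d] : List D2DField), by simp⟩, fun j => by cases j <;> simp⟩

lemma sum_d2dField {A : Type*} [AddCommMonoid A] (f : D2DField → A) :
    ∑ j, f j = f .station + f .user + f .d2d := by
  have : ∑ j, f j = (List.map f [.station, .user, .d2d]).sum := rfl
  rw [this]
  simp [add_assoc]

lemma measurable_famInterf_ball {J : Type} [Fintype J] (α : ℝ) (pw l : J → ℝ) (y : Plane) :
    Measurable fun x : ((J → Config) × (J → ℕ → ℝ)) × Plane =>
      famInterf α pw (fun j => Metric.ball x.2 (l j)) y x.1.1 x.1.2 := by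
  have hS : ∀ j : J, MeasurableSet {w : (((J → Config) × (J → ℕ → ℝ)) × Plane) × Plane |
      w.2 ∈ Metric.ball w.1.2 (l j)} := fun j =>
    measurableSet_lt (measurable_snd.dist (measurable_snd.comp measurable_fst)) measurable_const
  exact measurable_famInterf_param (X := ((J → Config) × (J → ℕ → ℝ)) × Plane)
    (c := fun x => x.1.1) (h := fun x => x.1.2) (Ex := fun x j => Metric.ball x.2 (l j))
    (y := fun _ => y) (measurable_fst.comp measurable_fst) (measurable_snd.comp measurable_fst) hS
    measurable_const

namespace D2DLink

variable {p : Params} {lamd : ℝ}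

/-- The powers of the interferers. -/
def powers (p : Params) : D2DField → ℝ
  | .station => p.P .sap
  | .user => p.Q .sap
  | .d2d => p.Qd

/-- The radii of the exclusion balls. -/
noncomputable def radius (p : Params) : D2DField → ℝ
  | .station => p.ιs
  | .user => p.ιs
  | .d2d => p.ιd

lemma powers_pos (j : D2DField) : 0 < powers p j := by
  cases j
  exacts [p.P_pos _, p.Q_pos _, p.Qd_pos]

lemma radius_pos (j : D2DField) : 0 < radius p j := by
  cases j
  exacts [p.ιs_pos, p.ιs_pos, p.ιd_pos]

lemma d2dDens_nonneg (hl : 0 ≤ lamd) (j : D2DField) : 0 ≤ p.d2dDens lamd j := by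
  cases j
  exacts [p.densD_nonneg _, p.densU_nonneg _, hl]

/-- The interference at the origin when the serving transmitter is at `z`. -/
noncomputable def interf (p : Params) (c : D2DField → Config) (h : D2DField → ℕ → ℝ) (z : Plane) :
    ℝ≥0∞ :=
  famInterf p.α (powers p) (fun j => Metric.ball z (radius p j)) 0 c h

lemma measurable_interf :
    Measurable fun x : ((D2DField → Config) × (D2DField → ℕ → ℝ)) × Plane =>
      interf p x.1.1 x.1.2 x.2 :=
  measurable_famInterf_ball p.α (powers p) (radius p) 0

variable {Ω : Type*} [MeasurableSpace Ω] {Pr : Measure Ω} [IsProbabilityMeasure Pr]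
  (T : D2DLink p lamd Pr)

lemma sir_eq (ω : Ω) : T.sir ω = ENNReal.ofReal (p.Qd * p.rd ^ (-p.α) * T.h₀ ω) /
    interf p (fun j => T.Φ j ω) (fun j n => T.h j n ω) (T.z₀ ω) := by
  unfold sir interf famInterf
  rw [sum_d2dField, mul_right_comm]
  rfl

/-- The probability of coverage is a Laplace transform of the interference. -/
lemma measure_covered :
    Pr {ω | ENNReal.ofReal p.γd < T.sir ω} = ∫⁻ ω, ∫⁻ ω',
      eexp (ENNReal.ofReal (p.γd / (p.Qd * p.rd ^ (-p.α))) *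
        interf p (fun j => T.Φ j ω') (fun j n => T.h j n ω') (T.z₀ ω)) ∂Pr ∂Pr := by
  set q := p.Qd * p.rd ^ (-p.α) with hq_def
  have hq : 0 < q := mul_pos p.Qd_pos (Real.rpow_pos_of_pos p.rd_pos _)
  let Y : Ω → (D2DField → Config) × (D2DField → ℕ → ℝ) :=
    fun ω => (fun j => T.Φ j ω, fun j n => T.h j n ω)
  have hY : AEMeasurable Y Pr :=
    T.field.measurable_points.aemeasurable.prodMk T.field.aemeasurable_fading
  have hz := T.z₀_measurable.aemeasurable (μ := Pr)
  have hh := T.h₀_law.aemeasurable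
  have hI := measurable_interf (p := p)
  let S : Set (((D2DField → Config) × (D2DField → ℕ → ℝ)) × ℝ × Plane) :=
    {x | ENNReal.ofReal p.γd < ENNReal.ofReal (q * x.2.1) / interf p x.1.1 x.1.2 x.2.2}
  have hS : MeasurableSet S := by
    have h1 : Measurable fun x : ((D2DField → Config) × (D2DField → ℕ → ℝ)) × ℝ × Plane =>
        interf p x.1.1 x.1.2 x.2.2 := by
      have h2 : Measurable fun x : ((D2DField → Config) × (D2DField → ℕ → ℝ)) × ℝ × Plane =>
        (x.1, x.2.2) := by fun_prop
      simpa only [Function.comp_def] using hI.comp h2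
    exact measurableSet_lt measurable_const (by fun_prop)
  have hind : Measurable (S.indicator fun _ => (1 : ℝ≥0∞)) := measurable_const.indicator hS
  have hset : {ω | ENNReal.ofReal p.γd < T.sir ω} = (fun ω => (Y ω, T.h₀ ω, T.z₀ ω)) ⁻¹' S := by
    ext ω
    simp only [Set.mem_ofPred_eq, T.sir_eq]
    rfl
  have hpair : AEMeasurable (fun ω => (Y ω, T.h₀ ω, T.z₀ ω)) Pr := hY.prodMk (hh.prodMk hz)
  have h1 : Pr {ω | ENNReal.ofReal p.γd < T.sir ω}
      = ∫⁻ ω, S.indicator (fun _ => 1) (Y ω, T.h₀ ω, T.z₀ ω) ∂Pr := by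
    rw [hset, ← lintegral_indicator_one₀ (hpair.nullMeasurableSet_preimage hS)]
    rfl
  have hE : Measurable (Function.uncurry fun (z : Plane)
      (y : (D2DField → Config) × (D2DField → ℕ → ℝ)) =>
        eexp (ENNReal.ofReal (p.γd / q) * interf p y.1 y.2 z)) := by
    have h2 : Measurable fun x : Plane × ((D2DField → Config) × (D2DField → ℕ → ℝ)) =>
        interf p x.2.1 x.2.2 x.1 := by
      simpa only [Function.comp_def, Prod.swap] using hI.comp measurable_swap
    exact measurable_eexp.comp (h2.const_mul _)
  have hE' : Measurable (Function.uncurry fun (y : (D2DField → Config) × (D2DField → ℕ → ℝ))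
      (z : Plane) => eexp (ENNReal.ofReal (p.γd / q) * interf p y.1 y.2 z)) :=
    measurable_eexp.comp (hI.const_mul _)
  have hzY : IndepFun T.z₀ Y Pr := T.link_indep.comp measurable_snd measurable_id
  rw [h1, lintegral_of_indepFun (F := fun y x => S.indicator (fun _ => (1 : ℝ≥0∞)) (y, x)) hY
    (hh.prodMk hz) T.link_indep.symm hind]
  -- The signal fading is averaged first, with interferers and transmitter position fixed. Then the
  -- order is exchanged, so that the transmitter position is outermost and the inner integral is a
  -- Laplace transform with a fixed exclusion ball.
  trans ∫⁻ ω, ∫⁻ ω', eexp (ENNReal.ofReal (p.γd / q) * interf p (Y ω).1 (Y ω).2 (T.z₀ ω')) ∂Pr ∂Pr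
  · refine lintegral_congr fun ω => ?_
    have hm : Measurable (Function.uncurry fun (z : Plane) (t : ℝ) =>
        S.indicator (fun _ => (1 : ℝ≥0∞)) (Y ω, t, z)) := by
      have h2 : Measurable fun x : Plane × ℝ => (Y ω, x.2, x.1) := by fun_prop
      simpa only [Function.comp_def, Function.uncurry_def] using hind.comp h2
    rw [lintegral_of_indepFun (F := fun (z : Plane) (t : ℝ) =>
      S.indicator (fun _ => (1 : ℝ≥0∞)) (Y ω, t, z)) hz hh T.h₀_z₀_indep.symm hm]
    refine lintegral_congr fun ω' => ?_
    rw [← measure_sir_gt T.h₀_law p.γd_pos hq]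
    have hn : NullMeasurableSet ((fun ω'' => (Y ω, T.h₀ ω'', T.z₀ ω')) ⁻¹' S) Pr :=
      AEMeasurable.nullMeasurableSet_preimage
        (aemeasurable_const.prodMk (hh.prodMk aemeasurable_const)) hS
    exact lintegral_indicator_one₀ hn
  · exact (lintegral_of_indepFun (F := fun y z =>
      eexp (ENNReal.ofReal (p.γd / q) * interf p y.1 y.2 z)) hY hz hzY.symm hE').symm.trans
      (lintegral_of_indepFun (F := fun z y =>
        eexp (ENNReal.ofReal (p.γd / q) * interf p y.1 y.2 z)) hz hY hzY hE)

lemma mul_ballCoef_eq_Iexp (d s Q : ℝ) {l : ℝ} (h : p.rd ≤ l) :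
    d * p.ballCoef s Q l p.rd = p.Iexp d l s Q := by
  rw [Params.ballCoef, if_pos h, Params.Iexp]
  ring

/-- Each exponent depends on the transmitter only through `‖z₀‖ = rd`, so the inner Laplace
transform is constant and the outer average trivial. The bounds on `rd` select the case of a
receiver inside the exclusion balls. -/
theorem coverage_eq (hl : lamd = p.lamd) (hs : p.rd ≤ p.ιs) (hd : p.rd ≤ p.ιd) :
    T.coverage = p.covD2D := by
  subst hl
  have hdens := d2dDens_nonneg (p := p) p.lamd_nonneg
  set s := p.γd * p.rd ^ p.α / p.Qd with hs_def
  have hs0 : 0 < s := div_pos (mul_pos p.γd_pos (Real.rpow_pos_of_pos p.rd_pos _)) p.Qd_pos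
  have hq : p.γd / (p.Qd * p.rd ^ (-p.α)) = s := by
    rw [hs_def, Real.rpow_neg p.rd_pos.le, ← div_eq_mul_inv, div_div_eq_mul_div]
  have hle : ∀ j, p.rd ≤ radius p j := fun j => by
    cases j
    exacts [hs, hs, hd]
  have hterm : ∀ ω j, ENNReal.ofReal (p.d2dDens p.lamd j) * ∫⁻ x, (1 - eexp (fadingLoss p.α s
      (powers p) (fun j => Metric.ball (T.z₀ ω) (radius p j)) 0 j x))
      = ENNReal.ofReal (p.Iexp (p.d2dDens p.lamd j) (radius p j) s (powers p j)) := fun ω j => by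
    rw [p.lintegral_fadingLoss_ball (b := T.z₀ ω) (l := radius p j) (mul_pos hs0 (powers_pos j))
      (radius_pos j) rfl, ← ENNReal.ofReal_mul (hdens j), sub_zero, T.norm_z₀,
      mul_ballCoef_eq_Iexp _ _ _ (hle j)]
  have hnn : ∀ j, 0 ≤ p.Iexp (p.d2dDens p.lamd j) (radius p j) s (powers p j) := fun j => by
    rw [← mul_ballCoef_eq_Iexp _ _ _ (hle j)]
    exact mul_nonneg (hdens j)
      (p.ballCoef_pos (mul_pos hs0 (powers_pos j)) (radius_pos j) p.rd_pos.le).le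
  have hlap : ∀ ω, ∫⁻ ω', eexp (ENNReal.ofReal s *
      interf p (fun j => T.Φ j ω') (fun j n => T.h j n ω') (T.z₀ ω)) ∂Pr
      = ENNReal.ofReal p.covD2D := fun ω => by
    have h := T.field.laplace_famInterf (α := p.α) hdens (fun j => (powers_pos (p := p) j).le) hs0.le
      (Ex := fun j => Metric.ball (T.z₀ ω) (radius p j))
      (fun j => Metric.isOpen_ball.measurableSet) 0
    refine h.trans ?_
    have hsum : laplaceExponent (p.d2dDens p.lamd) (fadingLoss p.α s (powers p)
        (fun j => Metric.ball (T.z₀ ω) (radius p j)) 0)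
        = ENNReal.ofReal (∑ j, p.Iexp (p.d2dDens p.lamd j) (radius p j) s (powers p j)) := by
      rw [ENNReal.ofReal_sum_of_nonneg fun j _ => hnn j]
      exact Finset.sum_congr rfl fun j _ => hterm ω j
    rw [hsum, eexp_ofReal (Finset.sum_nonneg fun j _ => hnn j), sum_d2dField, Params.covD2D]
    simp only [Params.d2dDens, radius, powers, p.densD_eq, p.densU_eq]
    congr 2
    ring
  rw [coverage, measureReal_def, T.measure_covered, hq]
  simp only [hlap, lintegral_const, measure_univ, mul_one]
  exact ENNReal.toReal_ofReal (Real.exp_pos _).le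

end D2DLink

end HCN

/-! ### Assembly of the theorem. -/

theorem theorem1 (p : HCN.Params)
    {Ω₀ Ω₁ Ω₂ Ω₃ : Type*}
    [MeasurableSpace Ω₀] [MeasurableSpace Ω₁] [MeasurableSpace Ω₂] [MeasurableSpace Ω₃]
    (Pr₀ : Measure Ω₀) (Pr₁ : Measure Ω₁) (Pr₂ : Measure Ω₂) (Pr₃ : Measure Ω₃)
    [IsProbabilityMeasure Pr₀] [IsProbabilityMeasure Pr₁]
    [IsProbabilityMeasure Pr₂] [IsProbabilityMeasure Pr₃]
    (C : HCN.Contention p Pr₀)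
    (D : HCN.Downlink p C.activeDens Pr₁)
    (U : HCN.Uplink p C.activeDens Pr₂)
    (T : HCN.D2DLink p C.activeDens Pr₃) :
    -- the weights are the association probabilities
    (∀ i, Pr₁.real (D.associated i) = p.assocD i) ∧
    (∀ i, Pr₂.real (U.associated i) = p.assocU i) ∧
    -- overall coverage in downlink and uplink
    D.overall = D.coverage .mbs * p.assocD .mbs + D.coverage .sap * p.assocD .sap ∧
    U.overall = U.coverage .mbs * p.assocU .mbs + U.coverage .sap * p.assocU .sap ∧
    -- coverage per tier
    (0 < p.q .mbs → D.coverage .mbs = p.covMacroD) ∧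
    (p.q .mbs < 1 → U.coverage .mbs = p.covMacroU) ∧
    (0 < p.q .sap → D.coverage .sap = p.covSmallD) ∧
    (p.q .sap < 1 → U.coverage .sap = p.covSmallU) ∧
    -- Laplace transforms of the D2D interference outside the exclusion ball, downlink and uplink
    (∀ (y : HCN.Plane) (s : ℝ), 0 < s →
      ∫ ω, HCN.expNeg (ENNReal.ofReal s * D.interfd2d .sap y ω) ∂Pr₁ =
        if ‖y‖ ≤ p.ιs then p.laplaceShort s ‖y‖ else p.laplaceLong s ‖y‖) ∧
    (∀ (b : HCN.Plane) (s : ℝ), 0 < s →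
      ∫ ω, HCN.expNeg (ENNReal.ofReal s * U.interfd2d .sap b ω) ∂Pr₂ =
        if ‖b‖ ≤ p.ιs then p.laplaceShort s ‖b‖ else p.laplaceLong s ‖b‖) ∧
    -- coverage of the typical D2D receiver
    (p.rd ≤ p.ιs → p.rd ≤ p.ιd → T.coverage = p.covD2D) := by
  -- The contention model is connected with the three network models by this one number.
  -- Association, overall and macro-tier statements only use that it is nonnegative; the others use
  -- its value.
  have hl : C.activeDens = p.lamd := C.activeDens_eq
  have h0 : 0 ≤ C.activeDens := hl ▸ p.lamd_nonneg
  exact ⟨D.measure_associated h0, U.measure_associated h0, D.overall_eq h0, U.overall_eq h0,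
    D.coverage_mbs h0, U.coverage_mbs h0, D.coverage_sap hl, U.coverage_sap hl,
    fun y s hs => D.laplace_interfd2d hl y hs, fun b s hs => U.laplace_interfd2d hl b hs,
    T.coverage_eq hl⟩
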